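/- Let $\Omega=(0,1)^2$ and let $\boldsymbol b=(b_1,b_2)\in C^1(\bar\Omega)^2$, $c\in C(\bar\Omega)$ satisfy, on $\bar\Omega$, $b_1\ge\beta_1>0$, $b_2\ge\beta_2>0$, $c\ge 0$ and $c-\tfrac12\nabla\cdot\boldsymbol b\ge\mu_0>0$ with constants $\beta_1,\beta_2,\mu_0$. For $0<\varepsilon\le N^{-1}$ consider $$-\varepsilon\Delta u+\boldsymbol b\cdot\nabla u+cu=f\ \text{ in }\Omega,\qquad u=0\ \text{ on }\partial\Omega .$$ *Regularity.* Assume that $u=S+E_1+E_2+E_{12}$ on $\bar\Omega$ with $S,E_1,E_2,E_{12}\in C^3(\bar\Omega)$ such that, for $0\le i+j\le 3$ and all $(x,y)\in\bar\Omega$, $$|\partial_x^i\partial_y^jS|\le C_1,\quad |\partial_x^i\partial_y^jE_1|\le C_1\varepsilon^{-i}e^{-\beta_1(1-x)/\varepsilon},\quad |\partial_x^i\partial_y^jE_2|\le C_1\varepsilon^{-j}e^{-\beta_2(1-y)/\varepsilon},$$ $$|\partial_x^i\partial_y^jE_{12}|\le C_1\varepsilon^{-(i+j)}e^{-(\beta_1(1-x)+\beta_2(1-y))/\varepsilon},$$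 with a constant $C_1$ independent of $\varepsilon$ and $N$. *Mesh.* Let $N\ge 4$ be divisible by $4$ and suppose that $\lambda_x=\tfrac52\,\tfrac{\varepsilon}{\beta_1}\ln N\le\tfrac12$ and $\lambda_y=\tfrac52\,\tfrac{\varepsilon}{\beta_2}\ln N\le\tfrac12$. The nodes $0=x_0<\dots<x_N=1$ divide each of $[0,1-\lambda_x]$ and $[1-\lambda_x,1]$ into $N/2$ equal intervals, and the $y_j$ are defined likewise with $\lambda_y$. Each rectangle $[x_i,x_{i+1}]\times[y_j,y_{j+1}]$ is cut by the diagonal from $(x_i,y_{j+1})$ to $(x_{i+1},y_j)$ into two triangles. Let $V^N$ be the space of continuous functions on $\bar\Omega$ that are affine on every triangle $K$ and vanish on $\partial\Omega$, and let $\Omega_s=[0,1-\lambda_x]\times[0,1-\lambda_y]$. *Method.* For a constant $C^*>0$ put $\delta_K=C^*N^{-1}$ if $K\subset\Omega_s$ and $\delta_K=0$ otherwise, and $$a_{SD}(w,v)=\varepsilon(\nabla w,\nabla v)+(\boldsymbol b\cdot\nabla w+cw,v)+\sum_K(-\varepsilon\Delta w+\boldsymbol b\cdot\nabla w+cw,\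 \delta_K\boldsymbol b\cdot\nabla v)_K ,$$ $$\|v\|_\varepsilon^2=\varepsilon|v|_1^2+\mu_0\|v\|^2,\qquad \|v\|_{SD}^2=\|v\|_\varepsilon^2+\sum_K\delta_K\|\boldsymbol b\cdot\nabla v\|_K^2 .$$ The constant $C^*$ is called admissible for $(\varepsilon,N)$ if $a_{SD}(v,v)\ge\tfrac12\|v\|_{SD}^2$ for all $v\in V^N$. The SDFEM solution $u^N\in V^N$ is defined by $a_{SD}(u^N,v)=(f,v)+\sum_K(f,\delta_K\boldsymbol b\cdot\nabla v)_K$ for all $v\in V^N$. *Postprocessing.* Each macro-rectangle $[x_{2i},x_{2i+2}]\times[y_{2j},y_{2j+2}]$, $0\le i,j<N/2$, is cut by its diagonal from $(x_{2i},y_{2j+2})$ to $(x_{2i+2},y_{2j})$ into two macrotriangles $M$, each a union of four mesh triangles. Let $\mathcal P v$ be the continuous function whose restriction to each $M$ is the quadratic interpolant of $v$ at the three vertices and three edge midpoints of $M$. **Theorem.** There is $C_0>0$, independent of $\varepsilon$ and $N$, such that every $C^*\in(0,C_0]$ is admissible for all $(\varepsilon,N)$ as above. Moreover, for all constants $C^*>0$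 and $C_1$ there is a constant $C$, depending only on $\boldsymbol b,c,\beta_1,\beta_2,\mu_0,C^*,C_1$ and not on $\varepsilon,N,f,u$, such that for all $(\varepsilon,N)$ as above for which $C^*$ is admissible, and all $f,u$ as above, $$\|u-\mathcal P u^N\|_\varepsilon\le C\left(\varepsilon^{1/2}N^{-1}+N^{-3/2}\right)\ln^{3/2}N .$$ -/

import Mathlib

open Set MeasureTheory

noncomputable section

namespace SDFEM

/-- The closed unit square. -/
def closedSquare : Set (ℝ × ℝ) := Icc (0 : ℝ) 1 ×ˢ Icc (0 : ℝ) 1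

/-- The domain `Ω = (0,1)²`. -/
def Omega : Set (ℝ × ℝ) := Ioo (0 : ℝ) 1 ×ˢ Ioo (0 : ℝ) 1

/-- Partial derivative in `x`; it is the ordinary one for `0 < x < 1` and the one-sided one for
`x = 0` and `x = 1`. For a continuous function on the closed square that is piecewise smooth with
respect to a triangulation it represents the weak derivative `∂w/∂x` almost everywhere in `Ω`. -/
def dX (w : ℝ × ℝ → ℝ) (p : ℝ × ℝ) : ℝ := derivWithin (fun t => w (t, p.2)) (Icc 0 1) p.1

/-- Partial derivative in `y`. -/
def dY (w : ℝ × ℝ → ℝ) (p : ℝ × ℝ) : ℝ := derivWithin (fun t => w (p.1, t)) (Icc 0 1) p.2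

/-- The mixed partial derivative `∂^{i+j} w / ∂x^i ∂y^j`. -/
def partialD (i j : ℕ) (w : ℝ × ℝ → ℝ) : ℝ × ℝ → ℝ := dX^[i] (dY^[j] w)

/-- `b · ∇w`. -/
def convect (b₁ b₂ w : ℝ × ℝ → ℝ) (p : ℝ × ℝ) : ℝ := b₁ p * dX w p + b₂ p * dY w p

/-- The differential operator `-ε Δw + b · ∇w + c w`. -/
def diffOp (ε : ℝ) (b₁ b₂ c w : ℝ × ℝ → ℝ) (p : ℝ × ℝ) : ℝ :=
  -ε * (dX (dX w) p + dY (dY w) p) + convect b₁ b₂ w p + c p * w p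

/-- The standing assumptions on the coefficients. -/
structure Coefficients (b₁ b₂ c : ℝ × ℝ → ℝ) (β₁ β₂ μ₀ : ℝ) : Prop where
  smooth_b₁ : ContDiffOn ℝ 1 b₁ closedSquare
  smooth_b₂ : ContDiffOn ℝ 1 b₂ closedSquare
  cont_c : ContinuousOn c closedSquare
  β₁_pos : 0 < β₁
  β₂_pos : 0 < β₂
  μ₀_pos : 0 < μ₀
  le_b₁ : ∀ p ∈ closedSquare, β₁ ≤ b₁ p
  le_b₂ : ∀ p ∈ closedSquare, β₂ ≤ b₂ p
  c_nonneg : ∀ p ∈ closedSquare, 0 ≤ c p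
  le_c : ∀ p ∈ closedSquare, μ₀ ≤ c p - (dX b₁ p + dY b₂ p) / 2

/-- `u` solves the boundary value problem `-ε Δu + b · ∇u + c u = f` in `Ω`, `u = 0` on `∂Ω`. -/
structure IsSolution (ε : ℝ) (b₁ b₂ c f u : ℝ × ℝ → ℝ) : Prop where
  eqn : ∀ p ∈ Omega, diffOp ε b₁ b₂ c u p = f p
  bdry : ∀ p ∈ closedSquare \ Omega, u p = 0

/-- `w ∈ C³` on the closed square and, there, every derivative `∂_x^i ∂_y^j w` of order at most
three is bounded by `g i j`. -/
structure DerivBound (g : ℕ → ℕ → ℝ × ℝ → ℝ) (w : ℝ × ℝ → ℝ) : Prop where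
  smooth : ContDiffOn ℝ 3 w closedSquare
  bound : ∀ i j, i + j ≤ 3 → ∀ p ∈ closedSquare, |partialD i j w p| ≤ g i j p

/-- The splitting of `u` into a regular part and exponential layers, with constant `C₁`. -/
def HasDecomposition (C₁ ε β₁ β₂ : ℝ) (u : ℝ × ℝ → ℝ) : Prop :=
  ∃ S E₁ E₂ E₁₂ : ℝ × ℝ → ℝ,
    (∀ p ∈ closedSquare, u p = S p + E₁ p + E₂ p + E₁₂ p) ∧
    DerivBound (fun _ _ _ => C₁) S ∧
    DerivBound (fun i _ p => C₁ * (ε ^ i)⁻¹ * Real.exp (-(β₁ * (1 - p.1)) / ε)) E₁ ∧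
    DerivBound (fun _ j p => C₁ * (ε ^ j)⁻¹ * Real.exp (-(β₂ * (1 - p.2)) / ε)) E₂ ∧
    DerivBound (fun i j p => C₁ * (ε ^ (i + j))⁻¹ *
      Real.exp (-(β₁ * (1 - p.1) + β₂ * (1 - p.2)) / ε)) E₁₂

/-- The Shishkin transition parameter `λ = min {1/2, ρ (ε/β) ln N}` with `ρ = 5/2`. -/
def transition (N : ℕ) (ε β : ℝ) : ℝ := min (1 / 2) (5 / 2 * (ε / β) * Real.log N)

/-- The nodes of the one-dimensional Shishkin mesh: `[0, 1-λ]` and `[1-λ, 1]` are each divided into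
`N/2` equal intervals. -/
def node (N : ℕ) (ε β : ℝ) (i : ℕ) : ℝ :=
  if i ≤ N / 2 then i * (2 * (1 - transition N ε β) / N)
  else 1 - transition N ε β + (i - (N : ℝ) / 2) * (2 * transition N ε β / N)

/-- The mesh triangle with vertices `(x_i, y_j)`, `(x_{i+1}, y_j)`, `(x_i, y_{j+1})`. -/
def K1 (X Y : ℕ → ℝ) (i j : ℕ) : Set (ℝ × ℝ) :=
  convexHull ℝ {(X i, Y j), (X (i + 1), Y j), (X i, Y (j + 1))}

/-- The mesh triangle with vertices `(x_i, y_{j+1})`, `(x_{i+1}, y_j)`, `(x_{i+1}, y_{j+1})`. -/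
def K2 (X Y : ℕ → ℝ) (i j : ℕ) : Set (ℝ × ℝ) :=
  convexHull ℝ {(X i, Y (j + 1)), (X (i + 1), Y j), (X (i + 1), Y (j + 1))}

/-- `v` is a polynomial of degree at most one on `K`. -/
def IsAffineOn (v : ℝ × ℝ → ℝ) (K : Set (ℝ × ℝ)) : Prop :=
  ∃ a₀ a₁ a₂ : ℝ, ∀ p ∈ K, v p = a₀ + a₁ * p.1 + a₂ * p.2

/-- `v ∈ V^N`: continuous, piecewise linear on the triangulation, zero on the boundary. -/
structure IsFE (N : ℕ) (X Y : ℕ → ℝ) (v : ℝ × ℝ → ℝ) : Prop where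
  cont : ContinuousOn v closedSquare
  affine₁ : ∀ i < N, ∀ j < N, IsAffineOn v (K1 X Y i j)
  affine₂ : ∀ i < N, ∀ j < N, IsAffineOn v (K2 X Y i j)
  bdry : ∀ p ∈ closedSquare \ Omega, v p = 0

/-- The stabilization parameter of the triangles `K1 X Y i j` and `K2 X Y i j`: it is `Cs / N` if
they lie in `Ω_s = [0, x_{N/2}] × [0, y_{N/2}]` and zero otherwise. -/
def delta (Cs : ℝ) (N i j : ℕ) : ℝ := if i < N / 2 ∧ j < N / 2 then Cs / N else 0

/-- `∑_K δ_K ∫_K g`, the sum over all mesh triangles. -/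
def stabSum (Cs : ℝ) (N : ℕ) (X Y : ℕ → ℝ) (g : ℝ × ℝ → ℝ) : ℝ :=
  ∑ i ∈ Finset.range N, ∑ j ∈ Finset.range N,
    delta Cs N i j * ((∫ p in K1 X Y i j, g p) + ∫ p in K2 X Y i j, g p)

/-- The Galerkin form `ε (∇w, ∇v) + (b · ∇w + c w, v)`. -/
def aGal (ε : ℝ) (b₁ b₂ c w v : ℝ × ℝ → ℝ) : ℝ :=
  ε * (∫ p in Omega, (dX w p * dX v p + dY w p * dY v p)) +
    ∫ p in Omega, (convect b₁ b₂ w p + c p * w p) * v p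

/-- The stabilization form `∑_K (-ε Δw + b · ∇w + c w, δ_K b · ∇v)_K`. -/
def aStab (Cs : ℝ) (N : ℕ) (X Y : ℕ → ℝ) (ε : ℝ) (b₁ b₂ c w v : ℝ × ℝ → ℝ) : ℝ :=
  stabSum Cs N X Y fun p => diffOp ε b₁ b₂ c w p * convect b₁ b₂ v p

/-- The streamline diffusion form. -/
def aSD (Cs : ℝ) (N : ℕ) (X Y : ℕ → ℝ) (ε : ℝ) (b₁ b₂ c w v : ℝ × ℝ → ℝ) : ℝ :=
  aGal ε b₁ b₂ c w v + aStab Cs N X Y ε b₁ b₂ c w v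

/-- `uN` is a solution of the streamline diffusion finite element method. -/
structure IsSDFEMSolution (Cs : ℝ) (N : ℕ) (X Y : ℕ → ℝ) (ε : ℝ) (b₁ b₂ c f uN : ℝ × ℝ → ℝ) :
    Prop where
  mem : IsFE N X Y uN
  eqn : ∀ v, IsFE N X Y v → aSD Cs N X Y ε b₁ b₂ c uN v =
    (∫ p in Omega, f p * v p) + stabSum Cs N X Y fun p => f p * convect b₁ b₂ v p

/-- `‖w‖_ε² = ε |w|₁² + μ₀ ‖w‖²`. -/
def energySq (ε μ₀ : ℝ) (w : ℝ × ℝ → ℝ) : ℝ :=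
  ε * (∫ p in Omega, (dX w p ^ 2 + dY w p ^ 2)) + μ₀ * ∫ p in Omega, w p ^ 2

/-- The energy norm `‖w‖_ε`. -/
def energyNorm (ε μ₀ : ℝ) (w : ℝ × ℝ → ℝ) : ℝ := Real.sqrt (energySq ε μ₀ w)

/-- `‖w‖_SD² = ‖w‖_ε² + ∑_K δ_K ‖b · ∇w‖_K²`. -/
def sdSq (Cs : ℝ) (N : ℕ) (X Y : ℕ → ℝ) (ε μ₀ : ℝ) (b₁ b₂ w : ℝ × ℝ → ℝ) : ℝ :=
  energySq ε μ₀ w + stabSum Cs N X Y fun p => convect b₁ b₂ w p ^ 2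

/-- Coercivity of the streamline diffusion form on `V^N`, with constant `1/2`. -/
def IsCoercive (Cs : ℝ) (N : ℕ) (X Y : ℕ → ℝ) (ε μ₀ : ℝ) (b₁ b₂ c : ℝ × ℝ → ℝ) : Prop :=
  ∀ v, IsFE N X Y v →
    1 / 2 * sdSq Cs N X Y ε μ₀ b₁ b₂ v ≤ aSD Cs N X Y ε b₁ b₂ c v v

/-- The barycentric coordinate of `p` that belongs to the vertex `A` of the triangle `ABC`. -/
def bary (A B C p : ℝ × ℝ) : ℝ :=
  ((B.1 - p.1) * (C.2 - p.2) - (C.1 - p.1) * (B.2 - p.2)) /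
    ((B.1 - A.1) * (C.2 - A.2) - (C.1 - A.1) * (B.2 - A.2))

/-- The quadratic interpolant of `v` at the vertices and the edge midpoints of the triangle `ABC`,
in the standard Lagrange basis. -/
def quadInterp (A B C : ℝ × ℝ) (v : ℝ × ℝ → ℝ) (p : ℝ × ℝ) : ℝ :=
  let a := bary A B C p
  let b := bary B C A p
  let c := bary C A B p
  v A * (a * (2 * a - 1)) + v B * (b * (2 * b - 1)) + v C * (c * (2 * c - 1)) +
    v (midpoint ℝ A B) * (4 * a * b) + v (midpoint ℝ B C) * (4 * b * c) +
    v (midpoint ℝ C A) * (4 * c * a)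

/-- The index `i < N/2` of a macro-interval `[x_{2i}, x_{2i+2}]` that contains `x`. -/
def cell (N : ℕ) (X : ℕ → ℝ) (x : ℝ) : ℕ := Nat.findGreatest (fun i => X (2 * i) ≤ x) (N / 2 - 1)

/-- Interpolation on the macrotriangle with vertices `(x_{2i}, y_{2j})`, `(x_{2i+2}, y_{2j})`,
`(x_{2i}, y_{2j+2})`; this macrotriangle is the union of four mesh triangles. -/
def interpM1 (X Y : ℕ → ℝ) (i j : ℕ) (v : ℝ × ℝ → ℝ) : ℝ × ℝ → ℝ :=
  quadInterp (X (2 * i), Y (2 * j)) (X (2 * i + 2), Y (2 * j)) (X (2 * i), Y (2 * j + 2)) v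

/-- Interpolation on the macrotriangle with vertices `(x_{2i+2}, y_{2j+2})`, `(x_{2i}, y_{2j+2})`,
`(x_{2i+2}, y_{2j})`. -/
def interpM2 (X Y : ℕ → ℝ) (i j : ℕ) (v : ℝ × ℝ → ℝ) : ℝ × ℝ → ℝ :=
  quadInterp (X (2 * i + 2), Y (2 * j + 2)) (X (2 * i), Y (2 * j + 2)) (X (2 * i + 2), Y (2 * j)) v

/-- The postprocessing operator `P`: on each macrotriangle `M` it is the quadratic interpolation on
`M`. A point of the macro-rectangle `(i, j)` belongs to the lower left one of its two macrotriangles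
if and only if its barycentric coordinate for the lower left corner is nonnegative. The choice on
common edges is immaterial, see `postprocess_eq₁` and `postprocess_eq₂`. -/
def postprocess (N : ℕ) (X Y : ℕ → ℝ) (v : ℝ × ℝ → ℝ) (p : ℝ × ℝ) : ℝ :=
  let i := cell N X p.1
  let j := cell N Y p.2
  if 0 ≤ bary (X (2 * i), Y (2 * j)) (X (2 * i + 2), Y (2 * j)) (X (2 * i), Y (2 * j + 2)) p
  then interpM1 X Y i j v p else interpM2 X Y i j v p

/-- A barycentric coordinate is recovered from a representation `p = a A + b B + d C`. -/
theorem bary_eq {A B C p : ℝ × ℝ} {a b d : ℝ}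
    (hD : (B.1 - A.1) * (C.2 - A.2) - (C.1 - A.1) * (B.2 - A.2) ≠ 0) (hs : a + b + d = 1)
    (h1 : p.1 = a * A.1 + b * B.1 + d * C.1) (h2 : p.2 = a * A.2 + b * B.2 + d * C.2) :
    bary A B C p = a := by
  unfold bary
  rw [div_eq_iff hD, h1, h2]
  obtain rfl : a = 1 - b - d := by linarith
  ring

theorem mem_triangle {A B C p : ℝ × ℝ} (hp : p ∈ convexHull ℝ {A, B, C}) :
    ∃ a b d : ℝ, 0 ≤ a ∧ 0 ≤ b ∧ 0 ≤ d ∧ a + b + d = 1 ∧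
      p.1 = a * A.1 + b * B.1 + d * C.1 ∧ p.2 = a * A.2 + b * B.2 + d * C.2 := by
  rw [convexHull_insert (by simp), convexHull_pair, mem_convexJoin] at hp
  obtain ⟨_, rfl, q, ⟨b, d, hb, hd, hbd, rfl⟩, ⟨a, e, ha, he, hae, rfl⟩⟩ := hp
  refine ⟨a, e * b, e * d, ha, by positivity, by positivity, ?_, ?_, ?_⟩
  · rw [add_assoc, ← mul_add, hbd, mul_one, hae]
  · simp; ring
  · simp; ring

theorem midpoint_pair (a b c d : ℝ) :
    midpoint ℝ (a, b) (c, d) = (midpoint ℝ a c, midpoint ℝ b d) := by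
  simp [midpoint_eq_smul_add]

theorem cell_eq {N : ℕ} {X : ℕ → ℝ} (hX : ∀ i < N, X i < X (i + 1)) {i : ℕ} {x : ℝ}
    (hi : i < N / 2) (h1 : X (2 * i) ≤ x) (h2 : x < X (2 * i + 2)) : cell N X x = i := by
  have hmono : ∀ a b, a ≤ b → b ≤ N → X a ≤ X b := by
    intro a b hab
    induction b, hab using Nat.le_induction with
    | base => intro _; exact le_rfl
    | succ b _ ih => intro hb; exact (ih (by omega)).trans (hX b (by omega)).le
  unfold cell
  rw [Nat.findGreatest_eq_iff]
  refine ⟨by omega, fun _ => h1, fun n hn hnN hc => ?_⟩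
  have := hmono (2 * i + 2) (2 * n) (by omega) (by omega)
  linarith

theorem cell_last {N : ℕ} {X : ℕ → ℝ} {i : ℕ} (hX : ∀ i < N, X i < X (i + 1))
    (hi : i + 1 = N / 2) : cell N X (X (2 * i + 2)) = i := by
  unfold cell
  rw [Nat.findGreatest_eq_iff]
  refine ⟨by omega, fun _ => ?_, fun n hn hnN => by omega⟩
  exact ((hX (2 * i) (by omega)).trans (hX (2 * i + 1) (by omega))).le

/-- The piecewise quadratic interpolant on the macro-rectangle `(i, j)` in local coordinates. -/
def localInterp (X Y : ℕ → ℝ) (v : ℝ × ℝ → ℝ) (i j : ℕ) (s t : ℝ) : ℝ :=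
  let p : ℝ × ℝ := (X (2 * i) + s * (X (2 * i + 2) - X (2 * i)),
    Y (2 * j) + t * (Y (2 * j + 2) - Y (2 * j)))
  if s + t ≤ 1 then interpM1 X Y i j v p else interpM2 X Y i j v p

theorem interpM1_coord {X Y : ℕ → ℝ} {i j : ℕ} (v : ℝ × ℝ → ℝ) (s t : ℝ)
    (hx : X (2 * i) < X (2 * i + 2)) (hy : Y (2 * j) < Y (2 * j + 2)) :
    interpM1 X Y i j v (X (2 * i) + s * (X (2 * i + 2) - X (2 * i)),
      Y (2 * j) + t * (Y (2 * j + 2) - Y (2 * j))) =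
    v (X (2 * i), Y (2 * j)) * ((1 - s - t) * (2 * (1 - s - t) - 1)) +
    v (X (2 * i + 2), Y (2 * j)) * (s * (2 * s - 1)) +
    v (X (2 * i), Y (2 * j + 2)) * (t * (2 * t - 1)) +
    v (midpoint ℝ (X (2 * i)) (X (2 * i + 2)), Y (2 * j)) * (4 * (1 - s - t) * s) +
    v (midpoint ℝ (X (2 * i)) (X (2 * i + 2)), midpoint ℝ (Y (2 * j)) (Y (2 * j + 2))) *
      (4 * s * t) +
    v (X (2 * i), midpoint ℝ (Y (2 * j)) (Y (2 * j + 2))) * (4 * t * (1 - s - t)) := by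
  have hD : (X (2 * i + 2) - X (2 * i)) * (Y (2 * j + 2) - Y (2 * j)) ≠ 0 :=
    (mul_pos (sub_pos.2 hx) (sub_pos.2 hy)).ne'
  unfold interpM1 quadInterp
  simp only
  rw [bary_eq (a := 1 - s - t) (b := s) (d := t), bary_eq (a := s) (b := t) (d := 1 - s - t),
    bary_eq (a := t) (b := 1 - s - t) (d := s)]
  · simp only [midpoint_pair, midpoint_self]
    rw [midpoint_comm (R := ℝ) (X (2 * i + 2)), midpoint_comm (R := ℝ) (Y (2 * j + 2))]
  all_goals first
    | (intro h; apply hD; simp only at h; linarith)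
    | ring

theorem interpM2_coord {X Y : ℕ → ℝ} {i j : ℕ} (v : ℝ × ℝ → ℝ) (s t : ℝ)
    (hx : X (2 * i) < X (2 * i + 2)) (hy : Y (2 * j) < Y (2 * j + 2)) :
    interpM2 X Y i j v (X (2 * i) + s * (X (2 * i + 2) - X (2 * i)),
      Y (2 * j) + t * (Y (2 * j + 2) - Y (2 * j))) =
    v (X (2 * i + 2), Y (2 * j + 2)) * ((s + t - 1) * (2 * (s + t - 1) - 1)) +
    v (X (2 * i), Y (2 * j + 2)) * ((1 - s) * (2 * (1 - s) - 1)) +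
    v (X (2 * i + 2), Y (2 * j)) * ((1 - t) * (2 * (1 - t) - 1)) +
    v (midpoint ℝ (X (2 * i)) (X (2 * i + 2)), Y (2 * j + 2)) * (4 * (s + t - 1) * (1 - s)) +
    v (midpoint ℝ (X (2 * i)) (X (2 * i + 2)), midpoint ℝ (Y (2 * j)) (Y (2 * j + 2))) *
      (4 * (1 - s) * (1 - t)) +
    v (X (2 * i + 2), midpoint ℝ (Y (2 * j)) (Y (2 * j + 2))) * (4 * (1 - t) * (s + t - 1)) := by
  have hD : (X (2 * i + 2) - X (2 * i)) * (Y (2 * j + 2) - Y (2 * j)) ≠ 0 :=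
    (mul_pos (sub_pos.2 hx) (sub_pos.2 hy)).ne'
  unfold interpM2 quadInterp
  simp only
  rw [bary_eq (a := s + t - 1) (b := 1 - s) (d := 1 - t),
    bary_eq (a := 1 - s) (b := 1 - t) (d := s + t - 1),
    bary_eq (a := 1 - t) (b := s + t - 1) (d := 1 - s)]
  · simp only [midpoint_pair, midpoint_self]
    rw [midpoint_comm (R := ℝ) (X (2 * i + 2)), midpoint_comm (R := ℝ) (Y (2 * j + 2))]
  all_goals first
    | (intro h; apply hD; simp only at h; linarith)
    | ring

theorem node_step {N : ℕ} {X : ℕ → ℝ} (hX : ∀ i < N, X i < X (i + 1)) {i : ℕ} (hi : i < N / 2) :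
    X (2 * i) < X (2 * i + 2) :=
  (hX (2 * i) (by omega)).trans (hX (2 * i + 1) (by omega))

theorem localInterp_right {N : ℕ} {X Y : ℕ → ℝ} (hX : ∀ i < N, X i < X (i + 1))
    (hY : ∀ i < N, Y i < Y (i + 1)) {i j : ℕ} (v : ℝ × ℝ → ℝ) (hi : i + 1 < N / 2)
    (hj : j < N / 2) {t : ℝ} (ht0 : 0 ≤ t) (ht : t ≤ 1) :
    localInterp X Y v i j 1 t = localInterp X Y v (i + 1) j 0 t := by
  have h1 := node_step hX (show i < N / 2 by omega)
  have h2 := node_step hX hi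
  have h3 := node_step hY hj
  have e : 2 * (i + 1) = 2 * i + 2 := by ring
  unfold localInterp
  rw [if_pos (show (0 : ℝ) + t ≤ 1 by linarith)]
  simp only
  rw [interpM1_coord v _ _ h2 h3, interpM1_coord v _ _ h1 h3, interpM2_coord v _ _ h1 h3]
  split_ifs with h
  · obtain rfl : t = 0 := by linarith
    rw [e]; ring
  · rw [e]; ring

theorem localInterp_top {N : ℕ} {X Y : ℕ → ℝ} (hX : ∀ i < N, X i < X (i + 1))
    (hY : ∀ i < N, Y i < Y (i + 1)) {i j : ℕ} (v : ℝ × ℝ → ℝ) (hi : i < N / 2)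
    (hj : j + 1 < N / 2) {s : ℝ} (hs0 : 0 ≤ s) (hs : s ≤ 1) :
    localInterp X Y v i j s 1 = localInterp X Y v i (j + 1) s 0 := by
  have h1 := node_step hY (show j < N / 2 by omega)
  have h2 := node_step hY hj
  have h3 := node_step hX hi
  have e : 2 * (j + 1) = 2 * j + 2 := by ring
  unfold localInterp
  rw [if_pos (show s + (0 : ℝ) ≤ 1 by linarith)]
  simp only
  rw [interpM1_coord v _ _ h3 h2, interpM1_coord v _ _ h3 h1, interpM2_coord v _ _ h3 h1]
  split_ifs with h
  · obtain rfl : s = 0 := by linarith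
    rw [e]; ring
  · rw [e]; ring

theorem postprocess_of_cell {N : ℕ} {X Y : ℕ → ℝ} {i j : ℕ} (v : ℝ × ℝ → ℝ) {p : ℝ × ℝ} {s t : ℝ}
    (hx : X (2 * i) < X (2 * i + 2)) (hy : Y (2 * j) < Y (2 * j + 2))
    (h1 : p.1 = X (2 * i) + s * (X (2 * i + 2) - X (2 * i)))
    (h2 : p.2 = Y (2 * j) + t * (Y (2 * j + 2) - Y (2 * j)))
    (hi : cell N X p.1 = i) (hj : cell N Y p.2 = j) :
    postprocess N X Y v p = localInterp X Y v i j s t := by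
  have hD : (X (2 * i + 2) - X (2 * i)) * (Y (2 * j + 2) - Y (2 * j)) ≠ 0 :=
    (mul_pos (sub_pos.2 hx) (sub_pos.2 hy)).ne'
  unfold postprocess localInterp
  simp only
  rw [hi, hj, bary_eq (a := 1 - s - t) (b := s) (d := t), ← h1, ← h2]
  · by_cases h : s + t ≤ 1
    · rw [if_pos (by linarith), if_pos h]
    · rw [if_neg (by linarith), if_neg h]
  · intro h; apply hD; simp only at h; linarith
  · ring
  · simp only [h1]; ring
  · simp only [h2]; ring

theorem postprocess_eq_local {N : ℕ} {X Y : ℕ → ℝ} (hX : ∀ i < N, X i < X (i + 1))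
    (hY : ∀ i < N, Y i < Y (i + 1)) {i j : ℕ} (v : ℝ × ℝ → ℝ) (hi : i < N / 2)
    (hj : j < N / 2) {s t : ℝ} (hs0 : 0 ≤ s) (hs : s ≤ 1) (ht0 : 0 ≤ t) (ht : t ≤ 1) :
    postprocess N X Y v (X (2 * i) + s * (X (2 * i + 2) - X (2 * i)),
      Y (2 * j) + t * (Y (2 * j + 2) - Y (2 * j))) = localInterp X Y v i j s t := by
  have key : ∀ (Z : ℕ → ℝ), (∀ i < N, Z i < Z (i + 1)) → ∀ k < N / 2, ∀ r : ℝ, 0 ≤ r → r ≤ 1 →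
      cell N Z (Z (2 * k) + r * (Z (2 * k + 2) - Z (2 * k))) = k ∨
      (r = 1 ∧ k + 1 < N / 2 ∧
        cell N Z (Z (2 * k) + r * (Z (2 * k + 2) - Z (2 * k))) = k + 1) := by
    intro Z hZ k hk r hr0 hr
    have hz := node_step hZ hk
    rcases hr.lt_or_eq with hr | rfl
    · left
      exact cell_eq hZ hk (by nlinarith) (by nlinarith)
    · have e : Z (2 * k) + 1 * (Z (2 * k + 2) - Z (2 * k)) = Z (2 * k + 2) := by ring
      rw [e]
      by_cases h : k + 1 < N / 2
      · right
        exact ⟨rfl, h, cell_eq hZ h le_rfl (node_step hZ h)⟩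
      · left
        exact cell_last hZ (by omega)
  have hx := node_step hX hi
  have hy := node_step hY hj
  rcases key X hX i hi s hs0 hs with h1 | ⟨rfl, hi', h1⟩ <;>
    rcases key Y hY j hj t ht0 ht with h2 | ⟨rfl, hj', h2⟩
  · exact postprocess_of_cell v hx hy rfl rfl h1 h2
  · rw [localInterp_top hX hY v hi hj' hs0 hs]
    exact postprocess_of_cell v hx (node_step hY hj') rfl (by simp only [mul_add]; ring) h1 h2
  · rw [localInterp_right hX hY v hi' hj ht0 ht]
    exact postprocess_of_cell v (node_step hX hi') hy (by simp only [mul_add]; ring) rfl h1 h2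
  · rw [localInterp_right hX hY v hi' hj ht0 ht,
      localInterp_top hX hY v hi' hj' le_rfl zero_le_one]
    exact postprocess_of_cell v (node_step hX hi') (node_step hY hj')
      (by simp only [mul_add]; ring) (by simp only [mul_add]; ring) h1 h2

/-- `(P v)|_M = P_M (v|_M)` for the lower left macrotriangles. -/
theorem postprocess_eq₁ {N : ℕ} {X Y : ℕ → ℝ} (hX : ∀ i < N, X i < X (i + 1))
    (hY : ∀ i < N, Y i < Y (i + 1)) {i j : ℕ} (hi : i < N / 2) (hj : j < N / 2)
    (v : ℝ × ℝ → ℝ) {p : ℝ × ℝ} (hp : p ∈ convexHull ℝ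
      {(X (2 * i), Y (2 * j)), (X (2 * i + 2), Y (2 * j)), (X (2 * i), Y (2 * j + 2))}) :
    postprocess N X Y v p = interpM1 X Y i j v p := by
  obtain ⟨a, b, d, ha, hb, hd, hs, h1, h2⟩ := mem_triangle hp
  obtain rfl : a = 1 - b - d := by linarith
  have hp' : p = (X (2 * i) + b * (X (2 * i + 2) - X (2 * i)),
      Y (2 * j) + d * (Y (2 * j + 2) - Y (2 * j))) := by
    ext
    · rw [h1]; ring
    · rw [h2]; ring
  rw [hp', postprocess_eq_local hX hY v hi hj hb (by linarith) hd (by linarith)]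
  exact if_pos (by linarith)

/-- `(P v)|_M = P_M (v|_M)` for the upper right macrotriangles. -/
theorem postprocess_eq₂ {N : ℕ} {X Y : ℕ → ℝ} (hX : ∀ i < N, X i < X (i + 1))
    (hY : ∀ i < N, Y i < Y (i + 1)) {i j : ℕ} (hi : i < N / 2) (hj : j < N / 2)
    (v : ℝ × ℝ → ℝ) {p : ℝ × ℝ} (hp : p ∈ convexHull ℝ
      {(X (2 * i + 2), Y (2 * j + 2)), (X (2 * i), Y (2 * j + 2)), (X (2 * i + 2), Y (2 * j))}) :
    postprocess N X Y v p = interpM2 X Y i j v p := by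
  obtain ⟨a, b, d, ha, hb, hd, hs, h1, h2⟩ := mem_triangle hp
  obtain rfl : a = 1 - b - d := by linarith
  have hp' : p = (X (2 * i) + (1 - b) * (X (2 * i + 2) - X (2 * i)),
      Y (2 * j) + (1 - d) * (Y (2 * j + 2) - Y (2 * j))) := by
    ext
    · rw [h1]; ring
    · rw [h2]; ring
  rw [hp', postprocess_eq_local hX hY v hi hj (by linarith) (by linarith) (by linarith)
    (by linarith)]
  unfold localInterp
  simp only
  split_ifs with h
  · obtain rfl : b = 1 - d := by linarith
    rw [interpM1_coord v _ _ (node_step hX hi) (node_step hY hj),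
      interpM2_coord v _ _ (node_step hX hi) (node_step hY hj)]
    ring
  · rfl

/-- The nodes of the Shishkin mesh are increasing. -/
theorem node_lt {N : ℕ} {ε β : ℝ} (hN : 2 ≤ N) (h2 : 2 ∣ N) (hε : 0 < ε) (hβ : 0 < β) :
    ∀ i < N, node N ε β i < node N ε β (i + 1) := by
  intro i hi
  have hNr : (0 : ℝ) < N := by positivity
  have hlog : 0 < Real.log N := Real.log_pos (by exact_mod_cast hN)
  have hl : 0 < transition N ε β := lt_min (by norm_num) (by positivity)
  have hl' : transition N ε β ≤ 1 / 2 := min_le_left _ _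
  have hh : 0 < 2 * transition N ε β / N := by positivity
  have hH : 0 < 2 * (1 - transition N ε β) / N := div_pos (by linarith) hNr
  obtain ⟨m, rfl⟩ := h2
  have hm : 2 * m / 2 = m := by omega
  unfold node
  rw [hm]
  push_cast
  push_cast at hNr hh hH
  by_cases h1 : i + 1 ≤ m
  · rw [if_pos (by omega), if_pos h1]; linarith
  · by_cases h3 : i ≤ m
    · obtain rfl : i = m := by omega
      rw [if_pos le_rfl, if_neg h1]
      have : (i : ℝ) * (2 * (1 - transition (2 * i) ε β) / (2 * i)) =
        1 - transition (2 * i) ε β := by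
        have hi0 : (i : ℝ) ≠ 0 := by intro h0; simp [h0] at hNr
        field_simp
      rw [this]
      have : (i : ℝ) + 1 - 2 * i / 2 = 1 := by ring
      rw [this]; linarith
    · rw [if_neg h3, if_neg h1]; linarith

end SDFEM

end

noncomputable section

namespace SDFEM


/-! ### Calculus on the closed square -/

/-! Write `uᴵ` for the nodal interpolant `interp`, `ρ` for `rho` (a multiple of `N⁻¹ ln N`), `θ =
N^(-5/2)` for `theta`, `η = (N⁻¹ ln N)^(3/2)` for `eta`. The operator `P` sees only values at mesh
nodes, so `P u = P uᴵ` and `u - P uᴺ = (u - P u) + P (uᴵ - uᴺ)`, which is `sub_postprocess_ae`.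
Three facts then give the theorem.

Stability of `P` on discrete functions (`postprocess_stable_dX`, `postprocess_stable_dY`,
`postprocess_stable_val`). On a macrotriangle the nodal values and difference quotients of a
discrete function are controlled by its means over the mesh triangles, with constants that do not
see the aspect ratio; hence `P` is bounded in each part of the energy norm separately.

Approximation by quadratics (`postprocess_error_dX`, `postprocess_error_dY`,
`postprocess_error_val`). On each of the four blocks of the Shishkin mesh, `u` is a function that
varies on the scales resolved by the mesh plus layer terms of size `θ`. For the first part, Taylor
expansion gives an error `ρ²` in the values and at most `ρ²/ε` in the gradient; a layer strip has
area at most `ρ N ε`, so its share of the weighted gradient norm is `ρ² √(ρ N)`, which is of order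
`η` because `ln² N ≤ 4 N`.

Supercloseness of `uᴵ` and `uᴺ` (`discrete_error`). Let `χ = uᴵ - uᴺ` and `w = u - uᴵ`. Coercivity
bounds `‖χ‖²_SD` by `2 a_SD(χ, χ)`, and consistency (`error_equation`) turns the latter into four
terms in `w` and `χ`. (1) Diffusion in the layers uses cancellation (`block_superconvergence`):
`∂χ/∂x` is constant on a pair of triangles with a common horizontal edge, and the pair is symmetric
about the midpoint of that edge, so the first order part of `∂w/∂x` integrates to zero. Two extreme
rows of triangles in each block stay unpaired. There `∂w/∂x` is only `O(ρ/ε)`, but a row has area at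
most `2 ρ ε`, and this yields `ρ √(2ρ)`, a multiple of the rate. (2) Convection is integrated by
parts to `(w, b · ∇χ)`. In the layers `|w| = O(ρ²)` and the small area helps; on the coarse part
`|w| = O(N⁻²)`, and the streamline diffusion norm gives `‖b · ∇χ‖ ≤ √(N/C*) ‖χ‖_SD` with no power of
`ε`. (3) Reaction is `O(ρ²)`. (4) Stabilization lives on the coarse part only. Its smooth
contribution is `N⁻¹ · N⁻¹ · √N`. Derivatives of layer terms carry `ε⁻¹` there, but their integral
is `O(θ)` (`Params.integral_tail_le`), and an inverse estimate bounds `∇χ` by a multiple of `N²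
‖χ‖_SD`; this yields `N θ = N^(-3/2)`. Coarse diffusion is treated in the same way.

Coercivity for small `C*` follows from integration by parts and Young's inequality; Laplacians of
discrete functions vanish on triangles, so no inverse estimate is needed. Since `ε ≤ 1/N`, the term
`√ε/N` never exceeds `N^(-3/2)`, and the bound actually obtained is a multiple of `η` alone. -/

theorem uniqueDiffOn_closedSquare : UniqueDiffOn ℝ closedSquare :=
  (uniqueDiffOn_Icc zero_lt_one).prod (uniqueDiffOn_Icc zero_lt_one)

theorem isCompact_closedSquare : IsCompact closedSquare := isCompact_Icc.prod isCompact_Icc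

theorem Omega_subset : Omega ⊆ closedSquare :=
  prod_mono Ioo_subset_Icc_self Ioo_subset_Icc_self

theorem isOpen_Omega : IsOpen Omega := isOpen_Ioo.prod isOpen_Ioo

/-- Chain rule along a horizontal segment. The one-sided derivative therefore exists up to the
boundary, and the Fréchet form gives the regularity of partial derivatives. -/
theorem hasDerivWithinAt_dX {w : ℝ × ℝ → ℝ} (hw : DifferentiableOn ℝ w closedSquare)
    {p : ℝ × ℝ} (hp : p ∈ closedSquare) :
    HasDerivWithinAt (fun t => w (t, p.2)) (dX w p) (Icc 0 1) p.1 ∧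
      dX w p = fderivWithin ℝ w closedSquare p (1, 0) := by
  have h1 : HasDerivWithinAt (fun t : ℝ => (t, p.2)) ((1 : ℝ), (0 : ℝ)) (Icc 0 1) p.1 :=
    (hasDerivWithinAt_id _ _).prodMk (hasDerivWithinAt_const _ _ _)
  have h2 := ((hw p hp).hasFDerivWithinAt).comp_hasDerivWithinAt (f := fun t : ℝ => (t, p.2))
    p.1 h1 (fun t ht => ⟨ht, hp.2⟩)
  have h3 := h2.derivWithin (uniqueDiffOn_Icc zero_lt_one p.1 hp.1)
  refine ⟨?_, h3⟩
  have h4 : dX w p = fderivWithin ℝ w closedSquare p (1, 0) := h3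
  rw [h4]; exact h2

theorem hasDerivWithinAt_dY {w : ℝ × ℝ → ℝ} (hw : DifferentiableOn ℝ w closedSquare)
    {p : ℝ × ℝ} (hp : p ∈ closedSquare) :
    HasDerivWithinAt (fun t => w (p.1, t)) (dY w p) (Icc 0 1) p.2 ∧
      dY w p = fderivWithin ℝ w closedSquare p (0, 1) := by
  have h1 : HasDerivWithinAt (fun t : ℝ => (p.1, t)) ((0 : ℝ), (1 : ℝ)) (Icc 0 1) p.2 :=
    (hasDerivWithinAt_const _ _ _).prodMk (hasDerivWithinAt_id _ _)
  have h2 := ((hw p hp).hasFDerivWithinAt).comp_hasDerivWithinAt (f := fun t : ℝ => (p.1, t))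
    p.2 h1 (fun t ht => ⟨hp.1, ht⟩)
  have h3 := h2.derivWithin (uniqueDiffOn_Icc zero_lt_one p.2 hp.2)
  refine ⟨?_, h3⟩
  have h4 : dY w p = fderivWithin ℝ w closedSquare p (0, 1) := h3
  rw [h4]; exact h2

theorem dX_congr {v w : ℝ × ℝ → ℝ} (h : EqOn v w closedSquare) :
    EqOn (dX v) (dX w) closedSquare := fun _ hp =>
  derivWithin_congr (fun _ ht => h ⟨ht, hp.2⟩) (h hp)

theorem dY_congr {v w : ℝ × ℝ → ℝ} (h : EqOn v w closedSquare) :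
    EqOn (dY v) (dY w) closedSquare := fun _ hp =>
  derivWithin_congr (fun _ ht => h ⟨hp.1, ht⟩) (h hp)

theorem ContDiffOn.dX {n : ℕ} {w : ℝ × ℝ → ℝ} (hw : ContDiffOn ℝ (n + 1 : ℕ) w closedSquare) :
    ContDiffOn ℝ n (dX w) closedSquare := by
  have h := (hw.fderivWithin uniqueDiffOn_closedSquare (m := n) (by norm_cast)).clm_apply
    (contDiffOn_const (c := ((1 : ℝ), (0 : ℝ))))
  refine h.congr fun p hp => ?_
  exact (hasDerivWithinAt_dX (hw.differentiableOn (by norm_cast)) hp).2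

theorem ContDiffOn.dY {n : ℕ} {w : ℝ × ℝ → ℝ} (hw : ContDiffOn ℝ (n + 1 : ℕ) w closedSquare) :
    ContDiffOn ℝ n (dY w) closedSquare := by
  have h := (hw.fderivWithin uniqueDiffOn_closedSquare (m := n) (by norm_cast)).clm_apply
    (contDiffOn_const (c := ((0 : ℝ), (1 : ℝ))))
  refine h.congr fun p hp => ?_
  exact (hasDerivWithinAt_dY (hw.differentiableOn (by norm_cast)) hp).2

/-- Symmetry of second derivatives at boundary points is inherited from the interior, and this is
the geometric condition for it. -/
theorem closedSquare_subset_closure_interior :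
    closedSquare ⊆ closure (interior closedSquare) := by
  rw [closedSquare, interior_prod_eq, closure_prod_eq, interior_Icc,
    closure_Ioo (zero_ne_one' ℝ)]

/-- Both sides are the second Fréchet derivative within the square, applied to the two unit vectors
in opposite orders. -/
theorem dX_dY_comm {w : ℝ × ℝ → ℝ} (hw : ContDiffOn ℝ 2 w closedSquare) :
    EqOn (dX (dY w)) (dY (dX w)) closedSquare := by
  intro p hp
  have hw1 : ContDiffOn ℝ ((1 + 1 : ℕ) : ℕ) w closedSquare := by exact_mod_cast hw
  have hd := hw.differentiableOn (by norm_num)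
  have hf : DifferentiableOn ℝ (fderivWithin ℝ w closedSquare) closedSquare :=
    (hw.fderivWithin uniqueDiffOn_closedSquare (m := 1) (by norm_num)).differentiableOn (by simp)
  have key : ∀ a b : ℝ × ℝ,
      fderivWithin ℝ (fun q => fderivWithin ℝ w closedSquare q a) closedSquare p b =
        fderivWithin ℝ (fderivWithin ℝ w closedSquare) closedSquare p b a := by
    intro a b
    have h := ((hf p hp).hasFDerivWithinAt.clm_apply
      (hasFDerivWithinAt_const a p closedSquare)).fderivWithin (uniqueDiffOn_closedSquare p hp)
    rw [h]; simp
  have hs := (hw p hp).isSymmSndFDerivWithinAt (by simp) uniqueDiffOn_closedSquare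
    (closedSquare_subset_closure_interior hp) hp
  rw [(hasDerivWithinAt_dX ((ContDiffOn.dY hw1).differentiableOn (by simp)) hp).2,
    (hasDerivWithinAt_dY ((ContDiffOn.dX hw1).differentiableOn (by simp)) hp).2,
    fderivWithin_congr (fun q hq => (hasDerivWithinAt_dY hd hq).2)
      (hasDerivWithinAt_dY hd hp).2,
    fderivWithin_congr (fun q hq => (hasDerivWithinAt_dX hd hq).2)
      (hasDerivWithinAt_dX hd hp).2, key, key]
  exact hs _ _

theorem dX_add {v w : ℝ × ℝ → ℝ} (hv : DifferentiableOn ℝ v closedSquare)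
    (hw : DifferentiableOn ℝ w closedSquare) : EqOn (dX (v + w)) (dX v + dX w) closedSquare :=
  fun p hp => ((hasDerivWithinAt_dX hv hp).1.add (hasDerivWithinAt_dX hw hp).1).derivWithin
    (uniqueDiffOn_Icc zero_lt_one p.1 hp.1)

theorem dY_add {v w : ℝ × ℝ → ℝ} (hv : DifferentiableOn ℝ v closedSquare)
    (hw : DifferentiableOn ℝ w closedSquare) : EqOn (dY (v + w)) (dY v + dY w) closedSquare :=
  fun p hp => ((hasDerivWithinAt_dY hv hp).1.add (hasDerivWithinAt_dY hw hp).1).derivWithin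
    (uniqueDiffOn_Icc zero_lt_one p.2 hp.2)

theorem contDiffOn_iterate_dY {w : ℝ × ℝ → ℝ} (j : ℕ) {n : ℕ}
    (hw : ContDiffOn ℝ (n + j : ℕ) w closedSquare) : ContDiffOn ℝ n (dY^[j] w) closedSquare := by
  induction j generalizing n with
  | zero => exact hw
  | succ j ih =>
    rw [Function.iterate_succ_apply']
    exact ContDiffOn.dY (ih (by rwa [show n + 1 + j = n + (j + 1) by ring]))

theorem contDiffOn_partialD {w : ℝ × ℝ → ℝ} (i j : ℕ) {n : ℕ}
    (hw : ContDiffOn ℝ (n + i + j : ℕ) w closedSquare) :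
    ContDiffOn ℝ n (partialD i j w) closedSquare := by
  unfold partialD
  induction i generalizing n with
  | zero => exact contDiffOn_iterate_dY j hw
  | succ i ih =>
    rw [Function.iterate_succ_apply']
    exact ContDiffOn.dX (ih (by rwa [show n + 1 + i + j = n + (i + 1) + j by ring]))

theorem partialD_add {v w : ℝ × ℝ → ℝ} (i j : ℕ)
    (hv : ContDiffOn ℝ (i + j : ℕ) v closedSquare) (hw : ContDiffOn ℝ (i + j : ℕ) w closedSquare) :
    EqOn (partialD i j (v + w)) (partialD i j v + partialD i j w) closedSquare := by
  have hy : ∀ j : ℕ, ContDiffOn ℝ j v closedSquare → ContDiffOn ℝ j w closedSquare →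
      EqOn (dY^[j] (v + w)) (dY^[j] v + dY^[j] w) closedSquare := by
    intro j
    induction j with
    | zero => intro _ _ p _; rfl
    | succ j ih =>
      intro hv hw
      simp only [Function.iterate_succ_apply']
      have hle : ((j : ℕ) : WithTop ℕ∞) ≤ ((j + 1 : ℕ) : WithTop ℕ∞) := by
        exact_mod_cast Nat.le_succ j
      have h1 : ContDiffOn ℝ (1 + j : ℕ) v closedSquare := by rwa [add_comm]
      have h2 : ContDiffOn ℝ (1 + j : ℕ) w closedSquare := by rwa [add_comm]
      exact (dY_congr (ih (hv.of_le hle) (hw.of_le hle))).trans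
        (dY_add ((contDiffOn_iterate_dY j h1).differentiableOn (by simp))
          ((contDiffOn_iterate_dY j h2).differentiableOn (by simp)))
  unfold partialD
  induction i with
  | zero => exact hy j (by simpa using hv) (by simpa using hw)
  | succ i ih =>
    simp only [Function.iterate_succ_apply']
    have hle : ((i + j : ℕ) : WithTop ℕ∞) ≤ ((i + 1 + j : ℕ) : WithTop ℕ∞) := by
      exact_mod_cast (by omega)
    have h1 : ContDiffOn ℝ (1 + i + j : ℕ) v closedSquare := by rwa [add_comm 1 i]
    have h2 : ContDiffOn ℝ (1 + i + j : ℕ) w closedSquare := by rwa [add_comm 1 i]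
    exact (dX_congr (ih (hv.of_le hle) (hw.of_le hle))).trans
      (dX_add ((contDiffOn_partialD i j h1).differentiableOn (by simp))
        ((contDiffOn_partialD i j h2).differentiableOn (by simp)))

/-! ### Bounds on all derivatives up to order three -/

/-- `w ∈ C³` on the closed square, with `|∂_x^i ∂_y^j w| ≤ m i j` on the subset `R`. -/
structure JetBound (m : ℕ → ℕ → ℝ) (R : Set (ℝ × ℝ)) (w : ℝ × ℝ → ℝ) : Prop where
  smooth : ContDiffOn ℝ 3 w closedSquare
  bound : ∀ i j, i + j ≤ 3 → ∀ p ∈ R, |partialD i j w p| ≤ m i j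

namespace JetBound

variable {m m' : ℕ → ℕ → ℝ} {R : Set (ℝ × ℝ)} {w v : ℝ × ℝ → ℝ}

theorem mono (h : JetBound m R w) {R' : Set (ℝ × ℝ)} (hR : R' ⊆ R)
    (hm : ∀ i j, i + j ≤ 3 → m i j ≤ m' i j) : JetBound m' R' w :=
  ⟨h.smooth, fun i j hij p hp => (h.bound i j hij p (hR hp)).trans (hm i j hij)⟩

theorem add (hw : JetBound m R w) (hv : JetBound m' R v) (hR : R ⊆ closedSquare) :
    JetBound (m + m') R (w + v) := by
  refine ⟨hw.smooth.add hv.smooth, fun i j hij p hp => ?_⟩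
  have hle : ((i + j : ℕ) : WithTop ℕ∞) ≤ 3 := by exact_mod_cast hij
  rw [partialD_add i j (hw.smooth.of_le hle) (hv.smooth.of_le hle) (hR hp)]
  exact (abs_add_le _ _).trans (add_le_add (hw.bound i j hij p hp) (hv.bound i j hij p hp))

theorem smooth₂ (h : JetBound m R w) : ContDiffOn ℝ 2 w closedSquare :=
  h.smooth.of_le (by norm_num)

theorem smooth_dX (h : JetBound m R w) : ContDiffOn ℝ 2 (dX w) closedSquare :=
  ContDiffOn.dX (n := 2) (by exact_mod_cast h.smooth)

theorem smooth_dY (h : JetBound m R w) : ContDiffOn ℝ 2 (dY w) closedSquare :=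
  ContDiffOn.dY (n := 2) (by exact_mod_cast h.smooth)

theorem b00 (h : JetBound m R w) {p} (hp : p ∈ R) : |w p| ≤ m 0 0 := h.bound 0 0 (by norm_num) p hp
theorem b10 (h : JetBound m R w) {p} (hp : p ∈ R) : |dX w p| ≤ m 1 0 :=
  h.bound 1 0 (by norm_num) p hp
theorem b01 (h : JetBound m R w) {p} (hp : p ∈ R) : |dY w p| ≤ m 0 1 :=
  h.bound 0 1 (by norm_num) p hp
theorem b20 (h : JetBound m R w) {p} (hp : p ∈ R) : |dX (dX w) p| ≤ m 2 0 :=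
  h.bound 2 0 (by norm_num) p hp
theorem b02 (h : JetBound m R w) {p} (hp : p ∈ R) : |dY (dY w) p| ≤ m 0 2 :=
  h.bound 0 2 (by norm_num) p hp
-- `partialD` differentiates in `y` first, while the Taylor estimates below differentiate `dX w`
-- further. The mixed derivatives have to be reordered, here and in `b21` and `b12`.
theorem b11 (h : JetBound m R w) (hR : R ⊆ closedSquare) {p} (hp : p ∈ R) :
    |dY (dX w) p| ≤ m 1 1 := by
  rw [← dX_dY_comm h.smooth₂ (hR hp)]
  exact h.bound 1 1 (by norm_num) p hp
theorem b30 (h : JetBound m R w) {p} (hp : p ∈ R) : |dX (dX (dX w)) p| ≤ m 3 0 :=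
  h.bound 3 0 (by norm_num) p hp
theorem b21 (h : JetBound m R w) (hR : R ⊆ closedSquare) {p} (hp : p ∈ R) :
    |dY (dX (dX w)) p| ≤ m 2 1 := by
  rw [← dX_dY_comm h.smooth_dX (hR hp), ← dX_congr (dX_dY_comm h.smooth₂) (hR hp)]
  exact h.bound 2 1 (by norm_num) p hp
theorem b12 (h : JetBound m R w) (hR : R ⊆ closedSquare) {p} (hp : p ∈ R) :
    |dY (dY (dX w)) p| ≤ m 1 2 := by
  rw [← dY_congr (dX_dY_comm h.smooth₂) (hR hp), ← dX_dY_comm h.smooth_dY (hR hp)]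
  exact h.bound 1 2 (by norm_num) p hp

end JetBound

/-! ### Exchange of the coordinates -/

theorem swap_mem_closedSquare {p : ℝ × ℝ} : p.swap ∈ closedSquare ↔ p ∈ closedSquare := by
  simp [closedSquare]

theorem dX_swap (w : ℝ × ℝ → ℝ) : dX (w ∘ Prod.swap) = dY w ∘ Prod.swap := rfl

theorem dY_swap (w : ℝ × ℝ → ℝ) : dY (w ∘ Prod.swap) = dX w ∘ Prod.swap := rfl

theorem contDiffOn_swap {n : WithTop ℕ∞} {w : ℝ × ℝ → ℝ} (hw : ContDiffOn ℝ n w closedSquare) :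
    ContDiffOn ℝ n (w ∘ Prod.swap) closedSquare :=
  hw.comp (contDiff_snd.prodMk contDiff_fst).contDiffOn fun _ hp => swap_mem_closedSquare.2 hp

/-- Transports estimates in `x` to estimates in `y`. The swap reverses the order in which the
derivatives are taken; as `i + j ≤ 3`, commuting them back is a finite check. -/
theorem JetBound.swap {m : ℕ → ℕ → ℝ} {R : Set (ℝ × ℝ)} {w : ℝ × ℝ → ℝ} (h : JetBound m R w)
    (hR : R ⊆ closedSquare) :
    JetBound (fun i j => m j i) (Prod.swap ⁻¹' R) (w ∘ Prod.swap) := by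
  refine ⟨contDiffOn_swap h.smooth, fun i j hij p hp => ?_⟩
  have hp' := hR hp
  have hc1 := dX_dY_comm h.smooth₂ hp'
  have hc2 := dX_dY_comm h.smooth_dX hp'
  have hc3 := dX_dY_comm h.smooth_dY hp'
  have hc4 := dX_congr (dX_dY_comm h.smooth₂) hp'
  have hc5 := dY_congr (dX_dY_comm h.smooth₂) hp'
  have hb := h.bound j i (by omega) _ hp
  have : partialD i j (w ∘ Prod.swap) p = partialD j i w p.swap := by
    have hi : i ≤ 3 := by omega
    have hj : j ≤ 3 := by omega
    interval_cases i <;> interval_cases j <;> first | (exfalso; omega) | skip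
    all_goals
      simp only [partialD, Function.iterate_succ, Function.iterate_zero, Function.comp_apply, id,
        dX_swap, dY_swap]
    all_goals first | exact hc1.symm | exact hc2.symm.trans hc4.symm | exact hc5.symm.trans hc3.symm
  rw [this]; exact hb

/-! ### Taylor estimates on rectangles -/

/-- A rectangle inside the closed square, of width at most `h` and height at most `k`. -/
structure IsRect (R : Set (ℝ × ℝ)) (h k : ℝ) : Prop where
  exists_eq : ∃ a₁ a₂ b₁ b₂, R = Icc a₁ a₂ ×ˢ Icc b₁ b₂
  sub : R ⊆ closedSquare
  width : ∀ p ∈ R, ∀ q ∈ R, |p.1 - q.1| ≤ h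
  height : ∀ p ∈ R, ∀ q ∈ R, |p.2 - q.2| ≤ k

theorem IsRect.mk_mem {R : Set (ℝ × ℝ)} {h k : ℝ} (hR : IsRect R h k) {p q : ℝ × ℝ} (hp : p ∈ R)
    (hq : q ∈ R) : (p.1, q.2) ∈ R := by
  obtain ⟨a₁, a₂, b₁, b₂, rfl⟩ := hR.exists_eq
  exact ⟨hp.1, hq.2⟩

/-- Mean value inequality in the `x` direction. -/
theorem IsRect.mvt_x {R : Set (ℝ × ℝ)} {h k : ℝ} (hR : IsRect R h k) {f : ℝ → ℝ} {f' : ℝ → ℝ}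
    {M : ℝ} {y x₁ x₂ : ℝ} (h1 : (x₁, y) ∈ R) (h2 : (x₂, y) ∈ R)
    (hf : ∀ x, (x, y) ∈ R → HasDerivWithinAt f (f' x) (Icc 0 1) x)
    (hb : ∀ x, (x, y) ∈ R → |f' x| ≤ M) : |f x₂ - f x₁| ≤ M * |x₂ - x₁| := by
  obtain ⟨a₁, a₂, b₁, b₂, rfl⟩ := hR.exists_eq
  have hy : y ∈ Icc b₁ b₂ := h1.2
  have hs : Icc a₁ a₂ ⊆ Icc 0 1 := fun x hx => (hR.sub (show (x, y) ∈ _ from ⟨hx, hy⟩)).1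
  exact Convex.norm_image_sub_le_of_norm_hasDerivWithin_le (s := Icc a₁ a₂)
    (fun x hx => (hf x ⟨hx, hy⟩).mono hs) (fun x hx => hb x ⟨hx, hy⟩) (convex_Icc _ _) h1.1 h2.1

theorem IsRect.swap {R : Set (ℝ × ℝ)} {h k : ℝ} (hR : IsRect R h k) :
    IsRect (Prod.swap ⁻¹' R) k h := by
  obtain ⟨a₁, a₂, b₁, b₂, e⟩ := hR.exists_eq
  refine ⟨⟨b₁, b₂, a₁, a₂, ?_⟩, fun p hp => swap_mem_closedSquare.1 (hR.sub hp),
    fun p hp q hq => hR.height _ hp _ hq, fun p hp q hq => hR.width _ hp _ hq⟩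
  rw [e, preimage_swap_prod]

theorem IsRect.lipschitz_x {R : Set (ℝ × ℝ)} {h k : ℝ} (hR : IsRect R h k) {g : ℝ × ℝ → ℝ}
    (hg : DifferentiableOn ℝ g closedSquare) {M : ℝ} (hb : ∀ p ∈ R, |dX g p| ≤ M)
    {y x₁ x₂ : ℝ} (h1 : (x₁, y) ∈ R) (h2 : (x₂, y) ∈ R) :
    |g (x₂, y) - g (x₁, y)| ≤ M * |x₂ - x₁| :=
  hR.mvt_x h1 h2 (f := fun x => g (x, y)) (f' := fun x => dX g (x, y))
    (fun _ hx => (hasDerivWithinAt_dX hg (hR.sub hx)).1) fun _ hx => hb _ hx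

theorem IsRect.lipschitz_y {R : Set (ℝ × ℝ)} {h k : ℝ} (hR : IsRect R h k) {g : ℝ × ℝ → ℝ}
    (hg : DifferentiableOn ℝ g closedSquare) {M : ℝ} (hb : ∀ p ∈ R, |dY g p| ≤ M)
    {x y₁ y₂ : ℝ} (h1 : (x, y₁) ∈ R) (h2 : (x, y₂) ∈ R) :
    |g (x, y₂) - g (x, y₁)| ≤ M * |y₂ - y₁| := by
  have hg' : DifferentiableOn ℝ (g ∘ Prod.swap) closedSquare :=
    hg.comp (differentiable_snd.prodMk differentiable_fst).differentiableOn
      fun _ hp => swap_mem_closedSquare.2 hp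
  exact hR.swap.lipschitz_x hg' (fun p hp => hb _ hp) (y := x) (x₁ := y₁) (x₂ := y₂) h1 h2

/-- One-dimensional Taylor estimate in the `x` direction. -/
theorem IsRect.taylor_x {R : Set (ℝ × ℝ)} {h k : ℝ} (hR : IsRect R h k) {g : ℝ × ℝ → ℝ}
    (hg : ContDiffOn ℝ 2 g closedSquare) {M : ℝ} (hb : ∀ p ∈ R, |dX (dX g) p| ≤ M)
    {y a x : ℝ} (h1 : (a, y) ∈ R) (h2 : (x, y) ∈ R) :
    |g (x, y) - g (a, y) - (x - a) * dX g (a, y)| ≤ h ^ 2 * M := by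
  have hM : 0 ≤ M := (abs_nonneg _).trans (hb _ h1)
  have hgd : DifferentiableOn ℝ (dX g) closedSquare :=
    (ContDiffOn.dX (n := 1) (by exact_mod_cast hg)).differentiableOn (by simp)
  have h0 : |x - a| ≤ h := hR.width _ h2 _ h1
  have hh : 0 ≤ h := (abs_nonneg _).trans h0
  -- Mean value inequality for `g` minus its tangent at `a`, whose derivative is at most `M * h`.
  -- The factor `1/2` of Taylor's formula is given away.
  have := hR.mvt_x h1 h2 (f := fun t => g (t, y) - t * dX g (a, y))
    (f' := fun t => dX g (t, y) - 1 * dX g (a, y)) (M := M * h)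
    (fun t ht => ((hasDerivWithinAt_dX (hg.differentiableOn (by norm_num)) (hR.sub ht)).1).sub
      ((hasDerivWithinAt_id t _).mul_const _)) (fun t ht => by
        rw [one_mul]
        exact (hR.lipschitz_x hgd hb h1 ht).trans
          (mul_le_mul_of_nonneg_left (hR.width _ ht _ h1) hM))
  have e : g (x, y) - g (a, y) - (x - a) * dX g (a, y) =
    g (x, y) - x * dX g (a, y) - (g (a, y) - a * dX g (a, y)) := by ring
  rw [e]
  refine this.trans ?_
  calc M * h * |x - a| ≤ M * h * h := mul_le_mul_of_nonneg_left h0 (by positivity)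
    _ = h ^ 2 * M := by ring

theorem IsRect.taylor_y {R : Set (ℝ × ℝ)} {h k : ℝ} (hR : IsRect R h k) {g : ℝ × ℝ → ℝ}
    (hg : ContDiffOn ℝ 2 g closedSquare) {M : ℝ} (hb : ∀ p ∈ R, |dY (dY g) p| ≤ M)
    {x b y : ℝ} (h1 : (x, b) ∈ R) (h2 : (x, y) ∈ R) :
    |g (x, y) - g (x, b) - (y - b) * dY g (x, b)| ≤ k ^ 2 * M :=
  hR.swap.taylor_x (contDiffOn_swap hg) (fun _ hp => hb _ hp) (y := x) (a := b) (x := y) h1 h2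

/-- First order Taylor polynomial of `g` about `A`. -/
def taylor₁ (g : ℝ × ℝ → ℝ) (A p : ℝ × ℝ) : ℝ :=
  g A + (p.1 - A.1) * dX g A + (p.2 - A.2) * dY g A

/-- The path from `A` to `p` goes vertically to `(A.1, p.2)` and then horizontally; a rectangle
contains this corner. The mixed derivative enters because `dX g` must be moved from the corner back
to `A`. -/
theorem IsRect.taylor {R : Set (ℝ × ℝ)} {h k : ℝ} (hR : IsRect R h k) {g : ℝ × ℝ → ℝ}
    (hg : ContDiffOn ℝ 2 g closedSquare) {M₂₀ M₁₁ M₀₂ : ℝ} (h20 : ∀ p ∈ R, |dX (dX g) p| ≤ M₂₀)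
    (h11 : ∀ p ∈ R, |dY (dX g) p| ≤ M₁₁) (h02 : ∀ p ∈ R, |dY (dY g) p| ≤ M₀₂)
    {A p : ℝ × ℝ} (hA : A ∈ R) (hp : p ∈ R) :
    |g p - taylor₁ g A p| ≤ h ^ 2 * M₂₀ + h * k * M₁₁ + k ^ 2 * M₀₂ := by
  have hAp : (A.1, p.2) ∈ R := hR.mk_mem hA hp
  have hgd : DifferentiableOn ℝ (dX g) closedSquare :=
    (ContDiffOn.dX (n := 1) (by exact_mod_cast hg)).differentiableOn (by simp)
  have hM : 0 ≤ M₁₁ := (abs_nonneg _).trans (h11 _ hA)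
  have e1 := hR.taylor_x hg h20 hAp hp
  have e2 := hR.taylor_y hg h02 (x := A.1) (b := A.2) (y := p.2) hA hAp
  have e3 := hR.lipschitz_y hgd h11 (x := A.1) (y₁ := A.2) (y₂ := p.2) hA hAp
  have w1 := hR.width _ hp _ hA
  have w2 := hR.height _ hp _ hA
  have e4 : |(p.1 - A.1) * (dX g (A.1, p.2) - dX g A)| ≤ h * k * M₁₁ := by
    rw [abs_mul]
    calc _ ≤ h * (M₁₁ * k) := mul_le_mul w1 (e3.trans (mul_le_mul_of_nonneg_left w2 hM))
          (abs_nonneg _) ((abs_nonneg _).trans w1)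
      _ = _ := by ring
  have e : g p - taylor₁ g A p = (g (p.1, p.2) - g (A.1, p.2) - (p.1 - A.1) * dX g (A.1, p.2)) +
      (p.1 - A.1) * (dX g (A.1, p.2) - dX g A) +
      (g (A.1, p.2) - g (A.1, A.2) - (p.2 - A.2) * dY g (A.1, A.2)) := by
    unfold taylor₁; ring
  rw [e]
  exact (abs_add_three _ _ _).trans (add_le_add_three e1 e4 e2)

/-- The bound for second order Taylor remainders of `g`. -/
def rem₂ (m : ℕ → ℕ → ℝ) (h k : ℝ) : ℝ := h ^ 2 * m 2 0 + h * k * m 1 1 + k ^ 2 * m 0 2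

/-- The bound for second order Taylor remainders of `∂g/∂x`. -/
def rem₃ (m : ℕ → ℕ → ℝ) (h k : ℝ) : ℝ := h ^ 2 * m 3 0 + h * k * m 2 1 + k ^ 2 * m 1 2

theorem JetBound.taylor {m : ℕ → ℕ → ℝ} {R : Set (ℝ × ℝ)} {g : ℝ × ℝ → ℝ} {h k : ℝ}
    (hg : JetBound m R g) (hR : IsRect R h k) {A p : ℝ × ℝ} (hA : A ∈ R) (hp : p ∈ R) :
    |g p - taylor₁ g A p| ≤ rem₂ m h k :=
  hR.taylor hg.smooth₂ (fun _ hp => hg.b20 hp) (fun _ hp => hg.b11 hR.sub hp)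
    (fun _ hp => hg.b02 hp) hA hp

theorem JetBound.taylor_dX {m : ℕ → ℕ → ℝ} {R : Set (ℝ × ℝ)} {g : ℝ × ℝ → ℝ} {h k : ℝ}
    (hg : JetBound m R g) (hR : IsRect R h k) {A p : ℝ × ℝ} (hA : A ∈ R) (hp : p ∈ R) :
    |dX g p - taylor₁ (dX g) A p| ≤ rem₃ m h k :=
  hR.taylor hg.smooth_dX (fun _ hp => hg.b30 hp) (fun _ hp => hg.b21 hR.sub hp)
    (fun _ hp => hg.b12 hR.sub hp) hA hp

/-- Difference quotients are approximated by the Taylor polynomial of the derivative at the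
midpoint. -/
theorem JetBound.taylor_diff {m : ℕ → ℕ → ℝ} {R : Set (ℝ × ℝ)} {g : ℝ × ℝ → ℝ} {h k : ℝ}
    (hg : JetBound m R g) (hR : IsRect R h k) {A : ℝ × ℝ} {x₁ x₂ y : ℝ} (hA : A ∈ R)
    (h1 : (x₁, y) ∈ R) (h2 : (x₂, y) ∈ R) (hne : x₁ ≠ x₂) :
    |(g (x₂, y) - g (x₁, y)) / (x₂ - x₁) - taylor₁ (dX g) A ((x₁ + x₂) / 2, y)| ≤ rem₃ m h k := by
  have hpos : 0 < |x₂ - x₁| := abs_pos.2 (sub_ne_zero.2 hne.symm)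
  -- What is subtracted from `g` is a primitive in `t` of the Taylor polynomial of `dX g` about `A`.
  -- This polynomial is affine in `t`, so its mean over `[x₁, x₂]` is its value at the midpoint, and
  -- the mean value inequality controls the rest.
  have := hR.mvt_x h1 h2 (f := fun t => g (t, y) - (t * dX g A + (t - A.1) ^ 2 / 2 * dX (dX g) A +
      t * ((y - A.2) * dY (dX g) A)))
    (f' := fun t => dX g (t, y) - (1 * dX g A + (2 * (t - A.1) ^ 1 * 1) / 2 * dX (dX g) A +
      1 * ((y - A.2) * dY (dX g) A))) (M := rem₃ m h k)
    (fun t ht => ((hasDerivWithinAt_dX (hg.smooth.differentiableOn (by norm_num))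
      (hR.sub ht)).1).sub (((((hasDerivWithinAt_id t _).mul_const _)).add
      (((((hasDerivWithinAt_id t _).sub_const A.1).pow 2).div_const 2).mul_const _)).add
      ((hasDerivWithinAt_id t _).mul_const _))) (fun t ht => by
        have := hg.taylor_dX hR hA ht
        unfold taylor₁ at this
        convert this using 2
        ring)
  have e : (g (x₂, y) - g (x₁, y)) / (x₂ - x₁) - taylor₁ (dX g) A ((x₁ + x₂) / 2, y) =
      (g (x₂, y) - (x₂ * dX g A + (x₂ - A.1) ^ 2 / 2 * dX (dX g) A +
      x₂ * ((y - A.2) * dY (dX g) A)) - (g (x₁, y) - (x₁ * dX g A + (x₁ - A.1) ^ 2 / 2 *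
      dX (dX g) A + x₁ * ((y - A.2) * dY (dX g) A)))) / (x₂ - x₁) := by
    have : x₂ - x₁ ≠ 0 := sub_ne_zero.2 hne.symm
    unfold taylor₁
    field_simp
    ring
  rw [e, abs_div, div_le_iff₀ hpos]
  exact this


/-! ### Triangles and grids -/

/-- The open right triangle with right angle at `(a, b)` and signed legs `h`, `k`. -/
def otri (a b h k : ℝ) : Set (ℝ × ℝ) :=
  {p | 0 < (p.1 - a) / h ∧ 0 < (p.2 - b) / k ∧ (p.1 - a) / h + (p.2 - b) / k < 1}

theorem isOpen_otri (a b h k : ℝ) : IsOpen (otri a b h k) := by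
  have h1 : Continuous fun p : ℝ × ℝ => (p.1 - a) / h := by fun_prop
  have h2 : Continuous fun p : ℝ × ℝ => (p.2 - b) / k := by fun_prop
  exact (isOpen_lt continuous_const h1).inter
    ((isOpen_lt continuous_const h2).inter (isOpen_lt (h1.add h2) continuous_const))

theorem measurableSet_otri (a b h k : ℝ) : MeasurableSet (otri a b h k) :=
  (isOpen_otri a b h k).measurableSet

theorem volume_fst_eq (a : ℝ) : volume {p : ℝ × ℝ | p.1 = a} = 0 := by
  have : {p : ℝ × ℝ | p.1 = a} = {a} ×ˢ univ := by ext p; simp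
  rw [this, Measure.volume_eq_prod, Measure.prod_prod]; simp

theorem volume_snd_eq (a : ℝ) : volume {p : ℝ × ℝ | p.2 = a} = 0 := by
  have : {p : ℝ × ℝ | p.2 = a} = univ ×ˢ {a} := by ext p; simp
  rw [this, Measure.volume_eq_prod, Measure.prod_prod]; simp

theorem volume_diag (a b h : ℝ) {k : ℝ} (hk : k ≠ 0) :
    volume {p : ℝ × ℝ | (p.1 - a) / h + (p.2 - b) / k = 1} = 0 := by
  rw [Measure.volume_eq_prod, Measure.measure_prod_null]
  · refine Filter.Eventually.of_forall fun x => ?_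
    refine Set.Subsingleton.measure_zero (fun y hy z hz => ?_) _
    simp only [mem_preimage, mem_ofPred_eq] at hy hz
    have : (y - b) / k = (z - b) / k := by linarith
    field_simp at this
    linarith
  · exact (isClosed_eq (by fun_prop) continuous_const).measurableSet

theorem otri_subset_hull {a b h k : ℝ} (hh : h ≠ 0) (hk : k ≠ 0) :
    otri a b h k ⊆ convexHull ℝ {(a, b), (a + h, b), (a, b + k)} := by
  intro p hp
  obtain ⟨h1, h2, h3⟩ := hp
  have hc := (convex_convexHull ℝ ({(a, b), (a + h, b), (a, b + k)} : Set (ℝ × ℝ)))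
  have m1 := subset_convexHull ℝ ({(a, b), (a + h, b), (a, b + k)} : Set (ℝ × ℝ))
    (show (a, b) ∈ _ by simp)
  have m2 := subset_convexHull ℝ ({(a, b), (a + h, b), (a, b + k)} : Set (ℝ × ℝ))
    (show (a + h, b) ∈ _ by simp)
  have m3 := subset_convexHull ℝ ({(a, b), (a + h, b), (a, b + k)} : Set (ℝ × ℝ))
    (show (a, b + k) ∈ _ by simp)
  have := hc.sum_mem (t := Finset.univ) (w := ![1 - (p.1 - a) / h - (p.2 - b) / k, (p.1 - a) / h,
    (p.2 - b) / k]) (z := ![(a, b), (a + h, b), (a, b + k)])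
    (by intro i _; fin_cases i <;> simp <;> linarith)
    (by simp [Fin.sum_univ_three]; ring) (by intro i _; fin_cases i <;> simpa)
  convert this using 1
  simp [Fin.sum_univ_three]
  ext
  · simp; field_simp; ring
  · simp; field_simp; ring

/-- The two sets differ only on the three lines that carry the edges. -/
theorem hull_ae_eq_otri {a b h k : ℝ} (hh : h ≠ 0) (hk : k ≠ 0) :
    (convexHull ℝ {(a, b), (a + h, b), (a, b + k)} : Set (ℝ × ℝ)) =ᵐ[volume] otri a b h k := by
  refine Filter.EventuallyLE.antisymm ?_ (otri_subset_hull hh hk).eventuallyLE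
  rw [ae_le_set]
  refine measure_mono_null (t := {p | p.1 = a} ∪ {p | p.2 = b} ∪
    {p : ℝ × ℝ | (p.1 - a) / h + (p.2 - b) / k = 1}) ?_ ?_
  · rintro p ⟨hp, hn⟩
    obtain ⟨r, s, t, hr, hs, ht, hst, h1, h2⟩ := mem_triangle hp
    obtain rfl : r = 1 - s - t := by linarith
    have e1 : (p.1 - a) / h = s := by rw [h1]; field_simp; ring
    have e2 : (p.2 - b) / k = t := by rw [h2]; field_simp; ring
    by_contra hc
    simp only [mem_union, mem_ofPred_eq, not_or] at hc
    refine hn ⟨?_, ?_, ?_⟩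
    · rw [e1]; refine lt_of_le_of_ne hs fun h0 => hc.1.1 ?_
      rw [← h0] at h1; rw [h1]; simp; ring
    · rw [e2]; refine lt_of_le_of_ne ht fun h0 => hc.1.2 ?_
      rw [← h0] at h2; rw [h2]; simp; ring
    · refine lt_of_le_of_ne ?_ hc.2
      rw [e1, e2]; linarith
  · exact measure_union_null (measure_union_null (volume_fst_eq a) (volume_snd_eq b))
      (volume_diag a b h hk)

/-- `otri a b h k` is one of the two open triangles in the cell `(i, j)` of the grid `X × Y`. -/
def IsTri (X Y : ℕ → ℝ) (i j : ℕ) (a b h k : ℝ) : Prop :=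
  (a = X i ∧ b = Y j ∧ h = X (i + 1) - X i ∧ k = Y (j + 1) - Y j) ∨
    (a = X (i + 1) ∧ b = Y (j + 1) ∧ h = X i - X (i + 1) ∧ k = Y j - Y (j + 1))

/-- `0 = X 0 < ⋯ < X n = 1`. -/
structure IsGrid (n : ℕ) (X : ℕ → ℝ) : Prop where
  zero : X 0 = 0
  last : X n = 1
  lt : ∀ i < n, X i < X (i + 1)

namespace IsGrid

variable {n : ℕ} {X Y : ℕ → ℝ}

theorem mono (hX : IsGrid n X) {i j : ℕ} (hij : i ≤ j) (hj : j ≤ n) : X i ≤ X j := by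
  induction j, hij using Nat.le_induction with
  | base => exact le_rfl
  | succ b _ ih => exact (ih (by omega)).trans (hX.lt b (by omega)).le

theorem mem_Icc (hX : IsGrid n X) {i : ℕ} (hi : i ≤ n) : X i ∈ Icc (0 : ℝ) 1 :=
  ⟨hX.zero ▸ hX.mono (Nat.zero_le _) hi, hX.last ▸ hX.mono hi le_rfl⟩

theorem exists_cell (hX : IsGrid n X) {x : ℝ} (h0 : 0 < x) (h1 : x ≤ 1) :
    ∃ i < n, X i < x ∧ x ≤ X (i + 1) := by
  have hex : ∃ i, x ≤ X i := ⟨n, by rw [hX.last]; exact h1⟩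
  classical
  have hf := Nat.find_spec hex
  have hpos : Nat.find hex ≠ 0 := fun h => by rw [h, hX.zero] at hf; linarith
  have hle : Nat.find hex ≤ n := Nat.find_min' hex (by rw [hX.last]; exact h1)
  obtain ⟨i, hi⟩ := Nat.exists_eq_succ_of_ne_zero hpos
  have hm := Nat.find_min hex (m := i) (by omega)
  refine ⟨i, by omega, not_le.1 hm, ?_⟩
  rw [hi] at hf; exact hf

end IsGrid

theorem IsTri.ne {n : ℕ} {X Y : ℕ → ℝ} (hX : IsGrid n X) (hY : IsGrid n Y) {i j : ℕ} {a b h k : ℝ}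
    (ht : IsTri X Y i j a b h k) (hi : i < n) (hj : j < n) : h ≠ 0 ∧ k ≠ 0 := by
  have := hX.lt i hi
  have := hY.lt j hj
  rcases ht with ⟨-, -, rfl, rfl⟩ | ⟨-, -, rfl, rfl⟩ <;> constructor <;> intro h <;> linarith

/-- The open rectangle `(a, a + h) × (b, b + k)` for legs of arbitrary sign. -/
theorem IsTri.mem_cell {n : ℕ} {X Y : ℕ → ℝ} (hX : IsGrid n X) (hY : IsGrid n Y) {i j : ℕ}
    {a b h k : ℝ} (ht : IsTri X Y i j a b h k) (hi : i < n) (hj : j < n) {s t : ℝ} :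
    (0 ≤ s → s ≤ 1 → a + s * h ∈ Icc (X i) (X (i + 1))) ∧
    (0 ≤ t → t ≤ 1 → b + t * k ∈ Icc (Y j) (Y (j + 1))) ∧
    (0 < s → s < 1 → a + s * h ∈ Ioo (X i) (X (i + 1))) ∧
    (0 < t → t < 1 → b + t * k ∈ Ioo (Y j) (Y (j + 1))) := by
  have h1 := hX.lt i hi
  have h2 := hY.lt j hj
  rcases ht with ⟨rfl, rfl, rfl, rfl⟩ | ⟨rfl, rfl, rfl, rfl⟩
  all_goals refine ⟨fun _ _ => ⟨?_, ?_⟩, fun _ _ => ⟨?_, ?_⟩, fun _ _ => ⟨?_, ?_⟩,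
    fun _ _ => ⟨?_, ?_⟩⟩ <;> nlinarith

theorem otri_param {a b h k : ℝ} (hh : h ≠ 0) (hk : k ≠ 0) {p : ℝ × ℝ} (hp : p ∈ otri a b h k) :
    ∃ s t, 0 < s ∧ 0 < t ∧ s + t < 1 ∧ p = (a + s * h, b + t * k) := by
  refine ⟨(p.1 - a) / h, (p.2 - b) / k, hp.1, hp.2.1, hp.2.2, ?_⟩
  ext <;> field_simp <;> ring

theorem IsTri.otri_subset {n : ℕ} {X Y : ℕ → ℝ} (hX : IsGrid n X) (hY : IsGrid n Y) {i j : ℕ}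
    {a b h k : ℝ} (ht : IsTri X Y i j a b h k) (hi : i < n) (hj : j < n) :
    otri a b h k ⊆ Ioo (X i) (X (i + 1)) ×ˢ Ioo (Y j) (Y (j + 1)) := by
  intro p hp
  obtain ⟨hh, hk⟩ := ht.ne hX hY hi hj
  obtain ⟨s, t, hs, ht0, hst, rfl⟩ := otri_param hh hk hp
  exact ⟨(ht.mem_cell hX hY hi hj (t := 0)).2.2.1 hs (by linarith),
    (ht.mem_cell hX hY hi hj (s := 0)).2.2.2 ht0 (by linarith)⟩

/-- The union of all open triangles of the grid. -/
def goodSet (n : ℕ) (X Y : ℕ → ℝ) : Set (ℝ × ℝ) :=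
  {p | ∃ i < n, ∃ j < n, ∃ a b h k, IsTri X Y i j a b h k ∧ p ∈ otri a b h k}

theorem isOpen_goodSet (n : ℕ) (X Y : ℕ → ℝ) : IsOpen (goodSet n X Y) := by
  rw [isOpen_iff_mem_nhds]
  rintro p ⟨i, hi, j, hj, a, b, h, k, ht, hp⟩
  exact Filter.mem_of_superset ((isOpen_otri a b h k).mem_nhds hp) fun q hq =>
    ⟨i, hi, j, hj, a, b, h, k, ht, hq⟩

theorem cell_subset_Omega {n : ℕ} {X Y : ℕ → ℝ} (hX : IsGrid n X) (hY : IsGrid n Y) {i j : ℕ}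
    (hi : i < n) (hj : j < n) : Ioo (X i) (X (i + 1)) ×ˢ Ioo (Y j) (Y (j + 1)) ⊆ Omega :=
  prod_mono (Ioo_subset_Ioo (hX.mem_Icc hi.le).1 (hX.mem_Icc hi).2)
    (Ioo_subset_Ioo (hY.mem_Icc hj.le).1 (hY.mem_Icc hj).2)

theorem goodSet_subset {n : ℕ} {X Y : ℕ → ℝ} (hX : IsGrid n X) (hY : IsGrid n Y) :
    goodSet n X Y ⊆ Omega := by
  rintro p ⟨i, hi, j, hj, a, b, h, k, ht, hp⟩
  exact cell_subset_Omega hX hY hi hj (ht.otri_subset hX hY hi hj hp)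

/-- Off the grid lines and diagonals all inequalities that define the triangles are strict. In the
coordinates of the cell, the sign of `s + t - 1` decides between the two. -/
theorem mem_goodSet {n : ℕ} {X Y : ℕ → ℝ} (hX : IsGrid n X) (hY : IsGrid n Y) {p : ℝ × ℝ}
    (hp : p ∈ Omega) (h1 : ∀ i ≤ n, p.1 ≠ X i) (h2 : ∀ j ≤ n, p.2 ≠ Y j)
    (h3 : ∀ i < n, ∀ j < n,
      (p.1 - X i) / (X (i + 1) - X i) + (p.2 - Y j) / (Y (j + 1) - Y j) ≠ 1) :
    p ∈ goodSet n X Y := by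
  obtain ⟨i, hi, x1, x2⟩ := hX.exists_cell hp.1.1 hp.1.2.le
  obtain ⟨j, hj, y1, y2⟩ := hY.exists_cell hp.2.1 hp.2.2.le
  have x2 := lt_of_le_of_ne x2 (h1 _ hi)
  have y2 := lt_of_le_of_ne y2 (h2 _ hj)
  have hh : 0 < X (i + 1) - X i := by linarith
  have hk : 0 < Y (j + 1) - Y j := by linarith
  refine ⟨i, hi, j, hj, ?_⟩
  rcases lt_or_gt_of_ne (h3 i hi j hj) with h | h
  · exact ⟨X i, Y j, _, _, Or.inl ⟨rfl, rfl, rfl, rfl⟩, div_pos (by linarith) hh,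
      div_pos (by linarith) hk, h⟩
  · refine ⟨X (i + 1), Y (j + 1), _, _, Or.inr ⟨rfl, rfl, rfl, rfl⟩,
      div_pos_of_neg_of_neg (by linarith) (by linarith),
      div_pos_of_neg_of_neg (by linarith) (by linarith), ?_⟩
    have e1 : (p.1 - X (i + 1)) / (X i - X (i + 1)) = 1 - (p.1 - X i) / (X (i + 1) - X i) := by
      have : X i - X (i + 1) ≠ 0 := by linarith
      field_simp; ring
    have e2 : (p.2 - Y (j + 1)) / (Y j - Y (j + 1)) = 1 - (p.2 - Y j) / (Y (j + 1) - Y j) := by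
      have : Y j - Y (j + 1) ≠ 0 := by linarith
      field_simp; ring
    rw [e1, e2]; linarith

theorem ae_mem_goodSet {n : ℕ} {X Y : ℕ → ℝ} (hX : IsGrid n X) (hY : IsGrid n Y) :
    ∀ᵐ p ∂(volume.restrict Omega), p ∈ goodSet n X Y := by
  have h1 : ∀ᵐ p : ℝ × ℝ, ∀ i ≤ n, p.1 ≠ X i :=
    (ae_ball_iff (Set.to_countable _)).2 fun i _ =>
      measure_eq_zero_iff_ae_notMem.1 (volume_fst_eq (X i))
  have h2 : ∀ᵐ p : ℝ × ℝ, ∀ i ≤ n, p.2 ≠ Y i :=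
    (ae_ball_iff (Set.to_countable _)).2 fun i _ =>
      measure_eq_zero_iff_ae_notMem.1 (volume_snd_eq (Y i))
  have h3 : ∀ᵐ p : ℝ × ℝ, ∀ i < n, ∀ j < n,
      (p.1 - X i) / (X (i + 1) - X i) + (p.2 - Y j) / (Y (j + 1) - Y j) ≠ 1 :=
    (ae_ball_iff (Set.to_countable _)).2 fun i _ => (ae_ball_iff (Set.to_countable _)).2 fun j hj =>
      measure_eq_zero_iff_ae_notMem.1 (volume_diag _ _ _ (by have := hY.lt j hj; linarith))
  filter_upwards [ae_restrict_of_ae h1, ae_restrict_of_ae h2, ae_restrict_of_ae h3,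
    ae_restrict_mem isOpen_Omega.measurableSet] with p a b c d
  exact mem_goodSet hX hY d a b c

/-- On a vertical line through no node, an exceptional `y` is a node or the single intersection with
one of finitely many diagonals. Countability is what the fundamental theorem of calculus allows as
exceptional set. -/
theorem countable_slice_y {n : ℕ} {X Y : ℕ → ℝ} (hX : IsGrid n X) (hY : IsGrid n Y) {x : ℝ}
    (hx : x ∈ Ioo (0 : ℝ) 1) (h1 : ∀ i ≤ n, x ≠ X i) :
    {y | y ∈ Ioo (0 : ℝ) 1 ∧ (x, y) ∉ goodSet n X Y}.Countable := by
  refine Set.Countable.mono (s₂ := (⋃ j ∈ Iic n, {Y j}) ∪ ⋃ i ∈ Iio n, ⋃ j ∈ Iio n,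
    {y | (x - X i) / (X (i + 1) - X i) + (y - Y j) / (Y (j + 1) - Y j) = 1}) ?_ ?_
  · rintro y ⟨hy, hg⟩
    by_contra hc
    simp only [mem_union, mem_iUnion, not_or, not_exists, mem_Iic, mem_Iio, mem_ofPred_eq,
      mem_singleton_iff] at hc
    exact hg (mem_goodSet hX hY ⟨hx, hy⟩ h1 hc.1 hc.2)
  · refine Set.Countable.union ?_ ?_
    · exact (Set.to_countable _).biUnion fun j _ => Set.countable_singleton _
    · refine (Set.to_countable _).biUnion fun i _ => (Set.to_countable _).biUnion fun j hj => ?_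
      refine Set.Subsingleton.countable fun y hy z hz => ?_
      have : Y (j + 1) - Y j ≠ 0 := by have := hY.lt j hj; linarith
      simp only [mem_ofPred_eq] at hy hz
      have : (y - Y j) / (Y (j + 1) - Y j) = (z - Y j) / (Y (j + 1) - Y j) := by linarith
      field_simp at this
      linarith

theorem IsTri.swap {X Y : ℕ → ℝ} {i j : ℕ} {a b h k : ℝ} (ht : IsTri X Y i j a b h k) :
    IsTri Y X j i b a k h := by
  rcases ht with ⟨h1, h2, h3, h4⟩ | ⟨h1, h2, h3, h4⟩
  · exact Or.inl ⟨h2, h1, h4, h3⟩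
  · exact Or.inr ⟨h2, h1, h4, h3⟩

theorem swap_mem_otri {a b h k : ℝ} {p : ℝ × ℝ} : p.swap ∈ otri a b h k ↔ p ∈ otri b a k h := by
  simp only [otri, mem_ofPred_eq, Prod.fst_swap, Prod.snd_swap]
  rw [add_comm]; tauto

theorem swap_mem_goodSet {n : ℕ} {X Y : ℕ → ℝ} {p : ℝ × ℝ} :
    p.swap ∈ goodSet n X Y ↔ p ∈ goodSet n Y X := by
  constructor
  · rintro ⟨i, hi, j, hj, a, b, h, k, ht, hp⟩
    exact ⟨j, hj, i, hi, b, a, k, h, ht.swap, swap_mem_otri.1 hp⟩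
  · rintro ⟨i, hi, j, hj, a, b, h, k, ht, hp⟩
    exact ⟨j, hj, i, hi, b, a, k, h, ht.swap, swap_mem_otri.2 hp⟩

/-! ### Bounded measurable functions on `Omega` -/

/-- Essentially bounded functions on `Omega`. -/
abbrev BM (F : ℝ × ℝ → ℝ) : Prop := MemLp F ⊤ (volume.restrict Omega)

instance : IsFiniteMeasure (volume.restrict Omega) :=
  ⟨by
    rw [Measure.restrict_apply_univ]
    exact (measure_mono Omega_subset).trans_lt isCompact_closedSquare.measure_lt_top⟩

theorem BM.mul {F G : ℝ × ℝ → ℝ} (hF : BM F) (hG : BM G) : BM (fun p => F p * G p) :=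
  MemLp.mul (p := ⊤) (q := ⊤) (r := ⊤) hG hF

theorem BM.sq {F : ℝ × ℝ → ℝ} (hF : BM F) : BM (fun p => F p ^ 2) := by
  simp only [pow_two]; exact hF.mul hF

theorem BM.add {F G : ℝ × ℝ → ℝ} (hF : BM F) (hG : BM G) : BM (fun p => F p + G p) :=
  MemLp.add hF hG

theorem BM.sub {F G : ℝ × ℝ → ℝ} (hF : BM F) (hG : BM G) : BM (fun p => F p - G p) :=
  MemLp.sub hF hG

theorem BM.const (c : ℝ) : BM (fun _ => c) := memLp_const c

theorem BM.abs {F : ℝ × ℝ → ℝ} (hF : BM F) : BM (fun p => |F p|) := MemLp.norm hF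

theorem BM.int {F : ℝ × ℝ → ℝ} (hF : BM F) : IntegrableOn F Omega := hF.integrable le_top

/-- Up to a null set `Omega` is the open set `goodSet`, so continuity inside the triangles already
gives measurability. Jumps across edges, as for gradients of discrete functions, do no harm. -/
theorem BM.of_good {n : ℕ} {X Y : ℕ → ℝ} (hX : IsGrid n X) (hY : IsGrid n Y) {F : ℝ × ℝ → ℝ}
    (hc : ContinuousOn F (goodSet n X Y)) {C : ℝ} (hb : ∀ p ∈ goodSet n X Y, |F p| ≤ C) : BM F := by
  have hae := ae_mem_goodSet hX hY
  have e : volume.restrict Omega = volume.restrict (goodSet n X Y) := by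
    refine Measure.restrict_congr_set (Filter.EventuallyLE.antisymm ?_
      (goodSet_subset hX hY).eventuallyLE)
    rw [ae_restrict_iff' isOpen_Omega.measurableSet] at hae
    exact hae
  refine memLp_top_of_bound ?_ C ?_
  · rw [e]; exact hc.aestronglyMeasurable (isOpen_goodSet n X Y).measurableSet
  · filter_upwards [hae] with p hp using hb p hp

theorem BM.of_continuousOn {F : ℝ × ℝ → ℝ} (hF : ContinuousOn F closedSquare) : BM F := by
  obtain ⟨C, hC⟩ := isCompact_closedSquare.exists_bound_of_continuousOn hF
  refine memLp_top_of_bound ((hF.mono Omega_subset).aestronglyMeasurable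
    isOpen_Omega.measurableSet) C ?_
  filter_upwards [ae_restrict_mem isOpen_Omega.measurableSet] with p hp using hC p (Omega_subset hp)

theorem BM.congr {F G : ℝ × ℝ → ℝ} (hF : BM F) (h : ∀ᵐ p ∂(volume.restrict Omega), G p = F p) :
    BM G := (memLp_congr_ae h).2 hF

theorem integral_Omega_swap (F : ℝ × ℝ → ℝ) :
    ∫ p in Omega, F p.swap = ∫ p in Omega, F p := setIntegral_prod_swap _ _ F

theorem BM.swap {F : ℝ × ℝ → ℝ} (hF : BM F) : BM (F ∘ Prod.swap) := by
  have : MeasurePreserving Prod.swap (volume.restrict Omega) (volume.restrict Omega) := by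
    have h := (Measure.measurePreserving_swap (μ := (volume : Measure ℝ))
      (ν := (volume : Measure ℝ))).restrict_preimage (s := Omega) isOpen_Omega.measurableSet
    rwa [Omega, preimage_swap_prod] at h
  exact hF.comp_measurePreserving this

/-! ### Integration by parts -/

/-- Fubini. On almost every vertical line `ψ` is continuous, differentiable off a countable set and
zero at both ends, so its derivative integrates to zero. No edge terms appear because `ψ` itself
does not jump. -/
theorem integral_dY_eq_zero {n : ℕ} {X Y : ℕ → ℝ} (hX : IsGrid n X) (hY : IsGrid n Y)
    {ψ : ℝ × ℝ → ℝ} (hc : ContinuousOn ψ closedSquare)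
    (hd : ∀ p ∈ goodSet n X Y, DifferentiableAt ℝ ψ p)
    (h0 : ∀ p ∈ closedSquare \ Omega, ψ p = 0) (hb : BM (dY ψ)) : ∫ p in Omega, dY ψ p = 0 := by
  have hint := hb.int
  have e : (volume.restrict Omega : Measure (ℝ × ℝ)) =
      (volume.restrict (Ioo (0 : ℝ) 1)).prod (volume.restrict (Ioo (0 : ℝ) 1)) := by
    rw [Omega, Measure.volume_eq_prod, Measure.prod_restrict]
  have hi : Integrable (dY ψ) ((volume.restrict (Ioo (0 : ℝ) 1)).prod
      (volume.restrict (Ioo (0 : ℝ) 1))) := e ▸ hint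
  rw [e, integral_prod _ hi]
  have h1 : ∀ᵐ x : ℝ, ∀ i ≤ n, x ≠ X i :=
    (ae_ball_iff (Set.to_countable _)).2 fun i _ => by
      have : volume ({X i} : Set ℝ) = 0 := by simp
      filter_upwards [measure_eq_zero_iff_ae_notMem.1 this] with x hx using hx
  refine integral_eq_zero_of_ae ?_
  filter_upwards [hi.prod_right_ae, ae_restrict_of_ae h1, ae_restrict_mem measurableSet_Ioo]
    with x hx hxn hx01
  have hx' : x ∈ Icc (0 : ℝ) 1 := Ioo_subset_Icc_self hx01
  rw [Pi.zero_apply]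
  rw [← integral_Ioc_eq_integral_Ioo, ← intervalIntegral.integral_of_le zero_le_one]
  rw [integral_eq_of_hasDerivAt_off_countable_of_le (fun y => ψ (x, y))
    (fun y => dY ψ (x, y)) zero_le_one
    (countable_slice_y hX hY hx01 hxn)]
  · rw [h0 (x, 1) ⟨⟨hx', by simp⟩, fun h => absurd h.2.2 (lt_irrefl _)⟩,
      h0 (x, 0) ⟨⟨hx', by simp⟩, fun h => absurd h.2.1 (lt_irrefl _)⟩]; simp
  · exact hc.comp (by fun_prop) fun y hy => ⟨hx', hy⟩
  · rintro y ⟨hy, hyn⟩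
    have hg : (x, y) ∈ goodSet n X Y := by
      by_contra h; exact hyn ⟨hy, h⟩
    have hdy : DifferentiableAt ℝ (fun t => ψ (x, t)) y :=
      (hd _ hg).comp y (by fun_prop)
    have : dY ψ (x, y) = deriv (fun t => ψ (x, t)) y :=
      derivWithin_of_mem_nhds (Icc_mem_nhds hy.1 hy.2)
    rw [this]; exact hdy.hasDerivAt
  · rw [intervalIntegrable_iff_integrableOn_Ioo_of_le zero_le_one]
    exact hx

theorem integral_dX_eq_zero {n : ℕ} {X Y : ℕ → ℝ} (hX : IsGrid n X) (hY : IsGrid n Y)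
    {ψ : ℝ × ℝ → ℝ} (hc : ContinuousOn ψ closedSquare)
    (hd : ∀ p ∈ goodSet n X Y, DifferentiableAt ℝ ψ p)
    (h0 : ∀ p ∈ closedSquare \ Omega, ψ p = 0) (hb : BM (dX ψ)) : ∫ p in Omega, dX ψ p = 0 := by
  rw [← integral_Omega_swap]
  refine integral_dY_eq_zero (ψ := ψ ∘ Prod.swap) hY hX ?_ ?_ ?_ hb.swap
  · exact hc.comp continuous_swap.continuousOn fun _ hp => swap_mem_closedSquare.2 hp
  · intro p hp
    exact (hd _ (swap_mem_goodSet.2 hp)).comp p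
      (differentiable_snd.prodMk differentiable_fst).differentiableAt
  · rintro p ⟨hp, hn⟩
    exact h0 _ ⟨swap_mem_closedSquare.2 hp, fun h => hn ⟨h.2, h.1⟩⟩


/-! ### Decomposition of integrals -/

/-- The half-open unit square, which differs from `Omega` by a null set. -/
def hSquare : Set (ℝ × ℝ) := Ioc (0 : ℝ) 1 ×ˢ Ioc (0 : ℝ) 1

/-- Half-open rectangles tile the square without overlap. Integrals are split exactly over blocks of
`hSquare`, and this lemma transfers the result to `Omega`. -/
theorem restrict_hSquare : (volume.restrict hSquare : Measure (ℝ × ℝ)) = volume.restrict Omega := by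
  refine Measure.restrict_congr_set ?_
  rw [hSquare, Omega, Measure.volume_eq_prod]
  exact Measure.set_prod_ae_eq Ioo_ae_eq_Ioc.symm Ioo_ae_eq_Ioc.symm

theorem integral_hSquare (F : ℝ × ℝ → ℝ) : ∫ p in hSquare, F p = ∫ p in Omega, F p := by
  rw [restrict_hSquare]

theorem hSquare_subset : hSquare ⊆ closedSquare :=
  prod_mono Ioc_subset_Icc_self Ioc_subset_Icc_self

theorem BM.intOn {F : ℝ × ℝ → ℝ} (hF : BM F) {A : Set (ℝ × ℝ)} (hA : A ⊆ hSquare) :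
    IntegrableOn F A := by
  have h : IntegrableOn F hSquare := by
    unfold IntegrableOn; rw [restrict_hSquare]; exact hF.int
  exact h.mono_set hA

theorem ae_of_Omega {P : ℝ × ℝ → Prop} (h : ∀ᵐ p ∂(volume.restrict Omega), P p)
    {A : Set (ℝ × ℝ)} (hA : A ⊆ hSquare) : ∀ᵐ p ∂(volume.restrict A), P p := by
  rw [← restrict_hSquare] at h
  exact ae_mono (Measure.restrict_mono hA le_rfl) h

theorem integral_mono_subset {F : ℝ × ℝ → ℝ} (hF : BM F) (h0 : ∀ p, 0 ≤ F p) {A B : Set (ℝ × ℝ)}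
    (hAB : A ⊆ B) (hB : B ⊆ hSquare) : ∫ p in A, F p ≤ ∫ p in B, F p :=
  setIntegral_mono_set (hF.intOn hB) (Filter.Eventually.of_forall h0) hAB.eventuallyLE

theorem integral_le_Omega {F : ℝ × ℝ → ℝ} (hF : BM F) (h0 : ∀ p, 0 ≤ F p) {A : Set (ℝ × ℝ)}
    (hA : A ⊆ hSquare) : ∫ p in A, F p ≤ ∫ p in Omega, F p := by
  rw [← integral_hSquare]
  exact integral_mono_subset hF h0 hA le_rfl

/-- The half-open rectangle spanned by the nodes `i₀ ≤ i₁` and `j₀ ≤ j₁`. -/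
def block (X Y : ℕ → ℝ) (i₀ i₁ j₀ j₁ : ℕ) : Set (ℝ × ℝ) := Ioc (X i₀) (X i₁) ×ˢ Ioc (Y j₀) (Y j₁)

theorem measurableSet_block (X Y : ℕ → ℝ) (i₀ i₁ j₀ j₁ : ℕ) :
    MeasurableSet (block X Y i₀ i₁ j₀ j₁) := measurableSet_Ioc.prod measurableSet_Ioc

theorem block_subset {n : ℕ} {X Y : ℕ → ℝ} (hX : IsGrid n X) (hY : IsGrid n Y) {i₀ i₁ j₀ j₁ : ℕ}
    (hi0 : i₀ ≤ n) (hi : i₁ ≤ n) (hj0 : j₀ ≤ n) (hj : j₁ ≤ n) :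
    block X Y i₀ i₁ j₀ j₁ ⊆ hSquare :=
  prod_mono (Ioc_subset_Ioc (hX.mem_Icc hi0).1 (hX.mem_Icc hi).2)
    (Ioc_subset_Ioc (hY.mem_Icc hj0).1 (hY.mem_Icc hj).2)

theorem block_full {n : ℕ} {X Y : ℕ → ℝ} (hX : IsGrid n X) (hY : IsGrid n Y) :
    block X Y 0 n 0 n = hSquare := by
  unfold block hSquare; rw [hX.zero, hX.last, hY.zero, hY.last]

theorem block_mono {n : ℕ} {X Y : ℕ → ℝ} (hX : IsGrid n X) (hY : IsGrid n Y)
    {i₀ i₁ j₀ j₁ i₀' i₁' j₀' j₁' : ℕ} (h1 : i₀' ≤ i₀) (h2 : i₁ ≤ i₁') (h3 : j₀' ≤ j₀)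
    (h4 : j₁ ≤ j₁') (hi0 : i₀ ≤ n) (hi : i₁' ≤ n) (hj0 : j₀ ≤ n) (hj : j₁' ≤ n) :
    block X Y i₀ i₁ j₀ j₁ ⊆ block X Y i₀' i₁' j₀' j₁' :=
  prod_mono (Ioc_subset_Ioc (hX.mono h1 hi0) (hX.mono h2 hi))
    (Ioc_subset_Ioc (hY.mono h3 hj0) (hY.mono h4 hj))

theorem integral_block_x {n : ℕ} {X Y : ℕ → ℝ} (hX : IsGrid n X) (hY : IsGrid n Y)
    {F : ℝ × ℝ → ℝ} (hF : BM F) {i₀ i₁ j₀ j₁ : ℕ} (h : i₀ ≤ i₁) (hi : i₁ ≤ n) (hj0 : j₀ ≤ n)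
    (hj : j₁ ≤ n) : ∫ p in block X Y i₀ i₁ j₀ j₁, F p =
      ∑ i ∈ Finset.Ico i₀ i₁, ∫ p in block X Y i (i + 1) j₀ j₁, F p := by
  induction i₁, h using Nat.le_induction with
  | base => simp [block]
  | succ m hm ih =>
    have hs : block X Y i₀ (m + 1) j₀ j₁ = block X Y i₀ m j₀ j₁ ∪ block X Y m (m + 1) j₀ j₁ := by
      unfold block
      rw [← union_prod, Ioc_union_Ioc_eq_Ioc (hX.mono hm (by omega)) (hX.mono (by omega) hi)]
    have hd : Disjoint (block X Y i₀ m j₀ j₁) (block X Y m (m + 1) j₀ j₁) :=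
      Set.disjoint_prod.2 (Or.inl (Ioc_disjoint_Ioc_of_le le_rfl))
    rw [hs, setIntegral_union hd (measurableSet_block _ _ _ _ _ _)
      (hF.intOn (block_subset hX hY (by omega) (by omega) hj0 hj))
      (hF.intOn (block_subset hX hY (by omega) (by omega) hj0 hj)),
      ih (by omega), Finset.sum_Ico_succ_top hm]

theorem integral_block_y {n : ℕ} {X Y : ℕ → ℝ} (hX : IsGrid n X) (hY : IsGrid n Y)
    {F : ℝ × ℝ → ℝ} (hF : BM F) {i₀ i₁ j₀ j₁ : ℕ} (h : j₀ ≤ j₁) (hj : j₁ ≤ n) (hi0 : i₀ ≤ n)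
    (hi : i₁ ≤ n) : ∫ p in block X Y i₀ i₁ j₀ j₁, F p =
      ∑ j ∈ Finset.Ico j₀ j₁, ∫ p in block X Y i₀ i₁ j (j + 1), F p := by
  induction j₁, h using Nat.le_induction with
  | base => simp [block]
  | succ m hm ih =>
    have hs : block X Y i₀ i₁ j₀ (m + 1) = block X Y i₀ i₁ j₀ m ∪ block X Y i₀ i₁ m (m + 1) := by
      unfold block
      rw [← prod_union, Ioc_union_Ioc_eq_Ioc (hY.mono hm (by omega)) (hY.mono (by omega) hj)]
    have hd : Disjoint (block X Y i₀ i₁ j₀ m) (block X Y i₀ i₁ m (m + 1)) :=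
      Set.disjoint_prod.2 (Or.inr (Ioc_disjoint_Ioc_of_le le_rfl))
    rw [hs, setIntegral_union hd (measurableSet_block _ _ _ _ _ _)
      (hF.intOn (block_subset hX hY hi0 hi (by omega) (by omega)))
      (hF.intOn (block_subset hX hY hi0 hi (by omega) (by omega))),
      ih (by omega), Finset.sum_Ico_succ_top hm]

theorem integral_block_cells {n : ℕ} {X Y : ℕ → ℝ} (hX : IsGrid n X) (hY : IsGrid n Y)
    {F : ℝ × ℝ → ℝ} (hF : BM F) {i₀ i₁ j₀ j₁ : ℕ} (hi : i₀ ≤ i₁) (hin : i₁ ≤ n) (hj : j₀ ≤ j₁)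
    (hjn : j₁ ≤ n) : ∫ p in block X Y i₀ i₁ j₀ j₁, F p =
      ∑ i ∈ Finset.Ico i₀ i₁, ∑ j ∈ Finset.Ico j₀ j₁,
        ∫ p in block X Y i (i + 1) j (j + 1), F p := by
  rw [integral_block_x hX hY hF hi hin (by omega) hjn]
  refine Finset.sum_congr rfl fun i hi => ?_
  rw [Finset.mem_Ico] at hi
  exact integral_block_y hX hY hF hj hjn (by omega) (by omega)

/-- The lower left open triangle of a cell. -/
def o1 (X Y : ℕ → ℝ) (i j : ℕ) : Set (ℝ × ℝ) :=
  otri (X i) (Y j) (X (i + 1) - X i) (Y (j + 1) - Y j)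

/-- The upper right open triangle of a cell. -/
def o2 (X Y : ℕ → ℝ) (i j : ℕ) : Set (ℝ × ℝ) :=
  otri (X (i + 1)) (Y (j + 1)) (X i - X (i + 1)) (Y j - Y (j + 1))

theorem isTri_o1 (X Y : ℕ → ℝ) (i j : ℕ) :
    IsTri X Y i j (X i) (Y j) (X (i + 1) - X i) (Y (j + 1) - Y j) := Or.inl ⟨rfl, rfl, rfl, rfl⟩

theorem isTri_o2 (X Y : ℕ → ℝ) (i j : ℕ) :
    IsTri X Y i j (X (i + 1)) (Y (j + 1)) (X i - X (i + 1)) (Y j - Y (j + 1)) :=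
  Or.inr ⟨rfl, rfl, rfl, rfl⟩

theorem IsTri.subset_block {n : ℕ} {X Y : ℕ → ℝ} (hX : IsGrid n X) (hY : IsGrid n Y) {i j : ℕ}
    {a b h k : ℝ} (ht : IsTri X Y i j a b h k) (hi : i < n) (hj : j < n) :
    otri a b h k ⊆ block X Y i (i + 1) j (j + 1) :=
  (ht.otri_subset hX hY hi hj).trans (prod_mono Ioo_subset_Ioc_self Ioo_subset_Ioc_self)

theorem IsTri.subset_hSquare {n : ℕ} {X Y : ℕ → ℝ} (hX : IsGrid n X) (hY : IsGrid n Y) {i j : ℕ}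
    {a b h k : ℝ} (ht : IsTri X Y i j a b h k) (hi : i < n) (hj : j < n) :
    otri a b h k ⊆ hSquare :=
  (ht.subset_block hX hY hi hj).trans
    (block_subset hX hY hi.le (by omega) hj.le (by omega))

theorem mem_block_cell {n : ℕ} {X Y : ℕ → ℝ} (hX : IsGrid n X) (hY : IsGrid n Y) {i j i' j' : ℕ}
    (hi : i < n) (hj : j < n) (hi' : i' < n) (hj' : j' < n) {p : ℝ × ℝ}
    (h1 : p ∈ block X Y i (i + 1) j (j + 1)) (h2 : p ∈ block X Y i' (i' + 1) j' (j' + 1)) :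
    i = i' ∧ j = j' := by
  obtain ⟨⟨a1, a2⟩, a3, a4⟩ := h1
  obtain ⟨⟨b1, b2⟩, b3, b4⟩ := h2
  constructor
  · by_contra hne
    rcases lt_or_gt_of_ne hne with h | h
    · have := hX.mono (show i + 1 ≤ i' by omega) hi'.le; linarith
    · have := hX.mono (show i' + 1 ≤ i by omega) hi.le; linarith
  · by_contra hne
    rcases lt_or_gt_of_ne hne with h | h
    · have := hY.mono (show j + 1 ≤ j' by omega) hj'.le; linarith
    · have := hY.mono (show j' + 1 ≤ j by omega) hj.le; linarith

theorem disjoint_o1_o2 {n : ℕ} {X Y : ℕ → ℝ} (hX : IsGrid n X) (hY : IsGrid n Y) {i j : ℕ}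
    (hi : i < n) (hj : j < n) : Disjoint (o1 X Y i j) (o2 X Y i j) := by
  rw [Set.disjoint_left]
  rintro p ⟨-, -, h1⟩ ⟨-, -, h2⟩
  have := hX.lt i hi
  have := hY.lt j hj
  have e1 : (p.1 - X (i + 1)) / (X i - X (i + 1)) = 1 - (p.1 - X i) / (X (i + 1) - X i) := by
    have : X i - X (i + 1) ≠ 0 := by linarith
    have : X (i + 1) - X i ≠ 0 := by linarith
    field_simp; ring
  have e2 : (p.2 - Y (j + 1)) / (Y j - Y (j + 1)) = 1 - (p.2 - Y j) / (Y (j + 1) - Y j) := by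
    have : Y j - Y (j + 1) ≠ 0 := by linarith
    have : Y (j + 1) - Y j ≠ 0 := by linarith
    field_simp; ring
  rw [e1, e2] at h2
  linarith

/-- Almost every point of the cell lies in some open triangle of the grid. Half-open cells are
disjoint, hence this triangle belongs to the same cell and is one of its two. -/
theorem integral_cell {n : ℕ} {X Y : ℕ → ℝ} (hX : IsGrid n X) (hY : IsGrid n Y) {F : ℝ × ℝ → ℝ}
    (hF : BM F) {i j : ℕ} (hi : i < n) (hj : j < n) :
    ∫ p in block X Y i (i + 1) j (j + 1), F p =
      (∫ p in o1 X Y i j, F p) + ∫ p in o2 X Y i j, F p := by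
  have h1 := (isTri_o1 X Y i j).subset_block hX hY hi hj
  have h2 := (isTri_o2 X Y i j).subset_block hX hY hi hj
  have hb := block_subset hX hY hi.le (show i + 1 ≤ n by omega) hj.le (show j + 1 ≤ n by omega)
  rw [← setIntegral_union (disjoint_o1_o2 hX hY hi hj) (measurableSet_otri _ _ _ _)
    (hF.intOn (h1.trans hb)) (hF.intOn (h2.trans hb))]
  refine setIntegral_congr_set (Filter.EventuallyLE.antisymm ?_ (union_subset h1 h2).eventuallyLE)
  have hg := ae_of_Omega (ae_mem_goodSet hX hY) hb
  rw [ae_restrict_iff' (measurableSet_block _ _ _ _ _ _)] at hg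
  filter_upwards [hg] with p hp hpb
  obtain ⟨i', hi', j', hj', a, b, h, k, ht, hpo⟩ := hp hpb
  obtain ⟨rfl, rfl⟩ := mem_block_cell hX hY hi hj hi' hj' hpb (ht.subset_block hX hY hi' hj' hpo)
  rcases ht with ⟨rfl, rfl, rfl, rfl⟩ | ⟨rfl, rfl, rfl, rfl⟩
  · exact Or.inl hpo
  · exact Or.inr hpo

theorem integral_block {n : ℕ} {X Y : ℕ → ℝ} (hX : IsGrid n X) (hY : IsGrid n Y)
    {F : ℝ × ℝ → ℝ} (hF : BM F) {i₀ i₁ j₀ j₁ : ℕ} (hi : i₀ ≤ i₁) (hin : i₁ ≤ n) (hj : j₀ ≤ j₁)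
    (hjn : j₁ ≤ n) : ∫ p in block X Y i₀ i₁ j₀ j₁, F p =
      ∑ i ∈ Finset.Ico i₀ i₁, ∑ j ∈ Finset.Ico j₀ j₁,
        ((∫ p in o1 X Y i j, F p) + ∫ p in o2 X Y i j, F p) := by
  rw [integral_block_cells hX hY hF hi hin hj hjn]
  refine Finset.sum_congr rfl fun i hi => Finset.sum_congr rfl fun j hj => ?_
  rw [Finset.mem_Ico] at hi hj
  exact integral_cell hX hY hF (by omega) (by omega)

theorem integral_K1 {n : ℕ} {X Y : ℕ → ℝ} (hX : IsGrid n X) (hY : IsGrid n Y) (F : ℝ × ℝ → ℝ)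
    {i j : ℕ} (hi : i < n) (hj : j < n) : ∫ p in K1 X Y i j, F p = ∫ p in o1 X Y i j, F p := by
  obtain ⟨hh, hk⟩ := (isTri_o1 X Y i j).ne hX hY hi hj
  refine setIntegral_congr_set ?_
  convert hull_ae_eq_otri (a := X i) (b := Y j) hh hk using 1
  unfold K1 o1; simp

theorem integral_K2 {n : ℕ} {X Y : ℕ → ℝ} (hX : IsGrid n X) (hY : IsGrid n Y) (F : ℝ × ℝ → ℝ)
    {i j : ℕ} (hi : i < n) (hj : j < n) : ∫ p in K2 X Y i j, F p = ∫ p in o2 X Y i j, F p := by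
  obtain ⟨hh, hk⟩ := (isTri_o2 X Y i j).ne hX hY hi hj
  refine setIntegral_congr_set ?_
  convert hull_ae_eq_otri (a := X (i + 1)) (b := Y (j + 1)) hh hk using 1
  unfold K2 o2
  rw [Set.pair_comm (X (i + 1), Y j), Set.insert_comm]; simp

/-- The weights are constant on the coarse block and zero elsewhere, so the sum over triangles
collapses to one integral. -/
theorem stabSum_eq {n : ℕ} {X Y : ℕ → ℝ} (hX : IsGrid n X) (hY : IsGrid n Y) (Cs : ℝ)
    {F : ℝ × ℝ → ℝ} (hF : BM F) :
    stabSum Cs n X Y F = Cs / n * ∫ p in block X Y 0 (n / 2) 0 (n / 2), F p := by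
  rw [integral_block hX hY hF (Nat.zero_le _) (Nat.div_le_self _ _) (Nat.zero_le _)
    (Nat.div_le_self _ _), stabSum, Nat.Ico_zero_eq_range, Finset.mul_sum]
  have hsub : Finset.range (n / 2) ⊆ Finset.range n :=
    Finset.range_subset_range.2 (Nat.div_le_self _ _)
  rw [← Finset.sum_subset hsub]
  · refine Finset.sum_congr rfl fun i hi => ?_
    rw [Finset.mul_sum, ← Finset.sum_subset hsub]
    · refine Finset.sum_congr rfl fun j hj => ?_
      rw [Finset.mem_range] at hi hj
      rw [delta, if_pos ⟨hi, hj⟩, integral_K1 hX hY F (by omega) (by omega),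
        integral_K2 hX hY F (by omega) (by omega)]
    · intro j _ hj
      rw [Finset.mem_range] at hj
      rw [delta, if_neg (fun h => hj h.2), zero_mul]
  · intro i _ hi
    rw [Finset.mem_range] at hi
    exact Finset.sum_eq_zero fun j _ => by rw [delta, if_neg (fun h => hi h.1), zero_mul]

/-! ### Reflections -/

/-- Point reflections preserve Lebesgue measure. Used with `c / 2` the centre of a rectangle, and
with `c / 2` the midpoint of an edge shared by two triangles. -/
theorem integral_reflect (c : ℝ × ℝ) (S : Set (ℝ × ℝ)) (F : ℝ × ℝ → ℝ) :
    ∫ p in (fun p => c - p) ⁻¹' S, F (c - p) = ∫ p in S, F p :=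
  (Measure.measurePreserving_sub_left volume c).setIntegral_preimage_emb
    (MeasurableEquiv.subLeft c).measurableEmbedding F S

theorem reflect_otri (c : ℝ × ℝ) (a b h k : ℝ) :
    (fun p => c - p) ⁻¹' otri a b h k = otri (c.1 - a) (c.2 - b) (-h) (-k) := by
  ext p
  simp only [otri, mem_preimage, mem_ofPred_eq, Prod.fst_sub, Prod.snd_sub]
  have e1 : (p.1 - (c.1 - a)) / -h = (c.1 - p.1 - a) / h := by rw [div_neg, ← neg_div]; ring_nf
  have e2 : (p.2 - (c.2 - b)) / -k = (c.2 - p.2 - b) / k := by rw [div_neg, ← neg_div]; ring_nf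
  rw [e1, e2]

/-! ### Cauchy-Schwarz -/

/-- The quadratic polynomial `t ↦ ∫ (F - t G)²` is nonnegative, hence its discriminant is not
positive. -/
theorem integral_mul_sq_le {α : Type*} [MeasurableSpace α] {μ : Measure α} {F G : α → ℝ}
    (hF : Integrable (fun p => F p ^ 2) μ) (hFG : Integrable (fun p => F p * G p) μ)
    (hG : Integrable (fun p => G p ^ 2) μ) :
    (∫ p, F p * G p ∂μ) ^ 2 ≤ (∫ p, F p ^ 2 ∂μ) * ∫ p, G p ^ 2 ∂μ := by
  have key : ∀ t : ℝ, 0 ≤ (∫ p, G p ^ 2 ∂μ) * (t * t) + (-2 * ∫ p, F p * G p ∂μ) * t +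
      ∫ p, F p ^ 2 ∂μ := by
    intro t
    have h : ∫ p, (F p - t * G p) ^ 2 ∂μ = (∫ p, G p ^ 2 ∂μ) * (t * t) +
        (-2 * ∫ p, F p * G p ∂μ) * t + ∫ p, F p ^ 2 ∂μ := by
      have e : (fun p => (F p - t * G p) ^ 2) = fun p => t * t * G p ^ 2 + (-2 * t) * (F p * G p) +
          F p ^ 2 := by ext p; ring
      have i1 : Integrable (fun p => t * t * G p ^ 2) μ := hG.const_mul _
      have i2 : Integrable (fun p => (-2 * t) * (F p * G p)) μ := hFG.const_mul _
      have i3 : Integrable (fun p => t * t * G p ^ 2 + (-2 * t) * (F p * G p)) μ := i1.add i2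
      rw [e, integral_add i3 hF, integral_add i1 i2, integral_const_mul, integral_const_mul]
      ring
    rw [← h]
    exact integral_nonneg fun p => sq_nonneg _
  have := discrim_le_zero key
  unfold discrim at this
  linarith

theorem volume_real_hSquare_subset {A : Set (ℝ × ℝ)} (hA : A ⊆ hSquare) : volume A < ⊤ :=
  (measure_mono (hA.trans hSquare_subset)).trans_lt isCompact_closedSquare.measure_lt_top

/-- Weighted Cauchy-Schwarz inequality on a subset of the square. -/
theorem integral_abs_mul_sq_le {F G : ℝ × ℝ → ℝ} (hF : BM F) (hG : BM G) {A : Set (ℝ × ℝ)}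
    (hA : A ⊆ hSquare) {s : ℝ} (hs : ∀ᵐ p ∂(volume.restrict A), |F p| ≤ s) :
    (∫ p in A, |F p| * |G p|) ^ 2 ≤ s ^ 2 * volume.real A * ∫ p in Omega, G p ^ 2 := by
  have h1 := integral_mul_sq_le (hF.abs.sq.intOn hA) ((hF.abs.mul hG.abs).intOn hA)
    (hG.abs.sq.intOn hA)
  refine h1.trans (mul_le_mul ?_ ?_ (integral_nonneg fun p => sq_nonneg _) (by positivity))
  · have : ∫ p in A, |F p| ^ 2 ≤ ∫ _ in A, s ^ 2 :=
      integral_mono_ae (hF.abs.sq.intOn hA) ((BM.const (s ^ 2)).intOn hA)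
        (by filter_upwards [hs] with p hp using pow_le_pow_left₀ (abs_nonneg _) hp 2)
    refine this.trans (le_of_eq ?_)
    rw [setIntegral_const, smul_eq_mul, mul_comm]
  · simp only [sq_abs]
    exact integral_le_Omega hG.sq (fun p => sq_nonneg _) hA

theorem volume_real_rect {a b c d : ℝ} (h1 : a ≤ b) (h2 : c ≤ d) :
    volume.real (Ioc a b ×ˢ Ioc c d : Set (ℝ × ℝ)) = (b - a) * (d - c) := by
  rw [Measure.volume_eq_prod, measureReal_prod_prod]
  simp [h1, h2]


/-! ### Piecewise linear functions -/

theorem dX_eqOn_open {U : Set (ℝ × ℝ)} (hU : IsOpen U) {v w : ℝ × ℝ → ℝ} (h : EqOn v w U) :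
    EqOn (dX v) (dX w) U := by
  intro p hp
  refine Filter.EventuallyEq.derivWithin_eq_of_nhds ?_
  have hc : ContinuousAt (fun t : ℝ => (t, p.2)) p.1 := by fun_prop
  filter_upwards [hc.preimage_mem_nhds (hU.mem_nhds hp)] with t ht using h ht

theorem dY_eqOn_open {U : Set (ℝ × ℝ)} (hU : IsOpen U) {v w : ℝ × ℝ → ℝ} (h : EqOn v w U) :
    EqOn (dY v) (dY w) U := by
  intro p hp
  refine Filter.EventuallyEq.derivWithin_eq_of_nhds ?_
  have hc : ContinuousAt (fun t : ℝ => (p.1, t)) p.2 := by fun_prop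
  filter_upwards [hc.preimage_mem_nhds (hU.mem_nhds hp)] with t ht using h ht

theorem dX_of_hasDerivAt {q : ℝ × ℝ → ℝ} {p : ℝ × ℝ} (hp : p ∈ closedSquare) {d : ℝ}
    (h : HasDerivAt (fun t => q (t, p.2)) d p.1) : dX q p = d :=
  h.hasDerivWithinAt.derivWithin (uniqueDiffOn_Icc zero_lt_one p.1 hp.1)

theorem dY_of_hasDerivAt {q : ℝ × ℝ → ℝ} {p : ℝ × ℝ} (hp : p ∈ closedSquare) {d : ℝ}
    (h : HasDerivAt (fun t => q (p.1, t)) d p.2) : dY q p = d :=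
  h.hasDerivWithinAt.derivWithin (uniqueDiffOn_Icc zero_lt_one p.2 hp.2)

theorem dX_hasDerivAt {v : ℝ × ℝ → ℝ} {p : ℝ × ℝ} (hp : p ∈ Omega) (hv : DifferentiableAt ℝ v p) :
    HasDerivAt (fun t => v (t, p.2)) (dX v p) p.1 := by
  have h : DifferentiableAt ℝ (fun t => v (t, p.2)) p.1 :=
    DifferentiableAt.comp (g := v) (f := fun t : ℝ => (t, p.2)) p.1 hv (by fun_prop)
  rw [dX_of_hasDerivAt (Omega_subset hp) h.hasDerivAt]
  exact h.hasDerivAt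

theorem dY_hasDerivAt {v : ℝ × ℝ → ℝ} {p : ℝ × ℝ} (hp : p ∈ Omega) (hv : DifferentiableAt ℝ v p) :
    HasDerivAt (fun t => v (p.1, t)) (dY v p) p.2 := by
  have h : DifferentiableAt ℝ (fun t => v (p.1, t)) p.2 :=
    DifferentiableAt.comp (g := v) (f := fun t : ℝ => (p.1, t)) p.2 hv (by fun_prop)
  rw [dY_of_hasDerivAt (Omega_subset hp) h.hasDerivAt]
  exact h.hasDerivAt

/-- Continuous piecewise linear functions on the triangulation. -/
structure IsPL (n : ℕ) (X Y : ℕ → ℝ) (v : ℝ × ℝ → ℝ) : Prop where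
  cont : ContinuousOn v closedSquare
  affine₁ : ∀ i < n, ∀ j < n, IsAffineOn v (K1 X Y i j)
  affine₂ : ∀ i < n, ∀ j < n, IsAffineOn v (K2 X Y i j)

theorem IsFE.isPL {n : ℕ} {X Y : ℕ → ℝ} {v : ℝ × ℝ → ℝ} (hv : IsFE n X Y v) : IsPL n X Y v :=
  ⟨hv.cont, hv.affine₁, hv.affine₂⟩

theorem IsAffineOn.sub {v w : ℝ × ℝ → ℝ} {K : Set (ℝ × ℝ)} (hv : IsAffineOn v K)
    (hw : IsAffineOn w K) : IsAffineOn (v - w) K := by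
  obtain ⟨a, b, c, h⟩ := hv
  obtain ⟨a', b', c', h'⟩ := hw
  exact ⟨a - a', b - b', c - c', fun p hp => by rw [Pi.sub_apply, h p hp, h' p hp]; ring⟩

theorem IsFE.sub {n : ℕ} {X Y : ℕ → ℝ} {v w : ℝ × ℝ → ℝ} (hv : IsFE n X Y v) (hw : IsFE n X Y w) :
    IsFE n X Y (v - w) :=
  ⟨hv.cont.sub hw.cont, fun i hi j hj => (hv.affine₁ i hi j hj).sub (hw.affine₁ i hi j hj),
    fun i hi j hj => (hv.affine₂ i hi j hj).sub (hw.affine₂ i hi j hj),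
    fun p hp => by rw [Pi.sub_apply, hv.bdry p hp, hw.bdry p hp, sub_zero]⟩

theorem K1_eq_hull (X Y : ℕ → ℝ) (i j : ℕ) : K1 X Y i j = convexHull ℝ
    {(X i, Y j), (X i + (X (i + 1) - X i), Y j), (X i, Y j + (Y (j + 1) - Y j))} := by
  simp [K1]

theorem K2_eq_hull (X Y : ℕ → ℝ) (i j : ℕ) : K2 X Y i j = convexHull ℝ
    {(X (i + 1), Y (j + 1)), (X (i + 1) + (X i - X (i + 1)), Y (j + 1)),
      (X (i + 1), Y (j + 1) + (Y j - Y (j + 1)))} := by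
  unfold K2
  rw [Set.pair_comm (X (i + 1), Y j), Set.insert_comm]; simp

/-- The difference quotient of `v` along the horizontal leg of a triangle. -/
def slopeX (v : ℝ × ℝ → ℝ) (a b h : ℝ) : ℝ := (v (a + h, b) - v (a, b)) / h

/-- The difference quotient of `v` along the vertical leg of a triangle. -/
def slopeY (v : ℝ × ℝ → ℝ) (a b k : ℝ) : ℝ := (v (a, b + k) - v (a, b)) / k

section

variable {n : ℕ} {X Y : ℕ → ℝ} {v : ℝ × ℝ → ℝ} {i j : ℕ} {a b h k : ℝ}

theorem IsPL.eq_on_hull (hX : IsGrid n X) (hY : IsGrid n Y) (hv : IsPL n X Y v)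
    (ht : IsTri X Y i j a b h k) (hi : i < n) (hj : j < n) {p : ℝ × ℝ}
    (hp : p ∈ convexHull ℝ {(a, b), (a + h, b), (a, b + k)}) :
    v p = v (a, b) + (p.1 - a) * slopeX v a b h + (p.2 - b) * slopeY v a b k := by
  obtain ⟨hh, hk⟩ := ht.ne hX hY hi hj
  have ha : IsAffineOn v (convexHull ℝ {(a, b), (a + h, b), (a, b + k)}) := by
    rcases ht with ⟨rfl, rfl, rfl, rfl⟩ | ⟨rfl, rfl, rfl, rfl⟩
    · rw [← K1_eq_hull]; exact hv.affine₁ i hi j hj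
    · rw [← K2_eq_hull]; exact hv.affine₂ i hi j hj
  obtain ⟨c₀, c₁, c₂, hc⟩ := ha
  have hs := subset_convexHull ℝ ({(a, b), (a + h, b), (a, b + k)} : Set (ℝ × ℝ))
  unfold slopeX slopeY
  rw [hc p hp, hc _ (hs (show (a, b) ∈ _ by simp)), hc _ (hs (show (a + h, b) ∈ _ by simp)),
    hc _ (hs (show (a, b + k) ∈ _ by simp))]
  simp only
  field_simp
  ring

theorem IsPL.eq_on_otri (hX : IsGrid n X) (hY : IsGrid n Y) (hv : IsPL n X Y v)
    (ht : IsTri X Y i j a b h k) (hi : i < n) (hj : j < n) :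
    EqOn v (fun p => v (a, b) + (p.1 - a) * slopeX v a b h + (p.2 - b) * slopeY v a b k)
      (otri a b h k) := fun _ hp => by
  obtain ⟨hh, hk⟩ := ht.ne hX hY hi hj
  exact hv.eq_on_hull hX hY ht hi hj (otri_subset_hull hh hk hp)

theorem IsTri.otri_subset_closed (hX : IsGrid n X) (hY : IsGrid n Y)
    (ht : IsTri X Y i j a b h k) (hi : i < n) (hj : j < n) : otri a b h k ⊆ closedSquare :=
  (ht.subset_hSquare hX hY hi hj).trans hSquare_subset

theorem IsPL.dX_eq (hX : IsGrid n X) (hY : IsGrid n Y) (hv : IsPL n X Y v)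
    (ht : IsTri X Y i j a b h k) (hi : i < n) (hj : j < n) :
    EqOn (dX v) (fun _ => slopeX v a b h) (otri a b h k) := fun p hp => by
  rw [dX_eqOn_open (isOpen_otri _ _ _ _) (hv.eq_on_otri hX hY ht hi hj) hp]
  refine dX_of_hasDerivAt (ht.otri_subset_closed hX hY hi hj hp) ?_
  have := (((hasDerivAt_id p.1).sub_const a).mul_const (slopeX v a b h)).const_add (v (a, b))
  simpa using this.add_const ((p.2 - b) * slopeY v a b k)

theorem IsPL.dY_eq (hX : IsGrid n X) (hY : IsGrid n Y) (hv : IsPL n X Y v)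
    (ht : IsTri X Y i j a b h k) (hi : i < n) (hj : j < n) :
    EqOn (dY v) (fun _ => slopeY v a b k) (otri a b h k) := fun p hp => by
  rw [dY_eqOn_open (isOpen_otri _ _ _ _) (hv.eq_on_otri hX hY ht hi hj) hp]
  refine dY_of_hasDerivAt (ht.otri_subset_closed hX hY hi hj hp) ?_
  have := (((hasDerivAt_id p.2).sub_const b).mul_const (slopeY v a b k)).const_add
    (v (a, b) + (p.1 - a) * slopeX v a b h)
  simpa using this

/-- On an open triangle the first derivatives are constant. This removes the Laplacian of a discrete
function from the stabilization form. -/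
theorem IsPL.dX_dX_eq (hX : IsGrid n X) (hY : IsGrid n Y) (hv : IsPL n X Y v) {p : ℝ × ℝ}
    (hp : p ∈ goodSet n X Y) : dX (dX v) p = 0 ∧ dY (dY v) p = 0 := by
  obtain ⟨i, hi, j, hj, a, b, h, k, ht, hp⟩ := hp
  have hq := ht.otri_subset_closed hX hY hi hj hp
  constructor
  · rw [dX_eqOn_open (isOpen_otri _ _ _ _) (hv.dX_eq hX hY ht hi hj) hp]
    exact dX_of_hasDerivAt hq (hasDerivAt_const _ _)
  · rw [dY_eqOn_open (isOpen_otri _ _ _ _) (hv.dY_eq hX hY ht hi hj) hp]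
    exact dY_of_hasDerivAt hq (hasDerivAt_const _ _)

theorem IsPL.differentiableAt (hX : IsGrid n X) (hY : IsGrid n Y) (hv : IsPL n X Y v) {p : ℝ × ℝ}
    (hp : p ∈ goodSet n X Y) : DifferentiableAt ℝ v p := by
  obtain ⟨i, hi, j, hj, a, b, h, k, ht, hp⟩ := hp
  have he := (hv.eq_on_otri hX hY ht hi hj).eventuallyEq_of_mem ((isOpen_otri a b h k).mem_nhds hp)
  exact DifferentiableAt.congr_of_eventuallyEq (by fun_prop) he

/-- On each open triangle `F` agrees with a globally continuous function, which is bounded on the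
square. There are finitely many triangles, so the sum of all local bounds serves as a global one. -/
theorem BM.of_locally_continuous (hX : IsGrid n X) (hY : IsGrid n Y) {F : ℝ × ℝ → ℝ}
    (s : ℝ → ℝ → ℝ → ℝ → ℝ × ℝ → ℝ) (hs : ∀ a b h k, Continuous (s a b h k))
    (hF : ∀ i j a b h k, IsTri X Y i j a b h k → i < n → j < n →
      EqOn F (s a b h k) (otri a b h k)) : BM F := by
  have hB : ∀ a b h k, ∃ B, ∀ p ∈ closedSquare, |s a b h k p| ≤ B := fun a b h k =>
    isCompact_closedSquare.exists_bound_of_continuousOn (hs a b h k).continuousOn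
  choose B hB using hB
  refine BM.of_good hX hY (C := ∑ i ∈ Finset.range n, ∑ j ∈ Finset.range n,
    (|B (X i) (Y j) (X (i + 1) - X i) (Y (j + 1) - Y j)| +
      |B (X (i + 1)) (Y (j + 1)) (X i - X (i + 1)) (Y j - Y (j + 1))|)) ?_ ?_
  · rintro p ⟨i, hi, j, hj, a, b, h, k, ht, hp⟩
    refine ContinuousAt.continuousWithinAt ?_
    exact (hs a b h k).continuousAt.congr ((hF i j a b h k ht hi hj).symm.eventuallyEq_of_mem
      ((isOpen_otri a b h k).mem_nhds hp))
  · rintro p ⟨i, hi, j, hj, a, b, h, k, ht, hp⟩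
    rw [hF i j a b h k ht hi hj hp]
    refine ((hB a b h k p (ht.otri_subset_closed hX hY hi hj hp)).trans (le_abs_self _)).trans ?_
    refine le_trans ?_ (Finset.single_le_sum (f := fun i => ∑ j ∈ Finset.range n,
      (|B (X i) (Y j) (X (i + 1) - X i) (Y (j + 1) - Y j)| +
      |B (X (i + 1)) (Y (j + 1)) (X i - X (i + 1)) (Y j - Y (j + 1))|))
      (fun i _ => by positivity) (Finset.mem_range.2 hi))
    refine le_trans ?_ (Finset.single_le_sum (f := fun j =>
      (|B (X i) (Y j) (X (i + 1) - X i) (Y (j + 1) - Y j)| +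
      |B (X (i + 1)) (Y (j + 1)) (X i - X (i + 1)) (Y j - Y (j + 1))|))
      (fun i _ => by positivity) (Finset.mem_range.2 hj))
    rcases ht with ⟨rfl, rfl, rfl, rfl⟩ | ⟨rfl, rfl, rfl, rfl⟩
    · exact le_add_of_nonneg_right (abs_nonneg _)
    · exact le_add_of_nonneg_left (abs_nonneg _)

theorem BM.of_locally_const (hX : IsGrid n X) (hY : IsGrid n Y) {F : ℝ × ℝ → ℝ}
    (s : ℝ → ℝ → ℝ → ℝ → ℝ) (hF : ∀ i j a b h k, IsTri X Y i j a b h k → i < n → j < n →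
      EqOn F (fun _ => s a b h k) (otri a b h k)) : BM F :=
  BM.of_locally_continuous hX hY (fun a b h k _ => s a b h k) (fun _ _ _ _ => continuous_const) hF

theorem IsPL.bm (hv : IsPL n X Y v) : BM v := BM.of_continuousOn hv.cont

theorem IsPL.bm_dX (hX : IsGrid n X) (hY : IsGrid n Y) (hv : IsPL n X Y v) : BM (dX v) :=
  BM.of_locally_const hX hY (fun a b h _ => slopeX v a b h)
    fun _ _ _ _ _ _ ht hi hj => hv.dX_eq hX hY ht hi hj

theorem IsPL.bm_dY (hX : IsGrid n X) (hY : IsGrid n Y) (hv : IsPL n X Y v) : BM (dY v) :=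
  BM.of_locally_const hX hY (fun a b _ k => slopeY v a b k)
    fun _ _ _ _ _ _ ht hi hj => hv.dY_eq hX hY ht hi hj

end

/-! ### Nodal interpolation -/

/-- The piecewise linear map that sends the node `X i` to `i`. -/
def gridCoord (n : ℕ) (X : ℕ → ℝ) (x : ℝ) : ℝ :=
  ∑ i ∈ Finset.range n, max 0 (min 1 ((x - X i) / (X (i + 1) - X i)))

theorem continuous_gridCoord (n : ℕ) (X : ℕ → ℝ) : Continuous (gridCoord n X) := by
  unfold gridCoord
  refine continuous_finsetSum _ fun i _ => ?_
  fun_prop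

/-- Each summand is a ramp that climbs from 0 to 1 across one cell. Cells to the left of `x`
contribute 1, those to the right 0, and the cell of `x` contributes the local coordinate. -/
theorem gridCoord_eq {n : ℕ} {X : ℕ → ℝ} (hX : IsGrid n X) {i : ℕ} (hi : i < n) {x : ℝ}
    (h0 : X i ≤ x) (h1 : x ≤ X (i + 1)) :
    gridCoord n X x = i + (x - X i) / (X (i + 1) - X i) := by
  unfold gridCoord
  have key : ∀ l ∈ Finset.range n, max 0 (min 1 ((x - X l) / (X (l + 1) - X l))) =
      (if l < i then 1 else 0) + if l = i then (x - X i) / (X (i + 1) - X i) else 0 := by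
    intro l hl
    rw [Finset.mem_range] at hl
    have hpos : 0 < X (l + 1) - X l := by have := hX.lt l hl; linarith
    rcases lt_trichotomy l i with h | h | h
    · rw [if_pos h, if_neg h.ne, add_zero]
      have := hX.mono (show l + 1 ≤ i by omega) hi.le
      rw [min_eq_left ((one_le_div hpos).2 (by linarith)), max_eq_right zero_le_one]
    · subst h
      rw [if_neg (lt_irrefl _), if_pos rfl, zero_add,
        min_eq_right ((div_le_one hpos).2 (by linarith)),
        max_eq_right (div_nonneg (by linarith) hpos.le)]
    · rw [if_neg (by omega), if_neg (by omega), add_zero]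
      have := hX.mono (show i + 1 ≤ l by omega) hl.le
      have h2 : (x - X l) / (X (l + 1) - X l) ≤ 0 :=
        div_nonpos_of_nonpos_of_nonneg (by linarith) hpos.le
      exact max_eq_left ((min_le_right _ _).trans h2)
  rw [Finset.sum_congr rfl key, Finset.sum_add_distrib, Finset.sum_ite_eq',
    if_pos (Finset.mem_range.2 hi), ← Finset.sum_filter]
  have : (Finset.range n).filter (· < i) = Finset.range i := by
    ext l; simp only [Finset.mem_filter, Finset.mem_range]; omega
  rw [this]; simp

theorem gridCoord_node {n : ℕ} {X : ℕ → ℝ} (hX : IsGrid n X) {i : ℕ} (hi : i ≤ n) (hn : 0 < n) :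
    gridCoord n X (X i) = i := by
  rcases hi.lt_or_eq with h | rfl
  · rw [gridCoord_eq hX h le_rfl (hX.lt i h).le]; simp
  · obtain ⟨m, rfl⟩ := Nat.exists_eq_succ_of_ne_zero hn.ne'
    have := hX.lt m (by omega)
    rw [gridCoord_eq hX (show m < m.succ by omega) this.le le_rfl, div_self (by linarith)]
    push_cast; ring

/-- The nodal basis function of the uniform triangulation with vertices `ℤ × ℤ`. -/
def hat (s t : ℝ) : ℝ := max 0 (1 - max (max |s| |t|) |s + t|)

theorem continuous_hat : Continuous fun p : ℝ × ℝ => hat p.1 p.2 := by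
  unfold hat; fun_prop

theorem hat_neg (s t : ℝ) : hat (-s) (-t) = hat s t := by
  unfold hat; rw [← neg_add, abs_neg, abs_neg, abs_neg]

theorem hat_eq_zero {s t : ℝ} (h : 1 ≤ |s| ∨ 1 ≤ |t| ∨ 1 ≤ |s + t|) : hat s t = 0 := by
  refine max_eq_left ?_
  have : 1 ≤ max (max |s| |t|) |s + t| := by
    rcases h with h | h | h
    · exact h.trans ((le_max_left _ _).trans (le_max_left _ _))
    · exact h.trans ((le_max_right _ _).trans (le_max_left _ _))
    · exact h.trans (le_max_right _ _)
  linarith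

/-- The support of `hat` is the hexagon `max (|s|, |t|, |s + t|) ≤ 1`. Most integer translates
vanish on the reference triangle, and on it the others are its barycentric coordinates. Only lower
left triangles are treated here; the others follow by `hat_neg`. -/
theorem hat_affine (d e : ℤ) : ∃ c₀ c₁ c₂ : ℝ, ∀ s t : ℝ, 0 ≤ s → 0 ≤ t → s + t ≤ 1 →
    hat (s + d) (t + e) = c₀ + c₁ * s + c₂ * t := by
  have big : ∀ m : ℤ, (m ≤ -2 ∨ 1 ≤ m) → ∀ s : ℝ, 0 ≤ s → s ≤ 1 → 1 ≤ |s + m| := by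
    intro m hm s h0 h1
    rcases hm with hm | hm
    · have : (m : ℝ) ≤ -2 := by exact_mod_cast hm
      rw [abs_of_neg (by linarith)]; linarith
    · have : (1 : ℝ) ≤ m := by exact_mod_cast hm
      rw [abs_of_nonneg (by linarith)]; linarith
  have zero : (d ≤ -2 ∨ 1 ≤ d) ∨ (e ≤ -2 ∨ 1 ≤ e) ∨ (d + e ≤ -2 ∨ 1 ≤ d + e) →
      ∃ c₀ c₁ c₂ : ℝ, ∀ s t : ℝ, 0 ≤ s → 0 ≤ t → s + t ≤ 1 →
        hat (s + d) (t + e) = c₀ + c₁ * s + c₂ * t := by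
    intro hz
    refine ⟨0, 0, 0, fun s t hs ht hst => ?_⟩
    rw [hat_eq_zero]
    · ring
    · rcases hz with hz | hz | hz
      · exact Or.inl (big d hz s hs (by linarith))
      · exact Or.inr (Or.inl (big e hz t ht (by linarith)))
      · refine Or.inr (Or.inr ?_)
        have := big (d + e) hz (s + t) (by linarith) hst
        push_cast at this
        rwa [show s + d + (t + e) = s + t + ((d : ℝ) + e) by ring]
  by_cases hd : d ≤ -2 ∨ 1 ≤ d
  · exact zero (Or.inl hd)
  by_cases he : e ≤ -2 ∨ 1 ≤ e
  · exact zero (Or.inr (Or.inl he))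
  by_cases hde : d + e ≤ -2 ∨ 1 ≤ d + e
  · exact zero (Or.inr (Or.inr hde))
  -- The translates that survive peak at the three vertices of the reference triangle.
  have : (d = 0 ∧ e = 0) ∨ (d = -1 ∧ e = 0) ∨ (d = 0 ∧ e = -1) := by omega
  rcases this with ⟨rfl, rfl⟩ | ⟨rfl, rfl⟩ | ⟨rfl, rfl⟩
  · refine ⟨1, -1, -1, fun s t hs ht hst => ?_⟩
    simp only [Int.cast_zero, add_zero]
    unfold hat
    rw [abs_of_nonneg hs, abs_of_nonneg ht, abs_of_nonneg (add_nonneg hs ht),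
      max_eq_right (max_le (by linarith) (by linarith)), max_eq_right (by linarith)]
    ring
  · refine ⟨0, 1, 0, fun s t hs ht hst => ?_⟩
    simp only [Int.cast_zero, add_zero, Int.cast_neg, Int.cast_one]
    unfold hat
    rw [abs_of_nonpos (show s + -1 ≤ 0 by linarith), abs_of_nonneg ht,
      abs_of_nonpos (show s + -1 + t ≤ 0 by linarith),
      max_eq_left (show t ≤ -(s + -1) by linarith),
      max_eq_left (show -(s + -1 + t) ≤ -(s + -1) by linarith),
      max_eq_right (show 0 ≤ 1 - -(s + -1) by linarith)]
    ring
  · refine ⟨0, 0, 1, fun s t hs ht hst => ?_⟩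
    simp only [Int.cast_zero, add_zero, Int.cast_neg, Int.cast_one]
    unfold hat
    rw [abs_of_nonneg hs, abs_of_nonpos (show t + -1 ≤ 0 by linarith),
      abs_of_nonpos (show s + (t + -1) ≤ 0 by linarith),
      max_eq_right (show s ≤ -(t + -1) by linarith),
      max_eq_left (show -(s + (t + -1)) ≤ -(t + -1) by linarith),
      max_eq_right (show 0 ≤ 1 - -(t + -1) by linarith)]
    ring

theorem hat_int (i i' j j' : ℕ) :
    hat ((i : ℝ) - i') ((j : ℝ) - j') = if i' = i then (if j' = j then 1 else 0) else 0 := by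
  have key : ∀ l l' : ℕ, l' ≠ l → 1 ≤ |(l : ℝ) - l'| := by
    intro l l' h
    have h2 : ((l : ℤ) - l') ≠ 0 := by omega
    have := Int.one_le_abs h2
    exact_mod_cast this
  split_ifs with h1 h2
  · subst h1; subst h2; simp [hat]
  · exact hat_eq_zero (Or.inr (Or.inl (key _ _ h2)))
  · exact hat_eq_zero (Or.inl (key _ _ h1))

/-- The piecewise linear nodal interpolant. -/
def interp (n : ℕ) (X Y : ℕ → ℝ) (g : ℝ × ℝ → ℝ) (p : ℝ × ℝ) : ℝ :=
  ∑ i ∈ Finset.range (n + 1), ∑ j ∈ Finset.range (n + 1),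
    g (X i, Y j) * hat (gridCoord n X p.1 - i) (gridCoord n Y p.2 - j)

section

variable {n : ℕ} {X Y : ℕ → ℝ} {g : ℝ × ℝ → ℝ}

theorem interp_node (hX : IsGrid n X) (hY : IsGrid n Y) (hn : 0 < n) {i j : ℕ} (hi : i ≤ n)
    (hj : j ≤ n) : interp n X Y g (X i, Y j) = g (X i, Y j) := by
  unfold interp
  simp only [gridCoord_node hX hi hn, gridCoord_node hY hj hn, hat_int, mul_ite, mul_one, mul_zero]
  simp only [Finset.sum_ite_irrel, Finset.sum_const_zero, Finset.sum_ite_eq', Finset.mem_range]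
  rw [if_pos (by omega), if_pos (by omega)]

theorem continuous_interp : Continuous (interp n X Y g) := by
  unfold interp
  refine continuous_finsetSum _ fun i _ => continuous_finsetSum _ fun j _ => ?_
  refine continuous_const.mul ?_
  exact continuous_hat.comp ((((continuous_gridCoord n X).comp continuous_fst).sub
    continuous_const).prodMk (((continuous_gridCoord n Y).comp continuous_snd).sub
    continuous_const))

theorem isAffineOn_sum {ι : Type*} (s : Finset ι) {f : ι → ℝ × ℝ → ℝ} {K : Set (ℝ × ℝ)}
    (h : ∀ i ∈ s, IsAffineOn (f i) K) : IsAffineOn (fun p => ∑ i ∈ s, f i p) K := by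
  classical
  induction s using Finset.induction_on with
  | empty => exact ⟨0, 0, 0, fun p _ => by simp⟩
  | insert a s ha ih =>
    obtain ⟨a₀, a₁, a₂, h1⟩ := h a (Finset.mem_insert_self _ _)
    obtain ⟨b₀, b₁, b₂, h2⟩ := ih fun i hi => h i (Finset.mem_insert_of_mem hi)
    refine ⟨a₀ + b₀, a₁ + b₁, a₂ + b₂, fun p hp => ?_⟩
    have h2' := h2 p hp
    simp only at h2' ⊢
    rw [Finset.sum_insert ha, h1 p hp, h2']; ring

/-- On a cell `gridCoord` is affine in each variable and maps the mesh to the integer lattice, where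
`hat_affine` applies to every summand. Affinity in the local coordinates `s`, `t` is then rewritten
in terms of `p`. -/
theorem isAffineOn_interp (hX : IsGrid n X) (hY : IsGrid n Y) {i j : ℕ} {a b h k : ℝ}
    (ht : IsTri X Y i j a b h k) (hi : i < n) (hj : j < n) :
    IsAffineOn (interp n X Y g) (convexHull ℝ {(a, b), (a + h, b), (a, b + k)}) := by
  obtain ⟨hh, hk⟩ := ht.ne hX hY hi hj
  refine isAffineOn_sum _ fun i' _ => isAffineOn_sum _ fun j' _ => ?_
  have key : ∃ c₀ c₁ c₂ : ℝ, ∀ s t : ℝ, 0 ≤ s → 0 ≤ t → s + t ≤ 1 →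
      hat (gridCoord n X (a + s * h) - i') (gridCoord n Y (b + t * k) - j') =
        c₀ + c₁ * s + c₂ * t := by
    have hc := fun s t => ht.mem_cell hX hY hi hj (s := s) (t := t)
    have hx := hX.lt i hi
    have hy := hY.lt j hj
    rcases ht with ⟨rfl, rfl, rfl, rfl⟩ | ⟨rfl, rfl, rfl, rfl⟩
    · obtain ⟨c₀, c₁, c₂, hc'⟩ := hat_affine ((i : ℤ) - i') ((j : ℤ) - j')
      refine ⟨c₀, c₁, c₂, fun s t hs ht hst => ?_⟩
      rw [← hc' s t hs ht hst]
      have m1 := (hc s t).1 hs (by linarith)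
      have m2 := (hc s t).2.1 ht (by linarith)
      rw [gridCoord_eq hX hi m1.1 m1.2, gridCoord_eq hY hj m2.1 m2.2]
      congr 1 <;> push_cast <;> field_simp <;> ring
    -- The right angle now sits at node `(i + 1, j + 1)` and the legs point backwards, so the first
    -- lattice coordinate is `i + 1 - s`. Evenness of `hat` turns the argument `i + 1 - s - i'` into
    -- `s + (i' - i - 1)`.
    · obtain ⟨c₀, c₁, c₂, hc'⟩ := hat_affine ((i' : ℤ) - i - 1) ((j' : ℤ) - j - 1)
      refine ⟨c₀, c₁, c₂, fun s t hs ht hst => ?_⟩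
      rw [← hc' s t hs ht hst, ← hat_neg]
      have m1 := (hc s t).1 hs (by linarith)
      have m2 := (hc s t).2.1 ht (by linarith)
      rw [gridCoord_eq hX hi m1.1 m1.2, gridCoord_eq hY hj m2.1 m2.2]
      have e1 : (X (i + 1) + s * (X i - X (i + 1)) - X i) / (X (i + 1) - X i) = 1 - s := by
        have : X (i + 1) - X i ≠ 0 := by linarith
        field_simp; ring
      have e2 : (Y (j + 1) + t * (Y j - Y (j + 1)) - Y j) / (Y (j + 1) - Y j) = 1 - t := by
        have : Y (j + 1) - Y j ≠ 0 := by linarith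
        field_simp; ring
      rw [e1, e2]
      congr 1 <;> push_cast <;> ring
  obtain ⟨c₀, c₁, c₂, hc⟩ := key
  refine ⟨g (X i', Y j') * (c₀ - c₁ * a / h - c₂ * b / k), g (X i', Y j') * (c₁ / h),
    g (X i', Y j') * (c₂ / k), fun p hp => ?_⟩
  obtain ⟨r, s, t, hr, hs, ht', hst, h1, h2⟩ := mem_triangle hp
  obtain rfl : r = 1 - s - t := by linarith
  have e1 : p.1 = a + s * h := by rw [h1]; ring
  have e2 : p.2 = b + t * k := by rw [h2]; ring
  simp only
  rw [e1, e2, hc s t hs ht' (by linarith)]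
  field_simp
  ring

theorem isPL_interp (hX : IsGrid n X) (hY : IsGrid n Y) : IsPL n X Y (interp n X Y g) :=
  ⟨continuous_interp.continuousOn,
    fun i hi j hj => by
      rw [K1_eq_hull]; exact isAffineOn_interp hX hY (isTri_o1 X Y i j) hi hj,
    fun i hi j hj => by
      rw [K2_eq_hull]; exact isAffineOn_interp hX hY (isTri_o2 X Y i j) hi hj⟩

/-- On a side of the square, say on the grid line of index `l`, basis functions of other lines
vanish, and the nodes of this line lie on the boundary, where `g = 0`. -/
theorem isFE_interp (hX : IsGrid n X) (hY : IsGrid n Y) (hn : 0 < n)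
    (hg : ∀ p ∈ closedSquare \ Omega, g p = 0) : IsFE n X Y (interp n X Y g) := by
  have hp := isPL_interp (g := g) hX hY
  refine ⟨hp.cont, hp.affine₁, hp.affine₂, ?_⟩
  rintro p ⟨hpQ, hpO⟩
  have far : ∀ l l' : ℕ, l' ≠ l → 1 ≤ |(l : ℝ) - l'| := by
    intro l l' h
    have h2 : ((l : ℤ) - l') ≠ 0 := by omega
    exact_mod_cast Int.one_le_abs h2
  have hnode : ∀ i ≤ n, ∀ j ≤ n, (X i, Y j) ∉ Omega → g (X i, Y j) = 0 := fun i hi j hj h =>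
    hg _ ⟨⟨hX.mem_Icc hi, hY.mem_Icc hj⟩, h⟩
  have hx : ∀ l, (l = 0 ∨ l = n) → p.1 = X l → interp n X Y g p = 0 := by
    intro l hl he
    refine Finset.sum_eq_zero fun i hi => Finset.sum_eq_zero fun j hj => ?_
    rw [Finset.mem_range] at hi hj
    rw [he, gridCoord_node hX (by omega) hn]
    by_cases h : i = l
    · rw [hnode i (by omega) j (by omega), zero_mul]
      rintro ⟨⟨h1, h2⟩, -⟩
      rw [h] at h1 h2
      rcases hl with rfl | rfl
      · rw [hX.zero] at h1; simp at h1
      · rw [hX.last] at h2; simp at h2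
    · rw [hat_eq_zero (Or.inl (far l i h)), mul_zero]
  have hy : ∀ l, (l = 0 ∨ l = n) → p.2 = Y l → interp n X Y g p = 0 := by
    intro l hl he
    refine Finset.sum_eq_zero fun i hi => Finset.sum_eq_zero fun j hj => ?_
    rw [Finset.mem_range] at hi hj
    rw [he, gridCoord_node hY (by omega) hn]
    by_cases h : j = l
    · rw [hnode i (by omega) j (by omega), zero_mul]
      rintro ⟨-, ⟨h1, h2⟩⟩
      rw [h] at h1 h2
      rcases hl with rfl | rfl
      · rw [hY.zero] at h1; simp at h1
      · rw [hY.last] at h2; simp at h2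
    · rw [hat_eq_zero (Or.inr (Or.inl (far l j h))), mul_zero]
  obtain ⟨⟨a1, a2⟩, b1, b2⟩ := hpQ
  by_contra hne
  refine hpO ⟨⟨lt_of_le_of_ne a1 fun h => hne ?_, lt_of_le_of_ne a2 fun h => hne ?_⟩,
    lt_of_le_of_ne b1 fun h => hne ?_, lt_of_le_of_ne b2 fun h => hne ?_⟩
  · exact hx 0 (Or.inl rfl) (by rw [hX.zero]; exact h.symm)
  · exact hx n (Or.inr rfl) (by rw [hX.last]; exact h)
  · exact hy 0 (Or.inl rfl) (by rw [hY.zero]; exact h.symm)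
  · exact hy n (Or.inr rfl) (by rw [hY.last]; exact h)

/-- The vertices of a mesh triangle are nodes. -/
theorem IsTri.vertices {i j : ℕ} {a b h k : ℝ} (ht : IsTri X Y i j a b h k) (hi : i < n)
    (hj : j < n) : (∃ l ≤ n, a = X l) ∧ (∃ l ≤ n, a + h = X l) ∧ (∃ l ≤ n, b = Y l) ∧
      ∃ l ≤ n, b + k = Y l := by
  rcases ht with ⟨rfl, rfl, rfl, rfl⟩ | ⟨rfl, rfl, rfl, rfl⟩
  · exact ⟨⟨i, by omega, rfl⟩, ⟨i + 1, by omega, by ring⟩, ⟨j, by omega, rfl⟩,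
      ⟨j + 1, by omega, by ring⟩⟩
  · exact ⟨⟨i + 1, by omega, rfl⟩, ⟨i, by omega, by ring⟩, ⟨j + 1, by omega, rfl⟩,
      ⟨j, by omega, by ring⟩⟩

theorem IsTri.interp_eq (hX : IsGrid n X) (hY : IsGrid n Y) {i j : ℕ} {a b h k : ℝ}
    (ht : IsTri X Y i j a b h k) (hi : i < n) (hj : j < n) :
    interp n X Y g (a, b) = g (a, b) ∧ interp n X Y g (a + h, b) = g (a + h, b) ∧
      interp n X Y g (a, b + k) = g (a, b + k) := by
  obtain ⟨⟨l₁, h1, e1⟩, ⟨l₂, h2, e2⟩, ⟨l₃, h3, e3⟩, ⟨l₄, h4, e4⟩⟩ := ht.vertices (n := n) hi hj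
  have hn : 0 < n := by omega
  rw [e2, e4, e1, e3]
  exact ⟨interp_node hX hY hn h1 h3, interp_node hX hY hn h2 h3, interp_node hX hY hn h1 h4⟩

end


/-! ### Integration by parts for piecewise smooth functions -/

/-- Continuous functions that are differentiable on all open triangles, with bounded gradient. -/
structure PW (n : ℕ) (X Y : ℕ → ℝ) (w : ℝ × ℝ → ℝ) : Prop where
  cont : ContinuousOn w closedSquare
  diff : ∀ p ∈ goodSet n X Y, DifferentiableAt ℝ w p
  bm_dX : BM (dX w)
  bm_dY : BM (dY w)

section

variable {n : ℕ} {X Y : ℕ → ℝ} {v w : ℝ × ℝ → ℝ}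

theorem IsPL.pw (hX : IsGrid n X) (hY : IsGrid n Y) (hv : IsPL n X Y v) : PW n X Y v :=
  ⟨hv.cont, fun _ hp => hv.differentiableAt hX hY hp, hv.bm_dX hX hY, hv.bm_dY hX hY⟩

theorem PW.of_smooth (hX : IsGrid n X) (hY : IsGrid n Y) (hv : ContDiffOn ℝ 1 v closedSquare) :
    PW n X Y v := by
  have hv' : ContDiffOn ℝ ((0 + 1 : ℕ) : ℕ) v closedSquare := by exact_mod_cast hv
  refine ⟨hv.continuousOn, fun p hp => ?_, BM.of_continuousOn (ContDiffOn.dX hv').continuousOn,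
    BM.of_continuousOn (ContDiffOn.dY hv').continuousOn⟩
  exact (hv.differentiableOn (by simp)).differentiableAt (Filter.mem_of_superset
    (isOpen_Omega.mem_nhds (goodSet_subset hX hY hp)) Omega_subset)

theorem PW.bm (hv : PW n X Y v) : BM v := BM.of_continuousOn hv.cont

theorem PW.dX_mul (hX : IsGrid n X) (hY : IsGrid n Y) (hv : PW n X Y v) (hw : PW n X Y w)
    {p : ℝ × ℝ} (hp : p ∈ goodSet n X Y) : dX (v * w) p = dX v p * w p + v p * dX w p := by
  have hO := goodSet_subset hX hY hp
  exact dX_of_hasDerivAt (Omega_subset hO)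
    ((dX_hasDerivAt hO (hv.diff p hp)).mul (dX_hasDerivAt hO (hw.diff p hp)))

theorem PW.dY_mul (hX : IsGrid n X) (hY : IsGrid n Y) (hv : PW n X Y v) (hw : PW n X Y w)
    {p : ℝ × ℝ} (hp : p ∈ goodSet n X Y) : dY (v * w) p = dY v p * w p + v p * dY w p := by
  have hO := goodSet_subset hX hY hp
  exact dY_of_hasDerivAt (Omega_subset hO)
    ((dY_hasDerivAt hO (hv.diff p hp)).mul (dY_hasDerivAt hO (hw.diff p hp)))

theorem PW.dX_sub (hX : IsGrid n X) (hY : IsGrid n Y) (hv : PW n X Y v) (hw : PW n X Y w)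
    {p : ℝ × ℝ} (hp : p ∈ goodSet n X Y) : dX (v - w) p = dX v p - dX w p := by
  have hO := goodSet_subset hX hY hp
  exact dX_of_hasDerivAt (Omega_subset hO)
    ((dX_hasDerivAt hO (hv.diff p hp)).sub (dX_hasDerivAt hO (hw.diff p hp)))

theorem PW.dY_sub (hX : IsGrid n X) (hY : IsGrid n Y) (hv : PW n X Y v) (hw : PW n X Y w)
    {p : ℝ × ℝ} (hp : p ∈ goodSet n X Y) : dY (v - w) p = dY v p - dY w p := by
  have hO := goodSet_subset hX hY hp
  exact dY_of_hasDerivAt (Omega_subset hO)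
    ((dY_hasDerivAt hO (hv.diff p hp)).sub (dY_hasDerivAt hO (hw.diff p hp)))

theorem PW.mul (hX : IsGrid n X) (hY : IsGrid n Y) (hv : PW n X Y v) (hw : PW n X Y w) :
    PW n X Y (v * w) := by
  refine ⟨hv.cont.mul hw.cont, fun p hp => (hv.diff p hp).mul (hw.diff p hp), ?_, ?_⟩
  · refine BM.congr ((hv.bm_dX.mul hw.bm).add (hv.bm.mul hw.bm_dX)) ?_
    filter_upwards [ae_mem_goodSet hX hY] with p hp using hv.dX_mul hX hY hw hp
  · refine BM.congr ((hv.bm_dY.mul hw.bm).add (hv.bm.mul hw.bm_dY)) ?_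
    filter_upwards [ae_mem_goodSet hX hY] with p hp using hv.dY_mul hX hY hw hp

theorem PW.sub (hX : IsGrid n X) (hY : IsGrid n Y) (hv : PW n X Y v) (hw : PW n X Y w) :
    PW n X Y (v - w) := by
  refine ⟨hv.cont.sub hw.cont, fun p hp => (hv.diff p hp).sub (hw.diff p hp), ?_, ?_⟩
  · refine BM.congr (hv.bm_dX.sub hw.bm_dX) ?_
    filter_upwards [ae_mem_goodSet hX hY] with p hp using hv.dX_sub hX hY hw hp
  · refine BM.congr (hv.bm_dY.sub hw.bm_dY) ?_
    filter_upwards [ae_mem_goodSet hX hY] with p hp using hv.dY_sub hX hY hw hp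

theorem PW.ibp_x (hX : IsGrid n X) (hY : IsGrid n Y) (hv : PW n X Y v) (hw : PW n X Y w)
    (h0 : ∀ p ∈ closedSquare \ Omega, w p = 0) :
    ∫ p in Omega, v p * dX w p = -∫ p in Omega, dX v p * w p := by
  have hm := hv.mul hX hY hw
  have h := integral_dX_eq_zero hX hY hm.cont hm.diff
    (fun p hp => by rw [Pi.mul_apply, h0 p hp, mul_zero]) hm.bm_dX
  rw [integral_congr_ae (g := fun p => dX v p * w p + v p * dX w p) (by
    filter_upwards [ae_mem_goodSet hX hY] with p hp using hv.dX_mul hX hY hw hp),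
    integral_add (hv.bm_dX.mul hw.bm).int (hv.bm.mul hw.bm_dX).int] at h
  linarith

theorem PW.ibp_y (hX : IsGrid n X) (hY : IsGrid n Y) (hv : PW n X Y v) (hw : PW n X Y w)
    (h0 : ∀ p ∈ closedSquare \ Omega, w p = 0) :
    ∫ p in Omega, v p * dY w p = -∫ p in Omega, dY v p * w p := by
  have hm := hv.mul hX hY hw
  have h := integral_dY_eq_zero hX hY hm.cont hm.diff
    (fun p hp => by rw [Pi.mul_apply, h0 p hp, mul_zero]) hm.bm_dY
  rw [integral_congr_ae (g := fun p => dY v p * w p + v p * dY w p) (by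
    filter_upwards [ae_mem_goodSet hX hY] with p hp using hv.dY_mul hX hY hw hp),
    integral_add (hv.bm_dY.mul hw.bm).int (hv.bm.mul hw.bm_dY).int] at h
  linarith

variable {b₁ b₂ c : ℝ × ℝ → ℝ} {β₁ β₂ μ₀ : ℝ}

theorem Coefficients.bm₁ (hb : Coefficients b₁ b₂ c β₁ β₂ μ₀) : BM b₁ :=
  BM.of_continuousOn hb.smooth_b₁.continuousOn

theorem Coefficients.bm₂ (hb : Coefficients b₁ b₂ c β₁ β₂ μ₀) : BM b₂ :=
  BM.of_continuousOn hb.smooth_b₂.continuousOn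

theorem Coefficients.bmc (hb : Coefficients b₁ b₂ c β₁ β₂ μ₀) : BM c :=
  BM.of_continuousOn hb.cont_c

/-- The divergence of `b`. -/
def divb (b₁ b₂ : ℝ × ℝ → ℝ) (p : ℝ × ℝ) : ℝ := dX b₁ p + dY b₂ p

theorem Coefficients.continuousOn_divb (hb : Coefficients b₁ b₂ c β₁ β₂ μ₀) :
    ContinuousOn (divb b₁ b₂) closedSquare := by
  have h1 : ContDiffOn ℝ ((0 + 1 : ℕ) : ℕ) b₁ closedSquare := by exact_mod_cast hb.smooth_b₁
  have h2 : ContDiffOn ℝ ((0 + 1 : ℕ) : ℕ) b₂ closedSquare := by exact_mod_cast hb.smooth_b₂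
  exact (ContDiffOn.dX h1).continuousOn.add (ContDiffOn.dY h2).continuousOn

theorem Coefficients.bm_divb (hb : Coefficients b₁ b₂ c β₁ β₂ μ₀) : BM (divb b₁ b₂) :=
  BM.of_continuousOn hb.continuousOn_divb

theorem PW.bm_convect (hb : Coefficients b₁ b₂ c β₁ β₂ μ₀) (hv : PW n X Y v) :
    BM (convect b₁ b₂ v) := (hb.bm₁.mul hv.bm_dX).add (hb.bm₂.mul hv.bm_dY)

theorem PW.convect_sub (hX : IsGrid n X) (hY : IsGrid n Y) (hv : PW n X Y v) (hw : PW n X Y w)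
    {p : ℝ × ℝ} (hp : p ∈ goodSet n X Y) :
    convect b₁ b₂ (v - w) p = convect b₁ b₂ v p - convect b₁ b₂ w p := by
  unfold convect
  rw [hv.dX_sub hX hY hw hp, hv.dY_sub hX hY hw hp]; ring

/-- Integration by parts of `b₁ v` and `b₂ v` against the derivatives of `w`; the product rule
produces the divergence of `b`. -/
theorem PW.integral_convect_mul (hX : IsGrid n X) (hY : IsGrid n Y)
    (hb : Coefficients b₁ b₂ c β₁ β₂ μ₀) (hv : PW n X Y v) (hw : PW n X Y w)
    (h0 : ∀ p ∈ closedSquare \ Omega, w p = 0) :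
    ∫ p in Omega, convect b₁ b₂ v p * w p =
      -(∫ p in Omega, v p * convect b₁ b₂ w p) - ∫ p in Omega, divb b₁ b₂ p * (v p * w p) := by
  have hb1 := PW.of_smooth hX hY hb.smooth_b₁
  have hb2 := PW.of_smooth hX hY hb.smooth_b₂
  have m1 := hb1.mul hX hY hv
  have m2 := hb2.mul hX hY hv
  have e1 := m1.ibp_x hX hY hw h0
  have e2 := m2.ibp_y hX hY hw h0
  have i1 : BM (fun p => v p * convect b₁ b₂ w p) := hv.bm.mul (hw.bm_convect hb)
  have i2 : BM (fun p => divb b₁ b₂ p * (v p * w p)) := hb.bm_divb.mul (hv.bm.mul hw.bm)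
  have i3 : BM (fun p => (b₁ * v) p * dX w p) := m1.bm.mul hw.bm_dX
  have i4 : BM (fun p => (b₂ * v) p * dY w p) := m2.bm.mul hw.bm_dY
  have i5 : BM (fun p => dX (b₁ * v) p * w p) := m1.bm_dX.mul hw.bm
  have i6 : BM (fun p => dY (b₂ * v) p * w p) := m2.bm_dY.mul hw.bm
  have s1 : ∫ p in Omega, v p * convect b₁ b₂ w p =
      (∫ p in Omega, (b₁ * v) p * dX w p) + ∫ p in Omega, (b₂ * v) p * dY w p := by
    rw [← integral_add i3.int i4.int]
    refine integral_congr_ae (Filter.Eventually.of_forall fun p => ?_)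
    simp only [convect, Pi.mul_apply]; ring
  have s2 : (∫ p in Omega, convect b₁ b₂ v p * w p) +
      ∫ p in Omega, divb b₁ b₂ p * (v p * w p) =
      (∫ p in Omega, dX (b₁ * v) p * w p) + ∫ p in Omega, dY (b₂ * v) p * w p := by
    rw [← integral_add i5.int i6.int, ← integral_add ((hv.bm_convect hb).mul hw.bm).int i2.int]
    refine integral_congr_ae ?_
    filter_upwards [ae_mem_goodSet hX hY] with p hp
    rw [hb1.dX_mul hX hY hv hp, hb2.dY_mul hX hY hv hp]
    simp only [convect, divb]; ring
  linarith

/-! ### Coercivity -/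

/-- The nodes that bound the coarse part of the mesh. -/
abbrev coarse (n : ℕ) (X Y : ℕ → ℝ) : Set (ℝ × ℝ) := block X Y 0 (n / 2) 0 (n / 2)

theorem coarse_subset (hX : IsGrid n X) (hY : IsGrid n Y) : coarse n X Y ⊆ hSquare :=
  block_subset hX hY (Nat.zero_le _) (Nat.div_le_self _ _) (Nat.zero_le _) (Nat.div_le_self _ _)

/-- For a discrete first argument the second derivatives vanish almost everywhere and the
stabilization is one integral over the coarse block. -/
theorem IsPL.aSD_eq (hX : IsGrid n X) (hY : IsGrid n Y) (hb : Coefficients b₁ b₂ c β₁ β₂ μ₀)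
    (hv : IsPL n X Y v) (hw : PW n X Y w) (Cs ε : ℝ) :
    aSD Cs n X Y ε b₁ b₂ c v w =
      ε * (∫ p in Omega, (dX v p * dX w p + dY v p * dY w p)) +
      (∫ p in Omega, (convect b₁ b₂ v p + c p * v p) * w p) +
      Cs / n * ∫ p in coarse n X Y, (convect b₁ b₂ v p + c p * v p) * convect b₁ b₂ w p := by
  have hp := hv.pw hX hY
  have h1 : BM (fun p => (convect b₁ b₂ v p + c p * v p) * convect b₁ b₂ w p) :=
    ((hp.bm_convect hb).add (hb.bmc.mul hp.bm)).mul (hw.bm_convect hb)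
  have h2 : ∀ᵐ p ∂(volume.restrict Omega), diffOp ε b₁ b₂ c v p * convect b₁ b₂ w p =
      (convect b₁ b₂ v p + c p * v p) * convect b₁ b₂ w p := by
    filter_upwards [ae_mem_goodSet hX hY] with p hp
    obtain ⟨e1, e2⟩ := hv.dX_dX_eq hX hY hp
    rw [diffOp, e1, e2]; ring
  rw [aSD, aGal, aStab, stabSum_eq hX hY Cs (h1.congr h2),
    integral_congr_ae (ae_of_Omega h2 (coarse_subset hX hY))]

theorem PW.sdSq_eq (hX : IsGrid n X) (hY : IsGrid n Y) (hb : Coefficients b₁ b₂ c β₁ β₂ μ₀)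
    (hv : PW n X Y v) (Cs ε : ℝ) : sdSq Cs n X Y ε μ₀ b₁ b₂ v =
      ε * (∫ p in Omega, (dX v p ^ 2 + dY v p ^ 2)) + μ₀ * (∫ p in Omega, v p ^ 2) +
      Cs / n * ∫ p in coarse n X Y, convect b₁ b₂ v p ^ 2 := by
  rw [sdSq, energySq, stabSum_eq hX hY Cs (hv.bm_convect hb).sq]

/-- Integrating by parts with `w = v` replaces the convection by `-div b / 2`, so the lower order
terms give at least `μ₀ ‖v‖²`. In the stabilization, `(B' + c v) B' ≥ B'²/2 - c² v²/2` for `B' = b ·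
∇v`. The loss `(Cs/n) B² ‖v‖² / 2` is at most half of `μ₀ ‖v‖²` because `Cs * B ^ 2 ≤ μ₀`. -/
theorem isCoercive (hX : IsGrid n X) (hY : IsGrid n Y) (hb : Coefficients b₁ b₂ c β₁ β₂ μ₀)
    {B Cs ε : ℝ} (hn : 1 ≤ n) (hB : ∀ p ∈ closedSquare, |c p| ≤ B) (hCs : 0 < Cs)
    (hCB : Cs * B ^ 2 ≤ μ₀) (hε : 0 < ε) : IsCoercive Cs n X Y ε μ₀ b₁ b₂ c := by
  intro v hv
  have hp := hv.isPL.pw hX hY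
  have hcv := hp.bm_convect hb
  have hsub := coarse_subset hX hY
  have hn' : (1 : ℝ) ≤ n := by exact_mod_cast hn
  rw [hv.isPL.aSD_eq hX hY hb hp, hp.sdSq_eq hX hY hb]
  have ibp := hp.integral_convect_mul hX hY hb hp hv.bdry
  have e1 : ∫ p in Omega, v p * convect b₁ b₂ v p = ∫ p in Omega, convect b₁ b₂ v p * v p := by
    simp only [mul_comm]
  have i0 : BM (fun p => c p * v p * v p) := (hb.bmc.mul hp.bm).mul hp.bm
  have i1 : BM (fun p => divb b₁ b₂ p * (v p * v p)) := hb.bm_divb.mul (hp.bm.mul hp.bm)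
  have e2 : ∫ p in Omega, (convect b₁ b₂ v p + c p * v p) * v p =
      (∫ p in Omega, convect b₁ b₂ v p * v p) + ∫ p in Omega, c p * v p * v p := by
    simp only [add_mul]
    exact integral_add (hcv.mul hp.bm).int i0.int
  have e3 : μ₀ * (∫ p in Omega, v p ^ 2) ≤
      (∫ p in Omega, c p * v p * v p) - 1 / 2 * ∫ p in Omega, divb b₁ b₂ p * (v p * v p) := by
    rw [← integral_const_mul, ← integral_const_mul, ← integral_sub i0.int
      (((BM.const (1 / 2)).mul i1).int)]
    refine setIntegral_mono_on ((BM.const μ₀).mul hp.bm.sq).int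
      (i0.sub ((BM.const (1 / 2)).mul i1)).int isOpen_Omega.measurableSet fun p hpO => ?_
    have := mul_le_mul_of_nonneg_right (hb.le_c p (Omega_subset hpO)) (sq_nonneg (v p))
    unfold divb
    linarith
  have e4 : ε * (∫ p in Omega, (dX v p * dX v p + dY v p * dY v p)) =
      ε * ∫ p in Omega, (dX v p ^ 2 + dY v p ^ 2) := by simp only [pow_two]
  have e5 : 0 ≤ ε * ∫ p in Omega, (dX v p ^ 2 + dY v p ^ 2) :=
    mul_nonneg hε.le (integral_nonneg fun p => by positivity)
  have i2 : BM (fun p => (convect b₁ b₂ v p + c p * v p) * convect b₁ b₂ v p) :=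
    (hcv.add (hb.bmc.mul hp.bm)).mul hcv
  have e6 : 1 / 2 * (∫ p in coarse n X Y, convect b₁ b₂ v p ^ 2) -
      1 / 2 * (B ^ 2 * ∫ p in Omega, v p ^ 2) ≤
      ∫ p in coarse n X Y, (convect b₁ b₂ v p + c p * v p) * convect b₁ b₂ v p := by
    have h1 := integral_le_Omega hp.bm.sq (fun p => sq_nonneg (v p)) hsub
    have h2 := mul_le_mul_of_nonneg_left h1 (sq_nonneg B)
    have h3 : 1 / 2 * (∫ p in coarse n X Y, convect b₁ b₂ v p ^ 2) -
        1 / 2 * (B ^ 2 * ∫ p in coarse n X Y, v p ^ 2) ≤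
        ∫ p in coarse n X Y, (convect b₁ b₂ v p + c p * v p) * convect b₁ b₂ v p := by
      rw [← integral_const_mul, ← integral_const_mul, ← integral_const_mul,
        ← integral_sub (((BM.const (1 / 2)).mul hcv.sq).intOn hsub)
        (((BM.const (1 / 2)).mul ((BM.const (B ^ 2)).mul hp.bm.sq)).intOn hsub)]
      refine setIntegral_mono_on (((BM.const (1 / 2)).mul hcv.sq).sub
        ((BM.const (1 / 2)).mul ((BM.const (B ^ 2)).mul hp.bm.sq)) |>.intOn hsub)
        (i2.intOn hsub) (measurableSet_block _ _ _ _ _ _) fun p hpc => ?_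
      have hc2 : c p ^ 2 ≤ B ^ 2 := by
        rw [← sq_abs (c p)]
        exact pow_le_pow_left₀ (abs_nonneg _) (hB p (hSquare_subset (hsub hpc))) 2
      have := mul_le_mul_of_nonneg_right hc2 (sq_nonneg (v p))
      nlinarith [sq_nonneg (convect b₁ b₂ v p + c p * v p)]
    linarith
  have hδ : 0 ≤ Cs / n := by positivity
  have e7 := mul_le_mul_of_nonneg_left e6 hδ
  have hV : 0 ≤ ∫ p in Omega, v p ^ 2 := integral_nonneg fun p => sq_nonneg _
  have e8 : Cs / n * B ^ 2 ≤ μ₀ := by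
    refine le_trans ?_ hCB
    exact mul_le_mul_of_nonneg_right (div_le_self hCs.le hn') (sq_nonneg B)
  have e9 := mul_le_mul_of_nonneg_right e8 hV
  rw [e2, e4]
  linarith

/-! ### The error equation -/

/-- Consistency: the stabilization tests the full residual, so `u` satisfies the discrete equations.
With `u = χ + uᴺ + w` only terms in `w` remain, apart from the Laplacian of `u`, since that of the
interpolant vanishes on triangles. The derivative in the convection is moved to `χ`, because `w` is
small while `∇w` is not. -/
theorem error_equation (hX : IsGrid n X) (hY : IsGrid n Y) (hn : 0 < n)
    (hb : Coefficients b₁ b₂ c β₁ β₂ μ₀) {Cs ε : ℝ} {f u uN : ℝ × ℝ → ℝ}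
    (hu : IsSolution ε b₁ b₂ c f u) (hs : ContDiffOn ℝ 2 u closedSquare)
    (hN : IsSDFEMSolution Cs n X Y ε b₁ b₂ c f uN) {χ w : ℝ × ℝ → ℝ}
    (hχ : χ = interp n X Y u - uN) (hw : w = u - interp n X Y u) :
    aSD Cs n X Y ε b₁ b₂ c χ χ = -(ε * (∫ p in Omega, (dX w p * dX χ p + dY w p * dY χ p)) -
      (∫ p in Omega, w p * convect b₁ b₂ χ p) +
      (∫ p in Omega, (c p - divb b₁ b₂ p) * (w p * χ p)) +
      Cs / n * ∫ p in coarse n X Y, (-ε * (dX (dX u) p + dY (dY u) p) + convect b₁ b₂ w p +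
        c p * w p) * convect b₁ b₂ χ p) := by
  have hI := isFE_interp hX hY hn hu.bdry
  have hχF : IsFE n X Y χ := hχ ▸ hI.sub hN.mem
  have pχ := hχF.isPL.pw hX hY
  have pI := hI.isPL.pw hX hY
  have pN := hN.mem.isPL.pw hX hY
  have pu : PW n X Y u := PW.of_smooth hX hY (hs.of_le (by norm_num))
  have pw : PW n X Y w := hw ▸ pu.sub hX hY pI
  have hs' : ContDiffOn ℝ ((1 + 1 : ℕ) : ℕ) u closedSquare := by exact_mod_cast hs
  have pux : PW n X Y (dX u) := PW.of_smooth hX hY (by exact_mod_cast ContDiffOn.dX hs')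
  have puy : PW n X Y (dY u) := PW.of_smooth hX hY (by exact_mod_cast ContDiffOn.dY hs')
  have hsub := coarse_subset hX hY
  have hg := ae_mem_goodSet hX hY
  have hgc := ae_of_Omega hg hsub
  have eN := hN.eqn χ hχF
  have bL : BM (fun p => -ε * (dX (dX u) p + dY (dY u) p)) :=
    (BM.const (-ε)).mul (pux.bm_dX.add puy.bm_dY)
  have bD : BM (diffOp ε b₁ b₂ c u) := (bL.add (pu.bm_convect hb)).add (hb.bmc.mul pu.bm)
  have hf : ∀ᵐ p ∂(volume.restrict Omega), f p = diffOp ε b₁ b₂ c u p := by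
    filter_upwards [ae_restrict_mem isOpen_Omega.measurableSet] with p hp using (hu.eqn p hp).symm
  have bf : BM f := bD.congr hf
  rw [stabSum_eq hX hY Cs (bf.mul (pχ.bm_convect hb)), hN.mem.isPL.aSD_eq hX hY hb pχ] at eN
  rw [hχF.isPL.aSD_eq hX hY hb pχ]
  -- the gradient terms
  have gI : BM (fun p => dX w p * dX χ p + dY w p * dY χ p) :=
    (pw.bm_dX.mul pχ.bm_dX).add (pw.bm_dY.mul pχ.bm_dY)
  have gN : BM (fun p => dX uN p * dX χ p + dY uN p * dY χ p) :=
    (pN.bm_dX.mul pχ.bm_dX).add (pN.bm_dY.mul pχ.bm_dY)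
  have gχ : BM (fun p => dX χ p * dX χ p + dY χ p * dY χ p) :=
    (pχ.bm_dX.mul pχ.bm_dX).add (pχ.bm_dY.mul pχ.bm_dY)
  have g1 : (∫ p in Omega, (dX χ p * dX χ p + dY χ p * dY χ p)) +
      (∫ p in Omega, (dX uN p * dX χ p + dY uN p * dY χ p)) +
      (∫ p in Omega, (dX w p * dX χ p + dY w p * dY χ p)) =
      (∫ p in Omega, dX u p * dX χ p) + ∫ p in Omega, dY u p * dY χ p := by
    rw [← integral_add gχ.int gN.int, ← integral_add (gχ.add gN).int gI.int,
      ← integral_add (pu.bm_dX.mul pχ.bm_dX).int (pu.bm_dY.mul pχ.bm_dY).int]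
    refine integral_congr_ae ?_
    filter_upwards [hg] with p hp
    have a1 : dX χ p = dX (interp n X Y u) p - dX uN p := by rw [hχ]; exact pI.dX_sub hX hY pN hp
    have a2 : dY χ p = dY (interp n X Y u) p - dY uN p := by rw [hχ]; exact pI.dY_sub hX hY pN hp
    have a3 : dX w p = dX u p - dX (interp n X Y u) p := by rw [hw]; exact pu.dX_sub hX hY pI hp
    have a4 : dY w p = dY u p - dY (interp n X Y u) p := by rw [hw]; exact pu.dY_sub hX hY pI hp
    linear_combination (dX χ p) * a1 + (dY χ p) * a2 + (dX χ p) * a3 + (dY χ p) * a4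
  have g2 := pux.ibp_x hX hY pχ hχF.bdry
  have g3 := puy.ibp_y hX hY pχ hχF.bdry
  -- the lower order terms
  have lχ : BM (fun p => (convect b₁ b₂ χ p + c p * χ p) * χ p) :=
    ((pχ.bm_convect hb).add (hb.bmc.mul pχ.bm)).mul pχ.bm
  have lN : BM (fun p => (convect b₁ b₂ uN p + c p * uN p) * χ p) :=
    ((pN.bm_convect hb).add (hb.bmc.mul pN.bm)).mul pχ.bm
  have lw : BM (fun p => convect b₁ b₂ w p * χ p) := (pw.bm_convect hb).mul pχ.bm
  have lc : BM (fun p => c p * (w p * χ p)) := hb.bmc.mul (pw.bm.mul pχ.bm)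
  have ld : BM (fun p => divb b₁ b₂ p * (w p * χ p)) := hb.bm_divb.mul (pw.bm.mul pχ.bm)
  have lf : BM (fun p => f p * χ p) := bf.mul pχ.bm
  have lx : BM (fun p => dX (dX u) p * χ p) := pux.bm_dX.mul pχ.bm
  have ly : BM (fun p => dY (dY u) p * χ p) := puy.bm_dY.mul pχ.bm
  have l1 : (∫ p in Omega, (convect b₁ b₂ χ p + c p * χ p) * χ p) +
      (∫ p in Omega, (convect b₁ b₂ uN p + c p * uN p) * χ p) +
      (∫ p in Omega, convect b₁ b₂ w p * χ p) + (∫ p in Omega, c p * (w p * χ p)) =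
      (∫ p in Omega, f p * χ p) + ε * (∫ p in Omega, dX (dX u) p * χ p) +
        ε * ∫ p in Omega, dY (dY u) p * χ p := by
    rw [← integral_const_mul, ← integral_const_mul, ← integral_add lχ.int lN.int,
      ← integral_add (lχ.add lN).int lw.int, ← integral_add ((lχ.add lN).add lw).int lc.int,
      ← integral_add lf.int ((BM.const ε).mul lx).int,
      ← integral_add (lf.add ((BM.const ε).mul lx)).int ((BM.const ε).mul ly).int]
    refine integral_congr_ae ?_
    filter_upwards [hg, hf] with p hp hfp
    have a1 : convect b₁ b₂ χ p = convect b₁ b₂ (interp n X Y u) p - convect b₁ b₂ uN p := by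
      rw [hχ]; exact pI.convect_sub hX hY pN hp
    have a2 : convect b₁ b₂ w p = convect b₁ b₂ u p - convect b₁ b₂ (interp n X Y u) p := by
      rw [hw]; exact pu.convect_sub hX hY pI hp
    have a3 : χ p = interp n X Y u p - uN p := by rw [hχ]; rfl
    have a4 : w p = u p - interp n X Y u p := by rw [hw]; rfl
    rw [hfp, diffOp]
    linear_combination χ p * a1 + χ p * a2 + c p * χ p * a3 + c p * χ p * a4
  have l2 := pw.integral_convect_mul hX hY hb pχ hχF.bdry
  have l3 : ∫ p in Omega, (c p - divb b₁ b₂ p) * (w p * χ p) =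
      (∫ p in Omega, c p * (w p * χ p)) - ∫ p in Omega, divb b₁ b₂ p * (w p * χ p) := by
    rw [← integral_sub lc.int ld.int]; simp only [sub_mul]
  -- the stabilization terms
  have sχ : BM (fun p => (convect b₁ b₂ χ p + c p * χ p) * convect b₁ b₂ χ p) :=
    ((pχ.bm_convect hb).add (hb.bmc.mul pχ.bm)).mul (pχ.bm_convect hb)
  have sN : BM (fun p => (convect b₁ b₂ uN p + c p * uN p) * convect b₁ b₂ χ p) :=
    ((pN.bm_convect hb).add (hb.bmc.mul pN.bm)).mul (pχ.bm_convect hb)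
  have sw : BM (fun p => (-ε * (dX (dX u) p + dY (dY u) p) + convect b₁ b₂ w p +
      c p * w p) * convect b₁ b₂ χ p) :=
    ((bL.add (pw.bm_convect hb)).add (hb.bmc.mul pw.bm)).mul (pχ.bm_convect hb)
  have s1 : (∫ p in coarse n X Y, (convect b₁ b₂ χ p + c p * χ p) * convect b₁ b₂ χ p) +
      (∫ p in coarse n X Y, (convect b₁ b₂ uN p + c p * uN p) * convect b₁ b₂ χ p) +
      (∫ p in coarse n X Y, (-ε * (dX (dX u) p + dY (dY u) p) + convect b₁ b₂ w p +
        c p * w p) * convect b₁ b₂ χ p) = ∫ p in coarse n X Y, f p * convect b₁ b₂ χ p := by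
    rw [← integral_add (sχ.intOn hsub) (sN.intOn hsub),
      ← integral_add ((sχ.add sN).intOn hsub) (sw.intOn hsub)]
    refine integral_congr_ae ?_
    filter_upwards [hgc, ae_of_Omega hf hsub] with p hp hfp
    have a1 : convect b₁ b₂ χ p = convect b₁ b₂ (interp n X Y u) p - convect b₁ b₂ uN p := by
      rw [hχ]; exact pI.convect_sub hX hY pN hp
    have a2 : convect b₁ b₂ w p = convect b₁ b₂ u p - convect b₁ b₂ (interp n X Y u) p := by
      rw [hw]; exact pu.convect_sub hX hY pI hp
    have a3 : χ p = interp n X Y u p - uN p := by rw [hχ]; rfl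
    have a4 : w p = u p - interp n X Y u p := by rw [hw]; rfl
    rw [hfp, diffOp]
    linear_combination convect b₁ b₂ χ p * a1 + convect b₁ b₂ χ p * a2 +
      c p * convect b₁ b₂ χ p * a3 + c p * convect b₁ b₂ χ p * a4
  rw [l3]
  -- `eN` is the scheme tested with `χ`. `g1`, `l1`, `s1` decompose `u` in the diffusion, lower
  -- order and stabilization terms; `g2`, `g3` integrate the Laplacian of `u` by parts, and `l2` the
  -- convection of `w`.
  linear_combination -eN + ε * g1 + l1 + Cs / n * s1 - l2 + ε * g2 + ε * g3
end


/-! ### Inverse estimates -/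

/-- The square of an affine function is at least its value at the centre, on average. -/
theorem sq_center_le_integral (α β γ x y r s : ℝ) (hr : 0 ≤ r) (hs : 0 ≤ s) :
    2 * r * (2 * s) * (α + β * x + γ * y) ^ 2 ≤
      ∫ p in Ioc (x - r) (x + r) ×ˢ Ioc (y - s) (y + s), (α + β * p.1 + γ * p.2) ^ 2 := by
  set S : Set (ℝ × ℝ) := Ioo (x - r) (x + r) ×ˢ Ioo (y - s) (y + s) with hS
  have hcong : (Ioc (x - r) (x + r) ×ˢ Ioc (y - s) (y + s) : Set (ℝ × ℝ)) =ᵐ[volume] S := by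
    rw [hS, Measure.volume_eq_prod]
    exact Measure.set_prod_ae_eq Ioo_ae_eq_Ioc.symm Ioo_ae_eq_Ioc.symm
  have hvol : volume.real S = 2 * r * (2 * s) := by
    rw [← measureReal_congr hcong, volume_real_rect (by linarith) (by linarith)]; ring
  rw [setIntegral_congr_set hcong]
  have hfin : volume S ≠ ⊤ := by
    refine ((measure_mono (prod_mono Ioo_subset_Icc_self Ioo_subset_Icc_self)).trans_lt
      (isCompact_Icc.prod isCompact_Icc).measure_lt_top).ne
  have hint : ∀ F : ℝ × ℝ → ℝ, Continuous F → IntegrableOn F S := fun F hF =>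
    (hF.continuousOn.integrableOn_compact (isCompact_Icc.prod isCompact_Icc)).mono_set
      (prod_mono Ioo_subset_Icc_self Ioo_subset_Icc_self)
  have hpre : (fun p => (2 * x, 2 * y) - p) ⁻¹' S = S := by
    ext p
    simp only [hS, mem_preimage, mem_prod, Prod.fst_sub, Prod.snd_sub, mem_Ioo]
    constructor <;> rintro ⟨⟨h1, h2⟩, h3, h4⟩ <;>
      exact ⟨⟨by linarith, by linarith⟩, by linarith, by linarith⟩
  have h1 := integral_reflect (2 * x, 2 * y) S fun p => (α + β * p.1 + γ * p.2) ^ 2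
  rw [hpre] at h1
  -- The values of an affine function at two points symmetric about the centre average to its
  -- central value, so by convexity the sum of their squares is at least twice the central square.
  have h2 : (∫ _ in S, 2 * (α + β * x + γ * y) ^ 2) ≤
      ∫ p in S, ((α + β * p.1 + γ * p.2) ^ 2 +
        (α + β * ((2 * x, 2 * y) - p).1 + γ * ((2 * x, 2 * y) - p).2) ^ 2) := by
    refine setIntegral_mono_on (integrableOn_const hfin) (hint _ (by fun_prop))
      (measurableSet_Ioo.prod measurableSet_Ioo) fun p _ => ?_
    simp only [Prod.fst_sub, Prod.snd_sub]
    nlinarith [sq_nonneg (β * (p.1 - x) + γ * (p.2 - y))]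
  rw [setIntegral_const, smul_eq_mul, hvol, integral_add (hint _ (by fun_prop))
    (hint _ (by fun_prop)), h1] at h2
  linarith

section

variable {n : ℕ} {X Y : ℕ → ℝ} {v g χ : ℝ × ℝ → ℝ} {i j : ℕ} {a b h k : ℝ}

/-- The local coordinates move by at most `1/9`. This keeps them positive, as `1/9 < 1/4`, and their
sum below 1, as `3/4 + 2/9 < 1`. -/
theorem subrect_subset_otri (hh : h ≠ 0) (hk : k ≠ 0) {s t : ℝ} (hs : 1 / 4 ≤ s) (ht : 1 / 4 ≤ t)
    (hst : s + t ≤ 3 / 4) :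
    (Ioc (a + s * h - |h| / 9) (a + s * h + |h| / 9) ×ˢ
      Ioc (b + t * k - |k| / 9) (b + t * k + |k| / 9) : Set (ℝ × ℝ)) ⊆ otri a b h k := by
  have key : ∀ c l r x : ℝ, l ≠ 0 → x ∈ Ioc (c + r * l - |l| / 9) (c + r * l + |l| / 9) →
      |(x - c) / l - r| ≤ 1 / 9 := by
    intro c l r x hl hx
    have hpos := abs_pos.2 hl
    have e : (x - c) / l - r = (x - c - r * l) / l := by field_simp
    rw [e, abs_div, div_le_iff₀ hpos, abs_le]
    constructor <;> linarith [hx.1, hx.2]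
  rintro p ⟨h1, h2⟩
  have a1 := abs_le.1 (key a h s p.1 hh h1)
  have a2 := abs_le.1 (key b k t p.2 hk h2)
  exact ⟨by linarith, by linarith, by linarith⟩

theorem IsPL.bm_sq (hv : IsPL n X Y v) : BM (fun p => v p ^ 2) := hv.bm.sq

/-- The value at an interior point is controlled by the mean over a rectangle centred there. This
rectangle has area `4/81 |h| |k|`, and `81/4 ≤ 21`. -/
theorem IsPL.sq_le_integral (hX : IsGrid n X) (hY : IsGrid n Y) (hv : IsPL n X Y v)
    (ht : IsTri X Y i j a b h k) (hi : i < n) (hj : j < n) {s t : ℝ} (hs : 1 / 4 ≤ s)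
    (ht' : 1 / 4 ≤ t) (hst : s + t ≤ 3 / 4) :
    |h| * |k| * (v (a, b) + s * (v (a + h, b) - v (a, b)) + t * (v (a, b + k) - v (a, b))) ^ 2 ≤
      21 * ∫ p in otri a b h k, v p ^ 2 := by
  obtain ⟨hh, hk⟩ := ht.ne hX hY hi hj
  have hsub := subrect_subset_otri (a := a) (b := b) hh hk hs ht' hst
  have hO := ht.subset_hSquare hX hY hi hj
  have h1 := sq_center_le_integral (v (a, b) - a * slopeX v a b h - b * slopeY v a b k)
    (slopeX v a b h) (slopeY v a b k) (a + s * h) (b + t * k) (|h| / 9) (|k| / 9) (by positivity)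
    (by positivity)
  have h2 : ∫ p in Ioc (a + s * h - |h| / 9) (a + s * h + |h| / 9) ×ˢ
      Ioc (b + t * k - |k| / 9) (b + t * k + |k| / 9),
      (v (a, b) - a * slopeX v a b h - b * slopeY v a b k + slopeX v a b h * p.1 +
        slopeY v a b k * p.2) ^ 2 =
      ∫ p in Ioc (a + s * h - |h| / 9) (a + s * h + |h| / 9) ×ˢ
      Ioc (b + t * k - |k| / 9) (b + t * k + |k| / 9), v p ^ 2 := by
    refine setIntegral_congr_fun (measurableSet_Ioc.prod measurableSet_Ioc) fun p hp => ?_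
    rw [hv.eq_on_otri hX hY ht hi hj (hsub hp)]
    ring
  rw [h2] at h1
  have h3 := integral_mono_subset hv.bm_sq (fun p => sq_nonneg _) hsub hO
  have e : v (a, b) - a * slopeX v a b h - b * slopeY v a b k + slopeX v a b h * (a + s * h) +
      slopeY v a b k * (b + t * k) =
      v (a, b) + s * (v (a + h, b) - v (a, b)) + t * (v (a, b + k) - v (a, b)) := by
    unfold slopeX slopeY; field_simp; ring
  rw [e] at h1
  have h4 : 0 ≤ ∫ p in otri a b h k, v p ^ 2 := integral_nonneg fun p => sq_nonneg _
  linarith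

/-- Nodal values are bounded by the mean square over the triangle. -/
theorem IsPL.node_sq_le (hX : IsGrid n X) (hY : IsGrid n Y) (hv : IsPL n X Y v)
    (ht : IsTri X Y i j a b h k) (hi : i < n) (hj : j < n) :
    |h| * |k| * v (a, b) ^ 2 ≤ 1701 * ∫ p in otri a b h k, v p ^ 2 ∧
    |h| * |k| * v (a + h, b) ^ 2 ≤ 1701 * ∫ p in otri a b h k, v p ^ 2 ∧
    |h| * |k| * v (a, b + k) ^ 2 ≤ 1701 * ∫ p in otri a b h k, v p ^ 2 := by
  have hp : 0 ≤ |h| * |k| := by positivity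
  have h1 := hv.sq_le_integral hX hY ht hi hj (s := 1 / 4) (t := 1 / 4) (by norm_num)
    (by norm_num) (by norm_num)
  have h2 := hv.sq_le_integral hX hY ht hi hj (s := 1 / 2) (t := 1 / 4) (by norm_num)
    (by norm_num) (by norm_num)
  have h3 := hv.sq_le_integral hX hY ht hi hj (s := 1 / 4) (t := 1 / 2) (by norm_num)
    (by norm_num) (by norm_num)
  set z := v (a, b)
  set z₁ := v (a + h, b)
  set z₂ := v (a, b + k)
  -- From the values `A`, `B`, `D` at three interior points the vertex values are `3 A - B - D`, `3
  -- B - A - D` and `3 D - A - B`. Then `z² ≤ 9 · 3 (A² + B² + D²)`, and three times the constant 21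
  -- gives `27 · 63 = 1701`.
  have key : ∀ A B D z : ℝ, |z| ≤ 3 * (|A| + |B| + |D|) →
      z ^ 2 ≤ 27 * (A ^ 2 + B ^ 2 + D ^ 2) := by
    intro A B D z hz
    rw [← sq_abs z, ← sq_abs A, ← sq_abs B, ← sq_abs D]
    have := pow_le_pow_left₀ (abs_nonneg _) hz 2
    nlinarith [sq_nonneg (|A| - |B|), sq_nonneg (|B| - |D|), sq_nonneg (|A| - |D|)]
  have fin : ∀ w : ℝ, |w| ≤ 3 * (|z + 1 / 4 * (z₁ - z) + 1 / 4 * (z₂ - z)| +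
      |z + 1 / 2 * (z₁ - z) + 1 / 4 * (z₂ - z)| + |z + 1 / 4 * (z₁ - z) + 1 / 2 * (z₂ - z)|) →
      |h| * |k| * w ^ 2 ≤ 1701 * ∫ p in otri a b h k, v p ^ 2 := by
    intro w hw
    have := mul_le_mul_of_nonneg_left (key _ _ _ w hw) hp
    linarith
  set A := z + 1 / 4 * (z₁ - z) + 1 / 4 * (z₂ - z) with hA
  set B := z + 1 / 2 * (z₁ - z) + 1 / 4 * (z₂ - z) with hB
  set D := z + 1 / 4 * (z₁ - z) + 1 / 2 * (z₂ - z) with hD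
  have b1 := abs_le.1 (le_refl |A|)
  have b2 := abs_le.1 (le_refl |B|)
  have b3 := abs_le.1 (le_refl |D|)
  refine ⟨fin _ (abs_le.2 ⟨?_, ?_⟩), fin _ (abs_le.2 ⟨?_, ?_⟩), fin _ (abs_le.2 ⟨?_, ?_⟩)⟩ <;>
    linarith

/-- A crude bound, taken from the inscribed rectangle that is already available; the sharp constant
is 2. -/
theorem volume_otri_ge (hX : IsGrid n X) (hY : IsGrid n Y) (ht : IsTri X Y i j a b h k)
    (hi : i < n) (hj : j < n) : |h| * |k| ≤ 21 * volume.real (otri a b h k) := by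
  obtain ⟨hh, hk⟩ := ht.ne hX hY hi hj
  have h1 := measureReal_mono (μ := volume) (subrect_subset_otri (a := a) (b := b) hh hk
    (s := 1 / 4) (t := 1 / 4) (by norm_num) (by norm_num) (by norm_num))
    (volume_real_hSquare_subset (ht.subset_hSquare hX hY hi hj)).ne
  rw [volume_real_rect (by linarith [abs_nonneg h]) (by linarith [abs_nonneg k])] at h1
  have : 0 ≤ volume.real (otri a b h k) := measureReal_nonneg
  linarith

theorem IsPL.slopeX_sq_le (hX : IsGrid n X) (hY : IsGrid n Y) (hv : IsPL n X Y v)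
    (ht : IsTri X Y i j a b h k) (hi : i < n) (hj : j < n) :
    |h| * |k| * slopeX v a b h ^ 2 ≤ 21 * ∫ p in otri a b h k, dX v p ^ 2 := by
  rw [setIntegral_congr_fun (measurableSet_otri _ _ _ _) (g := fun _ => slopeX v a b h ^ 2)
    (fun p hp => by simp only; rw [hv.dX_eq hX hY ht hi hj hp]), setIntegral_const, smul_eq_mul]
  have := mul_le_mul_of_nonneg_right (volume_otri_ge hX hY ht hi hj) (sq_nonneg (slopeX v a b h))
  linarith

/-! ### Interpolation errors on triangles -/

/-- The closed cell `(i, j)`. -/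
def cellR (X Y : ℕ → ℝ) (i j : ℕ) : Set (ℝ × ℝ) :=
  Icc (X i) (X (i + 1)) ×ˢ Icc (Y j) (Y (j + 1))

theorem isRect_Icc {a₁ a₂ b₁ b₂ H K : ℝ} (ha : 0 ≤ a₁) (ha' : a₂ ≤ 1) (hb : 0 ≤ b₁) (hb' : b₂ ≤ 1)
    (hH : a₂ - a₁ ≤ H) (hK : b₂ - b₁ ≤ K) : IsRect (Icc a₁ a₂ ×ˢ Icc b₁ b₂) H K :=
  ⟨⟨_, _, _, _, rfl⟩, prod_mono (Icc_subset_Icc ha ha') (Icc_subset_Icc hb hb'),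
    fun p hp q hq => abs_le.2 ⟨by linarith [hp.1.1, hp.1.2, hq.1.1, hq.1.2],
      by linarith [hp.1.1, hp.1.2, hq.1.1, hq.1.2]⟩,
    fun p hp q hq => abs_le.2 ⟨by linarith [hp.2.1, hp.2.2, hq.2.1, hq.2.2],
      by linarith [hp.2.1, hp.2.2, hq.2.1, hq.2.2]⟩⟩

theorem isRect_cellR (hX : IsGrid n X) (hY : IsGrid n Y) (hi : i < n) (hj : j < n) {H K : ℝ}
    (hH : X (i + 1) - X i ≤ H) (hK : Y (j + 1) - Y j ≤ K) : IsRect (cellR X Y i j) H K :=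
  isRect_Icc (hX.mem_Icc hi.le).1 (hX.mem_Icc hi).2 (hY.mem_Icc hj.le).1 (hY.mem_Icc hj).2 hH hK

/-- The rectangle `R` contains the triangle with corner `(a, b)` and legs `h ≠ 0`, `k ≠ 0`. -/
structure LegsIn (R : Set (ℝ × ℝ)) (a b h k : ℝ) : Prop where
  h_ne : h ≠ 0
  k_ne : k ≠ 0
  corner : (a, b) ∈ R
  right : (a + h, b) ∈ R
  top : (a, b + k) ∈ R
  sub : otri a b h k ⊆ R

theorem IsTri.legsIn (hX : IsGrid n X) (hY : IsGrid n Y) (ht : IsTri X Y i j a b h k)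
    (hi : i < n) (hj : j < n) : LegsIn (cellR X Y i j) a b h k := by
  obtain ⟨hh, hk⟩ := ht.ne hX hY hi hj
  have m := fun s t => ht.mem_cell hX hY hi hj (s := s) (t := t)
  have a0 := (m 0 0).1 le_rfl zero_le_one
  have a1 := (m 1 0).1 zero_le_one le_rfl
  have b0 := (m 0 0).2.1 le_rfl zero_le_one
  have b1 := (m 0 1).2.1 zero_le_one le_rfl
  rw [zero_mul, add_zero] at a0 b0
  rw [one_mul] at a1 b1
  exact ⟨hh, hk, ⟨a0, b0⟩, ⟨a1, b0⟩, ⟨a0, b1⟩, (ht.otri_subset hX hY hi hj).trans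
    (prod_mono Ioo_subset_Icc_self Ioo_subset_Icc_self)⟩

theorem LegsIn.swap {R : Set (ℝ × ℝ)} (hl : LegsIn R a b h k) :
    LegsIn (Prod.swap ⁻¹' R) b a k h :=
  ⟨hl.k_ne, hl.h_ne, hl.corner, hl.top, hl.right, fun _ hp => hl.sub (swap_mem_otri.2 hp)⟩

/-- The linear interpolant on the triangle with corner `(a, b)` and legs `h`, `k`. -/
def linInterp (g : ℝ × ℝ → ℝ) (a b h k : ℝ) (p : ℝ × ℝ) : ℝ :=
  g (a, b) + (p.1 - a) * slopeX g a b h + (p.2 - b) * slopeY g a b k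

variable {m : ℕ → ℕ → ℝ} {R : Set (ℝ × ℝ)} {H K : ℝ}

/-- Inside the triangle the interpolant is a convex combination of the three vertex values. -/
theorem abs_linInterp_le {B : ℝ} (hl : LegsIn R a b h k) (hB : ∀ p ∈ R, |g p| ≤ B) {p : ℝ × ℝ}
    (hp : p ∈ otri a b h k) : |linInterp g a b h k p| ≤ B := by
  obtain ⟨s, t, hs, ht, hst, rfl⟩ := otri_param hl.h_ne hl.k_ne hp
  have e : linInterp g a b h k (a + s * h, b + t * k) =
      (1 - s - t) * g (a, b) + s * g (a + h, b) + t * g (a, b + k) := by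
    have := hl.h_ne
    have := hl.k_ne
    unfold linInterp slopeX slopeY; field_simp; ring
  rw [e]
  have h1 := abs_le.1 (hB _ hl.corner)
  have h2 := abs_le.1 (hB _ hl.right)
  have h3 := abs_le.1 (hB _ hl.top)
  have hr : 0 ≤ 1 - s - t := by linarith
  rw [abs_le]
  constructor <;> nlinarith

/-- Linear interpolation reproduces the first order Taylor polynomial at the corner and does not
increase maxima. The remainder is therefore counted twice. -/
theorem JetBound.linInterp_error (hg : JetBound m R g) (hR : IsRect R H K)
    (hl : LegsIn R a b h k) {p : ℝ × ℝ} (hp : p ∈ otri a b h k) :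
    |g p - linInterp g a b h k p| ≤ 2 * rem₂ m H K := by
  have hB : ∀ q ∈ R, |(fun q => g q - taylor₁ g (a, b) q) q| ≤ rem₂ m H K := fun q hq =>
    hg.taylor hR hl.corner hq
  have h1 := abs_linInterp_le (g := fun q => g q - taylor₁ g (a, b) q) hl hB hp
  have h2 := hB p (hl.sub hp)
  have e : g p - linInterp g a b h k p = (g p - taylor₁ g (a, b) p) -
      linInterp (fun q => g q - taylor₁ g (a, b) q) a b h k p := by
    have := hl.h_ne
    have := hl.k_ne
    unfold linInterp slopeX slopeY taylor₁; field_simp; ring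
  rw [e]
  exact (abs_sub _ _).trans (by linarith)

/-- The slope is the mean of `dX g` over the horizontal leg. Each value there is compared with `dX g
p` by moving first in `y` and then in `x`. -/
theorem JetBound.slopeX_error (hg : JetBound m R g) (hR : IsRect R H K)
    (hl : LegsIn R a b h k) {p : ℝ × ℝ} (hp : p ∈ R) :
    |dX g p - slopeX g a b h| ≤ H * m 2 0 + K * m 1 1 := by
  have hpos := abs_pos.2 hl.h_ne
  have hM20 : 0 ≤ m 2 0 := (abs_nonneg _).trans (hg.b20 hp)
  have hM11 : 0 ≤ m 1 1 := (abs_nonneg _).trans (hg.b11 hR.sub hp)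
  have h1 := hR.mvt_x (x₁ := a) (x₂ := a + h) (y := b) hl.corner hl.right
    (f := fun t => g (t, b) - t * dX g p) (f' := fun t => dX g (t, b) - 1 * dX g p)
    (M := H * m 2 0 + K * m 1 1)
    (fun t ht => ((hasDerivWithinAt_dX (hg.smooth.differentiableOn (by norm_num))
      (hR.sub ht)).1).sub ((hasDerivWithinAt_id t _).mul_const _)) (fun t ht => by
        have hd := hg.smooth_dX.differentiableOn (by norm_num)
        have hq : (t, p.2) ∈ R := hR.mk_mem ht hp
        have e1 := hR.lipschitz_x hd (fun q hq => hg.b20 hq) (y := p.2) (x₁ := p.1) (x₂ := t) hp hq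
        have e2 := hR.lipschitz_y hd (fun q hq => hg.b11 hR.sub hq) (x := t) hq ht
        have w1 := mul_le_mul_of_nonneg_left (hR.width _ ht _ hp) hM20
        have w2 := mul_le_mul_of_nonneg_left (hR.height _ ht _ hp) hM11
        simp only at w1 w2
        have e : dX g (t, b) - 1 * dX g p = (dX g (t, b) - dX g (t, p.2)) +
          (dX g (t, p.2) - dX g (p.1, p.2)) := by ring
        rw [e]
        refine (abs_add_le _ _).trans ?_
        linarith)
  rw [add_sub_cancel_left] at h1
  have e : dX g p - slopeX g a b h =
      -((g (a + h, b) - (a + h) * dX g p - (g (a, b) - a * dX g p)) / h) := by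
    have := hl.h_ne
    unfold slopeX; field_simp; ring
  rw [e, abs_neg, abs_div, div_le_iff₀ hpos]
  exact h1

theorem JetBound.slopeY_error (hg : JetBound m R g) (hR : IsRect R H K)
    (hl : LegsIn R a b h k) {p : ℝ × ℝ} (hp : p ∈ R) :
    |dY g p - slopeY g a b k| ≤ K * m 0 2 + H * m 1 1 :=
  (hg.swap hR.sub).slopeX_error hR.swap hl.swap (p := p.swap) hp

theorem JetBound.abs_slopeX_le (hg : JetBound m R g) (hR : IsRect R H K)
    (hl : LegsIn R a b h k) : |slopeX g a b h| ≤ m 1 0 := by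
  have hpos := abs_pos.2 hl.h_ne
  have h1 := hR.lipschitz_x (hg.smooth.differentiableOn (by norm_num)) (fun q hq => hg.b10 hq)
    hl.corner hl.right
  rw [add_sub_cancel_left] at h1
  unfold slopeX
  rw [abs_div, div_le_iff₀ hpos]
  exact h1

theorem JetBound.abs_slopeY_le (hg : JetBound m R g) (hR : IsRect R H K)
    (hl : LegsIn R a b h k) : |slopeY g a b k| ≤ m 0 1 :=
  (hg.swap hR.sub).abs_slopeX_le hR.swap hl.swap

theorem abs_slopeX_le {B : ℝ} (hl : LegsIn R a b h k) (hB : ∀ p ∈ R, |g p| ≤ B) :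
    |slopeX g a b h| ≤ 2 * B / |h| := by
  unfold slopeX
  rw [abs_div]
  refine div_le_div_of_nonneg_right ?_ (abs_nonneg _)
  exact (abs_sub _ _).trans (by linarith [hB _ hl.corner, hB _ hl.right])

theorem abs_slopeY_le {B : ℝ} (hl : LegsIn R a b h k) (hB : ∀ p ∈ R, |g p| ≤ B) :
    |slopeY g a b k| ≤ 2 * B / |k| := by
  unfold slopeY
  rw [abs_div]
  refine div_le_div_of_nonneg_right ?_ (abs_nonneg _)
  exact (abs_sub _ _).trans (by linarith [hB _ hl.corner, hB _ hl.top])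

/-- On the triangles of the mesh the nodal interpolant is the linear interpolant. -/
theorem interp_on_otri (hX : IsGrid n X) (hY : IsGrid n Y) (ht : IsTri X Y i j a b h k)
    (hi : i < n) (hj : j < n) {p : ℝ × ℝ} (hp : p ∈ otri a b h k) :
    interp n X Y g p = linInterp g a b h k p ∧ dX (interp n X Y g) p = slopeX g a b h ∧
      dY (interp n X Y g) p = slopeY g a b k := by
  have hI := isPL_interp (g := g) hX hY
  obtain ⟨e1, e2, e3⟩ := ht.interp_eq (g := g) hX hY hi hj
  have s1 : slopeX (interp n X Y g) a b h = slopeX g a b h := by unfold slopeX; rw [e1, e2]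
  have s2 : slopeY (interp n X Y g) a b k = slopeY g a b k := by unfold slopeY; rw [e1, e3]
  refine ⟨?_, ?_, ?_⟩
  · rw [hI.eq_on_otri hX hY ht hi hj hp]
    simp only [linInterp]
    rw [s1, s2, e1]
  · rw [hI.dX_eq hX hY ht hi hj hp]; exact s1
  · rw [hI.dY_eq hX hY ht hi hj hp]; exact s2

end


/-! ### Superconvergence on blocks of equal rows -/

/-- Summation by rows inside one column of cells. `D j` is the slope of the test function on row
`j`, which belongs to the lower triangle of cell `j` and to the upper triangle of cell `j - 1`.
Regrouping by `D` pairs these two; only the first lower and the last upper triangle have no partner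
and are estimated with the larger constant `M`. -/
theorem abs_sum_pairs_le {D a b P Q : ℕ → ℝ} {M B : ℝ} {j₀ : ℕ} (l : ℕ) (hl : j₀ ≤ l)
    (hB : ∀ j ∈ Finset.Ico j₀ (l + 1), 0 ≤ B * P j)
    (ha : |D j₀ * a j₀| ≤ M * P j₀) (hb : |D (l + 1) * b l| ≤ M * Q l)
    (hab : ∀ j ∈ Finset.Ico j₀ l, |D (j + 1) * (a (j + 1) + b j)| ≤ B * P (j + 1)) :
    |∑ j ∈ Finset.Ico j₀ (l + 1), (D j * a j + D (j + 1) * b j)| ≤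
      M * (P j₀ + Q l) + B * ∑ j ∈ Finset.Ico j₀ (l + 1), P j := by
  have key : ∀ l, j₀ ≤ l →
      (∀ j ∈ Finset.Ico j₀ l, |D (j + 1) * (a (j + 1) + b j)| ≤ B * P (j + 1)) →
      (∀ j ∈ Finset.Ico j₀ (l + 1), 0 ≤ B * P j) →
      |∑ j ∈ Finset.Ico j₀ (l + 1), (D j * a j + D (j + 1) * b j) - D (l + 1) * b l| ≤
        M * P j₀ + B * ∑ j ∈ Finset.Ico j₀ (l + 1), P j := by
    intro l hl
    induction l, hl using Nat.le_induction with
    | base =>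
      intro _ h0
      have := h0 j₀ (by simp)
      simp only [Nat.Ico_succ_singleton, Finset.sum_singleton, add_sub_cancel_right]
      linarith
    | succ l hl ih =>
      intro h1 h0
      have i1 := ih (fun j hj => h1 j (by rw [Finset.mem_Ico] at hj ⊢; omega))
        (fun j hj => h0 j (by rw [Finset.mem_Ico] at hj ⊢; omega))
      have i2 := h1 l (by rw [Finset.mem_Ico]; omega)
      rw [Finset.sum_Ico_succ_top (show j₀ ≤ l + 1 by omega),
        Finset.sum_Ico_succ_top (f := P) (show j₀ ≤ l + 1 by omega)]
      have e : ∑ j ∈ Finset.Ico j₀ (l + 1), (D j * a j + D (j + 1) * b j) +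
          (D (l + 1) * a (l + 1) + D (l + 1 + 1) * b (l + 1)) - D (l + 1 + 1) * b (l + 1) =
          (∑ j ∈ Finset.Ico j₀ (l + 1), (D j * a j + D (j + 1) * b j) - D (l + 1) * b l) +
          D (l + 1) * (a (l + 1) + b l) := by ring
      rw [e]
      refine (abs_add_le _ _).trans ?_
      rw [mul_add B]
      linarith
  have h := key l hl hab hB
  have e : ∑ j ∈ Finset.Ico j₀ (l + 1), (D j * a j + D (j + 1) * b j) =
      (∑ j ∈ Finset.Ico j₀ (l + 1), (D j * a j + D (j + 1) * b j) - D (l + 1) * b l) +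
        D (l + 1) * b l := by ring
  rw [e, mul_add]
  refine (abs_add_le _ _).trans ?_
  linarith

/-- The difference quotient of `v` between the nodes `(i, j)` and `(i + 1, j)`. -/
def rowSlope (X Y : ℕ → ℝ) (v : ℝ × ℝ → ℝ) (i j : ℕ) : ℝ :=
  slopeX v (X i) (Y j) (X (i + 1) - X i)

section

variable {n : ℕ} {X Y : ℕ → ℝ} {v g χ : ℝ × ℝ → ℝ} {i j : ℕ} {m : ℕ → ℕ → ℝ}

theorem slopeX_o1 (i j : ℕ) : slopeX v (X i) (Y j) (X (i + 1) - X i) = rowSlope X Y v i j := rfl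

theorem slopeX_o2 (i j : ℕ) :
    slopeX v (X (i + 1)) (Y j) (X i - X (i + 1)) = rowSlope X Y v i j := by
  unfold rowSlope slopeX
  rw [add_sub_cancel, add_sub_cancel, ← neg_sub (X (i + 1)), ← neg_sub (v (X (i + 1), Y j)),
    neg_div_neg_eq]

theorem JetBound.bm_dX (hg : JetBound m R g) : BM (dX g) :=
  BM.of_continuousOn hg.smooth_dX.continuousOn

theorem JetBound.bm_dY (hg : JetBound m R g) : BM (dY g) :=
  BM.of_continuousOn hg.smooth_dY.continuousOn

/-- The `x`-derivative of the interpolation error. -/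
def errX (n : ℕ) (X Y : ℕ → ℝ) (g : ℝ × ℝ → ℝ) (p : ℝ × ℝ) : ℝ := dX g p - dX (interp n X Y g) p

/-- The `y`-derivative of the interpolation error. -/
def errY (n : ℕ) (X Y : ℕ → ℝ) (g : ℝ × ℝ → ℝ) (p : ℝ × ℝ) : ℝ := dY g p - dY (interp n X Y g) p

theorem JetBound.bm_errX (hX : IsGrid n X) (hY : IsGrid n Y) (hg : JetBound m R g) :
    BM (errX n X Y g) := hg.bm_dX.sub ((isPL_interp hX hY).bm_dX hX hY)

theorem JetBound.bm_errY (hX : IsGrid n X) (hY : IsGrid n Y) (hg : JetBound m R g) :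
    BM (errY n X Y g) := hg.bm_dY.sub ((isPL_interp hX hY).bm_dY hX hY)

theorem errX_o1 (hX : IsGrid n X) (hY : IsGrid n Y) (hi : i < n) (hj : j < n) {p : ℝ × ℝ}
    (hp : p ∈ o1 X Y i j) : errX n X Y g p = dX g p - rowSlope X Y g i j := by
  unfold errX
  rw [(interp_on_otri hX hY (isTri_o1 X Y i j) hi hj hp).2.1, slopeX_o1]

theorem errX_o2 (hX : IsGrid n X) (hY : IsGrid n Y) (hi : i < n) (hj : j < n) {p : ℝ × ℝ}
    (hp : p ∈ o2 X Y i j) : errX n X Y g p = dX g p - rowSlope X Y g i (j + 1) := by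
  unfold errX
  rw [(interp_on_otri hX hY (isTri_o2 X Y i j) hi hj hp).2.1, slopeX_o2]

theorem IsPL.dX_o1 (hX : IsGrid n X) (hY : IsGrid n Y) (hχ : IsPL n X Y χ) (hi : i < n)
    (hj : j < n) {p : ℝ × ℝ} (hp : p ∈ o1 X Y i j) : dX χ p = rowSlope X Y χ i j :=
  hχ.dX_eq hX hY (isTri_o1 X Y i j) hi hj hp

theorem IsPL.dX_o2 (hX : IsGrid n X) (hY : IsGrid n Y) (hχ : IsPL n X Y χ) (hi : i < n)
    (hj : j < n) {p : ℝ × ℝ} (hp : p ∈ o2 X Y i j) : dX χ p = rowSlope X Y χ i (j + 1) := by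
  rw [hχ.dX_eq hX hY (isTri_o2 X Y i j) hi hj hp, slopeX_o2]

theorem o1_subset_hSquare (hX : IsGrid n X) (hY : IsGrid n Y) (hi : i < n) (hj : j < n) :
    o1 X Y i j ⊆ hSquare := (isTri_o1 X Y i j).subset_hSquare hX hY hi hj

theorem o2_subset_hSquare (hX : IsGrid n X) (hY : IsGrid n Y) (hi : i < n) (hj : j < n) :
    o2 X Y i j ⊆ hSquare := (isTri_o2 X Y i j).subset_hSquare hX hY hi hj

theorem abs_setIntegral_le {F : ℝ × ℝ → ℝ} {S : Set (ℝ × ℝ)} (hS : S ⊆ hSquare)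
    {B : ℝ} (hB : ∀ p ∈ S, |F p| ≤ B) : |∫ p in S, F p| ≤ B * volume.real S := by
  have := norm_setIntegral_le_of_norm_le_const (f := F) (volume_real_hSquare_subset hS) hB
  rwa [Real.norm_eq_abs] at this

theorem setIntegral_eq_const {F : ℝ × ℝ → ℝ} {S : Set (ℝ × ℝ)} (hm : MeasurableSet S) {B : ℝ}
    (hB : ∀ p ∈ S, F p = B) : ∫ p in S, F p = B * volume.real S := by
  rw [setIntegral_congr_fun hm (g := fun _ => B) hB, setIntegral_const, smul_eq_mul, mul_comm]

/-- Points `p` and `c - p` in a pair of triangles with a common horizontal edge. -/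
theorem errX_pair (hX : IsGrid n X) (hY : IsGrid n Y) (hi : i < n) (hj : j + 1 < n)
    {R : Set (ℝ × ℝ)} {H K : ℝ} (hR : IsRect R H K) (hg : JetBound m R g)
    (hsub : Icc (X i) (X (i + 1)) ×ˢ Icc (Y j) (Y (j + 1 + 1)) ⊆ R)
    (hk : Y (j + 1 + 1) - Y (j + 1) = Y (j + 1) - Y j) :
    |(∫ p in o1 X Y i (j + 1), errX n X Y g p) + ∫ p in o2 X Y i j, errX n X Y g p| ≤
      4 * rem₃ m H K * volume.real (o1 X Y i (j + 1)) := by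
  have hx := hX.lt i hi
  have hy := hY.lt (j + 1) hj
  have hy' := hY.lt j (by omega)
  -- Twice the midpoint of the common edge. The reflection `p ↦ c - p` exchanges the two triangles
  -- because both rows have the same height, by `hk`.
  set c : ℝ × ℝ := (X i + X (i + 1), 2 * Y (j + 1)) with hc
  have hpre : (fun p => c - p) ⁻¹' o2 X Y i j = o1 X Y i (j + 1) := by
    unfold o2
    rw [reflect_otri]
    unfold o1
    have e1 : c.1 - X (i + 1) = X i := by simp [hc]
    have e2 : c.2 - Y (j + 1) = Y (j + 1) := by simp [hc]; ring
    rw [e1, e2, neg_sub, neg_sub, hk]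
  have hs1 := o1_subset_hSquare hX hY hi hj
  have hs2 := o2_subset_hSquare (j := j) hX hY hi (by omega)
  have hb := hg.bm_errX hX hY
  have h1 := integral_reflect c (o2 X Y i j) (errX n X Y g)
  rw [hpre] at h1
  have hint : IntegrableOn (fun p => errX n X Y g (c - p)) (o1 X Y i (j + 1)) := by
    rw [← hpre]
    exact (MeasurePreserving.integrableOn_comp_preimage
      (Measure.measurePreserving_sub_left volume c)
      (MeasurableEquiv.subLeft c).measurableEmbedding).2 (hb.intOn hs2)
  rw [← h1, ← integral_add (hb.intOn hs1) hint]
  refine abs_setIntegral_le hs1 fun p hp => ?_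
  have hp2 : c - p ∈ o2 X Y i j := by rw [← hpre] at hp; exact hp
  have hpc := (isTri_o1 X Y i (j + 1)).otri_subset hX hY hi hj hp
  have hpc2 := (isTri_o2 X Y i j).otri_subset hX hY hi (by omega) hp2
  have mR : p ∈ R := hsub ⟨Ioo_subset_Icc_self hpc.1, by linarith [hpc.2.1], hpc.2.2.le⟩
  have mR2 : c - p ∈ R := hsub ⟨Ioo_subset_Icc_self hpc2.1, hpc2.2.1.le, by linarith [hpc2.2.2]⟩
  set A : ℝ × ℝ := ((X i + X (i + 1)) / 2, Y (j + 1)) with hA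
  have mA : A ∈ R := hsub ⟨⟨by simp only [hA]; linarith, by simp only [hA]; linarith⟩,
    by simp only [hA]; linarith, by simp only [hA]; linarith⟩
  have m1 : (X i, Y (j + 1)) ∈ R := hsub ⟨⟨le_rfl, hx.le⟩, hy'.le, hy.le⟩
  have m2 : (X (i + 1), Y (j + 1)) ∈ R := hsub ⟨⟨hx.le, le_rfl⟩, hy'.le, hy.le⟩
  have t1 := hg.taylor_dX hR mA mR
  have t2 := hg.taylor_dX hR mA mR2
  have t3 := hg.taylor_diff hR mA m1 m2 hx.ne
  have e3 : taylor₁ (dX g) A ((X i + X (i + 1)) / 2, Y (j + 1)) = dX g A := by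
    rw [← hA]; unfold taylor₁; ring
  have e4 : (g (X (i + 1), Y (j + 1)) - g (X i, Y (j + 1))) / (X (i + 1) - X i) =
      rowSlope X Y g i (j + 1) := by unfold rowSlope slopeX; rw [add_sub_cancel]
  rw [e3, e4] at t3
  -- The linear parts cancel: the Taylor polynomials at `p` and `c - p` add up to `2 * dX g A`, and
  -- the slope on the edge is `dX g A` up to a remainder. Two pointwise remainders and twice that of
  -- the slope make the factor 4.
  have e5 : taylor₁ (dX g) A p + taylor₁ (dX g) A (c - p) = 2 * dX g A := by
    unfold taylor₁; simp only [hA, hc, Prod.fst_sub, Prod.snd_sub]; ring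
  rw [errX_o1 hX hY hi hj hp, errX_o2 hX hY hi (by omega) hp2]
  have t1 := abs_le.1 t1
  have t2 := abs_le.1 t2
  have t3 := abs_le.1 t3
  rw [abs_le]
  constructor <;> linarith

/-- In each column `dX χ` takes one value per horizontal mesh edge, shared by the two triangles on
that edge, so second order holds for all pairs. Only the triangles at the bottom and the top of the
block are first order; they are kept apart since their rows are thin. `2 * k` is the height of a
pair. -/
theorem block_superconvergence (hX : IsGrid n X) (hY : IsGrid n Y) (hχ : IsPL n X Y χ)
    {i₀ i₁ j₀ l : ℕ} (hi : i₀ ≤ i₁) (hin : i₁ ≤ n) (hl : j₀ ≤ l) (hln : l + 1 ≤ n) {H k : ℝ}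
    (hk : ∀ j, j₀ ≤ j → j ≤ l → Y (j + 1) - Y j = k)
    (hH : ∀ i, i₀ ≤ i → i < i₁ → X (i + 1) - X i ≤ H)
    (hg : JetBound m (Icc (X i₀) (X i₁) ×ˢ Icc (Y j₀) (Y (l + 1))) g) :
    |∫ p in block X Y i₀ i₁ j₀ (l + 1), errX n X Y g p * dX χ p| ≤
      (H * m 2 0 + k * m 1 1) * ((∫ p in block X Y i₀ i₁ j₀ (j₀ + 1), |dX χ p|) +
        ∫ p in block X Y i₀ i₁ l (l + 1), |dX χ p|) +
      4 * rem₃ m H (2 * k) * ∫ p in block X Y i₀ i₁ j₀ (l + 1), |dX χ p| := by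
  have hbe := hg.bm_errX hX hY
  have hbχ := hχ.bm_dX hX hY
  set M := H * m 2 0 + k * m 1 1 with hM
  set B := 4 * rem₃ m H (2 * k) with hB
  rw [integral_block hX hY (hbe.mul hbχ) hi hin (by omega) hln,
    integral_block_x hX hY hbχ.abs hi hin (by omega) (by omega),
    integral_block_x hX hY hbχ.abs hi hin (by omega) hln,
    integral_block_x hX hY hbχ.abs hi hin (by omega) hln, ← Finset.sum_add_distrib,
    Finset.mul_sum, Finset.mul_sum, ← Finset.sum_add_distrib]
  refine (Finset.abs_sum_le_sum_abs _ _).trans (Finset.sum_le_sum fun i hi' => ?_)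
  rw [Finset.mem_Ico] at hi'
  have hi1 : i < n := by omega
  have hHi := hH i hi'.1 hi'.2
  have hxi := hX.lt i hi1
  have cell_sub : ∀ j, j₀ ≤ j → j ≤ l →
      cellR X Y i j ⊆ Icc (X i₀) (X i₁) ×ˢ Icc (Y j₀) (Y (l + 1)) := fun j h1 h2 =>
    prod_mono (Icc_subset_Icc (hX.mono hi'.1 hi1.le) (hX.mono hi'.2 hin))
      (Icc_subset_Icc (hY.mono h1 (by omega)) (hY.mono (by omega) hln))
  set P : ℕ → ℝ := fun j => ∫ p in o1 X Y i j, |dX χ p| with hP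
  set Q : ℕ → ℝ := fun j => ∫ p in o2 X Y i j, |dX χ p| with hQ
  have hP0 : ∀ j, 0 ≤ P j := fun j => integral_nonneg fun _ => abs_nonneg _
  have hQ0 : ∀ j, 0 ≤ Q j := fun j => integral_nonneg fun _ => abs_nonneg _
  have hPe : ∀ j < n, P j = |rowSlope X Y χ i j| * volume.real (o1 X Y i j) := fun j hj =>
    setIntegral_eq_const (measurableSet_otri _ _ _ _) fun p hp => by rw [hχ.dX_o1 hX hY hi1 hj hp]
  have hQe : ∀ j < n, Q j = |rowSlope X Y χ i (j + 1)| * volume.real (o2 X Y i j) := fun j hj =>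
    setIntegral_eq_const (measurableSet_otri _ _ _ _) fun p hp => by rw [hχ.dX_o2 hX hY hi1 hj hp]
  have hPQ : ∀ j < n, ∫ p in block X Y i (i + 1) j (j + 1), |dX χ p| = P j + Q j := fun j hj =>
    integral_cell hX hY hbχ.abs hi1 hj
  have hB0 : 0 ≤ B := by
    have hk0 : 0 ≤ k := by rw [← hk j₀ le_rfl hl]; linarith [hY.lt j₀ (by omega)]
    have hH0 : 0 ≤ H := by linarith
    have hmem : (X i, Y j₀) ∈ Icc (X i₀) (X i₁) ×ˢ Icc (Y j₀) (Y (l + 1)) :=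
      cell_sub j₀ le_rfl hl ⟨⟨le_rfl, hxi.le⟩, le_rfl, (hY.lt j₀ (by omega)).le⟩
    have h1 := (abs_nonneg _).trans (hg.bound 3 0 (by norm_num) _ hmem)
    have h2 := (abs_nonneg _).trans (hg.bound 2 1 (by norm_num) _ hmem)
    have h3 := (abs_nonneg _).trans (hg.bound 1 2 (by norm_num) _ hmem)
    rw [hB, rem₃]; positivity
  have erB : ∀ j, j₀ ≤ j → j ≤ l → ∀ a b h k', IsTri X Y i j a b h k' → ∀ p ∈ otri a b h k',
      |errX n X Y g p| ≤ M := by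
    intro j h1 h2 a b h k' ht p hp
    have hR := isRect_cellR hX hY hi1 (show j < n by omega) hHi (hk j h1 h2).le
    have hl' := ht.legsIn hX hY hi1 (show j < n by omega)
    unfold errX
    rw [(interp_on_otri hX hY ht hi1 (by omega) hp).2.1]
    exact (hg.mono (cell_sub j h1 h2) fun _ _ _ => le_rfl).slopeX_error hR hl' (hl'.sub hp)
  have inner : ∑ j ∈ Finset.Ico j₀ (l + 1), ((∫ p in o1 X Y i j, errX n X Y g p * dX χ p) +
      ∫ p in o2 X Y i j, errX n X Y g p * dX χ p) =
      ∑ j ∈ Finset.Ico j₀ (l + 1), (rowSlope X Y χ i j * (∫ p in o1 X Y i j, errX n X Y g p) +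
        rowSlope X Y χ i (j + 1) * ∫ p in o2 X Y i j, errX n X Y g p) := by
    refine Finset.sum_congr rfl fun j hj => ?_
    rw [Finset.mem_Ico] at hj
    rw [← integral_const_mul, ← integral_const_mul]
    congr 1
    · refine setIntegral_congr_fun (measurableSet_otri _ _ _ _) fun p hp => ?_
      rw [hχ.dX_o1 hX hY hi1 (by omega) hp, mul_comm]
    · refine setIntegral_congr_fun (measurableSet_otri _ _ _ _) fun p hp => ?_
      rw [hχ.dX_o2 hX hY hi1 (by omega) hp, mul_comm]
  rw [inner]
  -- `P` and `Q` are the integrals of `|dX χ|` over lower and upper triangles, so a constant bound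
  -- on the error times the slope and the area becomes that bound times `P` or `Q`.
  have main := abs_sum_pairs_le (D := rowSlope X Y χ i)
    (a := fun j => ∫ p in o1 X Y i j, errX n X Y g p)
    (b := fun j => ∫ p in o2 X Y i j, errX n X Y g p) (P := P) (Q := Q) (M := M) (B := B) l hl
    (fun j _ => mul_nonneg hB0 (hP0 j)) (by
      rw [abs_mul, hPe j₀ (by omega), mul_left_comm]
      exact mul_le_mul_of_nonneg_left (abs_setIntegral_le
        (o1_subset_hSquare hX hY hi1 (by omega))
        (erB j₀ le_rfl hl _ _ _ _ (isTri_o1 X Y i j₀))) (abs_nonneg _)) (by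
      rw [abs_mul, hQe l (by omega), mul_left_comm]
      exact mul_le_mul_of_nonneg_left (abs_setIntegral_le
        (o2_subset_hSquare hX hY hi1 (by omega))
        (erB l hl le_rfl _ _ _ _ (isTri_o2 X Y i l))) (abs_nonneg _)) (fun j hj => by
      rw [Finset.mem_Ico] at hj
      rw [abs_mul, hPe (j + 1) (by omega), mul_left_comm]
      refine mul_le_mul_of_nonneg_left ?_ (abs_nonneg _)
      have hxi' := hX.mem_Icc hi1.le
      have hsub : Icc (X i) (X (i + 1)) ×ˢ Icc (Y j) (Y (j + 1 + 1)) ⊆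
          Icc (X i₀) (X i₁) ×ˢ Icc (Y j₀) (Y (l + 1)) :=
        prod_mono (Icc_subset_Icc (hX.mono hi'.1 hi1.le) (hX.mono hi'.2 hin))
          (Icc_subset_Icc (hY.mono hj.1 (by omega)) (hY.mono (by omega) hln))
      have k1 := hk j hj.1 hj.2.le
      have k2 := hk (j + 1) (by omega) (by omega)
      exact errX_pair hX hY hi1 (by omega) (isRect_Icc (hX.mem_Icc hi1.le).1 (hX.mem_Icc hi1).2
        (hY.mem_Icc (show j ≤ n by omega)).1 (hY.mem_Icc (show j + 1 + 1 ≤ n by omega)).2 hHi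
        (by linarith)) (hg.mono hsub fun _ _ _ => le_rfl) le_rfl (by rw [k1, k2]))
  refine main.trans ?_
  have hM0 : 0 ≤ M := by
    have hmem := (isTri_o1 X Y i j₀).legsIn hX hY hi1 (show j₀ < n by omega)
    have hR := isRect_cellR hX hY hi1 (show j₀ < n by omega) hHi (hk j₀ le_rfl hl).le
    exact (abs_nonneg _).trans ((hg.mono (cell_sub j₀ le_rfl hl) fun _ _ _ => le_rfl).slopeX_error
      hR hmem hmem.corner)
  refine add_le_add (mul_le_mul_of_nonneg_left ?_ hM0) (mul_le_mul_of_nonneg_left ?_ hB0)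
  · rw [hPQ j₀ (by omega), hPQ l (by omega)]
    linarith [hQ0 j₀, hP0 l]
  · rw [integral_block_y hX hY hbχ.abs (by omega) hln hi1.le hi1]
    refine Finset.sum_le_sum fun j hj => ?_
    rw [Finset.mem_Ico] at hj
    rw [hPQ j (by omega)]
    linarith [hQ0 j]

end


/-! ### The Shishkin mesh -/

/-- The standing assumptions on the discretization parameters. -/
structure Params (N : ℕ) (ε β₁ β₂ : ℝ) : Prop where
  four_le : 4 ≤ N
  dvd : 4 ∣ N
  ε_pos : 0 < ε
  ε_le : ε ≤ 1 / N
  β₁_pos : 0 < β₁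
  β₂_pos : 0 < β₂
  small₁ : 5 / 2 * (ε / β₁) * Real.log N ≤ 1 / 2
  small₂ : 5 / 2 * (ε / β₂) * Real.log N ≤ 1 / 2

/-- The size of layer terms outside of the layer, `N^{-5/2}`. -/
def theta (N : ℕ) : ℝ := Real.exp (-(5 / 2 * Real.log N))

/-- A multiple of `N⁻¹ ln N`. -/
def rho (N : ℕ) (β₁ β₂ : ℝ) : ℝ := (5 / β₁ + 5 / β₂ + 2) * (Real.log N / N)

section

variable {N : ℕ} {ε β₁ β₂ : ℝ}

theorem Params.swap (hP : Params N ε β₁ β₂) : Params N ε β₂ β₁ :=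
  ⟨hP.four_le, hP.dvd, hP.ε_pos, hP.ε_le, hP.β₂_pos, hP.β₁_pos, hP.small₂, hP.small₁⟩

theorem Params.N_ge (hP : Params N ε β₁ β₂) : (4 : ℝ) ≤ N := by exact_mod_cast hP.four_le

theorem Params.N_pos (hP : Params N ε β₁ β₂) : (0 : ℝ) < N := by linarith [hP.N_ge]

theorem Params.one_le_log (hP : Params N ε β₁ β₂) : 1 ≤ Real.log N := by
  have h : Real.log 4 ≤ Real.log N := Real.log_le_log (by norm_num) hP.N_ge
  have h4 : Real.log 4 = 2 * Real.log 2 := by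
    rw [show (4 : ℝ) = 2 ^ 2 by norm_num, Real.log_pow]; norm_num
  have := Real.log_two_gt_d9
  linarith

/-- From `ln N = 2 ln √N ≤ 2 √N`. It absorbs the surplus logarithms on the layer strips. -/
theorem Params.log_sq_le (hP : Params N ε β₁ β₂) : Real.log N ^ 2 ≤ 4 * N := by
  have hN := hP.N_pos
  have h1 : Real.log N = 2 * Real.log (Real.sqrt N) := by
    rw [Real.log_sqrt hN.le]; ring
  have h2 := Real.log_le_sub_one_of_pos (Real.sqrt_pos.2 hN)
  have h3 : Real.log N ≤ 2 * Real.sqrt N := by linarith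
  have h4 := pow_le_pow_left₀ (by linarith [hP.one_le_log]) h3 2
  rw [mul_pow, Real.sq_sqrt hN.le] at h4
  linarith

theorem Params.log_le (hP : Params N ε β₁ β₂) : Real.log N ≤ N := by
  have := Real.log_le_sub_one_of_pos hP.N_pos
  linarith

theorem Params.ε_mul_le (hP : Params N ε β₁ β₂) : ε * N ≤ 1 := by
  have := hP.ε_le
  rwa [le_div_iff₀ hP.N_pos] at this

theorem Params.ε_le_one (hP : Params N ε β₁ β₂) : ε ≤ 1 := by
  have := hP.ε_mul_le
  nlinarith [hP.N_ge, hP.ε_pos]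

theorem theta_pos (N : ℕ) : 0 < theta N := Real.exp_pos _

theorem Params.theta_sq (hP : Params N ε β₁ β₂) : theta N ^ 2 * N ^ 5 = 1 := by
  have h : (N : ℝ) = Real.exp (Real.log N) := (Real.exp_log hP.N_pos).symm
  unfold theta
  nth_rewrite 2 [h]
  rw [← Real.exp_nat_mul, ← Real.exp_nat_mul, ← Real.exp_add]
  norm_num
  ring

theorem Params.theta_le (hP : Params N ε β₁ β₂) : theta N * N ^ 2 ≤ 1 := by
  have h := hP.theta_sq
  have hN := hP.N_ge
  have h0 : 0 ≤ theta N * N ^ 2 := mul_nonneg (theta_pos N).le (by positivity)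
  have h1 : (theta N * N ^ 2) ^ 2 ≤ 1 := by
    rw [← h]
    have : (theta N * N ^ 2) ^ 2 = theta N ^ 2 * N ^ 4 := by ring
    rw [this]
    refine mul_le_mul_of_nonneg_left ?_ (sq_nonneg _)
    exact pow_le_pow_right₀ (by linarith) (by norm_num)
  nlinarith

theorem Params.transition_eq (hP : Params N ε β₁ β₂) :
    transition N ε β₁ = 5 / 2 * (ε / β₁) * Real.log N := min_eq_right hP.small₁

theorem Params.even (hP : Params N ε β₁ β₂) : ((N / 2 : ℕ) : ℝ) = N / 2 := by
  obtain ⟨k, rfl⟩ := hP.dvd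
  have : 4 * k / 2 = 2 * k := by omega
  rw [this]; push_cast; ring

theorem node_coarse {i : ℕ} (hi : i ≤ N / 2) :
    node N ε β₁ i = i * (2 * (1 - transition N ε β₁) / N) := if_pos hi

theorem Params.node_fine (hP : Params N ε β₁ β₂) {i : ℕ} (hi : N / 2 ≤ i) :
    node N ε β₁ i = 1 - transition N ε β₁ + (i - (N : ℝ) / 2) * (2 * transition N ε β₁ / N) := by
  unfold node
  rcases hi.eq_or_lt with h | h
  · have := hP.N_pos
    subst h
    rw [if_pos le_rfl, hP.even]; field_simp; ring
  · rw [if_neg (by omega)]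

theorem Params.node_half (hP : Params N ε β₁ β₂) :
    node N ε β₁ (N / 2) = 1 - transition N ε β₁ := by
  rw [hP.node_fine le_rfl, hP.even]; ring

theorem Params.isGrid (hP : Params N ε β₁ β₂) : IsGrid N (node N ε β₁) := by
  have hN := hP.N_pos
  refine ⟨by simp [node], ?_, node_lt (by linarith [hP.four_le]) ((by norm_num : 2 ∣ 4).trans hP.dvd)
    hP.ε_pos hP.β₁_pos⟩
  rw [hP.node_fine (Nat.div_le_self _ _)]
  field_simp
  ring

theorem Params.transition_bounds (hP : Params N ε β₁ β₂) :
    0 < transition N ε β₁ ∧ transition N ε β₁ ≤ 1 / 2 := by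
  refine ⟨?_, min_le_left _ _⟩
  rw [hP.transition_eq]
  have := hP.one_le_log
  have := hP.ε_pos
  have := hP.β₁_pos
  positivity

theorem step_coarse {i : ℕ} (hi : i < N / 2) :
    node N ε β₁ (i + 1) - node N ε β₁ i = 2 * (1 - transition N ε β₁) / N := by
  rw [node_coarse (show i + 1 ≤ N / 2 by omega), node_coarse hi.le]
  push_cast; ring

theorem Params.step_fine (hP : Params N ε β₁ β₂) {i : ℕ} (hi : N / 2 ≤ i) :
    node N ε β₁ (i + 1) - node N ε β₁ i = 2 * transition N ε β₁ / N := by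
  rw [hP.node_fine (show N / 2 ≤ i + 1 by omega), hP.node_fine hi]
  push_cast; ring

theorem Params.log_div_pos (hP : Params N ε β₁ β₂) : 0 < Real.log N / N :=
  div_pos (by linarith [hP.one_le_log]) hP.N_pos

/-- The summand 2 in the constant of `rho` serves for the coarse mesh width; the summands `5 / β`
serve for the fine widths, see `Params.step_fine_le`. One `ρ` can thus be used on all blocks. -/
theorem Params.rho_ge (hP : Params N ε β₁ β₂) : 2 / N ≤ rho N β₁ β₂ := by
  have h1 := hP.β₁_pos
  have h2 := hP.β₂_pos
  have h3 := hP.log_div_pos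
  have h4 : 1 / (N : ℝ) ≤ Real.log N / N := div_le_div_of_nonneg_right hP.one_le_log hP.N_pos.le
  have h5 : 0 ≤ (5 / β₁ + 5 / β₂) * (Real.log N / N) := by positivity
  have h6 : 2 / (N : ℝ) = 2 * (1 / N) := by ring
  unfold rho
  rw [h6]; linarith

theorem Params.rho_pos (hP : Params N ε β₁ β₂) : 0 < rho N β₁ β₂ :=
  lt_of_lt_of_le (div_pos two_pos hP.N_pos) hP.rho_ge

theorem Params.theta_le_rho (hP : Params N ε β₁ β₂) : theta N ≤ rho N β₁ β₂ ^ 2 := by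
  have h1 := hP.theta_le
  have hN := hP.N_pos
  have h2 : theta N ≤ 1 / N ^ 2 := by rwa [le_div_iff₀ (by positivity)]
  have h3 := pow_le_pow_left₀ (by positivity) hP.rho_ge 2
  have h4 : (2 / (N : ℝ)) ^ 2 = 4 * (1 / N ^ 2) := by field_simp; norm_num
  have h5 : 0 < 1 / (N : ℝ) ^ 2 := by positivity
  linarith

theorem Params.step_fine_le (hP : Params N ε β₁ β₂) {i : ℕ} (hi : N / 2 ≤ i) :
    node N ε β₁ (i + 1) - node N ε β₁ i ≤ rho N β₁ β₂ * ε := by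
  have h1 := hP.β₁_pos
  have h2 := hP.β₂_pos
  have h3 := hP.log_div_pos
  have h4 := hP.ε_pos
  rw [hP.step_fine hi, hP.transition_eq]
  have e : 2 * (5 / 2 * (ε / β₁) * Real.log N) / N = 5 / β₁ * (Real.log N / N) * ε := by ring
  rw [e, rho]
  refine mul_le_mul_of_nonneg_right (mul_le_mul_of_nonneg_right ?_ h3.le) h4.le
  have : 0 < 5 / β₂ := by positivity
  linarith

theorem Params.step_le (hP : Params N ε β₁ β₂) (i : ℕ) :
    node N ε β₁ (i + 1) - node N ε β₁ i ≤ 2 / N := by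
  have hN := hP.N_pos
  have ht := hP.transition_bounds
  rcases lt_or_ge i (N / 2) with h | h
  · rw [step_coarse h]
    exact div_le_div_of_nonneg_right (by linarith) hN.le
  · rw [hP.step_fine h]
    exact div_le_div_of_nonneg_right (by linarith) hN.le

theorem Params.step_coarse_ge (hP : Params N ε β₁ β₂) {i : ℕ} (hi : i < N / 2) :
    1 / N ≤ node N ε β₁ (i + 1) - node N ε β₁ i := by
  rw [step_coarse hi]
  exact div_le_div_of_nonneg_right (by linarith [hP.transition_bounds.2]) hP.N_pos.le

/-- The strip has width `(5/2) (ε/β₁) ln N`. Together with `‖∇χ‖ ≤ s/√ε`, its small area is what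
removes negative powers of `ε` in the layers. -/
theorem Params.width_fine (hP : Params N ε β₁ β₂) :
    node N ε β₁ N - node N ε β₁ (N / 2) ≤ rho N β₁ β₂ * N * ε := by
  have h1 := hP.β₁_pos
  have h2 := hP.β₂_pos
  have h3 := hP.one_le_log
  have h4 := hP.ε_pos
  have hN := hP.N_pos
  rw [hP.isGrid.last, hP.node_half, hP.transition_eq, rho]
  have e : (5 / β₁ + 5 / β₂ + 2) * (Real.log N / N) * N * ε =
      (5 / β₁ + 5 / β₂ + 2) * Real.log N * ε := by field_simp
  have e2 : 1 - (1 - 5 / 2 * (ε / β₁) * Real.log N) = 5 / 2 / β₁ * Real.log N * ε := by ring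
  rw [e, e2]
  refine mul_le_mul_of_nonneg_right (mul_le_mul_of_nonneg_right ?_ (by linarith)) h4.le
  have a1 : 0 < 5 / β₂ := by positivity
  have a2 : 5 / 2 / β₁ ≤ 5 / β₁ := div_le_div_of_nonneg_right (by norm_num) h1.le
  linarith

/-! ### The layer functions -/

/-- The exponential boundary layer function of one variable. -/
def layer (ε β x : ℝ) : ℝ := Real.exp (-(β * (1 - x)) / ε)

theorem layer_pos (ε β x : ℝ) : 0 < layer ε β x := Real.exp_pos _

theorem layer_le_one (hε : 0 < ε) (hβ : 0 < β₁) {x : ℝ} (hx : x ≤ 1) : layer ε β₁ x ≤ 1 := by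
  refine Real.exp_le_one_iff.2 (div_nonpos_of_nonpos_of_nonneg ?_ hε.le)
  have : 0 ≤ β₁ * (1 - x) := mul_nonneg hβ.le (by linarith)
  linarith

/-- The factor `5/2` in the transition point is chosen for this: the exponential at distance `λ`
from the boundary equals `N^(-5/2)`. -/
theorem Params.layer_le_theta (hP : Params N ε β₁ β₂) {x : ℝ} (hx : x ≤ node N ε β₁ (N / 2)) :
    layer ε β₁ x ≤ theta N := by
  have h1 := hP.β₁_pos
  have h4 := hP.ε_pos
  rw [hP.node_half, hP.transition_eq] at hx
  refine Real.exp_le_exp.2 ?_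
  rw [neg_div, neg_le_neg_iff, le_div_iff₀ h4]
  have : 5 / 2 * (ε / β₁) * Real.log N ≤ 1 - x := by linarith
  have h5 := mul_le_mul_of_nonneg_left this h1.le
  have e : β₁ * (5 / 2 * (ε / β₁) * Real.log N) = 5 / 2 * Real.log N * ε := by field_simp
  linarith

theorem layer_mul (ε β₁ β₂ x y : ℝ) :
    Real.exp (-(β₁ * (1 - x) + β₂ * (1 - y)) / ε) = layer ε β₁ x * layer ε β₂ y := by
  unfold layer
  rw [← Real.exp_add]; ring_nf

/-- The bound varies with the point, so `JetBound.swap` is applied on one-point sets. -/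
theorem DerivBound.swap {g : ℕ → ℕ → ℝ × ℝ → ℝ} {w : ℝ × ℝ → ℝ} (h : DerivBound g w) :
    DerivBound (fun i j p => g j i p.swap) (w ∘ Prod.swap) := by
  refine ⟨contDiffOn_swap h.smooth, fun i j hij p hp => ?_⟩
  have hj : JetBound (fun i j => g i j p.swap) {p.swap} w :=
    ⟨h.smooth, fun i j hij q hq => by
      rw [mem_singleton_iff] at hq; subst hq; exact h.bound i j hij _ (swap_mem_closedSquare.2 hp)⟩
  exact (hj.swap (singleton_subset_iff.2 (swap_mem_closedSquare.2 hp))).bound i j hij p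
    (by simp)

theorem HasDecomposition.swap {C₁ : ℝ} {u : ℝ × ℝ → ℝ} (h : HasDecomposition C₁ ε β₁ β₂ u) :
    HasDecomposition C₁ ε β₂ β₁ (u ∘ Prod.swap) := by
  obtain ⟨S, E₁, E₂, E₁₂, he, hS, h1, h2, h12⟩ := h
  refine ⟨S ∘ Prod.swap, E₂ ∘ Prod.swap, E₁ ∘ Prod.swap, E₁₂ ∘ Prod.swap, fun p hp => ?_,
    hS.swap, h2.swap, h1.swap, ?_⟩
  · have := he p.swap (swap_mem_closedSquare.2 hp)
    simp only [Function.comp_apply]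
    linarith
  · convert h12.swap using 4 with i j p
    rw [add_comm i j]
    simp only [Prod.fst_swap, Prod.snd_swap]
    rw [add_comm (β₂ * _)]

/-- A splitting `u = A + T` over the rectangle `R`, where `A` varies on the scale `τ₁` in `x` and
`τ₂` in `y`, and `T` is a small layer term. -/
structure Splitting (C θ ε τ₁ τ₂ : ℝ) (R : Set (ℝ × ℝ)) (u A T : ℝ × ℝ → ℝ) : Prop where
  eq : EqOn u (A + T) closedSquare
  jetA : JetBound (fun i j => C * (τ₁ ^ i)⁻¹ * (τ₂ ^ j)⁻¹) closedSquare A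
  jetT : JetBound (fun i j => C * θ * (ε ^ (i + j))⁻¹) R T

theorem JetBound.of_derivBound {g : ℕ → ℕ → ℝ × ℝ → ℝ} {w : ℝ × ℝ → ℝ} (h : DerivBound g w)
    {m : ℕ → ℕ → ℝ} {R : Set (ℝ × ℝ)} (hR : R ⊆ closedSquare)
    (hm : ∀ i j, i + j ≤ 3 → ∀ p ∈ R, g i j p ≤ m i j) : JetBound m R w :=
  ⟨h.smooth, fun i j hij p hp => (h.bound i j hij p (hR hp)).trans (hm i j hij p hp)⟩

theorem HasDecomposition.nonneg {C₁ : ℝ} {u : ℝ × ℝ → ℝ} (h : HasDecomposition C₁ ε β₁ β₂ u) :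
    0 ≤ C₁ := by
  obtain ⟨S, E₁, E₂, E₁₂, he, hS, h1, h2, h12⟩ := h
  exact (abs_nonneg _).trans (hS.bound 0 0 (by norm_num) (0, 0) ⟨by simp, by simp⟩)

theorem jetBound_zero (m : ℕ → ℕ → ℝ) (hm : ∀ i j, 0 ≤ m i j) (R : Set (ℝ × ℝ)) : JetBound m R 0 := by
  refine ⟨contDiffOn_const, fun i j _ p hp => ?_⟩
  have hY : ∀ j, dY^[j] (0 : ℝ × ℝ → ℝ) = 0 := by
    intro j
    induction j with
    | zero => rfl
    | succ j ih =>
      rw [Function.iterate_succ_apply', ih]; ext p; simp [dY]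
  have hX : ∀ i, dX^[i] (0 : ℝ × ℝ → ℝ) = 0 := by
    intro i
    induction i with
    | zero => rfl
    | succ j ih =>
      rw [Function.iterate_succ_apply', ih]; ext p; simp [dX]
  unfold partialD
  rw [hY, hX]; simpa using hm i j

theorem Params.inv_pow_le (hP : Params N ε β₁ β₂) {i l : ℕ} (h : i ≤ l) :
    (ε ^ i)⁻¹ ≤ (ε ^ l)⁻¹ :=
  inv_anti₀ (pow_pos hP.ε_pos _) (pow_le_pow_of_le_one hP.ε_pos.le hP.ε_le_one h)

theorem Params.one_le_inv_pow (hP : Params N ε β₁ β₂) (l : ℕ) : 1 ≤ (ε ^ l)⁻¹ := by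
  simpa using hP.inv_pow_le (Nat.zero_le l)

variable {C₁ : ℝ} {u : ℝ × ℝ → ℝ}

/-- Where the mesh is fine in both directions it resolves every part of `u`, and nothing has to be
split off. -/
theorem HasDecomposition.splitting_fine_fine (h : HasDecomposition C₁ ε β₁ β₂ u)
    (hP : Params N ε β₁ β₂) (R : Set (ℝ × ℝ)) :
    ∃ A T, Splitting (4 * C₁) (theta N) ε ε ε R u A T := by
  have hC := h.nonneg
  obtain ⟨S, E₁, E₂, E₁₂, he, hS, h1, h2, h12⟩ := h
  have hε := hP.ε_pos
  refine ⟨S + E₁ + E₂ + E₁₂, 0, fun p hp => by simp [he p hp], ?_,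
    jetBound_zero _ (fun i j => by have := theta_pos N; positivity) _⟩
  have k : ∀ g w, DerivBound g w → (∀ i j, i + j ≤ 3 → ∀ p ∈ closedSquare,
      g i j p ≤ C₁ * (ε ^ (i + j))⁻¹) → JetBound (fun i j => C₁ * (ε ^ (i + j))⁻¹) closedSquare w :=
    fun g w hg hb => JetBound.of_derivBound hg le_rfl hb
  have l1 : ∀ p ∈ closedSquare, layer ε β₁ p.1 ≤ 1 := fun p hp =>
    layer_le_one hε hP.β₁_pos hp.1.2
  have l2 : ∀ p ∈ closedSquare, layer ε β₂ p.2 ≤ 1 := fun p hp =>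
    layer_le_one hε hP.β₂_pos hp.2.2
  have j1 := k _ _ hS fun i j _ p _ => le_mul_of_one_le_right hC (hP.one_le_inv_pow _)
  have j2 := k _ _ h1 fun i j _ p hp => by
    have a := mul_le_mul_of_nonneg_left (hP.inv_pow_le (Nat.le_add_right i j)) hC
    exact (mul_le_of_le_one_right (by positivity) (l1 p hp)).trans a
  have j3 := k _ _ h2 fun i j _ p hp => by
    have a := mul_le_mul_of_nonneg_left (hP.inv_pow_le (Nat.le_add_left j i)) hC
    exact (mul_le_of_le_one_right (by positivity) (l2 p hp)).trans a
  have j4 := k _ _ h12 fun i j _ p hp => by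
    rw [layer_mul]
    exact mul_le_of_le_one_right (by positivity)
      (mul_le_one₀ (l1 p hp) (layer_pos _ _ _).le (l2 p hp))
  refine (((j1.add j2 le_rfl).add j3 le_rfl).add j4 le_rfl).mono le_rfl fun i j _ => ?_
  simp only [Pi.add_apply]
  rw [pow_add, mul_inv]
  linarith

/-- `S` and `E₁` are smooth on the unit scale in `y`, hence resolved; `E₂` and `E₁₂` decay in `y`
and have dropped to size `θ` below the transition line. -/
theorem HasDecomposition.splitting_fine_coarse (h : HasDecomposition C₁ ε β₁ β₂ u)
    (hP : Params N ε β₁ β₂) {R : Set (ℝ × ℝ)} (hR : R ⊆ closedSquare)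
    (hR2 : ∀ p ∈ R, p.2 ≤ node N ε β₂ (N / 2)) :
    ∃ A T, Splitting (4 * C₁) (theta N) ε ε 1 R u A T := by
  have hC := h.nonneg
  obtain ⟨S, E₁, E₂, E₁₂, he, hS, h1, h2, h12⟩ := h
  have hε := hP.ε_pos
  have hθ := theta_pos N
  refine ⟨S + E₁, E₂ + E₁₂, fun p hp => by simp only [Pi.add_apply, he p hp]; ring, ?_, ?_⟩
  · have j1 := JetBound.of_derivBound (m := fun i _ => C₁ * (ε ^ i)⁻¹) hS le_rfl
      fun i j _ p _ => le_mul_of_one_le_right hC (hP.one_le_inv_pow _)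
    have j2 := JetBound.of_derivBound (m := fun i _ => C₁ * (ε ^ i)⁻¹) h1 le_rfl
      fun i j _ p hp => mul_le_of_le_one_right (by positivity)
        (layer_le_one hε hP.β₁_pos hp.1.2)
    refine (j1.add j2 le_rfl).mono le_rfl fun i j _ => ?_
    have : 0 ≤ C₁ * (ε ^ i)⁻¹ := by positivity
    simp only [Pi.add_apply, one_pow, inv_one, mul_one]
    linarith
  · have j1 := JetBound.of_derivBound (m := fun i j => C₁ * theta N * (ε ^ (i + j))⁻¹) h2 hR
      fun i j _ p hp => by
        have a := mul_le_mul_of_nonneg_left (hP.inv_pow_le (Nat.le_add_left j i)) hC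
        have b := hP.swap.layer_le_theta (hR2 p hp)
        calc C₁ * (ε ^ j)⁻¹ * layer ε β₂ p.2 ≤ C₁ * (ε ^ (i + j))⁻¹ * theta N :=
              mul_le_mul a b (layer_pos _ _ _).le (by positivity)
          _ = _ := by ring
    have j2 := JetBound.of_derivBound (m := fun i j => C₁ * theta N * (ε ^ (i + j))⁻¹) h12 hR
      fun i j _ p hp => by
        have b := hP.swap.layer_le_theta (hR2 p hp)
        have b1 := layer_le_one hε hP.β₁_pos (hR hp).1.2
        rw [layer_mul]
        calc C₁ * (ε ^ (i + j))⁻¹ * (layer ε β₁ p.1 * layer ε β₂ p.2)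
            ≤ C₁ * (ε ^ (i + j))⁻¹ * (1 * theta N) :=
              mul_le_mul_of_nonneg_left (mul_le_mul b1 b (layer_pos _ _ _).le zero_le_one)
                (by positivity)
          _ = _ := by ring
    refine (j1.add j2 hR).mono le_rfl fun i j _ => ?_
    have : 0 ≤ C₁ * theta N * (ε ^ (i + j))⁻¹ := by positivity
    simp only [Pi.add_apply]
    linarith

theorem Splitting.swap {C θ τ₁ τ₂ : ℝ} {R : Set (ℝ × ℝ)} {A T : ℝ × ℝ → ℝ}
    (h : Splitting C θ ε τ₁ τ₂ R u A T) (hR : R ⊆ closedSquare) :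
    Splitting C θ ε τ₂ τ₁ (Prod.swap ⁻¹' R) (u ∘ Prod.swap) (A ∘ Prod.swap) (T ∘ Prod.swap) := by
  refine ⟨fun p hp => h.eq (swap_mem_closedSquare.2 hp), ?_, ?_⟩
  · have e : Prod.swap ⁻¹' closedSquare = closedSquare := by
      ext p; exact swap_mem_closedSquare
    have := h.jetA.swap le_rfl
    rw [e] at this
    exact this.mono le_rfl fun i j _ => le_of_eq (by ring)
  · exact (h.jetT.swap hR).mono le_rfl fun i j _ => by rw [add_comm i j]

/-- On the coarse part of the mesh all layer terms are small. -/
theorem HasDecomposition.splitting_coarse_coarse (h : HasDecomposition C₁ ε β₁ β₂ u)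
    (hP : Params N ε β₁ β₂) {R : Set (ℝ × ℝ)} (hR : R ⊆ closedSquare)
    (hR1 : ∀ p ∈ R, p.1 ≤ node N ε β₁ (N / 2)) (hR2 : ∀ p ∈ R, p.2 ≤ node N ε β₂ (N / 2)) :
    ∃ A T, Splitting (4 * C₁) (theta N) ε 1 1 R u A T ∧
      ∀ i j, i + j ≤ 3 → ∀ p ∈ closedSquare,
        |partialD i j T p| ≤ 2 * C₁ * (ε ^ (i + j))⁻¹ * (layer ε β₁ p.1 + layer ε β₂ p.2) := by
  have hC := h.nonneg
  obtain ⟨S, E₁, E₂, E₁₂, he, hS, h1, h2, h12⟩ := h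
  have hε := hP.ε_pos
  have hθ := theta_pos N
  -- The pointwise decay is kept besides the uniform bound: a gradient of uniform size `θ/ε` is too
  -- large, whereas the exponentials gain a factor `ε` on integration.
  have hT : ∀ i j, i + j ≤ 3 → ∀ p ∈ closedSquare, |partialD i j (E₁ + E₂ + E₁₂) p| ≤
      2 * C₁ * (ε ^ (i + j))⁻¹ * (layer ε β₁ p.1 + layer ε β₂ p.2) := by
    intro i j hij p hp
    have hs : {p} ⊆ closedSquare := singleton_subset_iff.2 hp
    have k : ∀ g w, DerivBound g w → JetBound (fun i j => g i j p) {p} w := fun g w hg =>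
      JetBound.of_derivBound hg hs fun i j _ q hq => by rw [mem_singleton_iff.1 hq]
    have := ((((k _ _ h1).add (k _ _ h2) hs).add (k _ _ h12) hs).bound i j hij p rfl)
    refine this.trans ?_
    simp only [Pi.add_apply]
    rw [layer_mul]
    have l1 := layer_le_one hε hP.β₁_pos hp.1.2
    have l2 := layer_le_one hε hP.β₂_pos hp.2.2
    have p1 := layer_pos ε β₁ p.1
    have p2 := layer_pos ε β₂ p.2
    have a1 := mul_le_mul_of_nonneg_right
      (mul_le_mul_of_nonneg_left (hP.inv_pow_le (Nat.le_add_right i j)) hC) p1.le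
    have a2 := mul_le_mul_of_nonneg_right
      (mul_le_mul_of_nonneg_left (hP.inv_pow_le (Nat.le_add_left j i)) hC) p2.le
    have hpos : 0 ≤ C₁ * (ε ^ (i + j))⁻¹ := by positivity
    have a3 := mul_le_mul_of_nonneg_left (mul_le_of_le_one_right p1.le l2) hpos
    have a4 := mul_nonneg hpos p2.le
    unfold layer at *
    linarith
  refine ⟨S, E₁ + E₂ + E₁₂, ⟨fun p hp => by simp only [Pi.add_apply, he p hp]; ring, ?_,
    ⟨(h1.smooth.add h2.smooth).add h12.smooth, fun i j hij p hp => ?_⟩⟩, hT⟩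
  · exact JetBound.of_derivBound hS le_rfl fun i j _ p _ => by
      simp only [one_pow, inv_one, mul_one]; linarith
  · refine (hT i j hij p (hR hp)).trans ?_
    have a1 := hP.layer_le_theta (hR1 p hp)
    have a2 := hP.swap.layer_le_theta (hR2 p hp)
    have hpos : 0 ≤ C₁ * (ε ^ (i + j))⁻¹ := by positivity
    have a3 := mul_le_mul_of_nonneg_left (add_le_add a1 a2) hpos
    linarith

end


/-! ### Interpolation errors on blocks of cells -/

theorem ae_block {n : ℕ} {X Y : ℕ → ℝ} (hX : IsGrid n X) (hY : IsGrid n Y) {i₀ i₁ j₀ j₁ : ℕ}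
    (hi0 : i₀ ≤ n) (hi : i₁ ≤ n) (hj0 : j₀ ≤ n) (hj : j₁ ≤ n) :
    ∀ᵐ p ∂(volume.restrict (block X Y i₀ i₁ j₀ j₁)), ∃ i j a b h k, i₀ ≤ i ∧ i < i₁ ∧ j₀ ≤ j ∧
      j < j₁ ∧ IsTri X Y i j a b h k ∧ p ∈ otri a b h k := by
  filter_upwards [ae_of_Omega (ae_mem_goodSet hX hY) (block_subset hX hY hi0 hi hj0 hj),
    ae_restrict_mem (measurableSet_block X Y i₀ i₁ j₀ j₁)] with p hp hb
  obtain ⟨i, hin, j, hjn, a, b, h, k, ht, hp⟩ := hp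
  have hc := ht.otri_subset hX hY hin hjn hp
  refine ⟨i, j, a, b, h, k, ?_, ?_, ?_, ?_, ht, hp⟩ <;> by_contra hlt <;> push Not at hlt
  · have := hX.mono (show i + 1 ≤ i₀ from hlt) hi0
    linarith [hc.1.2, hb.1.1]
  · have := hX.mono hlt hin.le
    linarith [hc.1.1, hb.1.2]
  · have := hY.mono (show j + 1 ≤ j₀ from hlt) hj0
    linarith [hc.2.2, hb.2.1]
  · have := hY.mono hlt hjn.le
    linarith [hc.2.1, hb.2.2]

/-- The closure of a block. -/
def blockR (X Y : ℕ → ℝ) (i₀ i₁ j₀ j₁ : ℕ) : Set (ℝ × ℝ) :=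
  Icc (X i₀) (X i₁) ×ˢ Icc (Y j₀) (Y j₁)

/-- A block of cells whose sizes are at most `ρ τ₁` and `ρ τ₂`. -/
structure Region (n : ℕ) (X Y : ℕ → ℝ) (i₀ i₁ j₀ j₁ : ℕ) (ρ τ₁ τ₂ : ℝ) : Prop where
  gridX : IsGrid n X
  gridY : IsGrid n Y
  hi : i₀ < i₁
  hin : i₁ ≤ n
  hj : j₀ < j₁
  hjn : j₁ ≤ n
  τ₁_pos : 0 < τ₁
  τ₂_pos : 0 < τ₂
  ρ_pos : 0 < ρ
  stepX : ∀ i, i₀ ≤ i → i < i₁ → X (i + 1) - X i ≤ ρ * τ₁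
  stepY : ∀ j, j₀ ≤ j → j < j₁ → Y (j + 1) - Y j ≤ ρ * τ₂

section

variable {n : ℕ} {X Y : ℕ → ℝ} {i₀ i₁ j₀ j₁ : ℕ} {ρ τ₁ τ₂ C θ ε : ℝ} {u A T : ℝ × ℝ → ℝ}

theorem Region.swap (h : Region n X Y i₀ i₁ j₀ j₁ ρ τ₁ τ₂) :
    Region n Y X j₀ j₁ i₀ i₁ ρ τ₂ τ₁ :=
  ⟨h.gridY, h.gridX, h.hj, h.hjn, h.hi, h.hin, h.τ₂_pos, h.τ₁_pos, h.ρ_pos, h.stepY, h.stepX⟩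

theorem Region.ae (h : Region n X Y i₀ i₁ j₀ j₁ ρ τ₁ τ₂) :
    ∀ᵐ p ∂(volume.restrict (block X Y i₀ i₁ j₀ j₁)), ∃ i j a b h k, i₀ ≤ i ∧ i < i₁ ∧ j₀ ≤ j ∧
      j < j₁ ∧ IsTri X Y i j a b h k ∧ p ∈ otri a b h k :=
  ae_block h.gridX h.gridY (h.hi.le.trans h.hin) h.hin (h.hj.le.trans h.hjn) h.hjn

theorem Region.subset (h : Region n X Y i₀ i₁ j₀ j₁ ρ τ₁ τ₂) :
    block X Y i₀ i₁ j₀ j₁ ⊆ hSquare :=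
  block_subset h.gridX h.gridY (h.hi.le.trans h.hin) h.hin (h.hj.le.trans h.hjn) h.hjn

theorem Region.blockR_subset (h : Region n X Y i₀ i₁ j₀ j₁ ρ τ₁ τ₂) :
    blockR X Y i₀ i₁ j₀ j₁ ⊆ closedSquare :=
  prod_mono (Icc_subset_Icc (h.gridX.mem_Icc (h.hi.le.trans h.hin)).1 (h.gridX.mem_Icc h.hin).2)
    (Icc_subset_Icc (h.gridY.mem_Icc (h.hj.le.trans h.hjn)).1 (h.gridY.mem_Icc h.hjn).2)

theorem Region.cellR_subset (h : Region n X Y i₀ i₁ j₀ j₁ ρ τ₁ τ₂) {i j : ℕ} (hi0 : i₀ ≤ i)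
    (hi : i < i₁) (hj0 : j₀ ≤ j) (hj : j < j₁) : cellR X Y i j ⊆ blockR X Y i₀ i₁ j₀ j₁ :=
  prod_mono (Icc_subset_Icc (h.gridX.mono hi0 (hi.le.trans h.hin)) (h.gridX.mono hi h.hin))
    (Icc_subset_Icc (h.gridY.mono hj0 (hj.le.trans h.hjn)) (h.gridY.mono hj h.hjn))

/-- The jet of a function that varies on the scales `τ₁` and `τ₂`. -/
def scaleJet (C τ₁ τ₂ : ℝ) (i j : ℕ) : ℝ := C * (τ₁ ^ i)⁻¹ * (τ₂ ^ j)⁻¹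

/-- Scale invariance: each derivative costs `1/τ` and each step is `ρ τ`, so the scales cancel. -/
theorem rem₂_scaleJet (h1 : τ₁ ≠ 0) (h2 : τ₂ ≠ 0) :
    rem₂ (scaleJet C τ₁ τ₂) (ρ * τ₁) (ρ * τ₂) = 3 * C * ρ ^ 2 := by
  unfold rem₂ scaleJet
  field_simp
  ring

theorem rem₃_scaleJet (h1 : τ₁ ≠ 0) (h2 : τ₂ ≠ 0) (r : ℝ) :
    rem₃ (scaleJet C τ₁ τ₂) (ρ * τ₁) (r * (ρ * τ₂)) = (1 + r + r ^ 2) * C * ρ ^ 2 / τ₁ := by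
  unfold rem₃ scaleJet
  field_simp

/-- Pointwise interpolation errors in a mesh triangle of a region. -/
structure InterpError (n : ℕ) (X Y : ℕ → ℝ) (C θ ε ρ τ₁ τ₂ : ℝ) (u A T : ℝ × ℝ → ℝ)
    (p : ℝ × ℝ) : Prop where
  val : |u p - interp n X Y u p| ≤ 6 * C * ρ ^ 2 + 2 * (C * θ)
  splitX : errX n X Y u p = errX n X Y A p + errX n X Y T p
  splitY : errY n X Y u p = errY n X Y A p + errY n X Y T p
  smoothX : |errX n X Y A p| ≤ 2 * C * ρ / τ₁
  smoothY : |errY n X Y A p| ≤ 2 * C * ρ / τ₂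
  layerX : |errX n X Y T p| ≤ 2 * C * θ / ε
  layerY : |errY n X Y T p| ≤ 2 * C * θ / ε

/-- `A` is treated by Taylor expansion, `T` only by size: `T` and its interpolant, and likewise
their derivatives, are bounded separately by the same jet, which produces the factor 2. -/
theorem Region.interpError (hr : Region n X Y i₀ i₁ j₀ j₁ ρ τ₁ τ₂)
    (hs : Splitting C θ ε τ₁ τ₂ (blockR X Y i₀ i₁ j₀ j₁) u A T) {i j : ℕ} {a b h k : ℝ}
    (hi0 : i₀ ≤ i) (hi : i < i₁) (hj0 : j₀ ≤ j) (hj : j < j₁) (ht : IsTri X Y i j a b h k)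
    {p : ℝ × ℝ} (hp : p ∈ otri a b h k) : InterpError n X Y C θ ε ρ τ₁ τ₂ u A T p := by
  have hX := hr.gridX
  have hY := hr.gridY
  have hin : i < n := hi.trans_le hr.hin
  have hjn : j < n := hj.trans_le hr.hjn
  have h1 := hr.τ₁_pos
  have h2 := hr.τ₂_pos
  have hl := ht.legsIn hX hY hin hjn
  have hR := isRect_cellR hX hY hin hjn (hr.stepX i hi0 hi) (hr.stepY j hj0 hj)
  have hpR := hl.sub hp
  have hpc := hR.sub hpR
  have hA : JetBound (scaleJet C τ₁ τ₂) (cellR X Y i j) A := hs.jetA.mono hR.sub fun _ _ _ => le_rfl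
  have hT := hs.jetT.mono (hr.cellR_subset hi0 hi hj0 hj) fun _ _ _ => le_rfl
  have eq := fun g => interp_on_otri (g := g) hX hY ht hin hjn hp
  have dA := hs.jetA.smooth.differentiableOn (by norm_num)
  have dT := hs.jetT.smooth.differentiableOn (by norm_num)
  have vals := fun q (hq : q ∈ cellR X Y i j) => hs.eq (hR.sub hq)
  have sX : slopeX u a b h = slopeX A a b h + slopeX T a b h := by
    unfold slopeX; rw [vals _ hl.corner, vals _ hl.right]; simp only [Pi.add_apply]; ring
  have sY : slopeY u a b k = slopeY A a b k + slopeY T a b k := by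
    unfold slopeY; rw [vals _ hl.corner, vals _ hl.top]; simp only [Pi.add_apply]; ring
  have eA := hA.linInterp_error hR hl hp
  rw [rem₂_scaleJet h1.ne' h2.ne'] at eA
  have bT : ∀ q ∈ cellR X Y i j, |T q| ≤ C * θ := fun q hq => by
    simpa using hT.b00 hq
  have eT := abs_linInterp_le hl bT hp
  have lin : linInterp u a b h k p = linInterp A a b h k p + linInterp T a b h k p := by
    unfold linInterp; rw [sX, sY, vals _ hl.corner]; simp only [Pi.add_apply]; ring
  refine ⟨?_, ?_, ?_, ?_, ?_, ?_, ?_⟩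
  · rw [(eq u).1, lin, hs.eq hpc, Pi.add_apply]
    have := bT p hpR
    have e : A p + T p - (linInterp A a b h k p + linInterp T a b h k p) =
      (A p - linInterp A a b h k p) + (T p - linInterp T a b h k p) := by ring
    rw [e]
    refine (abs_add_le _ _).trans ((add_le_add eA ((abs_sub _ _).trans
      (add_le_add this eT))).trans (le_of_eq (by ring)))
  · unfold errX
    rw [(eq u).2.1, (eq A).2.1, (eq T).2.1, sX, dX_congr hs.eq hpc, dX_add dA dT hpc, Pi.add_apply]
    ring
  · unfold errY
    rw [(eq u).2.2, (eq A).2.2, (eq T).2.2, sY, dY_congr hs.eq hpc, dY_add dA dT hpc, Pi.add_apply]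
    ring
  · unfold errX
    rw [(eq A).2.1]
    refine (hA.slopeX_error hR hl hpR).trans (le_of_eq ?_)
    unfold scaleJet; field_simp; ring
  · unfold errY
    rw [(eq A).2.2]
    refine (hA.slopeY_error hR hl hpR).trans (le_of_eq ?_)
    unfold scaleJet; field_simp; ring
  · unfold errX
    rw [(eq T).2.1]
    have a1 := hT.b10 hpR
    have a2 := hT.abs_slopeX_le hR hl
    refine ((abs_sub _ _).trans (add_le_add a1 a2)).trans (le_of_eq ?_)
    simp only [add_zero, pow_one]; ring
  · unfold errY
    rw [(eq T).2.2]
    have a1 := hT.b01 hpR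
    have a2 := hT.abs_slopeY_le hR hl
    refine ((abs_sub _ _).trans (add_le_add a1 a2)).trans (le_of_eq ?_)
    simp only [zero_add, pow_one]; ring

theorem Region.ae_interpError (hr : Region n X Y i₀ i₁ j₀ j₁ ρ τ₁ τ₂)
    (hs : Splitting C θ ε τ₁ τ₂ (blockR X Y i₀ i₁ j₀ j₁) u A T) :
    ∀ᵐ p ∂(volume.restrict (block X Y i₀ i₁ j₀ j₁)), InterpError n X Y C θ ε ρ τ₁ τ₂ u A T p := by
  filter_upwards [hr.ae] with p hp
  obtain ⟨i, j, a, b, h, k, hi0, hi, hj0, hj, ht, hp⟩ := hp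
  exact hr.interpError hs hi0 hi hj0 hj ht hp

/-- Cauchy-Schwarz with the final bound prescribed through its square, which avoids square roots of
products in the applications. -/
theorem integral_abs_mul_le {F G : ℝ × ℝ → ℝ} (hF : BM F) (hG : BM G) {S : Set (ℝ × ℝ)}
    (hS : S ⊆ hSquare) {s V g r : ℝ} (hs : ∀ᵐ p ∂(volume.restrict S), |F p| ≤ s)
    (hV : volume.real S ≤ V) (hg : ∫ p in Omega, G p ^ 2 ≤ g) (hr : 0 ≤ r)
    (h : s ^ 2 * V * g ≤ r ^ 2) : ∫ p in S, |F p| * |G p| ≤ r := by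
  refine (abs_le_of_sq_le_sq' ?_ hr).2
  have h1 := integral_abs_mul_sq_le hF hG hS hs
  have hV0 : 0 ≤ volume.real S := measureReal_nonneg
  refine h1.trans (le_trans ?_ h)
  refine mul_le_mul (mul_le_mul_of_nonneg_left hV (sq_nonneg _)) hg
    (integral_nonneg fun p => sq_nonneg _) (mul_nonneg (sq_nonneg _) (hV0.trans hV))

/-- The superconvergence estimate on a region. -/
theorem Region.superconvergence (hr : Region n X Y i₀ i₁ j₀ j₁ ρ τ₁ τ₂)
    (hA : JetBound (scaleJet C τ₁ τ₂) closedSquare A) (hC : 0 ≤ C) {χ : ℝ × ℝ → ℝ}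
    (hχ : IsPL n X Y χ) {k W V g r₁ r₂ : ℝ} (hk : ∀ j, j₀ ≤ j → j < j₁ → Y (j + 1) - Y j = k)
    (hW : X i₁ - X i₀ ≤ W) (hV : k * W ≤ V) (hg : ∫ p in Omega, dX χ p ^ 2 ≤ g) (hr1 : 0 ≤ r₁)
    (h1 : V * g ≤ r₁ ^ 2) (hr2 : 0 ≤ r₂) (h2 : W * g ≤ r₂ ^ 2) :
    |∫ p in block X Y i₀ i₁ j₀ j₁, errX n X Y A p * dX χ p| ≤
      4 * C * ρ / τ₁ * r₁ + 28 * C * ρ ^ 2 / τ₁ * r₂ := by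
  have hX := hr.gridX
  have hY := hr.gridY
  have t1 := hr.τ₁_pos
  have t2 := hr.τ₂_pos
  have hρ := hr.ρ_pos
  have hmX := hX.mono hr.hi.le hr.hin
  obtain ⟨l, rfl⟩ : ∃ l, j₁ = l + 1 := ⟨j₁ - 1, by have := hr.hj; omega⟩
  have hj : j₀ ≤ l := Nat.lt_succ_iff.1 hr.hj
  have hjn := hr.hjn
  have key := block_superconvergence hX hY hχ hr.hi.le hr.hin hj hr.hjn
    (fun j h h' => hk j h (by omega)) hr.stepX (hA.mono hr.blockR_subset fun _ _ _ => le_rfl)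
  have hk' : k ≤ ρ * τ₂ := by
    rw [← hk j₀ le_rfl (by omega)]; exact hr.stepY j₀ le_rfl (by omega)
  have hk0 : 0 < k := by
    rw [← hk j₀ le_rfl (by omega)]; have := hY.lt j₀ (by omega); linarith
  have hdX := hχ.bm_dX hX hY
  have sub : ∀ j, j₀ ≤ j → j ≤ l → block X Y i₀ i₁ j (j + 1) ⊆ hSquare := fun j h h' =>
    block_subset hX hY (hr.hi.le.trans hr.hin) hr.hin (by omega) (by omega)
  -- A single row has area at most `k * W ≤ V`, which is much less than the area of the block. This
  -- compensates the missing cancellation in the two extreme rows.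
  have row : ∀ j, j₀ ≤ j → j ≤ l → ∫ p in block X Y i₀ i₁ j (j + 1), |dX χ p| ≤ r₁ := by
    intro j h h'
    have := integral_abs_mul_le (F := fun _ => 1) (s := 1) (V := V) (BM.const 1) hdX (sub j h h')
      (by simp) ?_ hg hr1 (by linarith)
    · simpa using this
    · have hm := hY.mono (Nat.le_succ j) (show j + 1 ≤ n by omega)
      unfold block
      rw [volume_real_rect hmX hm, hk j h (by omega), mul_comm]
      exact (mul_le_mul_of_nonneg_left hW hk0.le).trans hV
  have full : ∫ p in block X Y i₀ i₁ j₀ (l + 1), |dX χ p| ≤ r₂ := by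
    have := integral_abs_mul_le (F := fun _ => 1) (s := 1) (V := W) (BM.const 1) hdX hr.subset
      (by simp) ?_ hg hr2 (by linarith)
    · simpa using this
    · have hm := hY.mono (show j₀ ≤ l + 1 by omega) hjn
      unfold block
      rw [volume_real_rect hmX hm]
      have b1 := (hY.mem_Icc (show j₀ ≤ n by omega)).1
      have b2 := (hY.mem_Icc hjn).2
      nlinarith
  refine key.trans (add_le_add ?_ ?_)
  · have e : ρ * τ₁ * scaleJet C τ₁ τ₂ 2 0 + ρ * τ₂ * scaleJet C τ₁ τ₂ 1 1 = 2 * C * ρ / τ₁ := by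
      unfold scaleJet; field_simp; ring
    have e0 : 0 ≤ scaleJet C τ₁ τ₂ 1 1 := by unfold scaleJet; positivity
    have e1 : ρ * τ₁ * scaleJet C τ₁ τ₂ 2 0 + k * scaleJet C τ₁ τ₂ 1 1 ≤ 2 * C * ρ / τ₁ := by
      rw [← e]; gcongr
    have a1 := row j₀ le_rfl hj
    have a2 := row l hj le_rfl
    have a3 : 0 ≤ (∫ p in block X Y i₀ i₁ j₀ (j₀ + 1), |dX χ p|) +
      ∫ p in block X Y i₀ i₁ l (l + 1), |dX χ p| := add_nonneg
        (integral_nonneg fun _ => abs_nonneg _) (integral_nonneg fun _ => abs_nonneg _)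
    calc _ ≤ 2 * C * ρ / τ₁ * (r₁ + r₁) := mul_le_mul e1 (add_le_add a1 a2) a3 (by positivity)
      _ = _ := by ring
  -- `7 = 1 + 2 + 2²`, since a pair of triangles is twice as high as a row.
  · have e : rem₃ (scaleJet C τ₁ τ₂) (ρ * τ₁) (2 * k) ≤ 7 * C * ρ ^ 2 / τ₁ := by
      have := rem₃_scaleJet (C := C) (ρ := ρ) t1.ne' t2.ne' 2
      have e2 : (1 + 2 + (2 : ℝ) ^ 2) = 7 := by norm_num
      rw [e2] at this
      rw [← this]
      unfold rem₃
      have e0 : 0 ≤ scaleJet C τ₁ τ₂ 2 1 := by unfold scaleJet; positivity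
      have e0 : 0 ≤ scaleJet C τ₁ τ₂ 1 2 := by unfold scaleJet; positivity
      gcongr
    calc _ ≤ 4 * (7 * C * ρ ^ 2 / τ₁) * r₂ :=
          mul_le_mul (mul_le_mul_of_nonneg_left e (by norm_num)) full
            (integral_nonneg fun _ => abs_nonneg _) (by positivity)
      _ = _ := by ring

end


/-! ### Powers of the mesh width -/

/-- The convergence rate `(N⁻¹ ln N)^{3/2}`. -/
def eta (N : ℕ) : ℝ := √((Real.log N / N) ^ 3)

/-- The constant in `rho`. -/
def sigma (β₁ β₂ : ℝ) : ℝ := 5 / β₁ + 5 / β₂ + 2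

section

variable {N : ℕ} {ε β₁ β₂ : ℝ}

theorem rho_eq : rho N β₁ β₂ = sigma β₁ β₂ * (Real.log N / N) := rfl

theorem sigma_comm : sigma β₂ β₁ = sigma β₁ β₂ := by unfold sigma; ring

theorem rho_comm : rho N β₂ β₁ = rho N β₁ β₂ := by rw [rho_eq, rho_eq, sigma_comm]

theorem eta_nonneg : 0 ≤ eta N := Real.sqrt_nonneg _

theorem Params.two_le_sigma (hP : Params N ε β₁ β₂) : 2 ≤ sigma β₁ β₂ := by
  have h1 := hP.β₁_pos
  have h2 := hP.β₂_pos
  have h3 : 0 < 5 / β₁ := by positivity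
  have h4 : 0 < 5 / β₂ := by positivity
  unfold sigma; linarith

theorem Params.eta_sq (hP : Params N ε β₁ β₂) : eta N ^ 2 = (Real.log N / N) ^ 3 :=
  Real.sq_sqrt (pow_nonneg hP.log_div_pos.le 3)

theorem le_mul_eta {a x : ℝ} (ha : 0 ≤ a) (h : x ^ 2 ≤ a ^ 2 * eta N ^ 2) : x ≤ a * eta N :=
  (abs_le_of_sq_le_sq' (by rwa [mul_pow]) (mul_nonneg ha eta_nonneg)).2

theorem Params.inv_cube_le (hP : Params N ε β₁ β₂) : 1 / (N : ℝ) ^ 3 ≤ eta N ^ 2 := by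
  have hN := hP.N_pos
  rw [hP.eta_sq, div_pow]
  exact div_le_div_of_nonneg_right (one_le_pow₀ hP.one_le_log) (by positivity)

/-- The contribution of the unpaired rows, `√2 ρ^(3/2)`. It is exactly of the order of `η`. -/
theorem Params.rho_sqrt_le (hP : Params N ε β₁ β₂) :
    rho N β₁ β₂ * √(2 * rho N β₁ β₂) ≤ 2 * sigma β₁ β₂ ^ 2 * eta N := by
  have hρ := hP.rho_pos
  have hσ := hP.two_le_sigma
  refine le_mul_eta (by positivity) ?_
  rw [mul_pow, Real.sq_sqrt (by positivity), hP.eta_sq]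
  have e : rho N β₁ β₂ ^ 2 * (2 * rho N β₁ β₂) =
      2 * sigma β₁ β₂ ^ 3 * (Real.log N / N) ^ 3 := by rw [rho_eq]; ring
  rw [e]
  refine mul_le_mul_of_nonneg_right ?_ (pow_nonneg hP.log_div_pos.le 3)
  have : 0 < sigma β₁ β₂ ^ 3 := by positivity
  nlinarith

/-- The contribution of second order errors on a layer strip. The square is `σ⁵ (ln² N / N) (ln N /
N)³`, and the first quotient is at most 4. -/
theorem Params.rho_sq_sqrt_le (hP : Params N ε β₁ β₂) :
    rho N β₁ β₂ ^ 2 * √(rho N β₁ β₂ * N) ≤ 2 * sigma β₁ β₂ ^ 3 * eta N := by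
  have hρ := hP.rho_pos
  have hσ := hP.two_le_sigma
  have hN := hP.N_pos
  refine le_mul_eta (by positivity) ?_
  rw [mul_pow, Real.sq_sqrt (by positivity), hP.eta_sq]
  have e : (rho N β₁ β₂ ^ 2) ^ 2 * (rho N β₁ β₂ * N) =
      sigma β₁ β₂ ^ 5 * (Real.log N ^ 2 / N) * (Real.log N / N) ^ 3 := by
    rw [rho_eq]; field_simp
  rw [e]
  refine mul_le_mul_of_nonneg_right ?_ (pow_nonneg hP.log_div_pos.le 3)
  have h1 : Real.log N ^ 2 / N ≤ 4 := by rw [div_le_iff₀ hN]; exact hP.log_sq_le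
  have h2 : 0 < sigma β₁ β₂ ^ 5 := by positivity
  have h3 := mul_le_mul_of_nonneg_left h1 h2.le
  nlinarith

theorem Params.theta_sqrt_le (hP : Params N ε β₁ β₂) :
    theta N * √(rho N β₁ β₂ * N) ≤ sigma β₁ β₂ * eta N := by
  have hρ := hP.rho_pos
  have hσ := hP.two_le_sigma
  have hN := hP.N_pos
  have hN4 := hP.N_ge
  have hL := hP.one_le_log
  refine le_mul_eta (by positivity) ?_
  rw [mul_pow, Real.sq_sqrt (by positivity), hP.eta_sq]
  have hθ : theta N ^ 2 = 1 / N ^ 5 := by rw [eq_div_iff (by positivity)]; exact hP.theta_sq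
  have e : theta N ^ 2 * (rho N β₁ β₂ * N) = sigma β₁ β₂ * (Real.log N / N ^ 5) := by
    rw [hθ, rho_eq]; field_simp
  rw [e]
  have h1 : Real.log N / N ^ 5 ≤ (Real.log N / N) ^ 3 := by
    rw [div_pow]
    refine div_le_div₀ (by positivity) ?_ (by positivity)
      (pow_le_pow_right₀ (by linarith) (by norm_num))
    exact le_self_pow₀ hL (by norm_num)
  refine mul_le_mul ?_ h1 (by positivity) (sq_nonneg _)
  nlinarith

theorem Params.eps_rho_sqrt_le (hP : Params N ε β₁ β₂) :
    ε * (rho N β₁ β₂ * √(rho N β₁ β₂ * N)) ≤ sigma β₁ β₂ ^ 2 * eta N := by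
  have hρ := hP.rho_pos
  have hσ := hP.two_le_sigma
  have hN := hP.N_pos
  have hε := hP.ε_pos
  refine le_mul_eta (by positivity) ?_
  rw [mul_pow, mul_pow, Real.sq_sqrt (by positivity), hP.eta_sq]
  have e : ε ^ 2 * (rho N β₁ β₂ ^ 2 * (rho N β₁ β₂ * N)) =
      ε * (ε * N) * (sigma β₁ β₂ ^ 3 * (Real.log N / N) ^ 3) := by rw [rho_eq]; ring
  rw [e]
  have h1 : ε * (ε * N) ≤ 1 := mul_le_one₀ hP.ε_le_one (by positivity) hP.ε_mul_le
  have h2 : sigma β₁ β₂ ^ 3 ≤ (sigma β₁ β₂ ^ 2) ^ 2 := by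
    rw [← pow_mul]; exact pow_le_pow_right₀ (by linarith) (by norm_num)
  have h3 := pow_nonneg hP.log_div_pos.le 3
  calc _ ≤ 1 * (sigma β₁ β₂ ^ 3 * (Real.log N / N) ^ 3) :=
        mul_le_mul_of_nonneg_right h1 (by positivity)
    _ ≤ _ := by rw [one_mul]; exact mul_le_mul_of_nonneg_right h2 h3

theorem Params.rho_sq_le (hP : Params N ε β₁ β₂) :
    rho N β₁ β₂ ^ 2 ≤ sigma β₁ β₂ ^ 2 * eta N := by
  have hN := hP.N_pos
  refine le_mul_eta (by positivity) ?_
  rw [hP.eta_sq, rho_eq]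
  have h3 := pow_nonneg hP.log_div_pos.le 3
  have h1 : Real.log N / N ≤ 1 := by rw [div_le_one hN]; exact hP.log_le
  have e : ((sigma β₁ β₂ * (Real.log N / N)) ^ 2) ^ 2 =
    (sigma β₁ β₂ ^ 2) ^ 2 * ((Real.log N / N) * (Real.log N / N) ^ 3) := by ring
  rw [e]
  exact mul_le_mul_of_nonneg_left (mul_le_of_le_one_left h3 h1) (by positivity)

theorem Params.N_theta_le (hP : Params N ε β₁ β₂) : N * theta N ≤ 1 * eta N := by
  have hN := hP.N_pos
  refine le_mul_eta (by positivity) ?_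
  have h := hP.theta_sq
  have e : (N * theta N) ^ 2 = 1 / (N : ℝ) ^ 3 := by
    rw [eq_div_iff (by positivity), ← h]; ring
  rw [e]; linarith [hP.inv_cube_le]

theorem Params.theta_N_le (hP : Params N ε β₁ β₂) : theta N * N ≤ 1 / N := by
  have hN := hP.N_pos
  rw [le_div_iff₀ hN]
  have := hP.theta_le
  linarith

/-- From `ε ≤ 1/N`. First order smooth errors on the coarse part, weighted by `√ε`, are thus
absorbed by the rate `N^(-3/2)`. -/
theorem Params.sqrt_eps_div_le (hP : Params N ε β₁ β₂) : √ε / N ≤ 1 * eta N := by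
  have hN := hP.N_pos
  refine le_mul_eta (by positivity) ?_
  rw [div_pow, Real.sq_sqrt hP.ε_pos.le]
  have : ε / N ^ 2 ≤ 1 / N ^ 3 := by
    rw [div_le_div_iff₀ (by positivity) (by positivity)]
    have := mul_le_mul_of_nonneg_right hP.ε_mul_le (sq_nonneg (N : ℝ))
    nlinarith
  linarith [hP.inv_cube_le]

/-! ### The regions of the Shishkin mesh -/

theorem Params.half_pos (hP : Params N ε β₁ β₂) : 0 < N / 2 ∧ N / 2 < N := by
  have := hP.four_le
  omega

theorem Params.step_le_rho (hP : Params N ε β₁ β₂) (i : ℕ) :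
    node N ε β₁ (i + 1) - node N ε β₁ i ≤ rho N β₁ β₂ * 1 := by
  rw [mul_one]; exact (hP.step_le i).trans hP.rho_ge

theorem Params.region_fine_fine (hP : Params N ε β₁ β₂) :
    Region N (node N ε β₁) (node N ε β₂) (N / 2) N (N / 2) N (rho N β₁ β₂) ε ε :=
  ⟨hP.isGrid, hP.swap.isGrid, hP.half_pos.2, le_rfl, hP.half_pos.2, le_rfl, hP.ε_pos, hP.ε_pos,
    hP.rho_pos, fun _ hi _ => hP.step_fine_le hi,
    fun _ hi _ => by rw [← rho_comm]; exact hP.swap.step_fine_le hi⟩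

theorem Params.region_fine_coarse (hP : Params N ε β₁ β₂) :
    Region N (node N ε β₁) (node N ε β₂) (N / 2) N 0 (N / 2) (rho N β₁ β₂) ε 1 :=
  ⟨hP.isGrid, hP.swap.isGrid, hP.half_pos.2, le_rfl, hP.half_pos.1, hP.half_pos.2.le, hP.ε_pos,
    one_pos, hP.rho_pos, fun _ hi _ => hP.step_fine_le hi,
    fun _ _ _ => by rw [← rho_comm]; exact hP.swap.step_le_rho _⟩

theorem Params.region_coarse_coarse (hP : Params N ε β₁ β₂) :
    Region N (node N ε β₁) (node N ε β₂) 0 (N / 2) 0 (N / 2) (2 / N) 1 1 :=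
  ⟨hP.isGrid, hP.swap.isGrid, hP.half_pos.1, hP.half_pos.2.le, hP.half_pos.1, hP.half_pos.2.le,
    one_pos, one_pos, div_pos two_pos hP.N_pos, fun _ _ _ => by rw [mul_one]; exact hP.step_le _,
    fun _ _ _ => by rw [mul_one]; exact hP.swap.step_le _⟩

/-- A discrete function whose energy norm is at most `s`. -/
structure TestFn (n : ℕ) (X Y : ℕ → ℝ) (ε μ₀ : ℝ) (χ : ℝ × ℝ → ℝ) (s : ℝ) : Prop where
  pl : IsPL n X Y χ
  nonneg : 0 ≤ s
  gradX : ε * ∫ p in Omega, dX χ p ^ 2 ≤ s ^ 2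
  gradY : ε * ∫ p in Omega, dY χ p ^ 2 ≤ s ^ 2
  val : μ₀ * ∫ p in Omega, χ p ^ 2 ≤ s ^ 2

theorem preimage_swap_hull (a b c : ℝ × ℝ) :
    Prod.swap ⁻¹' convexHull ℝ {a, b, c} = convexHull ℝ {a.swap, b.swap, c.swap} := by
  have h := (LinearEquiv.prodComm ℝ ℝ ℝ).toLinearMap.image_convexHull {a, b, c}
  have e : ⇑(LinearEquiv.prodComm ℝ ℝ ℝ).toLinearMap = Prod.swap := rfl
  rw [e, image_insert_eq, image_insert_eq, image_singleton] at h
  rw [← h, image_swap_eq_preimage_swap]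

/-- The diagonals run from upper left to lower right, so exchanging the coordinates maps the
triangulation of `X × Y` to that of `Y × X` and keeps the type of each triangle. -/
theorem IsPL.swap {n : ℕ} {X Y : ℕ → ℝ} {χ : ℝ × ℝ → ℝ} (h : IsPL n X Y χ) :
    IsPL n Y X (χ ∘ Prod.swap) := by
  have k : ∀ K K' : Set (ℝ × ℝ), K' = Prod.swap ⁻¹' K → IsAffineOn χ K →
      IsAffineOn (χ ∘ Prod.swap) K' := by
    rintro K _ rfl ⟨a, b, c, h⟩
    exact ⟨a, c, b, fun p hp => by rw [Function.comp_apply, h _ hp]; simp; ring⟩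
  refine ⟨h.cont.comp continuous_swap.continuousOn fun p hp => swap_mem_closedSquare.2 hp,
    fun i hi j hj => k _ _ ?_ (h.affine₁ j hj i hi), fun i hi j hj => k _ _ ?_ (h.affine₂ j hj i hi)⟩
  · unfold K1
    rw [preimage_swap_hull]
    simp only [Prod.swap_prod_mk]
    rw [Set.pair_comm]
  · unfold K2
    rw [preimage_swap_hull]
    simp only [Prod.swap_prod_mk]
    rw [Set.insert_comm]

theorem TestFn.swap {n : ℕ} {X Y : ℕ → ℝ} {μ₀ s : ℝ} {χ : ℝ × ℝ → ℝ}
    (h : TestFn n X Y ε μ₀ χ s) : TestFn n Y X ε μ₀ (χ ∘ Prod.swap) s := by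
  refine ⟨h.pl.swap, h.nonneg, ?_, ?_, ?_⟩
  · rw [dX_swap]
    have := integral_Omega_swap fun p => dY χ p ^ 2
    simp only [Function.comp_apply]; rw [this]; exact h.gradY
  · rw [dY_swap]
    have := integral_Omega_swap fun p => dX χ p ^ 2
    simp only [Function.comp_apply]; rw [this]; exact h.gradX
  · have := integral_Omega_swap fun p => χ p ^ 2
    simp only [Function.comp_apply]; rw [this]; exact h.val

theorem integral_block_swap (X Y : ℕ → ℝ) (i₀ i₁ j₀ j₁ : ℕ) (F : ℝ × ℝ → ℝ) :
    ∫ p in block Y X j₀ j₁ i₀ i₁, F p.swap = ∫ p in block X Y i₀ i₁ j₀ j₁, F p :=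
  setIntegral_prod_swap _ _ F

theorem interp_swap (n : ℕ) (X Y : ℕ → ℝ) (g : ℝ × ℝ → ℝ) :
    interp n Y X (g ∘ Prod.swap) = interp n X Y g ∘ Prod.swap := by
  ext p
  simp only [interp, Function.comp_apply]
  rw [Finset.sum_comm]
  refine Finset.sum_congr rfl fun i _ => Finset.sum_congr rfl fun j _ => ?_
  simp only [Prod.swap_prod_mk, Prod.fst_swap, Prod.snd_swap, hat]
  rw [max_comm |_ - (j : ℝ)|, add_comm]

theorem errX_swap (n : ℕ) (X Y : ℕ → ℝ) (g : ℝ × ℝ → ℝ) (p : ℝ × ℝ) :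
    errX n Y X (g ∘ Prod.swap) p = errY n X Y g p.swap := by
  unfold errX errY
  rw [interp_swap, dX_swap, dX_swap]; rfl

theorem errY_swap (n : ℕ) (X Y : ℕ → ℝ) (g : ℝ × ℝ → ℝ) (p : ℝ × ℝ) :
    errY n Y X (g ∘ Prod.swap) p = errX n X Y g p.swap := by
  unfold errX errY
  rw [interp_swap, dY_swap, dY_swap]; rfl

end


/-! ### The layer regions -/

/-- Bounds by `B` of the error functionals on a block. -/
structure BlockBound (n : ℕ) (X Y : ℕ → ℝ) (i₀ i₁ j₀ j₁ : ℕ) (ε : ℝ) (u χ : ℝ × ℝ → ℝ) (B : ℝ) :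
    Prop where
  gradX : |ε * ∫ p in block X Y i₀ i₁ j₀ j₁, errX n X Y u p * dX χ p| ≤ B
  gradY : |ε * ∫ p in block X Y i₀ i₁ j₀ j₁, errY n X Y u p * dY χ p| ≤ B
  valX : ∫ p in block X Y i₀ i₁ j₀ j₁, |u p - interp n X Y u p| * |dX χ p| ≤ B
  valY : ∫ p in block X Y i₀ i₁ j₀ j₁, |u p - interp n X Y u p| * |dY χ p| ≤ B

section

variable {n : ℕ} {X Y : ℕ → ℝ} {i₀ i₁ j₀ j₁ : ℕ} {u χ : ℝ × ℝ → ℝ} {B : ℝ}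
  {N : ℕ} {ε β₁ β₂ μ₀ s C τ₂ : ℝ} {A T : ℝ × ℝ → ℝ}

theorem BlockBound.swap (h : BlockBound n X Y i₀ i₁ j₀ j₁ ε u χ B) :
    BlockBound n Y X j₀ j₁ i₀ i₁ ε (u ∘ Prod.swap) (χ ∘ Prod.swap) B := by
  refine ⟨?_, ?_, ?_, ?_⟩
  · simp only [errX_swap, dX_swap, Function.comp_apply]
    rw [integral_block_swap X Y i₀ i₁ j₀ j₁ fun p => errY n X Y u p * dY χ p]; exact h.gradY
  · simp only [errY_swap, dY_swap, Function.comp_apply]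
    rw [integral_block_swap X Y i₀ i₁ j₀ j₁ fun p => errX n X Y u p * dX χ p]; exact h.gradX
  · simp only [interp_swap, dX_swap, Function.comp_apply]
    rw [integral_block_swap X Y i₀ i₁ j₀ j₁ fun p => |u p - interp n X Y u p| * |dY χ p|]
    exact h.valY
  · simp only [interp_swap, dY_swap, Function.comp_apply]
    rw [integral_block_swap X Y i₀ i₁ j₀ j₁ fun p => |u p - interp n X Y u p| * |dX χ p|]
    exact h.valX

/-- The interpolation error on the regions where the mesh resolves the layers. -/
theorem InterpError.val_le {τ₁ : ℝ} {p : ℝ × ℝ} (hP : Params N ε β₁ β₂) (hC : 0 ≤ C)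
    (h : InterpError n X Y C (theta N) ε (rho N β₁ β₂) τ₁ τ₂ u A T p) :
    |u p - interp n X Y u p| ≤ 8 * C * rho N β₁ β₂ ^ 2 := by
  have := mul_le_mul_of_nonneg_left hP.theta_le_rho hC
  linarith [h.val]

theorem bm_interp_error (hX : IsGrid n X) (hY : IsGrid n Y) (hu : ContinuousOn u closedSquare) :
    BM fun p => u p - interp n X Y u p :=
  (BM.of_continuousOn hu).sub (isPL_interp hX hY).bm

theorem abs_mul_integral_le {F G : ℝ × ℝ → ℝ} {S : Set (ℝ × ℝ)} (hε : 0 ≤ ε)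
    (h : ∫ p in S, |F p| * |G p| ≤ B) : |ε * ∫ p in S, F p * G p| ≤ ε * B := by
  rw [abs_mul, abs_of_nonneg hε]
  refine mul_le_mul_of_nonneg_left ?_ hε
  refine (abs_integral_le_integral_abs).trans ?_
  simpa only [abs_mul] using h

theorem TestFn.dX_le (h : TestFn n X Y ε μ₀ χ s) (hε : 0 < ε) :
    ∫ p in Omega, dX χ p ^ 2 ≤ s ^ 2 / ε := by
  rw [le_div_iff₀ hε, mul_comm]; exact h.gradX

theorem TestFn.dY_le (h : TestFn n X Y ε μ₀ χ s) (hε : 0 < ε) :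
    ∫ p in Omega, dY χ p ^ 2 ≤ s ^ 2 / ε := by
  rw [le_div_iff₀ hε, mul_comm]; exact h.gradY

/-- The constant for the layer regions. -/
def fineConst (C β₁ β₂ : ℝ) : ℝ :=
  C * (2 * sigma β₁ β₂ + 18 * sigma β₁ β₂ ^ 2 + 72 * sigma β₁ β₂ ^ 3)

section fine

variable (hP : Params N ε β₁ β₂)
  (hr : Region N (node N ε β₁) (node N ε β₂) (N / 2) N j₀ j₁ (rho N β₁ β₂) ε τ₂)

include hP hr

theorem Params.volume_fine_le :
    volume.real (block (node N ε β₁) (node N ε β₂) (N / 2) N j₀ j₁) ≤ rho N β₁ β₂ * N * ε := by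
  have hY := hr.gridY
  have hmY := hY.mono hr.hj.le hr.hjn
  have hmX := hr.gridX.mono hr.hi.le hr.hin
  unfold block
  rw [volume_real_rect hmX hmY]
  have b1 := (hY.mem_Icc (hr.hj.le.trans hr.hjn)).1
  have b2 := (hY.mem_Icc hr.hjn).2
  have := hP.width_fine
  nlinarith

/-- Cauchy-Schwarz on the strip: its area `ρ N ε` cancels the `ε⁻¹` in the bound for `G`, so the
result is free of `ε`. -/
theorem Params.integral_fine_le {F G : ℝ × ℝ → ℝ} (hF : BM F) (hG : BM G) {a : ℝ} (ha : 0 ≤ a)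
    (hFa : ∀ᵐ p ∂(volume.restrict (block (node N ε β₁) (node N ε β₂) (N / 2) N j₀ j₁)), |F p| ≤ a)
    (hs : 0 ≤ s) (hg : ∫ p in Omega, G p ^ 2 ≤ s ^ 2 / ε) :
    ∫ p in block (node N ε β₁) (node N ε β₂) (N / 2) N j₀ j₁, |F p| * |G p| ≤
      a * √(rho N β₁ β₂ * N) * s := by
  have hρ := hP.rho_pos
  have hN := hP.N_pos
  have hε := hP.ε_pos
  refine integral_abs_mul_le hF hG hr.subset hFa (hP.volume_fine_le hr) hg (by positivity) ?_
  rw [mul_pow, mul_pow, Real.sq_sqrt (by positivity)]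
  refine le_of_eq ?_
  field_simp

variable (hs : Splitting C (theta N) ε ε τ₂
    (blockR (node N ε β₁) (node N ε β₂) (N / 2) N j₀ j₁) u A T)
  (hC : 0 ≤ C) (hχ : TestFn N (node N ε β₁) (node N ε β₂) ε μ₀ χ s)

include hs hC hχ

/-- Across the layer the gradient error of `A` is of order `ρ/ε`, so size alone gives too little and
the superconvergence estimate is needed. For the layer part `T` size is enough. -/
theorem Params.fine_gradX {k : ℝ}
    (hk : ∀ j, j₀ ≤ j → j < j₁ → node N ε β₂ (j + 1) - node N ε β₂ j = k) :
    |ε * ∫ p in block (node N ε β₁) (node N ε β₂) (N / 2) N j₀ j₁,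
      errX N (node N ε β₁) (node N ε β₂) u p * dX χ p| ≤ fineConst C β₁ β₂ * eta N * s := by
  have hX := hr.gridX
  have hY := hr.gridY
  have hρ := hP.rho_pos
  have hσ := hP.two_le_sigma
  have hN := hP.N_pos
  have hε := hP.ε_pos
  have hs0 := hχ.nonneg
  have hdX := hχ.pl.bm_dX hX hY
  have hbA := hs.jetA.bm_errX hX hY
  have hbT := hs.jetT.bm_errX hX hY
  have hk2 : k ≤ 2 / N := by rw [← hk j₀ le_rfl hr.hj]; exact hP.swap.step_le _
  have hW : 0 ≤ rho N β₁ β₂ * N * ε := by positivity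
  -- The strip has width `W = ρ N ε` and a row has height at most `2/N`, so the area of a row is at
  -- most `2 ρ ε`. The `ε` cancels against `s²/ε`.
  have h1 := hr.superconvergence hs.jetA hC hχ.pl hk hP.width_fine
    (V := 2 * rho N β₁ β₂ * ε) (r₁ := √(2 * rho N β₁ β₂) * s) (r₂ := √(rho N β₁ β₂ * N) * s)
    ((mul_le_mul_of_nonneg_right hk2 hW).trans (le_of_eq (by field_simp))) (hχ.dX_le hε)
    (by positivity) (by rw [mul_pow, Real.sq_sqrt (by positivity)]; exact le_of_eq (by field_simp))
    (by positivity) (by rw [mul_pow, Real.sq_sqrt (by positivity)]; exact le_of_eq (by field_simp))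
  have h2 := hP.integral_fine_le hr hbT hdX (a := 2 * C * theta N / ε)
    (by have := theta_pos N; positivity)
    (by filter_upwards [hr.ae_interpError hs] with p hp using hp.layerX) hs0 (hχ.dX_le hε)
  have e : ∫ p in block (node N ε β₁) (node N ε β₂) (N / 2) N j₀ j₁,
      errX N (node N ε β₁) (node N ε β₂) u p * dX χ p =
      (∫ p in block (node N ε β₁) (node N ε β₂) (N / 2) N j₀ j₁,
        errX N (node N ε β₁) (node N ε β₂) A p * dX χ p) +
      ∫ p in block (node N ε β₁) (node N ε β₂) (N / 2) N j₀ j₁,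
        errX N (node N ε β₁) (node N ε β₂) T p * dX χ p := by
    rw [← integral_add ((hbA.mul hdX).intOn hr.subset) ((hbT.mul hdX).intOn hr.subset)]
    refine integral_congr_ae ?_
    filter_upwards [hr.ae_interpError hs] with p hp
    rw [hp.splitX]; ring
  have h3 := abs_mul_integral_le hε.le h2
  rw [e, mul_add]
  refine (abs_add_le _ _).trans ?_
  have h1' := mul_le_mul_of_nonneg_left h1 hε.le
  rw [← abs_of_pos hε, ← abs_mul, abs_of_pos hε] at h1'
  have q1 := mul_le_mul_of_nonneg_right hP.rho_sqrt_le hs0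
  have q2 := mul_le_mul_of_nonneg_right hP.rho_sq_sqrt_le hs0
  have q3 := mul_le_mul_of_nonneg_right hP.theta_sqrt_le hs0
  have e1 : ε * (4 * C * rho N β₁ β₂ / ε * (√(2 * rho N β₁ β₂) * s) +
      28 * C * rho N β₁ β₂ ^ 2 / ε * (√(rho N β₁ β₂ * N) * s)) =
      4 * C * (rho N β₁ β₂ * √(2 * rho N β₁ β₂) * s) +
      28 * C * (rho N β₁ β₂ ^ 2 * √(rho N β₁ β₂ * N) * s) := by field_simp
  have e2 : ε * (2 * C * theta N / ε * √(rho N β₁ β₂ * N) * s) =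
    2 * C * (theta N * √(rho N β₁ β₂ * N) * s) := by field_simp
  rw [e1] at h1'
  rw [e2] at h3
  have p1 := mul_le_mul_of_nonneg_left q1 (show 0 ≤ 4 * C by positivity)
  have p2 := mul_le_mul_of_nonneg_left q2 (show 0 ≤ 28 * C by positivity)
  have p3 := mul_le_mul_of_nonneg_left q3 (show 0 ≤ 2 * C by positivity)
  have hη := eta_nonneg (N := N)
  have z1 : 0 ≤ C * sigma β₁ β₂ ^ 2 * eta N * s := by positivity
  have z2 : 0 ≤ C * sigma β₁ β₂ ^ 3 * eta N * s := by positivity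
  unfold fineConst
  nlinarith

theorem Params.fine_val {G : ℝ × ℝ → ℝ} (hG : BM G) (hg : ∫ p in Omega, G p ^ 2 ≤ s ^ 2 / ε)
    (hu : ContinuousOn u closedSquare) :
    ∫ p in block (node N ε β₁) (node N ε β₂) (N / 2) N j₀ j₁,
      |u p - interp N (node N ε β₁) (node N ε β₂) u p| * |G p| ≤
        fineConst C β₁ β₂ * eta N * s := by
  have hX := hr.gridX
  have hY := hr.gridY
  have hρ := hP.rho_pos
  have hσ := hP.two_le_sigma
  have hs0 := hχ.nonneg
  refine (hP.integral_fine_le hr (bm_interp_error hX hY hu) hG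
    (a := 8 * C * rho N β₁ β₂ ^ 2) (by positivity)
    (by filter_upwards [hr.ae_interpError hs] with p hp using hp.val_le hP hC) hs0 hg).trans ?_
  have q2 := mul_le_mul_of_nonneg_right hP.rho_sq_sqrt_le hs0
  have p2 := mul_le_mul_of_nonneg_left q2 (show 0 ≤ 8 * C by positivity)
  have hη := eta_nonneg (N := N)
  have z1 : 0 ≤ C * sigma β₁ β₂ ^ 2 * eta N * s := by positivity
  have z2 : 0 ≤ C * sigma β₁ β₂ ^ 3 * eta N * s := by positivity
  have z3 : 0 ≤ C * sigma β₁ β₂ * eta N * s := by positivity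
  unfold fineConst
  nlinarith

/-- Along the layer no cancellation is needed: the error of the resolved part is only `O(ρ)`, and
the factor `ε` in front, with `ε N ≤ 1`, makes up for it. -/
theorem Params.fine_gradY (hτ : τ₂ = 1) :
    |ε * ∫ p in block (node N ε β₁) (node N ε β₂) (N / 2) N j₀ j₁,
      errY N (node N ε β₁) (node N ε β₂) u p * dY χ p| ≤ fineConst C β₁ β₂ * eta N * s := by
  subst hτ
  have hX := hr.gridX
  have hY := hr.gridY
  have hρ := hP.rho_pos
  have hσ := hP.two_le_sigma
  have hε := hP.ε_pos
  have hs0 := hχ.nonneg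
  have hθ := theta_pos N
  have hu : BM (errY N (node N ε β₁) (node N ε β₂) u) := by
    have hj : JetBound (fun _ _ => 0) ∅ u := ⟨(hs.jetA.smooth.add hs.jetT.smooth).congr hs.eq,
      fun _ _ _ p hp => absurd hp (notMem_empty p)⟩
    exact hj.bm_errY hX hY
  have h := abs_mul_integral_le hε.le (hP.integral_fine_le hr hu (hχ.pl.bm_dY hX hY)
    (a := 2 * C * rho N β₁ β₂ + 2 * C * theta N / ε) (by positivity)
    (by
      filter_upwards [hr.ae_interpError hs] with p hp
      rw [hp.splitY]
      have := hp.smoothY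
      rw [div_one] at this
      exact (abs_add_le _ _).trans (add_le_add this hp.layerY)) hs0 (hχ.dY_le hε))
  refine h.trans ?_
  have e : ε * ((2 * C * rho N β₁ β₂ + 2 * C * theta N / ε) * √(rho N β₁ β₂ * N) * s) =
      2 * C * (ε * (rho N β₁ β₂ * √(rho N β₁ β₂ * N)) * s) +
      2 * C * (theta N * √(rho N β₁ β₂ * N) * s) := by field_simp
  rw [e]
  have q2 := mul_le_mul_of_nonneg_right hP.eps_rho_sqrt_le hs0
  have q3 := mul_le_mul_of_nonneg_right hP.theta_sqrt_le hs0
  have p2 := mul_le_mul_of_nonneg_left q2 (show 0 ≤ 2 * C by positivity)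
  have p3 := mul_le_mul_of_nonneg_left q3 (show 0 ≤ 2 * C by positivity)
  have hη := eta_nonneg (N := N)
  have z1 : 0 ≤ C * sigma β₁ β₂ ^ 2 * eta N * s := by positivity
  have z2 : 0 ≤ C * sigma β₁ β₂ ^ 3 * eta N * s := by positivity
  unfold fineConst
  nlinarith

end fine

theorem fineConst_comm : fineConst C β₂ β₁ = fineConst C β₁ β₂ := by
  unfold fineConst; rw [sigma_comm]

theorem HasDecomposition.smooth {C₁ : ℝ} (h : HasDecomposition C₁ ε β₁ β₂ u) :
    ContDiffOn ℝ 3 u closedSquare := by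
  obtain ⟨S, E₁, E₂, E₁₂, he, hS, h1, h2, h12⟩ := h
  exact (((hS.smooth.add h1.smooth).add h2.smooth).add h12.smooth).congr he

theorem blockR_swap (X Y : ℕ → ℝ) (i₀ i₁ j₀ j₁ : ℕ) :
    Prod.swap ⁻¹' blockR X Y i₀ i₁ j₀ j₁ = blockR Y X j₀ j₁ i₀ i₁ := preimage_swap_prod _ _

variable {C₁ : ℝ} (hP : Params N ε β₁ β₂) (hu : HasDecomposition C₁ ε β₁ β₂ u)
  (hχ : TestFn N (node N ε β₁) (node N ε β₂) ε μ₀ χ s)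

include hP hu hχ

theorem blockBound_fine_coarse :
    BlockBound N (node N ε β₁) (node N ε β₂) (N / 2) N 0 (N / 2) ε u χ
      (fineConst (4 * C₁) β₁ β₂ * eta N * s) := by
  have hr := hP.region_fine_coarse
  have hC : 0 ≤ 4 * C₁ := by linarith [hu.nonneg]
  obtain ⟨A, T, hs⟩ := hu.splitting_fine_coarse hP hr.blockR_subset fun p hp => hp.2.2
  exact ⟨hP.fine_gradX hr hs hC hχ fun j _ hj => step_coarse hj, hP.fine_gradY hr hs hC hχ rfl,
    hP.fine_val hr hs hC hχ (hχ.pl.bm_dX hr.gridX hr.gridY) (hχ.dX_le hP.ε_pos)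
      hu.smooth.continuousOn,
    hP.fine_val hr hs hC hχ (hχ.pl.bm_dY hr.gridX hr.gridY) (hχ.dY_le hP.ε_pos)
      hu.smooth.continuousOn⟩

theorem blockBound_fine_fine :
    BlockBound N (node N ε β₁) (node N ε β₂) (N / 2) N (N / 2) N ε u χ
      (fineConst (4 * C₁) β₁ β₂ * eta N * s) := by
  have hr := hP.region_fine_fine
  have hC : 0 ≤ 4 * C₁ := by linarith [hu.nonneg]
  obtain ⟨A, T, hs⟩ := hu.splitting_fine_fine hP (blockR (node N ε β₁) (node N ε β₂) (N / 2) N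
    (N / 2) N)
  have hr' := hP.swap.region_fine_fine
  have hs' := hs.swap hr.blockR_subset
  rw [blockR_swap] at hs'
  -- In the corner both derivatives cross a layer, so the `y` estimate is the superconvergence
  -- estimate of the swapped problem.
  have k := hP.swap.fine_gradX hr' hs' hC hχ.swap fun j hj _ => hP.step_fine hj
  simp only [errX_swap, dX_swap, Function.comp_apply] at k
  rw [integral_block_swap (node N ε β₁) (node N ε β₂) _ _ _ _
    fun p => errY N (node N ε β₁) (node N ε β₂) u p * dY χ p, fineConst_comm] at k
  exact ⟨hP.fine_gradX hr hs hC hχ fun j hj _ => hP.swap.step_fine hj, k,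
    hP.fine_val hr hs hC hχ (hχ.pl.bm_dX hr.gridX hr.gridY) (hχ.dX_le hP.ε_pos)
      hu.smooth.continuousOn,
    hP.fine_val hr hs hC hχ (hχ.pl.bm_dY hr.gridX hr.gridY) (hχ.dY_le hP.ε_pos)
      hu.smooth.continuousOn⟩

theorem blockBound_coarse_fine :
    BlockBound N (node N ε β₁) (node N ε β₂) 0 (N / 2) (N / 2) N ε u χ
      (fineConst (4 * C₁) β₁ β₂ * eta N * s) := by
  have h := (blockBound_fine_coarse hP.swap hu.swap hχ.swap).swap
  rw [fineConst_comm] at h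
  exact h

end


/-! ### The coarse region -/

section

variable {N : ℕ} {ε β₁ β₂ μ₀ s C₁ : ℝ} {u χ : ℝ × ℝ → ℝ}

theorem hasDerivAt_layer (hε : ε ≠ 0) (hβ : β₁ ≠ 0) (x : ℝ) :
    HasDerivAt (fun x => ε / β₁ * layer ε β₁ x) (layer ε β₁ x) x := by
  have h1 : HasDerivAt (fun x => -(β₁ * (1 - x)) / ε) (β₁ / ε) x := by
    have := ((((hasDerivAt_id x).const_sub 1).const_mul β₁).neg).div_const ε
    exact this.congr_deriv (by ring)
  exact ((h1.exp).const_mul (ε / β₁)).congr_deriv (by unfold layer; field_simp)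

theorem continuous_layer (ε β : ℝ) : Continuous (layer ε β) := by unfold layer; fun_prop

/-- The antiderivative of the layer function is `ε/β₁` times itself, and its upper end value is at
most `θ`. The factor `ε` gained here cancels the `ε⁻¹` of layer gradients. -/
theorem Params.integral_layer_le (hP : Params N ε β₁ β₂) :
    ∫ p in coarse N (node N ε β₁) (node N ε β₂), layer ε β₁ p.1 ≤ ε * (theta N / β₁) := by
  have hε := hP.ε_pos
  have hβ := hP.β₁_pos
  have hX := hP.isGrid
  have hY := hP.swap.isGrid
  have hh := hP.half_pos.2.le
  have x0 := (hX.mem_Icc hh).1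
  have e := setIntegral_prod_mul (μ := (volume : Measure ℝ)) (ν := (volume : Measure ℝ))
    (layer ε β₁) (fun _ => (1 : ℝ)) (Ioc (node N ε β₁ 0) (node N ε β₁ (N / 2)))
    (Ioc (node N ε β₂ 0) (node N ε β₂ (N / 2)))
  simp only [mul_one] at e
  unfold coarse block
  rw [Measure.volume_eq_prod, e, hX.zero, hY.zero]
  have i1 : ∫ x in Ioc 0 (node N ε β₁ (N / 2)), layer ε β₁ x ≤ ε * (theta N / β₁) := by
    rw [← intervalIntegral.integral_of_le x0,
      intervalIntegral.integral_eq_sub_of_hasDerivAt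
        (fun x _ => hasDerivAt_layer hε.ne' hβ.ne' x)
        ((continuous_layer ε β₁).intervalIntegrable _ _)]
    have h1 := hP.layer_le_theta le_rfl
    have h2 : 0 < ε / β₁ * layer ε β₁ 0 := mul_pos (by positivity) (layer_pos _ _ _)
    have h3 := mul_le_mul_of_nonneg_left h1 (show 0 ≤ ε / β₁ by positivity)
    have h4 : ε / β₁ * theta N = ε * (theta N / β₁) := by ring
    linarith
  have i2 : ∫ _ in Ioc 0 (node N ε β₂ (N / 2)), (1 : ℝ) ≤ 1 := by
    simp only [integral_const, MeasurableSet.univ, measureReal_restrict_apply, univ_inter,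
      Real.volume_real_Ioc, smul_eq_mul, mul_one, sub_zero]
    have := (hY.mem_Icc hh)
    exact max_le this.2 zero_le_one
  have i3 : 0 ≤ ∫ x in Ioc 0 (node N ε β₁ (N / 2)), layer ε β₁ x :=
    integral_nonneg fun x => (layer_pos _ _ _).le
  have := theta_pos N
  calc _ ≤ (ε * (theta N / β₁)) * 1 := mul_le_mul i1 i2 (by simp) (by positivity)
    _ = _ := mul_one _

theorem bm_layer (ε β : ℝ) : BM fun p => layer ε β p.1 :=
  BM.of_continuousOn ((continuous_layer ε β).comp continuous_fst).continuousOn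

theorem bm_layer' (ε β : ℝ) : BM fun p => layer ε β p.2 :=
  BM.of_continuousOn ((continuous_layer ε β).comp continuous_snd).continuousOn

/-- The gradient of the layer terms on the coarse region. -/
def tail (C₁ ε β₁ β₂ : ℝ) (p : ℝ × ℝ) : ℝ :=
  2 * C₁ * ε⁻¹ * (layer ε β₁ p.1 + layer ε β₂ p.2)

theorem bm_tail : BM (tail C₁ ε β₁ β₂) :=
  (BM.const _).mul ((bm_layer ε β₁).add (bm_layer' ε β₂))

theorem tail_nonneg (hC : 0 ≤ C₁) (hε : 0 < ε) (p : ℝ × ℝ) : 0 ≤ tail C₁ ε β₁ β₂ p := by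
  have := layer_pos ε β₁ p.1
  have := layer_pos ε β₂ p.2
  unfold tail; positivity

theorem Params.integral_tail_le (hP : Params N ε β₁ β₂) (hC : 0 ≤ C₁) :
    ∫ p in coarse N (node N ε β₁) (node N ε β₂), tail C₁ ε β₁ β₂ p ≤
      2 * C₁ * (1 / β₁ + 1 / β₂) * theta N := by
  have hε := hP.ε_pos
  have hS := coarse_subset hP.isGrid hP.swap.isGrid
  unfold tail
  rw [integral_const_mul, integral_add ((bm_layer ε β₁).intOn hS) ((bm_layer' ε β₂).intOn hS)]
  have h1 := hP.integral_layer_le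
  have h2 := hP.swap.integral_layer_le
  unfold coarse at *
  rw [← integral_block_swap] at h2
  simp only [Prod.fst_swap] at h2
  have h3 : 0 ≤ 2 * C₁ * ε⁻¹ := by positivity
  have := mul_le_mul_of_nonneg_left (add_le_add h1 h2) h3
  refine this.trans (le_of_eq ?_)
  field_simp

/-- The inverse inequality on the coarse region. -/
theorem TestFn.grad_le (hP : Params N ε β₁ β₂) (hμ : 0 < μ₀)
    (hχ : TestFn N (node N ε β₁) (node N ε β₂) ε μ₀ χ s) {i j : ℕ} {a b h k : ℝ}
    (hi : i < N / 2) (hj : j < N / 2)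
    (ht : IsTri (node N ε β₁) (node N ε β₂) i j a b h k) {p : ℝ × ℝ} (hp : p ∈ otri a b h k) :
    |dX χ p| ≤ 84 / √μ₀ * N ^ 2 * s ∧ |dY χ p| ≤ 84 / √μ₀ * N ^ 2 * s := by
  have hX := hP.isGrid
  have hY := hP.swap.isGrid
  have hin : i < N := hi.trans hP.half_pos.2
  have hjn : j < N := hj.trans hP.half_pos.2
  have hN := hP.N_pos
  have hs := hχ.nonneg
  have hm : 0 < √μ₀ := Real.sqrt_pos.2 hμ
  obtain ⟨hh, hk⟩ : 1 / (N : ℝ) ≤ |h| ∧ 1 / (N : ℝ) ≤ |k| := by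
    have h1 := hP.step_coarse_ge hi
    have h2 := hP.swap.step_coarse_ge hj
    have h0 : 0 < 1 / (N : ℝ) := by positivity
    rcases ht with ⟨-, -, rfl, rfl⟩ | ⟨-, -, rfl, rfl⟩
    · rw [abs_of_pos (by linarith), abs_of_pos (by linarith)]; exact ⟨h1, h2⟩
    · rw [abs_of_neg (by linarith), abs_of_neg (by linarith)]
      constructor <;> linarith
  have h0 : 0 < |h| := lt_of_lt_of_le (by positivity) hh
  have k0 : 0 < |k| := lt_of_lt_of_le (by positivity) hk
  have hint : ∫ p in otri a b h k, χ p ^ 2 ≤ s ^ 2 / μ₀ := by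
    refine (integral_le_Omega hχ.pl.bm.sq (fun p => sq_nonneg _)
      (ht.subset_hSquare hX hY hin hjn)).trans ?_
    rw [le_div_iff₀ hμ, mul_comm]; exact hχ.val
  -- Coarse cells have sides of length at least `1/N`, so the mean square estimate costs a factor
  -- `N` for nodal values and a further `N` for slopes. The constant 42 comes from `1701 ≤ 42²`.
  have node : ∀ v : ℝ, |h| * |k| * v ^ 2 ≤ 1701 * ∫ p in otri a b h k, χ p ^ 2 →
      |v| ≤ 42 / √μ₀ * N * s := by
    intro v hv
    refine abs_le_of_sq_le_sq ?_ (by positivity)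
    have e : (42 / √μ₀ * N * s) ^ 2 = 1764 * (s ^ 2 / μ₀) * N ^ 2 := by
      have := Real.sq_sqrt hμ.le
      rw [mul_pow, mul_pow, div_pow, this]; ring
    have h1 : 1 / (N : ℝ) * (1 / N) ≤ |h| * |k| := mul_le_mul hh hk (by positivity) h0.le
    have h2 : v ^ 2 = N ^ 2 * (1 / (N : ℝ) * (1 / N) * v ^ 2) := by field_simp
    have h3 : 1 / (N : ℝ) * (1 / N) * v ^ 2 ≤ 1701 * (s ^ 2 / μ₀) :=
      (mul_le_mul_of_nonneg_right h1 (sq_nonneg v)).trans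
        (hv.trans (mul_le_mul_of_nonneg_left hint (by norm_num)))
    have h4 : 0 ≤ s ^ 2 / μ₀ := by positivity
    rw [e, h2, mul_comm]
    exact mul_le_mul_of_nonneg_right (by linarith) (sq_nonneg _)
  obtain ⟨n1, n2, n3⟩ := hχ.pl.node_sq_le hX hY ht hin hjn
  have n1 := node _ n1
  have n2 := node _ n2
  have n3 := node _ n3
  have inv : ∀ h : ℝ, 1 / (N : ℝ) ≤ |h| → ∀ x y : ℝ, |x| ≤ 42 / √μ₀ * N * s →
      |y| ≤ 42 / √μ₀ * N * s → |(x - y) / h| ≤ 84 / √μ₀ * N ^ 2 * s := by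
    intro h hh x y hx hy
    have h0 : 0 < |h| := lt_of_lt_of_le (by positivity) hh
    rw [abs_div, div_le_iff₀ h0]
    have h1 : 84 / √μ₀ * N ^ 2 * s * (1 / N) ≤ 84 / √μ₀ * N ^ 2 * s * |h| :=
      mul_le_mul_of_nonneg_left hh (by positivity)
    have h2 : 84 / √μ₀ * N ^ 2 * s * (1 / N) = 42 / √μ₀ * N * s + 42 / √μ₀ * N * s := by
      field_simp; ring
    exact (abs_sub _ _).trans (by linarith)
  rw [hχ.pl.dX_eq hX hY ht hin hjn hp, hχ.pl.dY_eq hX hY ht hin hjn hp]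
  exact ⟨inv h hh _ _ n2 n1, inv k hk _ _ n3 n1⟩

theorem TestFn.ae_grad_le (hP : Params N ε β₁ β₂) (hμ : 0 < μ₀)
    (hχ : TestFn N (node N ε β₁) (node N ε β₂) ε μ₀ χ s) :
    ∀ᵐ p ∂(volume.restrict (coarse N (node N ε β₁) (node N ε β₂))),
      |dX χ p| ≤ 84 / √μ₀ * N ^ 2 * s ∧ |dY χ p| ≤ 84 / √μ₀ * N ^ 2 * s := by
  filter_upwards [hP.region_coarse_coarse.ae] with p hp
  obtain ⟨i, j, a, b, h, k, -, hi, -, hj, ht, hp⟩ := hp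
  exact hχ.grad_le hP hμ hi hj ht hp

/-- Pointwise errors on the coarse region. -/
structure CoarseError (N : ℕ) (ε β₁ β₂ C₁ : ℝ) (u : ℝ × ℝ → ℝ) (p : ℝ × ℝ) : Prop where
  val : |u p - interp N (node N ε β₁) (node N ε β₂) u p| ≤ 104 * C₁ / N ^ 2
  gradX : |errX N (node N ε β₁) (node N ε β₂) u p| ≤ 24 * C₁ / N + tail C₁ ε β₁ β₂ p
  gradY : |errY N (node N ε β₁) (node N ε β₂) u p| ≤ 24 * C₁ / N + tail C₁ ε β₁ β₂ p
  lap : |-ε * (dX (dX u) p + dY (dY u) p)| ≤ 8 * C₁ / N + 2 * tail C₁ ε β₁ β₂ p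

/-- The derivative of the layer part is kept pointwise as `tail`, but that of its interpolant comes
from nodal values of size `θ` and coarse steps, and is `O(1/N)`. The Laplacian has two second
derivatives; with the factor `ε` each of them is again at most `tail`. -/
theorem Params.ae_coarseError (hP : Params N ε β₁ β₂) (hu : HasDecomposition C₁ ε β₁ β₂ u) :
    ∀ᵐ p ∂(volume.restrict (coarse N (node N ε β₁) (node N ε β₂))),
      CoarseError N ε β₁ β₂ C₁ u p := by
  have hr := hP.region_coarse_coarse
  have hX := hP.isGrid
  have hY := hP.swap.isGrid
  have hN := hP.N_pos
  have hε := hP.ε_pos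
  have hC := hu.nonneg
  have hθ := theta_pos N
  have hθN := hP.theta_N_le
  obtain ⟨A, T, hs, hT⟩ := hu.splitting_coarse_coarse hP hr.blockR_subset
    (fun p hp => hp.1.2) (fun p hp => hp.2.2)
  have dA := hs.jetA.smooth
  have dT := hs.jetT.smooth
  filter_upwards [hr.ae] with p hp
  obtain ⟨i, j, a, b, h, k, hi0, hi, hj0, hj, ht, hp⟩ := hp
  have hin : i < N := hi.trans hP.half_pos.2
  have hjn : j < N := hj.trans hP.half_pos.2
  have hI := hr.interpError hs hi0 hi hj0 hj ht hp
  have hl := ht.legsIn hX hY hin hjn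
  have hR := isRect_cellR hX hY hin hjn le_rfl le_rfl
  have hpc := hR.sub (hl.sub hp)
  have bT : ∀ q ∈ cellR (node N ε β₁) (node N ε β₂) i j, |T q| ≤ 4 * C₁ * theta N := fun q hq => by
    simpa using hs.jetT.b00 (hr.cellR_subset hi0 hi hj0 hj hq)
  obtain ⟨hh, hk⟩ : 1 / (N : ℝ) ≤ |h| ∧ 1 / (N : ℝ) ≤ |k| := by
    have h1 := hP.step_coarse_ge hi
    have h2 := hP.swap.step_coarse_ge hj
    have h0 : 0 < 1 / (N : ℝ) := by positivity
    rcases ht with ⟨-, -, rfl, rfl⟩ | ⟨-, -, rfl, rfl⟩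
    · rw [abs_of_pos (by linarith), abs_of_pos (by linarith)]; exact ⟨h1, h2⟩
    · rw [abs_of_neg (by linarith), abs_of_neg (by linarith)]
      constructor <;> linarith
  -- Inverse estimate for a nodal slope: `θ / |h| ≤ θ N ≤ 1/N`, with no power of `ε`.
  have slope : ∀ h : ℝ, 1 / (N : ℝ) ≤ |h| → 2 * (4 * C₁ * theta N) / |h| ≤ 8 * C₁ / N := by
    intro h hh
    have h0 : 0 < |h| := lt_of_lt_of_le (by positivity) hh
    have h1 : 1 / |h| ≤ N := by
      rw [div_le_iff₀ h0]
      rw [div_le_iff₀ hN] at hh; linarith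
    have h2 : theta N * (1 / |h|) ≤ 1 / N := (mul_le_mul_of_nonneg_left h1 hθ.le).trans hθN
    calc _ = 8 * C₁ * (theta N * (1 / |h|)) := by ring
      _ ≤ 8 * C₁ * (1 / N) := mul_le_mul_of_nonneg_left h2 (by positivity)
      _ = _ := by ring
  have eq := interp_on_otri (g := T) hX hY ht hin hjn hp
  have tX : |dX T p| ≤ tail C₁ ε β₁ β₂ p := by
    have := hT 1 0 (by norm_num) p hpc
    simpa [partialD, tail] using this
  have tY : |dY T p| ≤ tail C₁ ε β₁ β₂ p := by
    have := hT 0 1 (by norm_num) p hpc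
    simpa [partialD, tail] using this
  have tXX : ε * |dX (dX T) p| ≤ tail C₁ ε β₁ β₂ p := by
    have := mul_le_mul_of_nonneg_left (hT 2 0 (by norm_num) p hpc) hε.le
    refine this.trans (le_of_eq ?_)
    unfold tail; norm_num; field_simp
  have tYY : ε * |dY (dY T) p| ≤ tail C₁ ε β₁ β₂ p := by
    have := mul_le_mul_of_nonneg_left (hT 0 2 (by norm_num) p hpc) hε.le
    refine this.trans (le_of_eq ?_)
    unfold tail; norm_num; field_simp
  have aXX : |dX (dX A) p| ≤ 4 * C₁ := by simpa using hs.jetA.b20 hpc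
  have aYY : |dY (dY A) p| ≤ 4 * C₁ := by simpa using hs.jetA.b02 hpc
  have eXX : dX (dX u) p = dX (dX A) p + dX (dX T) p := by
    have e1 := (dX_congr hs.eq).trans
      (dX_add (dA.differentiableOn (by norm_num)) (dT.differentiableOn (by norm_num)))
    rw [dX_congr e1 hpc, dX_add (hs.jetA.smooth_dX.differentiableOn (by norm_num))
      (hs.jetT.smooth_dX.differentiableOn (by norm_num)) hpc, Pi.add_apply]
  have eYY : dY (dY u) p = dY (dY A) p + dY (dY T) p := by
    have e1 := (dY_congr hs.eq).trans
      (dY_add (dA.differentiableOn (by norm_num)) (dT.differentiableOn (by norm_num)))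
    rw [dY_congr e1 hpc, dY_add (hs.jetA.smooth_dY.differentiableOn (by norm_num))
      (hs.jetT.smooth_dY.differentiableOn (by norm_num)) hpc, Pi.add_apply]
  refine ⟨?_, ?_, ?_, ?_⟩
  · have h1 : theta N ≤ 1 / N ^ 2 := by rw [le_div_iff₀ (by positivity)]; exact hP.theta_le
    have h2 := mul_le_mul_of_nonneg_left h1 hC
    have h3 : 6 * (4 * C₁) * (2 / (N : ℝ)) ^ 2 = 96 * (C₁ * (1 / N ^ 2)) := by ring
    have h4 : 104 * C₁ / (N : ℝ) ^ 2 = 104 * (C₁ * (1 / N ^ 2)) := by ring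
    have := hI.val
    rw [h3] at this
    rw [h4]; linarith
  · rw [hI.splitX]
    have h1 := hI.smoothX
    have h2 : |errX N (node N ε β₁) (node N ε β₂) T p| ≤ tail C₁ ε β₁ β₂ p + 8 * C₁ / N := by
      unfold errX
      rw [eq.2.1]
      exact (abs_sub _ _).trans (add_le_add tX ((abs_slopeX_le hl bT).trans (slope h hh)))
    have h3 : 2 * (4 * C₁) * (2 / N) / 1 = 16 * C₁ / (N : ℝ) := by ring
    have h4 : 24 * C₁ / (N : ℝ) = 16 * C₁ / N + 8 * C₁ / N := by ring
    rw [h3] at h1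
    exact (abs_add_le _ _).trans (by linarith)
  · rw [hI.splitY]
    have h1 := hI.smoothY
    have h2 : |errY N (node N ε β₁) (node N ε β₂) T p| ≤ tail C₁ ε β₁ β₂ p + 8 * C₁ / N := by
      unfold errY
      rw [eq.2.2]
      exact (abs_sub _ _).trans (add_le_add tY ((abs_slopeY_le hl bT).trans (slope k hk)))
    have h3 : 2 * (4 * C₁) * (2 / N) / 1 = 16 * C₁ / (N : ℝ) := by ring
    have h4 : 24 * C₁ / (N : ℝ) = 16 * C₁ / N + 8 * C₁ / N := by ring
    rw [h3] at h1
    exact (abs_add_le _ _).trans (by linarith)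
  · rw [abs_mul, abs_neg, abs_of_pos hε, eXX, eYY]
    have e1 : |dX (dX A) p + dX (dX T) p + (dY (dY A) p + dY (dY T) p)| ≤
        |dX (dX A) p| + |dX (dX T) p| + (|dY (dY A) p| + |dY (dY T) p|) :=
      (abs_add_le _ _).trans (add_le_add (abs_add_le _ _) (abs_add_le _ _))
    have e2 := mul_le_mul_of_nonneg_left e1 hε.le
    have e3 : ε * (4 * C₁) ≤ 4 * C₁ / N := by
      rw [le_div_iff₀ hN]
      have := mul_le_mul_of_nonneg_right hP.ε_mul_le hC
      linarith
    have e4 := mul_le_mul_of_nonneg_left aXX hε.le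
    have e5 := mul_le_mul_of_nonneg_left aYY hε.le
    have e6 : 8 * C₁ / (N : ℝ) = 4 * C₁ / N + 4 * C₁ / N := by ring
    rw [mul_add, mul_add, mul_add] at e2
    linarith

end


/-! ### The error of the method against the interpolant -/

section

variable {n : ℕ} {X Y : ℕ → ℝ}

theorem integral_split_x (hX : IsGrid n X) (hY : IsGrid n Y) {F : ℝ × ℝ → ℝ} (hF : BM F)
    {m j₀ j₁ : ℕ} (hm : m ≤ n) (hj0 : j₀ ≤ n) (hj : j₁ ≤ n) :
    ∫ p in block X Y 0 n j₀ j₁, F p =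
      (∫ p in block X Y 0 m j₀ j₁, F p) + ∫ p in block X Y m n j₀ j₁, F p := by
  rw [integral_block_x hX hY hF (Nat.zero_le _) le_rfl hj0 hj,
    integral_block_x hX hY hF (Nat.zero_le _) hm hj0 hj, integral_block_x hX hY hF hm le_rfl hj0 hj,
    Finset.sum_Ico_consecutive _ (Nat.zero_le _) hm]

theorem integral_split_y (hX : IsGrid n X) (hY : IsGrid n Y) {F : ℝ × ℝ → ℝ} (hF : BM F)
    {m i₀ i₁ : ℕ} (hm : m ≤ n) (hi0 : i₀ ≤ n) (hi : i₁ ≤ n) :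
    ∫ p in block X Y i₀ i₁ 0 n, F p =
      (∫ p in block X Y i₀ i₁ 0 m, F p) + ∫ p in block X Y i₀ i₁ m n, F p := by
  rw [integral_block_y hX hY hF (Nat.zero_le _) le_rfl hi0 hi,
    integral_block_y hX hY hF (Nat.zero_le _) hm hi0 hi, integral_block_y hX hY hF hm le_rfl hi0 hi,
    Finset.sum_Ico_consecutive _ (Nat.zero_le _) hm]

theorem integral_four (hX : IsGrid n X) (hY : IsGrid n Y) {F : ℝ × ℝ → ℝ} (hF : BM F) {m : ℕ}
    (hm : m ≤ n) : ∫ p in Omega, F p =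
      (∫ p in block X Y 0 m 0 m, F p) + (∫ p in block X Y m n 0 m, F p) +
      (∫ p in block X Y 0 m m n, F p) + ∫ p in block X Y m n m n, F p := by
  rw [← integral_hSquare, ← block_full hX hY,
    integral_split_x hX hY hF hm (Nat.zero_le _) le_rfl,
    integral_split_y hX hY hF hm (Nat.zero_le _) hm, integral_split_y hX hY hF hm hm le_rfl]
  ring

theorem ae_four (hX : IsGrid n X) (hY : IsGrid n Y) {m : ℕ} {P : ℝ × ℝ → Prop}
    (h1 : ∀ᵐ p ∂(volume.restrict (block X Y 0 m 0 m)), P p)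
    (h2 : ∀ᵐ p ∂(volume.restrict (block X Y m n 0 m)), P p)
    (h3 : ∀ᵐ p ∂(volume.restrict (block X Y 0 m m n)), P p)
    (h4 : ∀ᵐ p ∂(volume.restrict (block X Y m n m n)), P p) :
    ∀ᵐ p ∂(volume.restrict hSquare), P p := by
  have hsub : hSquare ⊆ (block X Y 0 m 0 m ∪ block X Y m n 0 m) ∪
      (block X Y 0 m m n ∪ block X Y m n m n) := by
    intro p hp
    rw [← block_full hX hY] at hp
    obtain ⟨⟨x0, x1⟩, y0, y1⟩ := hp
    rcases le_or_gt p.1 (X m) with hx | hx <;> rcases le_or_gt p.2 (Y m) with hy | hy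
    · exact Or.inl (Or.inl ⟨⟨x0, hx⟩, y0, hy⟩)
    · exact Or.inr (Or.inl ⟨⟨x0, hx⟩, hy, y1⟩)
    · exact Or.inl (Or.inr ⟨⟨hx, x1⟩, y0, hy⟩)
    · exact Or.inr (Or.inr ⟨⟨hx, x1⟩, hy, y1⟩)
  have h : ∀ᵐ p ∂(volume.restrict ((block X Y 0 m 0 m ∪ block X Y m n 0 m) ∪
      (block X Y 0 m m n ∪ block X Y m n m n))), P p := by
    rw [ae_restrict_union_iff, ae_restrict_union_iff, ae_restrict_union_iff]
    exact ⟨⟨h1, h2⟩, h3, h4⟩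
  exact ae_mono (Measure.restrict_mono hsub le_rfl) h

theorem volume_real_hSquare : volume.real hSquare = 1 := by
  unfold hSquare
  rw [volume_real_rect zero_le_one zero_le_one]; norm_num

theorem integral_abs_sq_le {G : ℝ × ℝ → ℝ} (hG : BM G) {S : Set (ℝ × ℝ)} (hS : S ⊆ hSquare) :
    (∫ p in S, |G p|) ^ 2 ≤ ∫ p in S, G p ^ 2 := by
  have h := integral_mul_sq_le (μ := volume.restrict S) (F := fun _ => (1 : ℝ))
    (G := fun p => |G p|) ((BM.const 1).sq.intOn hS) (((BM.const 1).mul hG.abs).intOn hS)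
    (hG.abs.sq.intOn hS)
  simp only [one_mul, one_pow, sq_abs, integral_const, MeasurableSet.univ,
    measureReal_restrict_apply, univ_inter, smul_eq_mul, mul_one] at h
  refine h.trans (mul_le_of_le_one_left (integral_nonneg fun p => sq_nonneg _) ?_)
  rw [← volume_real_hSquare]
  exact measureReal_mono hS (volume_real_hSquare_subset le_rfl).ne

/-- The uniform part of `F` is paired with the integral of `|G|`, the concentrated part `W` with the
supremum of `|G|`. -/
theorem integral_le_add_tail {F G W : ℝ × ℝ → ℝ} (hF : BM F) (hG : BM G) (hW : BM W)
    {S : Set (ℝ × ℝ)} (hS : S ⊆ hSquare) {a t g r w : ℝ} (ha : 0 ≤ a) (ht : 0 ≤ t) (hg : 0 ≤ g)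
    (hW0 : ∀ p, 0 ≤ W p)
    (hFa : ∀ᵐ p ∂(volume.restrict S), |F p| ≤ a + t * W p)
    (hGg : ∀ᵐ p ∂(volume.restrict S), |G p| ≤ g) (hr : ∫ p in S, |G p| ≤ r)
    (hw : ∫ p in S, W p ≤ w) : ∫ p in S, |F p| * |G p| ≤ a * r + t * g * w := by
  have h : ∫ p in S, |F p| * |G p| ≤ ∫ p in S, (a * |G p| + t * g * W p) := by
    refine integral_mono_ae ((hF.abs.mul hG.abs).intOn hS)
      ((((BM.const a).mul hG.abs).add ((BM.const (t * g)).mul hW)).intOn hS) ?_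
    filter_upwards [hFa, hGg] with p h1 h2
    have h3 := mul_le_mul_of_nonneg_right h1 (abs_nonneg (G p))
    have h4 := mul_le_mul_of_nonneg_left h2 (mul_nonneg ht (hW0 p))
    nlinarith
  rw [integral_add (((BM.const a).mul hG.abs).intOn hS) (((BM.const (t * g)).mul hW).intOn hS),
    integral_const_mul, integral_const_mul] at h
  exact h.trans (add_le_add (mul_le_mul_of_nonneg_left hr ha)
    (mul_le_mul_of_nonneg_left hw (mul_nonneg ht hg)))

end

/-! ### The four terms of the error equation -/

section

variable {b₁ b₂ c : ℝ × ℝ → ℝ} {β₁ β₂ μ₀ : ℝ}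

theorem Coefficients.exists_bound (hb : Coefficients b₁ b₂ c β₁ β₂ μ₀) : ∃ B : ℝ, 0 ≤ B ∧
    ∀ p ∈ closedSquare, |b₁ p| ≤ B ∧ |b₂ p| ≤ B ∧ |c p| ≤ B ∧ |c p - divb b₁ b₂ p| ≤ B := by
  have k : ∀ {f : ℝ × ℝ → ℝ}, ContinuousOn f closedSquare →
      ∃ B, ∀ p ∈ closedSquare, |f p| ≤ B := fun hf =>
    isCompact_closedSquare.exists_bound_of_continuousOn hf
  obtain ⟨B1, h1⟩ := k hb.smooth_b₁.continuousOn
  obtain ⟨B2, h2⟩ := k hb.smooth_b₂.continuousOn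
  obtain ⟨B3, h3⟩ := k hb.cont_c
  obtain ⟨B4, h4⟩ := k (hb.cont_c.sub hb.continuousOn_divb)
  refine ⟨max (max (max 0 B1) B2) (max B3 B4), by simp, fun p hp => ⟨?_, ?_, ?_, ?_⟩⟩
  · exact (h1 p hp).trans (by simp)
  · exact (h2 p hp).trans (by simp)
  · exact (h3 p hp).trans (by simp)
  · exact (h4 p hp).trans (by simp)

variable {N : ℕ} {ε s C₁ B Cs : ℝ} {u χ : ℝ × ℝ → ℝ}

theorem Params.sqrt_N_le (hP : Params N ε β₁ β₂) (hCs : 0 < Cs) :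
    √(N / Cs) / N ^ 2 ≤ 1 / √Cs * eta N := by
  have hN := hP.N_pos
  refine le_mul_eta (by positivity) ?_
  rw [div_pow, div_pow, Real.sq_sqrt (by positivity), Real.sq_sqrt hCs.le]
  have e : N / Cs / ((N : ℝ) ^ 2) ^ 2 = 1 ^ 2 / Cs * (1 / N ^ 3) := by field_simp
  rw [e]
  exact mul_le_mul_of_nonneg_left hP.inv_cube_le (by positivity)

/-- The constant in the estimate of the layer terms on the coarse region. -/
def tailConst (C₁ β₁ β₂ μ₀ : ℝ) : ℝ := 84 / √μ₀ * (2 * C₁ * (1 / β₁ + 1 / β₂))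

theorem tailConst_nonneg (hP : Params N ε β₁ β₂) (hC : 0 ≤ C₁) : 0 ≤ tailConst C₁ β₁ β₂ μ₀ := by
  have := hP.β₁_pos
  have := hP.β₂_pos
  unfold tailConst; positivity

/-- The smooth part gives `ε · N⁻¹ · s/√ε = (√ε/N) s`. The layer part gives `ε · N² s · θ = (ε N)(N
θ) s`, by the inverse estimate for `G` and the integral of `tail`. Both are at most of order `η s`.
-/
theorem Params.coarse_grad (hP : Params N ε β₁ β₂) (hC : 0 ≤ C₁) (hs : 0 ≤ s) {F G : ℝ × ℝ → ℝ}
    (hF : BM F) (hG : BM G)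
    (hFa : ∀ᵐ p ∂(volume.restrict (coarse N (node N ε β₁) (node N ε β₂))),
      |F p| ≤ 24 * C₁ / N + tail C₁ ε β₁ β₂ p)
    (hGg : ∀ᵐ p ∂(volume.restrict (coarse N (node N ε β₁) (node N ε β₂))),
      |G p| ≤ 84 / √μ₀ * N ^ 2 * s) (hGs : ∫ p in Omega, G p ^ 2 ≤ s ^ 2 / ε) :
    |ε * ∫ p in coarse N (node N ε β₁) (node N ε β₂), F p * G p| ≤
      (24 * C₁ + tailConst C₁ β₁ β₂ μ₀) * eta N * s := by
  have hε := hP.ε_pos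
  have hN := hP.N_pos
  have hS := coarse_subset hP.isGrid hP.swap.isGrid
  have hθ := theta_pos N
  have hG1 : ∫ p in coarse N (node N ε β₁) (node N ε β₂), |G p| ≤ s / √ε := by
    refine (abs_le_of_sq_le_sq' ?_ (by positivity)).2
    rw [div_pow, Real.sq_sqrt hε.le]
    exact (integral_abs_sq_le hG hS).trans ((integral_le_Omega hG.sq (fun _ => sq_nonneg _) hS).trans
      hGs)
  have h := abs_mul_integral_le hε.le (integral_le_add_tail hF hG bm_tail hS
    (a := 24 * C₁ / N) (t := 1) (by positivity) zero_le_one (by positivity) (tail_nonneg hC hε)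
    (by simpa only [one_mul] using hFa) hGg hG1 (hP.integral_tail_le hC))
  refine h.trans ?_
  have e : ε * (24 * C₁ / N * (s / √ε) + 1 * (84 / √μ₀ * N ^ 2 * s) *
      (2 * C₁ * (1 / β₁ + 1 / β₂) * theta N)) =
      24 * C₁ * (√ε / N) * s + tailConst C₁ β₁ β₂ μ₀ * ((ε * N) * (N * theta N)) * s := by
    have : ε * (24 * C₁ / N * (s / √ε)) = 24 * C₁ * (√ε / N) * s := by
      nth_rewrite 1 [← Real.mul_self_sqrt hε.le]
      have := Real.sqrt_pos.2 hε
      field_simp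
    rw [mul_add, this]
    unfold tailConst; ring
  rw [e]
  have hT := tailConst_nonneg (μ₀ := μ₀) hP hC
  have h1 : √ε / N ≤ eta N := by simpa using hP.sqrt_eps_div_le
  have h2 : (ε * N) * (N * theta N) ≤ eta N := by
    have h3 : N * theta N ≤ eta N := by simpa using hP.N_theta_le
    exact (mul_le_of_le_one_left (by positivity) hP.ε_mul_le).trans h3
  have h3 := mul_le_mul_of_nonneg_right
    (mul_le_mul_of_nonneg_left h1 (show 0 ≤ 24 * C₁ by positivity)) hs
  have h4 := mul_le_mul_of_nonneg_right (mul_le_mul_of_nonneg_left h2 hT) hs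
  linarith

theorem convect_sub_interp {n : ℕ} {X Y : ℕ → ℝ} (hX : IsGrid n X) (hY : IsGrid n Y)
    (hu : ContDiffOn ℝ 1 u closedSquare) {p : ℝ × ℝ} (hp : p ∈ goodSet n X Y) :
    convect b₁ b₂ (u - interp n X Y u) p = b₁ p * errX n X Y u p + b₂ p * errY n X Y u p := by
  rw [(PW.of_smooth hX hY hu).convect_sub hX hY ((isPL_interp hX hY).pw hX hY) hp]
  unfold convect errX errY
  ring

variable (hB : ∀ p ∈ closedSquare, |b₁ p| ≤ B ∧ |b₂ p| ≤ B ∧ |c p| ≤ B ∧ |c p - divb b₁ b₂ p| ≤ B)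

include hB

theorem abs_convect_le {p : ℝ × ℝ} (hp : p ∈ closedSquare) :
    |convect b₁ b₂ χ p| ≤ B * (|dX χ p| + |dY χ p|) := by
  have h1 := mul_le_mul_of_nonneg_right (hB p hp).1 (abs_nonneg (dX χ p))
  have h2 := mul_le_mul_of_nonneg_right (hB p hp).2.1 (abs_nonneg (dY χ p))
  unfold convect
  refine (abs_add_le _ _).trans ?_
  rw [abs_mul, abs_mul]
  linarith

variable (hB0 : 0 ≤ B) (hb : Coefficients b₁ b₂ c β₁ β₂ μ₀) (hP : Params N ε β₁ β₂)
  (hu : HasDecomposition C₁ ε β₁ β₂ u)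
  (hχ : TestFn N (node N ε β₁) (node N ε β₂) ε μ₀ χ s) (hCs : 0 < Cs)
  (hcv : Cs / N * ∫ p in coarse N (node N ε β₁) (node N ε β₂), convect b₁ b₂ χ p ^ 2 ≤ s ^ 2)

include hB0 hb hP hu hχ

omit hu in
theorem coarse_convect_le :
    ∀ᵐ p ∂(volume.restrict (coarse N (node N ε β₁) (node N ε β₂))),
      |convect b₁ b₂ χ p| ≤ 2 * B * (84 / √μ₀ * N ^ 2 * s) := by
  have hS := coarse_subset hP.isGrid hP.swap.isGrid
  filter_upwards [hχ.ae_grad_le hP hb.μ₀_pos, ae_restrict_mem (measurableSet_block _ _ _ _ _ _)]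
    with p hp hm
  refine (abs_convect_le hB (hSquare_subset (hS hm))).trans ?_
  have := mul_le_mul_of_nonneg_left (add_le_add hp.1 hp.2) hB0
  linarith

theorem BlockBound.convect {i₀ i₁ j₀ j₁ : ℕ} {K : ℝ} (hi0 : i₀ ≤ N) (hi : i₁ ≤ N) (hj0 : j₀ ≤ N)
    (hj : j₁ ≤ N) (h : BlockBound N (node N ε β₁) (node N ε β₂) i₀ i₁ j₀ j₁ ε u χ K) :
    ∫ p in block (node N ε β₁) (node N ε β₂) i₀ i₁ j₀ j₁,
      |u p - interp N (node N ε β₁) (node N ε β₂) u p| * |SDFEM.convect b₁ b₂ χ p| ≤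
        2 * B * K := by
  have hX := hP.isGrid
  have hY := hP.swap.isGrid
  have hS := block_subset hX hY hi0 hi hj0 hj
  have hw := (bm_interp_error hX hY hu.smooth.continuousOn).abs
  have hpw := hχ.pl.pw hX hY
  have h1 := hw.mul hpw.bm_dX.abs
  have h2 := hw.mul hpw.bm_dY.abs
  have k : ∫ p in block (node N ε β₁) (node N ε β₂) i₀ i₁ j₀ j₁,
      |u p - interp N (node N ε β₁) (node N ε β₂) u p| * |SDFEM.convect b₁ b₂ χ p| ≤
      ∫ p in block (node N ε β₁) (node N ε β₂) i₀ i₁ j₀ j₁,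
        B * (|u p - interp N (node N ε β₁) (node N ε β₂) u p| * |dX χ p| +
          |u p - interp N (node N ε β₁) (node N ε β₂) u p| * |dY χ p|) := by
    refine setIntegral_mono_on ((hw.mul (hpw.bm_convect hb).abs).intOn hS)
      (((BM.const B).mul (h1.add h2)).intOn hS) (measurableSet_block _ _ _ _ _ _) fun p hp => ?_
    have := mul_le_mul_of_nonneg_left (abs_convect_le (χ := χ) hB (hSquare_subset (hS hp)))
      (abs_nonneg (u p - interp N (node N ε β₁) (node N ε β₂) u p))
    linarith
  rw [integral_const_mul, integral_add (h1.intOn hS) (h2.intOn hS)] at k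
  have := mul_le_mul_of_nonneg_left (add_le_add h.valX h.valY) hB0
  linarith

include hCs hcv

-- Here the stabilization pays off: the streamline derivative is bounded with a factor `√N` instead
-- of the `ε^(-1/2)` that the energy norm alone would give.
omit hB hB0 hu in
theorem coarse_integral_convect_le :
    ∫ p in coarse N (node N ε β₁) (node N ε β₂), |convect b₁ b₂ χ p| ≤ √(N / Cs) * s := by
  have hX := hP.isGrid
  have hY := hP.swap.isGrid
  have hN := hP.N_pos
  have hs := hχ.nonneg
  refine (abs_le_of_sq_le_sq' ?_ (by positivity)).2
  rw [mul_pow, Real.sq_sqrt (by positivity)]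
  refine (integral_abs_sq_le ((hχ.pl.pw hX hY).bm_convect hb) (coarse_subset hX hY)).trans ?_
  have := mul_le_mul_of_nonneg_left hcv (show 0 ≤ N / Cs by positivity)
  refine le_trans (le_of_eq ?_) this
  field_simp

/-- The convective part of the error. -/
theorem convect_error_le :
    |∫ p in Omega, (u p - interp N (node N ε β₁) (node N ε β₂) u p) * convect b₁ b₂ χ p| ≤
      (104 * C₁ * (1 / √Cs) + 6 * B * fineConst (4 * C₁) β₁ β₂) * eta N * s := by
  have hX := hP.isGrid
  have hY := hP.swap.isGrid
  have hN := hP.N_pos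
  have hh := hP.half_pos.2.le
  have hC := hu.nonneg
  have hs := hχ.nonneg
  have hw := bm_interp_error hX hY hu.smooth.continuousOn
  have hcχ := (hχ.pl.pw hX hY).bm_convect hb
  have hS := coarse_subset hX hY
  -- On the coarse part the values of the interpolation error are uniformly `O(N⁻²)`, so the tail is
  -- switched off by `t := 0`.
  have h0 := integral_le_add_tail hw hcχ bm_tail hS (a := 104 * C₁ / N ^ 2) (t := 0)
    (by positivity) le_rfl (by positivity) (tail_nonneg hC hP.ε_pos)
    (by filter_upwards [hP.ae_coarseError hu] with p hp using by linarith [hp.val])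
    (coarse_convect_le hB hB0 hb hP hχ)
    (coarse_integral_convect_le hb hP hχ hCs hcv) (hP.integral_tail_le hC)
  have h1 := (blockBound_fine_coarse hP hu hχ).convect hB hB0 hb hP hu hχ hh le_rfl
    (Nat.zero_le _) hh
  have h2 := (blockBound_coarse_fine hP hu hχ).convect hB hB0 hb hP hu hχ (Nat.zero_le _) hh
    hh le_rfl
  have h3 := (blockBound_fine_fine hP hu hχ).convect hB hB0 hb hP hu hχ hh le_rfl hh le_rfl
  refine (abs_integral_le_integral_abs).trans ?_
  simp only [abs_mul]
  rw [integral_four hX hY (hw.abs.mul hcχ.abs) hh]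
  have h4 : 104 * C₁ / (N : ℝ) ^ 2 * (√(N / Cs) * s) = 104 * C₁ * (√(N / Cs) / N ^ 2) * s := by
    ring
  have h5 := mul_le_mul_of_nonneg_right (mul_le_mul_of_nonneg_left (hP.sqrt_N_le hCs)
    (show 0 ≤ 104 * C₁ by positivity)) hs
  rw [h4] at h0
  unfold coarse at h0
  linarith

/-- The stabilization part of the error. -/
theorem stab_error_le :
    |Cs / N * ∫ p in coarse N (node N ε β₁) (node N ε β₂),
      (-ε * (dX (dX u) p + dY (dY u) p) +
        convect b₁ b₂ (u - interp N (node N ε β₁) (node N ε β₂) u) p +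
        c p * (u - interp N (node N ε β₁) (node N ε β₂) u) p) * convect b₁ b₂ χ p| ≤
      (Cs * ((8 + 152 * B) * C₁) * (1 / √Cs) +
        Cs * ((2 + 2 * B) * (2 * B)) * tailConst C₁ β₁ β₂ μ₀) * eta N * s := by
  have hX := hP.isGrid
  have hY := hP.swap.isGrid
  have hN := hP.N_pos
  have hh := hP.half_pos.2.le
  have hC := hu.nonneg
  have hs := hχ.nonneg
  have hθ := theta_pos N
  have hcχ := (hχ.pl.pw hX hY).bm_convect hb
  have hS := coarse_subset hX hY
  have hsm := hu.smooth
  have hpw : PW N (node N ε β₁) (node N ε β₂) u := PW.of_smooth hX hY (hsm.of_le (by norm_num))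
  have hwpw := hpw.sub hX hY ((isPL_interp (g := u) hX hY).pw hX hY)
  have hj : JetBound (fun _ _ => 0) ∅ u := ⟨hsm, fun _ _ _ p hp => absurd hp (notMem_empty p)⟩
  have hXX : BM (dX (dX u)) := (PW.of_smooth (v := dX u) hX hY (hj.smooth_dX.of_le (by norm_num))).bm_dX
  have hYY : BM (dY (dY u)) := (PW.of_smooth (v := dY u) hX hY (hj.smooth_dY.of_le (by norm_num))).bm_dY
  have hF : BM fun p => -ε * (dX (dX u) p + dY (dY u) p) +
        convect b₁ b₂ (u - interp N (node N ε β₁) (node N ε β₂) u) p +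
        c p * (u - interp N (node N ε β₁) (node N ε β₂) u) p :=
    (((BM.const (-ε)).mul (hXX.add hYY)).add (hwpw.bm_convect hb)).add (hb.bmc.mul hwpw.bm)
  -- `8` comes from the Laplacian and `152 B = 2 · 24 B + 104 B` from the two gradient components
  -- and the reaction term; the tail enters twice through the Laplacian and twice, with factor `B`,
  -- through the gradient.
  have h0 := integral_le_add_tail hF hcχ bm_tail hS (a := (8 + 152 * B) * C₁ / N) (t := 2 + 2 * B)
    (by positivity) (by positivity) (by positivity) (tail_nonneg hC hP.ε_pos) (by
      filter_upwards [hP.ae_coarseError hu, ae_of_Omega (ae_mem_goodSet hX hY) hS,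
        ae_restrict_mem (measurableSet_block _ _ _ _ _ _)] with p hp hg hm
      have hpc := hSquare_subset (hS hm)
      obtain ⟨q1, q2, q3, -⟩ := hB p hpc
      rw [convect_sub_interp hX hY (hsm.of_le (by norm_num)) hg]
      have a1 := mul_le_mul q1 hp.gradX (abs_nonneg _) hB0
      have a2 := mul_le_mul q2 hp.gradY (abs_nonneg _) hB0
      have a3 := mul_le_mul q3 hp.val (abs_nonneg _) hB0
      rw [← abs_mul] at a1 a2 a3
      have a4 : B * (104 * C₁ / N ^ 2) ≤ B * (104 * C₁ / N) := by
        refine mul_le_mul_of_nonneg_left (div_le_div_of_nonneg_left (by positivity) hN ?_) hB0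
        nlinarith [hP.N_ge]
      refine (abs_add_le _ _).trans ((add_le_add_left ((abs_add_le _ _).trans
        (add_le_add hp.lap (abs_add_le _ _))) _).trans ?_)
      rw [Pi.sub_apply]
      have e : (8 + 152 * B) * C₁ / (N : ℝ) = 8 * C₁ / N + 2 * (B * (24 * C₁ / N)) +
        B * (104 * C₁ / N) := by ring
      rw [e]
      linarith)
    (coarse_convect_le hB hB0 hb hP hχ)
    (coarse_integral_convect_le hb hP hχ hCs hcv) (hP.integral_tail_le hC)
  refine (abs_mul_integral_le (by positivity) h0).trans ?_
  have e : Cs / N * ((8 + 152 * B) * C₁ / N * (√(N / Cs) * s) +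
      (2 + 2 * B) * (2 * B * (84 / √μ₀ * N ^ 2 * s)) *
        (2 * C₁ * (1 / β₁ + 1 / β₂) * theta N)) =
      Cs * ((8 + 152 * B) * C₁) * (√(N / Cs) / N ^ 2) * s +
      Cs * ((2 + 2 * B) * (2 * B)) * tailConst C₁ β₁ β₂ μ₀ * (N * theta N) * s := by
    unfold tailConst; field_simp
  rw [e]
  have hT := tailConst_nonneg (μ₀ := μ₀) hP hC
  have h1 := mul_le_mul_of_nonneg_right (mul_le_mul_of_nonneg_left (hP.sqrt_N_le hCs)
    (show 0 ≤ Cs * ((8 + 152 * B) * C₁) by positivity)) hs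
  have h2 : N * theta N ≤ eta N := by simpa using hP.N_theta_le
  have h3 := mul_le_mul_of_nonneg_right (mul_le_mul_of_nonneg_left h2
    (show 0 ≤ Cs * ((2 + 2 * B) * (2 * B)) * tailConst C₁ β₁ β₂ μ₀ by positivity)) hs
  linarith

omit hCs hcv

omit hB hB0 in
theorem diffusion_error_le :
    |ε * ∫ p in Omega, (errX N (node N ε β₁) (node N ε β₂) u p * dX χ p +
      errY N (node N ε β₁) (node N ε β₂) u p * dY χ p)| ≤
      (2 * (24 * C₁ + tailConst C₁ β₁ β₂ μ₀) + 6 * fineConst (4 * C₁) β₁ β₂) * eta N * s := by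
  have hX := hP.isGrid
  have hY := hP.swap.isGrid
  have hh := hP.half_pos.2.le
  have hj : JetBound (fun _ _ => 0) ∅ u := ⟨hu.smooth, fun _ _ _ p hp => absurd hp (notMem_empty p)⟩
  have eX := hj.bm_errX hX hY
  have eY := hj.bm_errY hX hY
  have cX := hχ.pl.bm_dX hX hY
  have cY := hχ.pl.bm_dY hX hY
  have k1 := hP.coarse_grad hu.nonneg hχ.nonneg eX cX
    (by filter_upwards [hP.ae_coarseError hu] with p hp using hp.gradX)
    (by filter_upwards [hχ.ae_grad_le hP hb.μ₀_pos] with p hp using hp.1) (hχ.dX_le hP.ε_pos)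
  have k2 := hP.coarse_grad hu.nonneg hχ.nonneg eY cY
    (by filter_upwards [hP.ae_coarseError hu] with p hp using hp.gradY)
    (by filter_upwards [hχ.ae_grad_le hP hb.μ₀_pos] with p hp using hp.2) (hχ.dY_le hP.ε_pos)
  have h1 := blockBound_fine_coarse hP hu hχ
  have h2 := blockBound_coarse_fine hP hu hχ
  have h3 := blockBound_fine_fine hP hu hχ
  rw [integral_add (eX.mul cX).int (eY.mul cY).int, integral_four hX hY (eX.mul cX) hh,
    integral_four hX hY (eY.mul cY) hh, abs_le]
  have k1 := abs_le.1 k1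
  have k2 := abs_le.1 k2
  have a1 := abs_le.1 h1.gradX
  have a2 := abs_le.1 h2.gradX
  have a3 := abs_le.1 h3.gradX
  have c1 := abs_le.1 h1.gradY
  have c2 := abs_le.1 h2.gradY
  have c3 := abs_le.1 h3.gradY
  unfold coarse at k1 k2
  constructor <;> linarith

omit hB hB0 hb hχ in
theorem ae_interp_error_le : ∀ᵐ p ∂(volume.restrict hSquare),
    |u p - interp N (node N ε β₁) (node N ε β₂) u p| ≤ 32 * C₁ * rho N β₁ β₂ ^ 2 := by
  have hX := hP.isGrid
  have hY := hP.swap.isGrid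
  have hC : 0 ≤ 4 * C₁ := by linarith [hu.nonneg]
  have e : 8 * (4 * C₁) = 32 * C₁ := by ring
  refine ae_four hX hY (m := N / 2) ?_ ?_ ?_ ?_
  · filter_upwards [hP.ae_coarseError hu] with p hp
    refine hp.val.trans ?_
    have h1 := pow_le_pow_left₀ (by have := hP.N_pos; positivity) hP.rho_ge 2
    have h2 := mul_le_mul_of_nonneg_left h1 hu.nonneg
    have h3 : C₁ * (2 / (N : ℝ)) ^ 2 = 4 * (C₁ / N ^ 2) := by ring
    have h4 : 104 * C₁ / (N : ℝ) ^ 2 = 104 * (C₁ / N ^ 2) := by ring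
    have h5 : 0 ≤ C₁ / (N : ℝ) ^ 2 := div_nonneg hu.nonneg (sq_nonneg _)
    linarith
  · have hr := hP.region_fine_coarse
    obtain ⟨A, T, hs⟩ := hu.splitting_fine_coarse hP hr.blockR_subset fun p hp => hp.2.2
    filter_upwards [hr.ae_interpError hs] with p hp
    rw [← e]; exact hp.val_le hP hC
  · have hr := hP.swap.region_fine_coarse
    obtain ⟨A, T, hs⟩ := hu.swap.splitting_fine_coarse hP.swap hr.blockR_subset fun p hp => hp.2.2
    have hs' := hs.swap hr.blockR_subset
    rw [blockR_swap] at hs'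
    filter_upwards [hr.swap.ae_interpError hs'] with p hp
    rw [← e, ← rho_comm]
    exact hp.val_le hP.swap hC
  · have hr := hP.region_fine_fine
    obtain ⟨A, T, hs⟩ := hu.splitting_fine_fine hP (blockR (node N ε β₁) (node N ε β₂) (N / 2) N
      (N / 2) N)
    filter_upwards [hr.ae_interpError hs] with p hp
    rw [← e]; exact hp.val_le hP hC

theorem reaction_error_le :
    |∫ p in Omega, (c p - divb b₁ b₂ p) *
      ((u p - interp N (node N ε β₁) (node N ε β₂) u p) * χ p)| ≤
      B * (32 * C₁ * sigma β₁ β₂ ^ 2 * (1 / √μ₀)) * eta N * s := by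
  have hX := hP.isGrid
  have hY := hP.swap.isGrid
  have hC := hu.nonneg
  have hs := hχ.nonneg
  have hμ := hb.μ₀_pos
  have hw := bm_interp_error hX hY hu.smooth.continuousOn
  have h := integral_abs_mul_le hw hχ.pl.bm le_rfl (ae_interp_error_le hP hu)
    volume_real_hSquare.le (g := s ^ 2 / μ₀) (by rw [le_div_iff₀ hμ, mul_comm]; exact hχ.val)
    (r := 32 * C₁ * rho N β₁ β₂ ^ 2 * (1 / √μ₀) * s) (by positivity)
    (by rw [mul_pow _ s, mul_pow _ (1 / √μ₀), div_pow, Real.sq_sqrt hμ.le]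
        exact le_of_eq (by ring))
  have h1 : |∫ p in Omega, (c p - divb b₁ b₂ p) *
      ((u p - interp N (node N ε β₁) (node N ε β₂) u p) * χ p)| ≤
      ∫ p in hSquare, B * (|u p - interp N (node N ε β₁) (node N ε β₂) u p| * |χ p|) := by
    rw [integral_hSquare]
    refine (abs_integral_le_integral_abs).trans ?_
    refine setIntegral_mono_on (((hb.bmc.sub hb.bm_divb).mul (hw.mul hχ.pl.bm)).abs.int)
      ((BM.const B).mul (hw.abs.mul hχ.pl.bm.abs)).int isOpen_Omega.measurableSet fun p hp => ?_
    rw [abs_mul, abs_mul]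
    exact mul_le_mul_of_nonneg_right (hB p (Omega_subset hp)).2.2.2 (by positivity)
  rw [integral_const_mul] at h1
  have h2 := mul_le_mul_of_nonneg_left h hB0
  have h3 : 32 * C₁ * rho N β₁ β₂ ^ 2 * (1 / √μ₀) * s ≤
      32 * C₁ * (sigma β₁ β₂ ^ 2 * eta N) * (1 / √μ₀) * s := by
    have := hP.rho_sq_le
    gcongr
  have h4 := mul_le_mul_of_nonneg_left h3 hB0
  linarith

end

/-- The error of the method against the interpolant. -/
theorem discrete_error {b₁ b₂ c : ℝ × ℝ → ℝ} {β₁ β₂ μ₀ : ℝ}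
    (hb : Coefficients b₁ b₂ c β₁ β₂ μ₀) {Cs : ℝ} (hCs : 0 < Cs) (C₁ : ℝ) :
    ∃ K : ℝ, ∀ (N : ℕ) (ε : ℝ), Params N ε β₁ β₂ →
      IsCoercive Cs N (node N ε β₁) (node N ε β₂) ε μ₀ b₁ b₂ c →
      ∀ f u uN : ℝ × ℝ → ℝ, IsSolution ε b₁ b₂ c f u → HasDecomposition C₁ ε β₁ β₂ u →
        IsSDFEMSolution Cs N (node N ε β₁) (node N ε β₂) ε b₁ b₂ c f uN →
        energySq ε μ₀ (interp N (node N ε β₁) (node N ε β₂) u - uN) ≤ (K * eta N) ^ 2 := by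
  obtain ⟨B, hB0, hB⟩ := hb.exists_bound
  refine ⟨2 * ((2 * (24 * C₁ + tailConst C₁ β₁ β₂ μ₀) + 6 * fineConst (4 * C₁) β₁ β₂) +
    (104 * C₁ * (1 / √Cs) + 6 * B * fineConst (4 * C₁) β₁ β₂) +
    B * (32 * C₁ * sigma β₁ β₂ ^ 2 * (1 / √μ₀)) +
    (Cs * ((8 + 152 * B) * C₁) * (1 / √Cs) +
        Cs * ((2 + 2 * B) * (2 * B)) * tailConst C₁ β₁ β₂ μ₀)), ?_⟩
  intro N ε hP hco f u uN hsol hu hN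
  have hX := hP.isGrid
  have hY := hP.swap.isGrid
  have hn : 0 < N := by have := hP.four_le; omega
  have hNp := hP.N_pos
  have hε := hP.ε_pos
  have hμ := hb.μ₀_pos
  set χ := interp N (node N ε β₁) (node N ε β₂) u - uN with hχ
  set w := u - interp N (node N ε β₁) (node N ε β₂) u with hw
  have hFE : IsFE N (node N ε β₁) (node N ε β₂) χ :=
    (isFE_interp hX hY hn hsol.bdry).sub hN.mem
  have hpw := hFE.isPL.pw hX hY
  have hupw : PW N (node N ε β₁) (node N ε β₂) u :=
    PW.of_smooth hX hY (hu.smooth.of_le (by norm_num))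
  have hco := hco χ hFE
  rw [error_equation hX hY hn hb hsol (hu.smooth.of_le (by norm_num)) hN hχ hw] at hco
  have hsd := hpw.sdSq_eq hX hY hb Cs ε
  set Z := sdSq Cs N (node N ε β₁) (node N ε β₂) ε μ₀ b₁ b₂ χ with hZ
  have i1 : 0 ≤ ∫ p in Omega, dX χ p ^ 2 := integral_nonneg fun _ => sq_nonneg _
  have i2 : 0 ≤ ∫ p in Omega, dY χ p ^ 2 := integral_nonneg fun _ => sq_nonneg _
  have i3 : 0 ≤ ∫ p in Omega, χ p ^ 2 := integral_nonneg fun _ => sq_nonneg _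
  have i4 : 0 ≤ ∫ p in coarse N (node N ε β₁) (node N ε β₂), convect b₁ b₂ χ p ^ 2 :=
    integral_nonneg fun _ => sq_nonneg _
  have i1' := mul_nonneg hε.le i1
  have i2' := mul_nonneg hε.le i2
  have i3' := mul_nonneg hμ.le i3
  have i4' := mul_nonneg (show 0 ≤ Cs / N by positivity) i4
  have hen : energySq ε μ₀ χ ≤ Z := by rw [hsd]; unfold energySq; linarith
  rw [integral_add hpw.bm_dX.sq.int hpw.bm_dY.sq.int, mul_add] at hsd
  have hZ0 : 0 ≤ Z := by linarith
  have hs2 : √Z ^ 2 = Z := Real.sq_sqrt hZ0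
  -- All summands of `Z` are nonnegative, so `√Z` bounds each part of the norm of `χ`, including the
  -- stabilization part used for `e2` and `e4`.
  have hT : TestFn N (node N ε β₁) (node N ε β₂) ε μ₀ χ √Z :=
    ⟨hFE.isPL, Real.sqrt_nonneg _, by linarith, by linarith, by linarith⟩
  have e1 := diffusion_error_le hb hP hu hT
  have e2 := convect_error_le hB hB0 hb hP hu hT hCs (by linarith)
  have e3 := reaction_error_le hB hB0 hb hP hu hT
  have e4 := stab_error_le hB hB0 hb hP hu hT hCs (by linarith)
  have eg : ∫ p in Omega, (dX w p * dX χ p + dY w p * dY χ p) =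
      ∫ p in Omega, (errX N (node N ε β₁) (node N ε β₂) u p * dX χ p +
      errY N (node N ε β₁) (node N ε β₂) u p * dY χ p) := by
    refine integral_congr_ae ?_
    filter_upwards [ae_mem_goodSet hX hY] with p hp
    have hI := (isPL_interp (g := u) hX hY).pw hX hY
    rw [hw, hupw.dX_sub hX hY hI hp, hupw.dY_sub hX hY hI hp]; rfl
  rw [eg] at hco
  have e1 := (abs_le.1 e1).1
  have e2 := (abs_le.1 e2).2
  have e3 := (abs_le.1 e3).1
  have e4 := (abs_le.1 e4).1
  have hη := eta_nonneg (N := N)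
  have hfin : √Z ^ 2 ≤ (2 * ((2 * (24 * C₁ + tailConst C₁ β₁ β₂ μ₀) +
      6 * fineConst (4 * C₁) β₁ β₂) +
    (104 * C₁ * (1 / √Cs) + 6 * B * fineConst (4 * C₁) β₁ β₂) +
    B * (32 * C₁ * sigma β₁ β₂ ^ 2 * (1 / √μ₀)) +
    (Cs * ((8 + 152 * B) * C₁) * (1 / √Cs) +
        Cs * ((2 + 2 * B) * (2 * B)) * tailConst C₁ β₁ β₂ μ₀)) * eta N) * √Z := by
    rw [hs2]
    simp only [hw, Pi.sub_apply] at hco e4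
    linarith
  refine hen.trans ?_
  rw [← hs2]
  -- The estimate reads `Z ≤ K η √Z`; dividing by `√Z` needs it to be nonzero, and otherwise there
  -- is nothing to show.
  rcases (Real.sqrt_nonneg Z).eq_or_lt with h0 | h0
  · rw [← h0]; simpa using sq_nonneg _
  · refine pow_le_pow_left₀ h0.le ?_ 2
    rw [pow_two] at hfin
    exact le_of_mul_le_mul_right hfin h0


/-! ### The postprocessing operator on macrotriangles -/

/-- The nodes of the macro grid. -/
def macroNode (X : ℕ → ℝ) (i : ℕ) : ℝ := X (2 * i)

/-- A grid with an even number of cells whose macrocells are halved. -/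
structure MacroGrid (N : ℕ) (X : ℕ → ℝ) : Prop where
  grid : IsGrid N X
  even : 2 * (N / 2) = N
  mid : ∀ i < N / 2, X (2 * i + 1) = (X (2 * i) + X (2 * i + 2)) / 2

section

variable {N : ℕ} {X Y : ℕ → ℝ} {i j : ℕ} {a b h k : ℝ} {v u χ : ℝ × ℝ → ℝ}

theorem MacroGrid.isGrid (hX : MacroGrid N X) : IsGrid (N / 2) (macroNode X) :=
  ⟨hX.grid.zero, by rw [macroNode, hX.even]; exact hX.grid.last,
    fun _ hi => node_step hX.grid.lt hi⟩

/-- As `4 ∣ N`, the transition node has the even index `N / 2`. No macrocell straddles it, hence the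
two steps in each macrocell are equal. -/
theorem Params.macroGrid {ε β₁ β₂ : ℝ} (hP : Params N ε β₁ β₂) : MacroGrid N (node N ε β₁) := by
  have h4 := hP.dvd
  refine ⟨hP.isGrid, by omega, fun i hi => ?_⟩
  rcases le_or_gt (2 * i + 2) (N / 2) with h | h
  · rw [node_coarse (show 2 * i + 1 ≤ N / 2 by omega), node_coarse (show 2 * i ≤ N / 2 by omega),
      node_coarse h]
    push_cast; ring
  · rw [hP.node_fine (show N / 2 ≤ 2 * i + 1 by omega), hP.node_fine (show N / 2 ≤ 2 * i by omega),
      hP.node_fine h.le]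
    push_cast; ring

/-- `a, b, h, k` describe a mesh triangle in the macrocell `(i, j)`. -/
def SubTri (X Y : ℕ → ℝ) (i j : ℕ) (a b h k : ℝ) : Prop :=
  ∃ i' j', 2 * i ≤ i' ∧ i' < 2 * i + 2 ∧ 2 * j ≤ j' ∧ j' < 2 * j + 2 ∧ IsTri X Y i' j' a b h k

/-- The three mesh triangles at the corners of a macrotriangle. Their vertices are all six
interpolation points, so the fourth, middle triangle is not needed. -/
theorem IsTri.subTri (hX : MacroGrid N X) (hY : MacroGrid N Y)
    (ht : IsTri (macroNode X) (macroNode Y) i j a b h k) (hi : i < N / 2) (hj : j < N / 2) :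
    SubTri X Y i j a b (h / 2) (k / 2) ∧ SubTri X Y i j (a + h / 2) b (h / 2) (k / 2) ∧
      SubTri X Y i j a (b + k / 2) (h / 2) (k / 2) := by
  have hx := hX.mid i hi
  have hy := hY.mid j hj
  have e1 : macroNode X (i + 1) = X (2 * i + 2) := rfl
  have e2 : macroNode Y (j + 1) = Y (2 * j + 2) := rfl
  have e3 : macroNode X i = X (2 * i) := rfl
  have e4 : macroNode Y j = Y (2 * j) := rfl
  rcases ht with ⟨rfl, rfl, rfl, rfl⟩ | ⟨rfl, rfl, rfl, rfl⟩ <;> rw [e1, e2, e3, e4]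
  · refine ⟨⟨2 * i, 2 * j, by omega, by omega, by omega, by omega, Or.inl ⟨rfl, rfl, ?_, ?_⟩⟩,
      ⟨2 * i + 1, 2 * j, by omega, by omega, by omega, by omega, Or.inl ⟨?_, rfl, ?_, ?_⟩⟩,
      ⟨2 * i, 2 * j + 1, by omega, by omega, by omega, by omega, Or.inl ⟨rfl, ?_, ?_, ?_⟩⟩⟩ <;>
      linarith
  · refine ⟨⟨2 * i + 1, 2 * j + 1, by omega, by omega, by omega, by omega,
        Or.inr ⟨rfl, rfl, ?_, ?_⟩⟩,
      ⟨2 * i, 2 * j + 1, by omega, by omega, by omega, by omega, Or.inr ⟨?_, rfl, ?_, ?_⟩⟩,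
      ⟨2 * i + 1, 2 * j, by omega, by omega, by omega, by omega, Or.inr ⟨rfl, ?_, ?_, ?_⟩⟩⟩ <;>
      linarith

/-- The quadratic interpolant in local coordinates. -/
def quadST (v : ℝ × ℝ → ℝ) (a b h k s t : ℝ) : ℝ :=
  v (a, b) * ((1 - s - t) * (2 * (1 - s - t) - 1)) + v (a + h, b) * (s * (2 * s - 1)) +
    v (a, b + k) * (t * (2 * t - 1)) + v (a + h / 2, b) * (4 * (1 - s - t) * s) +
    v (a + h / 2, b + k / 2) * (4 * s * t) + v (a, b + k / 2) * (4 * t * (1 - s - t))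

/-- The quadratic interpolant on a triangle with legs `h` and `k`. -/
def quadP (v : ℝ × ℝ → ℝ) (a b h k : ℝ) (p : ℝ × ℝ) : ℝ :=
  quadST v a b h k ((p.1 - a) / h) ((p.2 - b) / k)

/-- The `x`-derivative of the quadratic interpolant. -/
def quadDX (v : ℝ × ℝ → ℝ) (a b h k : ℝ) (p : ℝ × ℝ) : ℝ :=
  1 / 2 * ((4 * ((p.1 - a) / h) - 1) * slopeX v (a + h / 2) b (h / 2) +
    (4 * (1 - (p.1 - a) / h - (p.2 - b) / k) - 1) * slopeX v a b (h / 2) +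
    4 * ((p.2 - b) / k) * slopeX v a (b + k / 2) (h / 2))

/-- The `y`-derivative of the quadratic interpolant. -/
def quadDY (v : ℝ × ℝ → ℝ) (a b h k : ℝ) (p : ℝ × ℝ) : ℝ :=
  quadDX (v ∘ Prod.swap) b a k h p.swap

theorem quadP_swap (v : ℝ × ℝ → ℝ) (a b h k : ℝ) (p : ℝ × ℝ) :
    quadP (v ∘ Prod.swap) b a k h p.swap = quadP v a b h k p := by
  simp only [quadP, quadST, Function.comp_apply, Prod.swap_prod_mk, Prod.fst_swap, Prod.snd_swap]
  ring

/-- The derivative is written through the three horizontal slopes of the corner subtriangles. In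
this form it is controlled by `dX` of a discrete function alone, so stability and approximation are
independent of the aspect ratio. -/
theorem hasDerivAt_quadP (hh : h ≠ 0) (p : ℝ × ℝ) :
    HasDerivAt (fun x => quadP v a b h k (x, p.2)) (quadDX v a b h k p) p.1 := by
  have hs : HasDerivAt (fun x : ℝ => (x - a) / h) (1 / h) p.1 :=
    ((hasDerivAt_id p.1).sub_const a).div_const h
  have hr := ((hasDerivAt_const p.1 (1 : ℝ)).sub hs).sub_const ((p.2 - b) / k)
  have h1 := (hr.mul ((hr.const_mul 2).sub_const 1)).const_mul (v (a, b))
  have h2 := (hs.mul ((hs.const_mul 2).sub_const 1)).const_mul (v (a + h, b))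
  have h3 := hasDerivAt_const p.1 (v (a, b + k) * ((p.2 - b) / k * (2 * ((p.2 - b) / k) - 1)))
  have h4 := ((hr.const_mul 4).mul hs).const_mul (v (a + h / 2, b))
  have h5 := ((hs.const_mul 4).mul_const ((p.2 - b) / k)).const_mul (v (a + h / 2, b + k / 2))
  have h6 := (hr.const_mul (4 * ((p.2 - b) / k))).const_mul (v (a, b + k / 2))
  refine (((((h1.add h2).add h3).add h4).add h5).add h6).congr_deriv ?_
  unfold quadDX slopeX
  rw [show a + h / 2 + h / 2 = a + h by ring]
  simp only [Pi.sub_apply]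
  field_simp
  ring

/-- With signed legs one formula serves both orientations. For the upper right macrotriangle the
local coordinates run backwards, hence `1 - s` and `1 - t`; the midpoints are mesh nodes by
`MacroGrid.mid`. -/
theorem postprocess_eqOn (hX : MacroGrid N X) (hY : MacroGrid N Y)
    (ht : IsTri (macroNode X) (macroNode Y) i j a b h k) (hi : i < N / 2) (hj : j < N / 2) :
    EqOn (postprocess N X Y v) (quadP v a b h k) (otri a b h k) := by
  intro p hp
  obtain ⟨hh, hk⟩ := ht.ne hX.isGrid hY.isGrid hi hj
  have hx := node_step hX.grid.lt hi
  have hy := node_step hY.grid.lt hj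
  have hull := otri_subset_hull hh hk hp
  obtain ⟨s, t, hs, ht0, hst, rfl⟩ := otri_param hh hk hp
  have es : (a + s * h - a) / h = s := by field_simp; ring
  have et : (b + t * k - b) / k = t := by field_simp; ring
  unfold quadP
  simp only [es, et]
  have e1 : macroNode X (i + 1) = X (2 * i + 2) := rfl
  have e2 : macroNode Y (j + 1) = Y (2 * j + 2) := rfl
  have e3 : macroNode X i = X (2 * i) := rfl
  have e4 : macroNode Y j = Y (2 * j) := rfl
  have mX : midpoint ℝ (X (2 * i)) (X (2 * i + 2)) = (X (2 * i) + X (2 * i + 2)) / 2 := by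
    rw [midpoint_eq_smul_add]; simp; ring
  have mY : midpoint ℝ (Y (2 * j)) (Y (2 * j + 2)) = (Y (2 * j) + Y (2 * j + 2)) / 2 := by
    rw [midpoint_eq_smul_add]; simp; ring
  rcases ht with ⟨rfl, rfl, rfl, rfl⟩ | ⟨rfl, rfl, rfl, rfl⟩ <;>
    simp only [e1, e2, e3, e4] at hull ⊢
  · rw [add_sub_cancel, add_sub_cancel] at hull
    rw [postprocess_eq₁ hX.grid.lt hY.grid.lt hi hj v hull, interpM1_coord v s t hx hy, mX, mY]
    unfold quadST
    rw [show X (2 * i) + (X (2 * i + 2) - X (2 * i)) / 2 = (X (2 * i) + X (2 * i + 2)) / 2 by ring,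
      show Y (2 * j) + (Y (2 * j + 2) - Y (2 * j)) / 2 = (Y (2 * j) + Y (2 * j + 2)) / 2 by ring,
      add_sub_cancel, add_sub_cancel]
  · rw [add_sub_cancel, add_sub_cancel] at hull
    have hull' : (X (2 * i + 2) + s * (X (2 * i) - X (2 * i + 2)),
        Y (2 * j + 2) + t * (Y (2 * j) - Y (2 * j + 2))) ∈ convexHull ℝ {(X (2 * i + 2),
        Y (2 * j + 2)), (X (2 * i), Y (2 * j + 2)), (X (2 * i + 2), Y (2 * j))} := hull
    rw [postprocess_eq₂ hX.grid.lt hY.grid.lt hi hj v hull']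
    have c := interpM2_coord v (1 - s) (1 - t) hx hy
    rw [show X (2 * i) + (1 - s) * (X (2 * i + 2) - X (2 * i)) =
      X (2 * i + 2) + s * (X (2 * i) - X (2 * i + 2)) by ring,
      show Y (2 * j) + (1 - t) * (Y (2 * j + 2) - Y (2 * j)) =
      Y (2 * j + 2) + t * (Y (2 * j) - Y (2 * j + 2)) by ring, mX, mY] at c
    rw [c]
    unfold quadST
    rw [show X (2 * i + 2) + (X (2 * i) - X (2 * i + 2)) / 2 = (X (2 * i) + X (2 * i + 2)) / 2 by
        ring,
      show Y (2 * j + 2) + (Y (2 * j) - Y (2 * j + 2)) / 2 = (Y (2 * j) + Y (2 * j + 2)) / 2 by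
        ring,
      add_sub_cancel, add_sub_cancel]
    ring

theorem continuous_quadP : Continuous (quadP v a b h k) := by
  unfold quadP quadST; fun_prop

theorem continuous_quadDX : Continuous (quadDX v a b h k) := by
  unfold quadDX; fun_prop

theorem continuous_quadDY : Continuous (quadDY v a b h k) :=
  continuous_quadDX.comp continuous_swap

theorem hasDerivAt_quadP_y (hk : k ≠ 0) (p : ℝ × ℝ) :
    HasDerivAt (fun y => quadP v a b h k (p.1, y)) (quadDY v a b h k p) p.2 := by
  have := hasDerivAt_quadP (v := v ∘ Prod.swap) (a := b) (b := a) (h := k) (k := h) hk p.swap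
  have e : (fun x => quadP (v ∘ Prod.swap) b a k h (x, p.swap.2)) =
      fun y => quadP v a b h k (p.1, y) := by
    ext y
    exact quadP_swap v a b h k (p.1, y)
  rw [e] at this
  exact this

/-- The postprocessed function on a macrotriangle. -/
theorem postprocess_on_otri (hX : MacroGrid N X) (hY : MacroGrid N Y)
    (ht : IsTri (macroNode X) (macroNode Y) i j a b h k) (hi : i < N / 2) (hj : j < N / 2)
    {p : ℝ × ℝ} (hp : p ∈ otri a b h k) :
    postprocess N X Y v p = quadP v a b h k p ∧ dX (postprocess N X Y v) p = quadDX v a b h k p ∧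
      dY (postprocess N X Y v) p = quadDY v a b h k p := by
  obtain ⟨hh, hk⟩ := ht.ne hX.isGrid hY.isGrid hi hj
  have e := postprocess_eqOn (v := v) hX hY ht hi hj
  have hpc := ht.otri_subset_closed hX.isGrid hY.isGrid hi hj hp
  refine ⟨e hp, ?_, ?_⟩
  · rw [dX_eqOn_open (isOpen_otri _ _ _ _) e hp]
    exact dX_of_hasDerivAt hpc (hasDerivAt_quadP hh p)
  · rw [dY_eqOn_open (isOpen_otri _ _ _ _) e hp]
    exact dY_of_hasDerivAt hpc (hasDerivAt_quadP_y hk p)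

theorem quadP_sub : quadP (u - v) a b h k = quadP u a b h k - quadP v a b h k := by
  ext p; simp only [quadP, quadST, Pi.sub_apply]; ring

theorem quadDX_sub : quadDX (u - v) a b h k = quadDX u a b h k - quadDX v a b h k := by
  ext p; simp only [quadDX, slopeX, Pi.sub_apply]; ring

theorem quadDY_sub : quadDY (u - v) a b h k = quadDY u a b h k - quadDY v a b h k := by
  ext p
  have := congrFun (quadDX_sub (u := u ∘ Prod.swap) (v := v ∘ Prod.swap) (a := b) (b := a)
    (h := k) (k := h)) p.swap
  exact this

theorem quadP_add : quadP (u + v) a b h k = quadP u a b h k + quadP v a b h k := by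
  ext p; simp only [quadP, quadST, Pi.add_apply]; ring

theorem quadDX_add : quadDX (u + v) a b h k = quadDX u a b h k + quadDX v a b h k := by
  ext p; simp only [quadDX, slopeX, Pi.add_apply]; ring

end


/-! ### Stability of the postprocessing operator -/

section

variable {N : ℕ} {X Y : ℕ → ℝ} {i j : ℕ} {a b h k : ℝ} {v u χ : ℝ × ℝ → ℝ}

theorem SubTri.cell_subset (hX : MacroGrid N X) (hY : MacroGrid N Y) (hi : i < N / 2)
    (hj : j < N / 2) {i' j' : ℕ} (h1 : 2 * i ≤ i') (h2 : i' < 2 * i + 2) (h3 : 2 * j ≤ j')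
    (h4 : j' < 2 * j + 2) : block X Y i' (i' + 1) j' (j' + 1) ⊆
      block X Y (2 * i) (2 * i + 2) (2 * j) (2 * j + 2) :=
  block_mono hX.grid hY.grid h1 (by omega) h3 (by omega) (by omega) (by omega) (by omega)
    (by omega)

theorem SubTri.integral_le (hX : MacroGrid N X) (hY : MacroGrid N Y) (hi : i < N / 2)
    (hj : j < N / 2) (ht : SubTri X Y i j a b h k) {F : ℝ × ℝ → ℝ} (hF : BM F)
    (h0 : ∀ p, 0 ≤ F p) : ∫ p in otri a b h k, F p ≤
      ∫ p in block X Y (2 * i) (2 * i + 2) (2 * j) (2 * j + 2), F p := by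
  obtain ⟨i', j', h1, h2, h3, h4, ht⟩ := ht
  exact integral_mono_subset hF h0 ((ht.subset_block hX.grid hY.grid (by omega) (by omega)).trans
    (SubTri.cell_subset hX hY hi hj h1 h2 h3 h4))
    (block_subset hX.grid hY.grid (by omega) (by omega) (by omega) (by omega))

theorem SubTri.slopeX_sq_le (hX : MacroGrid N X) (hY : MacroGrid N Y) (hi : i < N / 2)
    (hj : j < N / 2) (ht : SubTri X Y i j a b h k) (hv : IsPL N X Y v) :
    |h| * |k| * slopeX v a b h ^ 2 ≤
      21 * ∫ p in block X Y (2 * i) (2 * i + 2) (2 * j) (2 * j + 2), dX v p ^ 2 := by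
  have hI := ht.integral_le hX hY hi hj (hv.bm_dX hX.grid hY.grid).sq fun _ => sq_nonneg _
  obtain ⟨i', j', h1, h2, h3, h4, ht⟩ := ht
  have := hv.slopeX_sq_le hX.grid hY.grid ht (by omega) (by omega)
  linarith

theorem SubTri.node_sq_le (hX : MacroGrid N X) (hY : MacroGrid N Y) (hi : i < N / 2)
    (hj : j < N / 2) (ht : SubTri X Y i j a b h k) (hv : IsPL N X Y v) {I : ℝ}
    (hI : ∫ p in block X Y (2 * i) (2 * i + 2) (2 * j) (2 * j + 2), v p ^ 2 = I) :
    |h| * |k| * v (a, b) ^ 2 ≤ 1701 * I ∧ |h| * |k| * v (a + h, b) ^ 2 ≤ 1701 * I ∧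
      |h| * |k| * v (a, b + k) ^ 2 ≤ 1701 * I := by
  have hI' := ht.integral_le hX hY hi hj hv.bm.sq fun _ => sq_nonneg _
  obtain ⟨i', j', h1, h2, h3, h4, ht⟩ := ht
  obtain ⟨q1, q2, q3⟩ := hv.node_sq_le hX.grid hY.grid ht (by omega) (by omega)
  exact ⟨by linarith, by linarith, by linarith⟩

theorem volume_otri_le (hX : IsGrid N X) (hY : IsGrid N Y) (ht : IsTri X Y i j a b h k)
    (hi : i < N) (hj : j < N) : volume.real (otri a b h k) ≤ |h| * |k| := by
  have h1 := hX.lt i hi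
  have h2 := hY.lt j hj
  have hs := ht.subset_block hX hY hi hj
  have hb := block_subset hX hY hi.le (show i + 1 ≤ N by omega) hj.le (show j + 1 ≤ N by omega)
  refine (measureReal_mono hs (volume_real_hSquare_subset hb).ne).trans (le_of_eq ?_)
  unfold block
  obtain ⟨e1, e2⟩ : |h| = X (i + 1) - X i ∧ |k| = Y (j + 1) - Y j := by
    rcases ht with ⟨-, -, rfl, rfl⟩ | ⟨-, -, rfl, rfl⟩
    · exact ⟨abs_of_pos (by linarith), abs_of_pos (by linarith)⟩
    · exact ⟨by rw [abs_of_neg (by linarith)]; ring, by rw [abs_of_neg (by linarith)]; ring⟩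
  rw [volume_real_rect h1.le h2.le, e1, e2]

/-- From local to global. Both macrotriangles of a macro-rectangle are charged to the whole
rectangle, which doubles the constant. -/
theorem macro_integral_le (hX : MacroGrid N X) (hY : MacroGrid N Y) {F G : ℝ × ℝ → ℝ}
    (hF : BM F) (hG : BM G) {K : ℝ}
    (hK : ∀ i j a b h k, IsTri (macroNode X) (macroNode Y) i j a b h k → i < N / 2 → j < N / 2 →
      ∃ Q, 0 ≤ Q ∧ (∀ p ∈ otri a b h k, F p ^ 2 ≤ Q) ∧ |h| * |k| * Q ≤
        K * ∫ p in block X Y (2 * i) (2 * i + 2) (2 * j) (2 * j + 2), G p) :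
    ∫ p in Omega, F p ^ 2 ≤ 2 * K * ∫ p in Omega, G p := by
  have gX := hX.isGrid
  have gY := hY.isGrid
  have tri : ∀ i j a b h k, IsTri (macroNode X) (macroNode Y) i j a b h k → i < N / 2 →
      j < N / 2 → ∫ p in otri a b h k, F p ^ 2 ≤
        K * ∫ p in block X Y (2 * i) (2 * i + 2) (2 * j) (2 * j + 2), G p := by
    intro i j a b h k ht hi hj
    obtain ⟨Q, hQ, hFQ, hK⟩ := hK i j a b h k ht hi hj
    have h1 := abs_setIntegral_le (ht.subset_hSquare gX gY hi hj) (F := fun p => F p ^ 2) (B := Q)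
      fun p hp => by rw [abs_of_nonneg (sq_nonneg _)]; exact hFQ p hp
    have h2 := mul_le_mul_of_nonneg_left (volume_otri_le gX gY ht hi hj) hQ
    linarith [le_abs_self (∫ p in otri a b h k, F p ^ 2)]
  rw [← integral_hSquare, ← integral_hSquare, ← block_full gX gY,
    integral_block gX gY hF.sq (Nat.zero_le _) le_rfl (Nat.zero_le _) le_rfl,
    integral_block_cells gX gY hG (Nat.zero_le _) le_rfl (Nat.zero_le _) le_rfl, Finset.mul_sum]
  refine Finset.sum_le_sum fun i hi => ?_
  rw [Finset.mul_sum]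
  refine Finset.sum_le_sum fun j hj => ?_
  rw [Finset.mem_Ico] at hi hj
  have h1 := tri i j _ _ _ _ (isTri_o1 _ _ i j) hi.2 hj.2
  have h2 := tri i j _ _ _ _ (isTri_o2 _ _ i j) hi.2 hj.2
  have e : block (macroNode X) (macroNode Y) i (i + 1) j (j + 1) =
    block X Y (2 * i) (2 * i + 2) (2 * j) (2 * j + 2) := rfl
  rw [e]
  unfold o1 o2
  linarith

theorem bm_postprocess (hX : MacroGrid N X) (hY : MacroGrid N Y) :
    BM (postprocess N X Y v) ∧ BM (dX (postprocess N X Y v)) ∧ BM (dY (postprocess N X Y v)) :=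
  ⟨BM.of_locally_continuous hX.isGrid hY.isGrid (quadP v) (fun _ _ _ _ => continuous_quadP)
      fun _ _ _ _ _ _ ht hi hj _ hp => (postprocess_on_otri hX hY ht hi hj hp).1,
    BM.of_locally_continuous hX.isGrid hY.isGrid (quadDX v) (fun _ _ _ _ => continuous_quadDX)
      fun _ _ _ _ _ _ ht hi hj _ hp => (postprocess_on_otri hX hY ht hi hj hp).2.1,
    BM.of_locally_continuous hX.isGrid hY.isGrid (quadDY v) (fun _ _ _ _ => continuous_quadDY)
      fun _ _ _ _ _ _ ht hi hj _ hp => (postprocess_on_otri hX hY ht hi hj hp).2.2⟩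

theorem abs_quadDX_le {p : ℝ × ℝ} (hp : p ∈ otri a b h k) : |quadDX v a b h k p| ≤
    2 * (|slopeX v a b (h / 2)| + |slopeX v (a + h / 2) b (h / 2)| +
      |slopeX v a (b + k / 2) (h / 2)|) := by
  obtain ⟨hs, ht, hst⟩ := hp
  unfold quadDX
  set s := (p.1 - a) / h
  set t := (p.2 - b) / k
  have c1 : |4 * s - 1| ≤ 4 := abs_le.2 ⟨by linarith, by linarith⟩
  have c2 : |4 * (1 - s - t) - 1| ≤ 4 := abs_le.2 ⟨by linarith, by linarith⟩
  have c3 : |4 * t| ≤ 4 := abs_le.2 ⟨by linarith, by linarith⟩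
  rw [abs_mul, abs_of_pos (by norm_num : (0 : ℝ) < 1 / 2)]
  have h1 := mul_le_mul_of_nonneg_right c1 (abs_nonneg (slopeX v (a + h / 2) b (h / 2)))
  have h2 := mul_le_mul_of_nonneg_right c2 (abs_nonneg (slopeX v a b (h / 2)))
  have h3 := mul_le_mul_of_nonneg_right c3 (abs_nonneg (slopeX v a (b + k / 2) (h / 2)))
  rw [← abs_mul] at h1 h2 h3
  have h4 := abs_add_le ((4 * s - 1) * slopeX v (a + h / 2) b (h / 2) +
    (4 * (1 - s - t) - 1) * slopeX v a b (h / 2)) (4 * t * slopeX v a (b + k / 2) (h / 2))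
  have h5 := abs_add_le ((4 * s - 1) * slopeX v (a + h / 2) b (h / 2))
    ((4 * (1 - s - t) - 1) * slopeX v a b (h / 2))
  linarith

theorem abs_quadP_le {p : ℝ × ℝ} (hp : p ∈ otri a b h k) : |quadP v a b h k p| ≤
    |v (a, b)| + |v (a + h, b)| + |v (a, b + k)| + |v (a + h / 2, b)| +
      |v (a + h / 2, b + k / 2)| + |v (a, b + k / 2)| := by
  obtain ⟨hs, ht, hst⟩ := hp
  unfold quadP quadST
  set s := (p.1 - a) / h
  set t := (p.2 - b) / k
  have key : ∀ y c : ℝ, |c| ≤ 1 → |y * c| ≤ |y| := fun y c hc => by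
    rw [abs_mul]; exact mul_le_of_le_one_right (abs_nonneg _) hc
  have q : ∀ r : ℝ, 0 ≤ r → r ≤ 1 → |r * (2 * r - 1)| ≤ 1 := fun r h0 h1 =>
    abs_le.2 ⟨by nlinarith, by nlinarith⟩
  have m : ∀ r r' : ℝ, 0 ≤ r → 0 ≤ r' → r + r' ≤ 1 → |4 * r * r'| ≤ 1 := fun r r' h0 h1 h2 =>
    abs_le.2 ⟨by nlinarith [mul_nonneg h0 h1], by nlinarith [sq_nonneg (r - r')]⟩
  have a1 := key (v (a, b)) _ (q (1 - s - t) (by linarith) (by linarith))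
  have a2 := key (v (a + h, b)) _ (q s (by linarith) (by linarith))
  have a3 := key (v (a, b + k)) _ (q t (by linarith) (by linarith))
  have a4 := key (v (a + h / 2, b)) _ (m (1 - s - t) s (by linarith) (by linarith) (by linarith))
  have a5 := key (v (a + h / 2, b + k / 2)) _ (m s t (by linarith) (by linarith) (by linarith))
  have a6 := key (v (a, b + k / 2)) _ (m t (1 - s - t) (by linarith) (by linarith) (by linarith))
  refine (abs_add_le _ _).trans (add_le_add ?_ a6)
  refine (abs_add_le _ _).trans (add_le_add ?_ a5)
  refine (abs_add_le _ _).trans (add_le_add ?_ a4)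
  refine (abs_add_le _ _).trans (add_le_add ?_ a3)
  exact (abs_add_le _ _).trans (add_le_add a1 a2)

theorem postprocess_stable_dX (hX : MacroGrid N X) (hY : MacroGrid N Y) (hχ : IsPL N X Y χ) :
    ∫ p in Omega, dX (postprocess N X Y χ) p ^ 2 ≤ 6048 * ∫ p in Omega, dX χ p ^ 2 := by
  -- `3024 = 12 · 3 · 4 · 21`: the square of twice a sum of three slopes, three subtriangles, their
  -- area factor `1/4`, and the slope estimate.
  have key := macro_integral_le (K := 3024) hX hY (bm_postprocess (v := χ) hX hY).2.1
    (hχ.bm_dX hX.grid hY.grid).sq ?_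
  · norm_num at key; exact key
  · intro i j a b h k ht hi hj
    obtain ⟨t1, t2, t3⟩ := ht.subTri hX hY hi hj
    have s1 := t1.slopeX_sq_le hX hY hi hj hχ
    have s2 := t2.slopeX_sq_le hX hY hi hj hχ
    have s3 := t3.slopeX_sq_le hX hY hi hj hχ
    refine ⟨12 * (slopeX χ a b (h / 2) ^ 2 + slopeX χ (a + h / 2) b (h / 2) ^ 2 +
      slopeX χ a (b + k / 2) (h / 2) ^ 2), by positivity, fun p hp => ?_, ?_⟩
    · rw [(postprocess_on_otri hX hY ht hi hj hp).2.1]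
      have hq := pow_le_pow_left₀ (abs_nonneg _) (abs_quadDX_le (v := χ) hp) 2
      rw [sq_abs] at hq
      rw [← sq_abs (slopeX χ a b (h / 2)), ← sq_abs (slopeX χ (a + h / 2) b (h / 2)),
        ← sq_abs (slopeX χ a (b + k / 2) (h / 2))]
      set x := |slopeX χ a b (h / 2)|
      set y := |slopeX χ (a + h / 2) b (h / 2)|
      set z := |slopeX χ a (b + k / 2) (h / 2)|
      nlinarith [sq_nonneg (x - y), sq_nonneg (y - z), sq_nonneg (x - z)]
    · have e : |h / 2| * |k / 2| = |h| * |k| / 4 := by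
        rw [abs_div, abs_div, abs_of_pos (two_pos : (0 : ℝ) < 2)]; ring
      rw [e] at s1 s2 s3
      linarith

theorem postprocess_stable_val (hX : MacroGrid N X) (hY : MacroGrid N Y) (hχ : IsPL N X Y χ) :
    ∫ p in Omega, postprocess N X Y χ p ^ 2 ≤ 489888 * ∫ p in Omega, χ p ^ 2 := by
  -- `244944 = 6 · 6 · 4 · 1701`: Cauchy-Schwarz for six nodal values, six nodes, the area factor
  -- `1/4` of subtriangles, and the nodal estimate.
  have key := macro_integral_le (K := 244944) hX hY (bm_postprocess (v := χ) hX hY).1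
    hχ.bm.sq ?_
  · norm_num at key; exact key
  · intro i j a b h k ht hi hj
    obtain ⟨t1, t2, t3⟩ := ht.subTri hX hY hi hj
    obtain ⟨n1, n2, n3⟩ := t1.node_sq_le hX hY hi hj hχ rfl
    obtain ⟨-, n4, n5⟩ := t2.node_sq_le hX hY hi hj hχ rfl
    obtain ⟨-, -, n6⟩ := t3.node_sq_le hX hY hi hj hχ rfl
    rw [show a + h / 2 + h / 2 = a + h by ring] at n4
    rw [show b + k / 2 + k / 2 = b + k by ring] at n6
    have e : |h / 2| * |k / 2| = |h| * |k| / 4 := by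
      rw [abs_div, abs_div, abs_of_pos (two_pos : (0 : ℝ) < 2)]; ring
    rw [e] at n1 n2 n3 n4 n5 n6
    refine ⟨6 * (χ (a, b) ^ 2 + χ (a + h, b) ^ 2 + χ (a, b + k) ^ 2 + χ (a + h / 2, b) ^ 2 +
      χ (a + h / 2, b + k / 2) ^ 2 + χ (a, b + k / 2) ^ 2), by positivity, fun p hp => ?_, ?_⟩
    · rw [(postprocess_on_otri hX hY ht hi hj hp).1]
      have hq := pow_le_pow_left₀ (abs_nonneg _) (abs_quadP_le (v := χ) hp) 2
      rw [sq_abs] at hq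
      refine hq.trans ?_
      have := sq_sum_le_card_mul_sum_sq (s := Finset.univ) (f := ![|χ (a, b)|, |χ (a + h, b)|,
        |χ (a, b + k)|, |χ (a + h / 2, b)|, |χ (a + h / 2, b + k / 2)|, |χ (a, b + k / 2)|])
      simp only [Fin.sum_univ_succ, Finset.card_univ, Fintype.card_fin] at this
      simp at this
      linarith
    · linarith

end


/-! ### Approximation by piecewise quadratics -/

/-- The vertices and edge midpoints of a macrotriangle and its subtriangles lie in `R`. -/
structure MacroLegs (R : Set (ℝ × ℝ)) (a b h k : ℝ) : Prop where
  whole : LegsIn R a b h k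
  corner : LegsIn R a b (h / 2) (k / 2)
  right : LegsIn R (a + h / 2) b (h / 2) (k / 2)
  top : LegsIn R a (b + k / 2) (h / 2) (k / 2)

section

variable {N : ℕ} {X Y : ℕ → ℝ} {i j : ℕ} {a b h k : ℝ} {v u g : ℝ × ℝ → ℝ} {m : ℕ → ℕ → ℝ}
  {R : Set (ℝ × ℝ)} {H K B : ℝ} {p : ℝ × ℝ}

theorem LegsIn.mono (hl : LegsIn R a b h k) {R' : Set (ℝ × ℝ)} (hR : R ⊆ R') :
    LegsIn R' a b h k :=
  ⟨hl.h_ne, hl.k_ne, hR hl.corner, hR hl.right, hR hl.top, hl.sub.trans hR⟩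

theorem SubTri.legsIn (hX : MacroGrid N X) (hY : MacroGrid N Y) (hi : i < N / 2)
    (hj : j < N / 2) (ht : SubTri X Y i j a b h k) :
    LegsIn (cellR (macroNode X) (macroNode Y) i j) a b h k := by
  obtain ⟨i', j', h1, h2, h3, h4, ht⟩ := ht
  refine (ht.legsIn hX.grid hY.grid (by omega) (by omega)).mono (prod_mono ?_ ?_)
  · exact Icc_subset_Icc (hX.grid.mono h1 (by omega))
      (hX.grid.mono (show i' + 1 ≤ 2 * i + 2 by omega) (by omega))
  · exact Icc_subset_Icc (hY.grid.mono h3 (by omega))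
      (hY.grid.mono (show j' + 1 ≤ 2 * j + 2 by omega) (by omega))

theorem IsTri.macroLegs (hX : MacroGrid N X) (hY : MacroGrid N Y)
    (ht : IsTri (macroNode X) (macroNode Y) i j a b h k) (hi : i < N / 2) (hj : j < N / 2) :
    MacroLegs (cellR (macroNode X) (macroNode Y) i j) a b h k := by
  obtain ⟨t1, t2, t3⟩ := ht.subTri hX hY hi hj
  exact ⟨ht.legsIn hX.isGrid hY.isGrid hi hj, t1.legsIn hX hY hi hj, t2.legsIn hX hY hi hj,
    t3.legsIn hX hY hi hj⟩

theorem JetBound.slopeX_taylor (hg : JetBound m R g) (hR : IsRect R H K)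
    (hl : LegsIn R a b h k) (hp : p ∈ R) :
    |slopeX g a b h - taylor₁ (dX g) p (a + h / 2, b)| ≤ rem₃ m H K := by
  have h1 := hg.taylor_diff hR hp hl.corner hl.right (by have := hl.h_ne; simpa using this)
  rw [add_sub_cancel_left, show (a + (a + h)) / 2 = a + h / 2 by ring] at h1
  exact h1

/-- `quadDX` recovers the value at `p` of an affine `dX g` from its values at the midpoints of the
three legs. Each slope differs from the Taylor polynomial at the midpoint by one remainder, and the
weights are at most `(4 + 4 + 4)/2 = 6`. -/
theorem JetBound.quadDX_error (hg : JetBound m R g) (hR : IsRect R H K)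
    (hl : MacroLegs R a b h k) (hp : p ∈ otri a b h k) :
    |dX g p - quadDX g a b h k p| ≤ 6 * rem₃ m H K := by
  have hpR := hl.whole.sub hp
  have e1 := hg.slopeX_taylor hR hl.corner hpR
  have e2 := hg.slopeX_taylor hR hl.right hpR
  have e3 := hg.slopeX_taylor hR hl.top hpR
  have hh := hl.whole.h_ne
  have hk := hl.whole.k_ne
  obtain ⟨s, t, hs, ht, hst, rfl⟩ := otri_param hh hk hp
  have es : (a + s * h - a) / h = s := by field_simp; ring
  have et : (b + t * k - b) / k = t := by field_simp; ring
  unfold quadDX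
  simp only [es, et]
  unfold taylor₁ at e1 e2 e3
  simp only at e1 e2 e3
  set G := dX g (a + s * h, b + t * k)
  set Gx := dX (dX g) (a + s * h, b + t * k)
  set Gy := dY (dX g) (a + s * h, b + t * k)
  set D0 := slopeX g a b (h / 2)
  set D1 := slopeX g (a + h / 2) b (h / 2)
  set D2 := slopeX g a (b + k / 2) (h / 2)
  set r := rem₃ m H K
  have c1 : |4 * s - 1| ≤ 4 := abs_le.2 ⟨by linarith, by linarith⟩
  have c2 : |4 * (1 - s - t) - 1| ≤ 4 := abs_le.2 ⟨by linarith, by linarith⟩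
  have c3 : |4 * t| ≤ 4 := abs_le.2 ⟨by linarith, by linarith⟩
  have f1 := mul_le_mul c2 e1 (abs_nonneg _) (by norm_num)
  have f2 := mul_le_mul c1 e2 (abs_nonneg _) (by norm_num)
  have f3 := mul_le_mul c3 e3 (abs_nonneg _) (by norm_num)
  rw [← abs_mul] at f1 f2 f3
  have f1 := abs_le.1 f1
  have f2 := abs_le.1 f2
  have f3 := abs_le.1 f3
  rw [abs_le]
  constructor <;> linarith

theorem quadP_affine (hh : h ≠ 0) (hk : k ≠ 0) (c₀ c₁ c₂ : ℝ) (q : ℝ × ℝ) :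
    quadP (fun p => c₀ + (p.1 - q.1) * c₁ + (p.2 - q.2) * c₂) a b h k q = c₀ := by
  unfold quadP quadST
  simp only
  field_simp
  ring

/-- Only the exactness on affine functions is used, as second order suffices for the values. The
remainder enters once at each of the six interpolation points. -/
theorem JetBound.quadP_error (hg : JetBound m R g) (hR : IsRect R H K)
    (hl : MacroLegs R a b h k) (hp : p ∈ otri a b h k) :
    |g p - quadP g a b h k p| ≤ 6 * rem₂ m H K := by
  have hpR := hl.whole.sub hp
  have e := fun q (hq : q ∈ R) => hg.taylor hR hpR hq
  have e1 : quadP (g - taylor₁ g p) a b h k p = quadP g a b h k p - g p := by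
    rw [quadP_sub, Pi.sub_apply]
    congr 1
    exact quadP_affine hl.whole.h_ne hl.whole.k_ne _ _ _ p
  rw [abs_sub_comm, ← e1]
  refine (abs_quadP_le hp).trans ?_
  simp only [Pi.sub_apply]
  have a1 := e _ hl.whole.corner
  have a2 := e _ hl.whole.right
  have a3 := e _ hl.whole.top
  have a4 := e _ hl.corner.right
  have a5 := e _ hl.right.top
  have a6 := e _ hl.corner.top
  linarith

/-- Pointwise errors of the postprocessed exact solution in a macrotriangle of a region. -/
structure MacroError (N : ℕ) (X Y : ℕ → ℝ) (C θ ε ρ τ₁ : ℝ) (u A T : ℝ × ℝ → ℝ)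
    (p : ℝ × ℝ) : Prop where
  val : |u p - postprocess N X Y u p| ≤ 72 * C * ρ ^ 2 + 7 * (C * θ)
  split : dX u p - dX (postprocess N X Y u) p =
    (dX A p - dX (postprocess N X Y A) p) + (dX T p - dX (postprocess N X Y T) p)
  smooth : |dX A p - dX (postprocess N X Y A) p| ≤ 72 * C * ρ ^ 2 / τ₁
  layer : |dX T p - dX (postprocess N X Y T) p| ≤ 7 * C * θ / ε

/-- Macrocells are twice as large, hence `2 * ρ`, and `72 = 6 · 3 · 2²` for values and gradient
alike. For the layer part, 7 counts the function and six nodal values, or the derivative and twice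
three slopes. -/
theorem Region.macroError {i₀ i₁ j₀ j₁ : ℕ} {C θ ε ρ τ₁ τ₂ : ℝ} {A T : ℝ × ℝ → ℝ}
    (hX : MacroGrid N X) (hY : MacroGrid N Y)
    (hr : Region (N / 2) (macroNode X) (macroNode Y) i₀ i₁ j₀ j₁ (2 * ρ) τ₁ τ₂)
    (hs : Splitting C θ ε τ₁ τ₂ (blockR (macroNode X) (macroNode Y) i₀ i₁ j₀ j₁) u A T)
    (hi0 : i₀ ≤ i) (hi : i < i₁) (hj0 : j₀ ≤ j) (hj : j < j₁)
    (ht : IsTri (macroNode X) (macroNode Y) i j a b h k) (hp : p ∈ otri a b h k) :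
    MacroError N X Y C θ ε ρ τ₁ u A T p := by
  have gX := hr.gridX
  have gY := hr.gridY
  have hin : i < N / 2 := hi.trans_le hr.hin
  have hjn : j < N / 2 := hj.trans_le hr.hjn
  have h1 := hr.τ₁_pos
  have h2 := hr.τ₂_pos
  have hl := ht.macroLegs hX hY hin hjn
  have hR := isRect_cellR gX gY hin hjn (hr.stepX i hi0 hi) (hr.stepY j hj0 hj)
  have hpR := hl.whole.sub hp
  have hpc := hR.sub hpR
  have hA : JetBound (scaleJet C τ₁ τ₂) (cellR (macroNode X) (macroNode Y) i j) A :=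
    hs.jetA.mono hR.sub fun _ _ _ => le_rfl
  have hT := hs.jetT.mono (hr.cellR_subset hi0 hi hj0 hj) fun _ _ _ => le_rfl
  have eq := fun g => postprocess_on_otri (v := g) hX hY ht hin hjn hp
  have dA := hs.jetA.smooth.differentiableOn (by norm_num)
  have dT := hs.jetT.smooth.differentiableOn (by norm_num)
  have vals := fun q (hq : q ∈ cellR (macroNode X) (macroNode Y) i j) => hs.eq (hR.sub hq)
  have v1 := vals _ hl.whole.corner
  have v2 := vals _ hl.whole.right
  have v3 := vals _ hl.whole.top
  have v4 := vals _ hl.corner.right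
  have v5 := vals _ hl.right.top
  have v6 := vals _ hl.corner.top
  have qP : quadP u a b h k p = quadP A a b h k p + quadP T a b h k p := by
    rw [← Pi.add_apply, ← quadP_add]
    unfold quadP quadST
    rw [v1, v2, v3, v4, v5, v6]
  have qX : quadDX u a b h k p = quadDX A a b h k p + quadDX T a b h k p := by
    rw [← Pi.add_apply, ← quadDX_add]
    unfold quadDX slopeX
    rw [show a + h / 2 + h / 2 = a + h by ring, v1, v2, v4, v5, v6]
  have e2 := hA.quadP_error hR hl hp
  rw [rem₂_scaleJet h1.ne' h2.ne'] at e2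
  have e3 := hA.quadDX_error hR hl hp
  have r3 := rem₃_scaleJet (C := C) (ρ := 2 * ρ) h1.ne' h2.ne' 1
  rw [one_mul] at r3
  rw [r3] at e3
  have bT : ∀ q ∈ cellR (macroNode X) (macroNode Y) i j, |T q| ≤ C * θ := fun q hq => by
    simpa using hT.b00 hq
  have t1 := abs_quadP_le (v := T) hp
  have t2 := abs_quadDX_le (v := T) hp
  refine ⟨?_, ?_, ?_, ?_⟩
  · rw [(eq u).1, qP, hs.eq hpc, Pi.add_apply]
    have w0 := bT p hpR
    have w1 := bT _ hl.whole.corner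
    have w2 := bT _ hl.whole.right
    have w3 := bT _ hl.whole.top
    have w4 := bT _ hl.corner.right
    have w5 := bT _ hl.right.top
    have w6 := bT _ hl.corner.top
    have e : A p + T p - (quadP A a b h k p + quadP T a b h k p) =
      (A p - quadP A a b h k p) + (T p - quadP T a b h k p) := by ring
    rw [e]
    refine (abs_add_le _ _).trans ?_
    have := abs_sub (T p) (quadP T a b h k p)
    linarith
  · rw [(eq u).2.1, (eq A).2.1, (eq T).2.1, qX, dX_congr hs.eq hpc, dX_add dA dT hpc, Pi.add_apply]
    ring
  · rw [(eq A).2.1]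
    refine e3.trans (le_of_eq ?_)
    ring
  · rw [(eq T).2.1]
    have a1 := hT.b10 hpR
    have s1 := hT.abs_slopeX_le hR hl.corner
    have s2 := hT.abs_slopeX_le hR hl.right
    have s3 := hT.abs_slopeX_le hR hl.top
    have := abs_sub (dX T p) (quadDX T a b h k p)
    refine this.trans ?_
    have e : 7 * C * θ / ε = C * θ * (ε ^ (1 + 0))⁻¹ + 2 * (C * θ * (ε ^ (1 + 0))⁻¹ +
      C * θ * (ε ^ (1 + 0))⁻¹ + C * θ * (ε ^ (1 + 0))⁻¹) := by
      simp only [add_zero, pow_one]; ring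
    rw [e]
    linarith

theorem Region.ae_macroError {i₀ i₁ j₀ j₁ : ℕ} {C θ ε ρ τ₁ τ₂ : ℝ} {A T : ℝ × ℝ → ℝ}
    (hX : MacroGrid N X) (hY : MacroGrid N Y)
    (hr : Region (N / 2) (macroNode X) (macroNode Y) i₀ i₁ j₀ j₁ (2 * ρ) τ₁ τ₂)
    (hs : Splitting C θ ε τ₁ τ₂ (blockR (macroNode X) (macroNode Y) i₀ i₁ j₀ j₁) u A T) :
    ∀ᵐ p ∂(volume.restrict (block (macroNode X) (macroNode Y) i₀ i₁ j₀ j₁)),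
      MacroError N X Y C θ ε ρ τ₁ u A T p := by
  filter_upwards [hr.ae] with p hp
  obtain ⟨i, j, a, b, h, k, hi0, hi, hj0, hj, ht, hp⟩ := hp
  exact hr.macroError hX hY hs hi0 hi hj0 hj ht hp

end

/-! ### Pointwise errors of the postprocessed exact solution on the Shishkin mesh -/

section

variable {N : ℕ} {ε β₁ β₂ C₁ : ℝ} {u : ℝ × ℝ → ℝ}

theorem Params.quarter (hP : Params N ε β₁ β₂) :
    2 * (N / 4) = N / 2 ∧ 2 * (N / 2) = N ∧ 0 < N / 4 ∧ N / 4 < N / 2 := by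
  have := hP.dvd
  have := hP.four_le
  omega

theorem Params.macroNode_quarter (hP : Params N ε β₁ β₂) :
    macroNode (node N ε β₁) (N / 4) = node N ε β₁ (N / 2) := by
  rw [macroNode, hP.quarter.1]

theorem Params.macroNode_half (hP : Params N ε β₁ β₂) :
    macroNode (node N ε β₁) (N / 2) = node N ε β₁ N := by
  rw [macroNode, hP.quarter.2.1]

theorem macroNode_zero : macroNode (node N ε β₁) 0 = node N ε β₁ 0 := rfl

theorem Params.macro_step_le (hP : Params N ε β₁ β₂) (i : ℕ) :
    macroNode (node N ε β₁) (i + 1) - macroNode (node N ε β₁) i ≤ 2 * rho N β₁ β₂ * 1 := by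
  have h1 := hP.step_le_rho (2 * i)
  have h2 := hP.step_le_rho (2 * i + 1)
  change node N ε β₁ (2 * i + 1 + 1) - node N ε β₁ (2 * i) ≤ _
  linarith

theorem Params.macro_step_fine_le (hP : Params N ε β₁ β₂) {i : ℕ} (hi : N / 4 ≤ i) :
    macroNode (node N ε β₁) (i + 1) - macroNode (node N ε β₁) i ≤ 2 * rho N β₁ β₂ * ε := by
  have := hP.quarter.1
  have h1 := hP.step_fine_le (show N / 2 ≤ 2 * i by omega)
  have h2 := hP.step_fine_le (show N / 2 ≤ 2 * i + 1 by omega)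
  change node N ε β₁ (2 * i + 1 + 1) - node N ε β₁ (2 * i) ≤ _
  linarith

theorem Params.macro_fine_fine (hP : Params N ε β₁ β₂) :
    Region (N / 2) (macroNode (node N ε β₁)) (macroNode (node N ε β₂)) (N / 4) (N / 2) (N / 4)
      (N / 2) (2 * rho N β₁ β₂) ε ε :=
  ⟨hP.macroGrid.isGrid, hP.swap.macroGrid.isGrid, hP.quarter.2.2.2, le_rfl, hP.quarter.2.2.2, le_rfl,
    hP.ε_pos, hP.ε_pos, mul_pos two_pos hP.rho_pos, fun _ hi _ => hP.macro_step_fine_le hi,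
    fun _ hi _ => by rw [← rho_comm]; exact hP.swap.macro_step_fine_le hi⟩

theorem Params.macro_fine_coarse (hP : Params N ε β₁ β₂) :
    Region (N / 2) (macroNode (node N ε β₁)) (macroNode (node N ε β₂)) (N / 4) (N / 2) 0
      (N / 4) (2 * rho N β₁ β₂) ε 1 :=
  ⟨hP.macroGrid.isGrid, hP.swap.macroGrid.isGrid, hP.quarter.2.2.2, le_rfl, hP.quarter.2.2.1,
    hP.quarter.2.2.2.le, hP.ε_pos, one_pos, mul_pos two_pos hP.rho_pos,
    fun _ hi _ => hP.macro_step_fine_le hi,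
    fun _ _ _ => by rw [← rho_comm]; exact hP.swap.macro_step_le _⟩

theorem Params.macro_coarse_coarse (hP : Params N ε β₁ β₂) :
    Region (N / 2) (macroNode (node N ε β₁)) (macroNode (node N ε β₂)) 0 (N / 4) 0
      (N / 4) (2 * rho N β₁ β₂) 1 1 :=
  ⟨hP.macroGrid.isGrid, hP.swap.macroGrid.isGrid, hP.quarter.2.2.1, hP.quarter.2.2.2.le,
    hP.quarter.2.2.1, hP.quarter.2.2.2.le, one_pos, one_pos, mul_pos two_pos hP.rho_pos,
    fun _ _ _ => hP.macro_step_le _,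
    fun _ _ _ => by rw [← rho_comm]; exact hP.swap.macro_step_le _⟩

/-- The error of the postprocessed exact solution on the layer regions. -/
structure FineMacroError (N : ℕ) (ε β₁ β₂ C₁ : ℝ) (u : ℝ × ℝ → ℝ) (p : ℝ × ℝ) : Prop where
  val : |u p - postprocess N (node N ε β₁) (node N ε β₂) u p| ≤ 316 * C₁ * rho N β₁ β₂ ^ 2
  grad : |dX u p - dX (postprocess N (node N ε β₁) (node N ε β₂) u) p| ≤
    316 * C₁ * rho N β₁ β₂ ^ 2 / ε

/-- With `θ ≤ ρ²` the layer part joins the smooth part: `316 = 4 · 72 + 4 · 7`. -/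
theorem MacroError.fine {τ₁ : ℝ} {A T : ℝ × ℝ → ℝ} {p : ℝ × ℝ} (hP : Params N ε β₁ β₂)
    (hC : 0 ≤ C₁) (hτ : ε ≤ τ₁) (h : MacroError N (node N ε β₁) (node N ε β₂) (4 * C₁) (theta N) ε
      (rho N β₁ β₂) τ₁ u A T p) : FineMacroError N ε β₁ β₂ C₁ u p := by
  have hε := hP.ε_pos
  have hθ := hP.theta_le_rho
  have h1 := mul_le_mul_of_nonneg_left hθ hC
  refine ⟨by linarith [h.val], ?_⟩
  rw [h.split]
  have h2 : 72 * (4 * C₁) * rho N β₁ β₂ ^ 2 / τ₁ ≤ 72 * (4 * C₁) * rho N β₁ β₂ ^ 2 / ε :=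
    div_le_div_of_nonneg_left (by positivity) hε hτ
  have h3 : 7 * (4 * C₁) * theta N / ε ≤ 7 * (4 * C₁) * rho N β₁ β₂ ^ 2 / ε :=
    div_le_div_of_nonneg_right (by linarith) hε.le
  have h4 : 316 * C₁ * rho N β₁ β₂ ^ 2 / ε = 72 * (4 * C₁) * rho N β₁ β₂ ^ 2 / ε +
    7 * (4 * C₁) * rho N β₁ β₂ ^ 2 / ε := by ring
  rw [h4]
  exact (abs_add_le _ _).trans (add_le_add (h.smooth.trans h2) (h.layer.trans h3))

variable (hP : Params N ε β₁ β₂) (hu : HasDecomposition C₁ ε β₁ β₂ u)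

include hP hu

theorem fineMacroError_fine_fine :
    ∀ᵐ p ∂(volume.restrict (block (node N ε β₁) (node N ε β₂) (N / 2) N (N / 2) N)),
      FineMacroError N ε β₁ β₂ C₁ u p := by
  have hr := hP.macro_fine_fine
  obtain ⟨A, T, hs⟩ := hu.splitting_fine_fine hP
    (blockR (macroNode (node N ε β₁)) (macroNode (node N ε β₂)) (N / 4) (N / 2) (N / 4) (N / 2))
  have h := hr.ae_macroError hP.macroGrid hP.swap.macroGrid hs
  unfold block at h ⊢
  rw [hP.macroNode_quarter, hP.macroNode_half, hP.swap.macroNode_quarter,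
    hP.swap.macroNode_half] at h
  filter_upwards [h] with p hp using hp.fine hP hu.nonneg le_rfl

theorem fineMacroError_fine_coarse :
    ∀ᵐ p ∂(volume.restrict (block (node N ε β₁) (node N ε β₂) (N / 2) N 0 (N / 2))),
      FineMacroError N ε β₁ β₂ C₁ u p := by
  have hr := hP.macro_fine_coarse
  obtain ⟨A, T, hs⟩ := hu.splitting_fine_coarse hP hr.blockR_subset fun p hp => by
    rw [← hP.swap.macroNode_quarter]; exact hp.2.2
  have h := hr.ae_macroError hP.macroGrid hP.swap.macroGrid hs
  unfold block at h ⊢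
  rw [hP.macroNode_quarter, hP.macroNode_half, hP.swap.macroNode_quarter, macroNode_zero] at h
  filter_upwards [h] with p hp using hp.fine hP hu.nonneg le_rfl

theorem fineMacroError_coarse_fine :
    ∀ᵐ p ∂(volume.restrict (block (node N ε β₁) (node N ε β₂) 0 (N / 2) (N / 2) N)),
      FineMacroError N ε β₁ β₂ C₁ u p := by
  have hr := hP.swap.macro_fine_coarse
  obtain ⟨A, T, hs⟩ := hu.swap.splitting_fine_coarse hP.swap hr.blockR_subset fun p hp => by
    rw [← hP.macroNode_quarter]; exact hp.2.2
  have hs' := hs.swap hr.blockR_subset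
  rw [blockR_swap] at hs'
  have h := hr.swap.ae_macroError hP.macroGrid hP.swap.macroGrid hs'
  unfold block at h ⊢
  rw [hP.macroNode_quarter, hP.swap.macroNode_half, hP.swap.macroNode_quarter, macroNode_zero,
    rho_comm] at h
  filter_upwards [h] with p hp using hp.fine hP hu.nonneg hP.ε_le_one

/-- The slopes of the layer part at coarse nodes are `O(1/N)`, and its exact derivative is kept as
`tail`. The uniform bound on `tail` is recorded too, because the square of the tail will be
integrated as supremum times integral. -/
theorem coarseMacroError :
    ∀ᵐ p ∂(volume.restrict (coarse N (node N ε β₁) (node N ε β₂))),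
      |u p - postprocess N (node N ε β₁) (node N ε β₂) u p| ≤ 316 * C₁ * rho N β₁ β₂ ^ 2 ∧
      |dX u p - dX (postprocess N (node N ε β₁) (node N ε β₂) u) p| ≤
        288 * C₁ * rho N β₁ β₂ ^ 2 + 48 * C₁ / N + tail C₁ ε β₁ β₂ p ∧
      tail C₁ ε β₁ β₂ p ≤ 4 * C₁ * theta N / ε := by
  have hr := hP.macro_coarse_coarse
  have hX := hP.macroGrid
  have hY := hP.swap.macroGrid
  have hC := hu.nonneg
  have hε := hP.ε_pos
  have hN := hP.N_pos
  have hθ := theta_pos N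
  obtain ⟨A, T, hs, hT⟩ := hu.splitting_coarse_coarse hP hr.blockR_subset
    (fun p hp => by rw [← hP.macroNode_quarter]; exact hp.1.2)
    (fun p hp => by rw [← hP.swap.macroNode_quarter]; exact hp.2.2)
  have hae := hr.ae
  have e : block (macroNode (node N ε β₁)) (macroNode (node N ε β₂)) 0 (N / 4) 0 (N / 4) =
      coarse N (node N ε β₁) (node N ε β₂) := by
    unfold coarse block
    rw [hP.macroNode_quarter, hP.swap.macroNode_quarter, macroNode_zero, macroNode_zero]
  rw [e] at hae
  filter_upwards [hae, ae_restrict_mem (measurableSet_block _ _ _ _ _ _)] with p hp hm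
  obtain ⟨i, j, a, b, h, k, hi0, hi, hj0, hj, ht, hp⟩ := hp
  have hin : i < N / 2 := hi.trans hP.quarter.2.2.2
  have hjn : j < N / 2 := hj.trans hP.quarter.2.2.2
  have hM := hr.macroError hX hY hs hi0 hi hj0 hj ht hp
  have hl := ht.macroLegs hX hY hin hjn
  have hpc := ht.otri_subset_closed hX.isGrid hY.isGrid hin hjn hp
  have bT : ∀ q ∈ cellR (macroNode (node N ε β₁)) (macroNode (node N ε β₂)) i j,
      |T q| ≤ 4 * C₁ * theta N := fun q hq => by
    simpa using hs.jetT.b00 (hr.cellR_subset hi0 hi hj0 hj hq)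
  have tX : |dX T p| ≤ tail C₁ ε β₁ β₂ p := by
    have := hT 1 0 (by norm_num) p hpc
    simpa [partialD, tail] using this
  have hh : 1 / (N : ℝ) ≤ |h / 2| := by
    obtain ⟨⟨i', j', h1, h2, h3, h4, ht'⟩, -⟩ := ht.subTri hX hY hin hjn
    have := hP.step_coarse_ge (show i' < N / 2 by have := hP.quarter.1; omega)
    have h0 : 0 < 1 / (N : ℝ) := by positivity
    rcases ht' with ⟨-, -, h5, -⟩ | ⟨-, -, h5, -⟩
    · rw [h5, abs_of_pos (by linarith)]; exact this
    · rw [h5, abs_of_neg (by linarith)]; linarith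
  have h0 : 0 < |h / 2| := lt_of_lt_of_le (by positivity) hh
  have slope : 2 * (4 * C₁ * theta N) / |h / 2| ≤ 8 * C₁ / N := by
    have h1 : 1 / |h / 2| ≤ N := by
      rw [div_le_iff₀ h0]
      rw [div_le_iff₀ hN] at hh; linarith
    have h2 : theta N * (1 / |h / 2|) ≤ 1 / N :=
      (mul_le_mul_of_nonneg_left h1 hθ.le).trans hP.theta_N_le
    calc _ = 8 * C₁ * (theta N * (1 / |h / 2|)) := by ring
      _ ≤ 8 * C₁ * (1 / N) := mul_le_mul_of_nonneg_left h2 (by positivity)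
      _ = _ := by ring
  have s1 := (abs_slopeX_le hl.corner bT).trans slope
  have s2 := (abs_slopeX_le hl.right bT).trans slope
  have s3 := (abs_slopeX_le hl.top bT).trans slope
  have q := abs_quadDX_le (v := T) hp
  refine ⟨(hM.fine hP hC hP.ε_le_one).val, ?_, ?_⟩
  · rw [hM.split]
    have h1 := hM.smooth
    rw [div_one] at h1
    have h2 := abs_sub (dX T p) (dX (postprocess N (node N ε β₁) (node N ε β₂) T) p)
    have eT := (postprocess_on_otri (v := T) hX hY ht hin hjn hp).2.1
    rw [eT] at h2 ⊢
    have e : 48 * C₁ / (N : ℝ) = 2 * (8 * C₁ / N + 8 * C₁ / N + 8 * C₁ / N) := by ring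
    refine (abs_add_le _ _).trans ?_
    rw [e]
    linarith
  · have l1 := hP.layer_le_theta hm.1.2
    have l2 := hP.swap.layer_le_theta hm.2.2
    unfold tail
    calc _ ≤ 2 * C₁ * ε⁻¹ * (theta N + theta N) :=
          mul_le_mul_of_nonneg_left (add_le_add l1 l2) (by positivity)
      _ = _ := by ring

theorem ae_postprocess_error_le : ∀ᵐ p ∂(volume.restrict hSquare),
    |u p - postprocess N (node N ε β₁) (node N ε β₂) u p| ≤ 316 * C₁ * rho N β₁ β₂ ^ 2 := by
  refine ae_four hP.isGrid hP.swap.isGrid (m := N / 2) ?_ ?_ ?_ ?_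
  · filter_upwards [coarseMacroError hP hu] with p hp using hp.1
  · filter_upwards [fineMacroError_fine_coarse hP hu] with p hp using hp.val
  · filter_upwards [fineMacroError_coarse_fine hP hu] with p hp using hp.val
  · filter_upwards [fineMacroError_fine_fine hP hu] with p hp using hp.val

end


/-! ### Energy norm error of the postprocessed exact solution -/

section

variable {N : ℕ} {ε β₁ β₂ C₁ : ℝ} {u : ℝ × ℝ → ℝ}

theorem setIntegral_sq_le {F : ℝ × ℝ → ℝ} (hF : BM F) {S : Set (ℝ × ℝ)} (hS : S ⊆ hSquare)
    {a V : ℝ} (ha : ∀ᵐ p ∂(volume.restrict S), |F p| ≤ a) (hV : volume.real S ≤ V) :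
    ∫ p in S, F p ^ 2 ≤ a ^ 2 * V := by
  have h : ∫ p in S, F p ^ 2 ≤ ∫ _ in S, a ^ 2 := by
    refine integral_mono_ae (hF.sq.intOn hS) ((BM.const (a ^ 2)).intOn hS) ?_
    filter_upwards [ha] with p hp
    rw [← sq_abs]
    exact pow_le_pow_left₀ (abs_nonneg _) hp 2
  rw [setIntegral_const, smul_eq_mul] at h
  rw [mul_comm]
  exact h.trans (mul_le_mul_of_nonneg_right hV (sq_nonneg _))

/-- The constant for the gradient of the error of the postprocessed exact solution. -/
def gradConst (C₁ β₁ β₂ : ℝ) : ℝ :=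
  3 * (632 * C₁ * sigma β₁ β₂ ^ 3) ^ 2 + 2 * (288 * C₁ * sigma β₁ β₂ ^ 2 + 48 * C₁) ^ 2 +
    16 * C₁ ^ 2 * (1 / β₁ + 1 / β₂)

theorem gradConst_comm : gradConst C₁ β₂ β₁ = gradConst C₁ β₁ β₂ := by
  unfold gradConst; rw [sigma_comm, add_comm (1 / β₂)]

theorem Params.fine_grad_sq_le (hP : Params N ε β₁ β₂) (hC : 0 ≤ C₁) {F : ℝ × ℝ → ℝ} (hF : BM F)
    {S : Set (ℝ × ℝ)} (hS : S ⊆ hSquare) (hV : volume.real S ≤ rho N β₁ β₂ * N * ε)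
    (ha : ∀ᵐ p ∂(volume.restrict S), |F p| ≤ 316 * C₁ * rho N β₁ β₂ ^ 2 / ε) :
    ε * ∫ p in S, F p ^ 2 ≤ (632 * C₁ * sigma β₁ β₂ ^ 3) ^ 2 * eta N ^ 2 := by
  have hε := hP.ε_pos
  have hρ := hP.rho_pos
  have hN := hP.N_pos
  calc ε * ∫ p in S, F p ^ 2
      ≤ ε * ((316 * C₁ * rho N β₁ β₂ ^ 2 / ε) ^ 2 * (rho N β₁ β₂ * N * ε)) :=
        mul_le_mul_of_nonneg_left (setIntegral_sq_le hF hS ha hV) hε.le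
    _ = (316 * C₁ * (rho N β₁ β₂ ^ 2 * √(rho N β₁ β₂ * N))) ^ 2 := by
        rw [mul_pow, mul_pow _ (√_), Real.sq_sqrt (by positivity)]
        field_simp
    _ ≤ (316 * C₁ * (2 * sigma β₁ β₂ ^ 3 * eta N)) ^ 2 :=
        pow_le_pow_left₀ (by positivity)
          (mul_le_mul_of_nonneg_left hP.rho_sq_sqrt_le (by positivity)) 2
    _ = _ := by ring

theorem Params.theta_le_eta (hP : Params N ε β₁ β₂) : theta N ≤ eta N := by
  have h1 := hP.N_theta_le
  have h2 : 1 * theta N ≤ N * theta N :=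
    mul_le_mul_of_nonneg_right (by linarith [hP.N_ge]) (theta_pos N).le
  linarith

/-- By `F² ≤ 2 g² + 2 tail²`. The first part is of order `(√ε (ρ² + 1/N))²`; for the second, `ε ·
(θ/ε) · θ = θ²`, up to constants. -/
theorem Params.coarse_grad_sq_le (hP : Params N ε β₁ β₂) (hC : 0 ≤ C₁) {F : ℝ × ℝ → ℝ}
    (hF : BM F) (ha : ∀ᵐ p ∂(volume.restrict (coarse N (node N ε β₁) (node N ε β₂))),
      |F p| ≤ 288 * C₁ * rho N β₁ β₂ ^ 2 + 48 * C₁ / N + tail C₁ ε β₁ β₂ p ∧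
      tail C₁ ε β₁ β₂ p ≤ 4 * C₁ * theta N / ε) :
    ε * ∫ p in coarse N (node N ε β₁) (node N ε β₂), F p ^ 2 ≤
      (2 * (288 * C₁ * sigma β₁ β₂ ^ 2 + 48 * C₁) ^ 2 + 16 * C₁ ^ 2 * (1 / β₁ + 1 / β₂)) *
        eta N ^ 2 := by
  have hε := hP.ε_pos
  have hρ := hP.rho_pos
  have hN := hP.N_pos
  have hβ₁ := hP.β₁_pos
  have hβ₂ := hP.β₂_pos
  have hθ := theta_pos N
  have hη := eta_nonneg (N := N)
  have hS := coarse_subset hP.isGrid hP.swap.isGrid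
  set S := coarse N (node N ε β₁) (node N ε β₂)
  set g := 288 * C₁ * rho N β₁ β₂ ^ 2 + 48 * C₁ / N with hg
  set τ := 4 * C₁ * theta N / ε with hτ
  have hg0 : 0 ≤ g := by positivity
  have hτ0 : 0 ≤ τ := by positivity
  have hV : volume.real S ≤ 1 := by
    rw [← volume_real_hSquare]
    exact measureReal_mono hS (volume_real_hSquare_subset le_rfl).ne
  have h1 : ∫ p in S, F p ^ 2 ≤ ∫ p in S, (2 * g ^ 2 + 2 * τ * tail C₁ ε β₁ β₂ p) := by
    refine integral_mono_ae (hF.sq.intOn hS)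
      (((BM.const (2 * g ^ 2)).add ((BM.const (2 * τ)).mul bm_tail)).intOn hS) ?_
    filter_upwards [ha] with p hp
    have t0 := tail_nonneg (β₁ := β₁) (β₂ := β₂) hC hε p
    have e1 : F p ^ 2 ≤ (g + tail C₁ ε β₁ β₂ p) ^ 2 := by
      rw [← sq_abs]; exact pow_le_pow_left₀ (abs_nonneg _) hp.1 2
    have e2 := mul_le_mul_of_nonneg_right hp.2 t0
    nlinarith [sq_nonneg (g - tail C₁ ε β₁ β₂ p)]
  rw [integral_add ((BM.const (2 * g ^ 2)).intOn hS) (((BM.const (2 * τ)).mul bm_tail).intOn hS),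
    setIntegral_const, smul_eq_mul, integral_const_mul] at h1
  have h2 : volume.real S * (2 * g ^ 2) ≤ 1 * (2 * g ^ 2) :=
    mul_le_mul_of_nonneg_right hV (by positivity)
  have h3 := mul_le_mul_of_nonneg_left (hP.integral_tail_le hC) (show 0 ≤ 2 * τ by positivity)
  have h4 : √ε * g ≤ (288 * C₁ * sigma β₁ β₂ ^ 2 + 48 * C₁) * eta N := by
    have i1 : √ε * rho N β₁ β₂ ^ 2 ≤ sigma β₁ β₂ ^ 2 * eta N :=
      (mul_le_of_le_one_left (by positivity) (Real.sqrt_le_one.2 hP.ε_le_one)).trans hP.rho_sq_le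
    have i2 := mul_le_mul_of_nonneg_left i1 (show 0 ≤ 288 * C₁ by positivity)
    have i3 := mul_le_mul_of_nonneg_left hP.sqrt_eps_div_le (show 0 ≤ 48 * C₁ by positivity)
    have e : √ε * g = 288 * C₁ * (√ε * rho N β₁ β₂ ^ 2) + 48 * C₁ * (√ε / N) := by rw [hg]; ring
    rw [e]; linarith
  have h5 := pow_le_pow_left₀ (by positivity) h4 2
  rw [mul_pow, Real.sq_sqrt hε.le] at h5
  have h6 : theta N ^ 2 ≤ eta N ^ 2 := pow_le_pow_left₀ hθ.le hP.theta_le_eta 2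
  have h7 := mul_le_mul_of_nonneg_left h6
    (show 0 ≤ 16 * C₁ ^ 2 * (1 / β₁ + 1 / β₂) by positivity)
  have h8 : ε * (2 * τ * (2 * C₁ * (1 / β₁ + 1 / β₂) * theta N)) =
      16 * C₁ ^ 2 * (1 / β₁ + 1 / β₂) * theta N ^ 2 := by
    rw [hτ]; field_simp; ring
  have h9 : ε * ∫ p in S, F p ^ 2 ≤
      ε * (1 * (2 * g ^ 2) + 2 * τ * (2 * C₁ * (1 / β₁ + 1 / β₂) * theta N)) :=
    mul_le_mul_of_nonneg_left (by linarith) hε.le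
  rw [mul_add, h8] at h9
  rw [mul_pow] at h5
  linarith

theorem HasDecomposition.pw {n : ℕ} {X Y : ℕ → ℝ} (hu : HasDecomposition C₁ ε β₁ β₂ u)
    (hX : IsGrid n X) (hY : IsGrid n Y) : PW n X Y u :=
  PW.of_smooth hX hY (hu.smooth.of_le (by norm_num))

theorem postprocess_error_dX (hP : Params N ε β₁ β₂) (hu : HasDecomposition C₁ ε β₁ β₂ u) :
    ε * ∫ p in Omega, (dX u p - dX (postprocess N (node N ε β₁) (node N ε β₂) u) p) ^ 2 ≤
      gradConst C₁ β₁ β₂ * eta N ^ 2 := by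
  have hX := hP.isGrid
  have hY := hP.swap.isGrid
  have hh := hP.half_pos.2.le
  have hC := hu.nonneg
  have hF : BM fun p => dX u p - dX (postprocess N (node N ε β₁) (node N ε β₂) u) p :=
    (hu.pw hX hY).bm_dX.sub (bm_postprocess hP.macroGrid hP.swap.macroGrid).2.1
  have h1 := hP.coarse_grad_sq_le hC hF (by
    filter_upwards [coarseMacroError hP hu] with p hp using hp.2)
  have h2 := hP.fine_grad_sq_le hC hF (block_subset hX hY hh le_rfl (Nat.zero_le _) hh)
    (hP.volume_fine_le hP.region_fine_coarse)
    (by filter_upwards [fineMacroError_fine_coarse hP hu] with p hp using hp.grad)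
  have h4 := hP.fine_grad_sq_le hC hF (block_subset hX hY hh le_rfl hh le_rfl)
    (hP.volume_fine_le hP.region_fine_fine)
    (by filter_upwards [fineMacroError_fine_fine hP hu] with p hp using hp.grad)
  have hV : volume.real (block (node N ε β₁) (node N ε β₂) 0 (N / 2) (N / 2) N) ≤
      rho N β₁ β₂ * N * ε := by
    have b1 := (hX.mem_Icc hh).1
    have b2 := (hX.mem_Icc hh).2
    have b3 := hY.mono hh le_rfl
    have := hP.swap.width_fine
    rw [rho_comm] at this
    unfold block
    rw [volume_real_rect (hX.mono (Nat.zero_le _) hh) b3, hX.zero]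
    nlinarith
  have h3 := hP.fine_grad_sq_le hC hF (block_subset hX hY (Nat.zero_le _) hh hh le_rfl) hV
    (by filter_upwards [fineMacroError_coarse_fine hP hu] with p hp using hp.grad)
  rw [integral_four hX hY hF.sq hh]
  unfold coarse at h1
  unfold gradConst
  linarith

/-- In the open macrotriangles both sides are the same explicit polynomial, so no symmetry of the
tie-breaking on edges in `postprocess` is needed. -/
theorem dY_postprocess_ae {X Y : ℕ → ℝ} {v : ℝ × ℝ → ℝ} (hX : MacroGrid N X) (hY : MacroGrid N Y) :
    ∀ᵐ p ∂(volume.restrict Omega),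
      dY (postprocess N X Y v) p = dX (postprocess N Y X (v ∘ Prod.swap)) p.swap := by
  filter_upwards [ae_mem_goodSet hX.isGrid hY.isGrid] with p hp
  obtain ⟨i, hi, j, hj, a, b, h, k, ht, hp⟩ := hp
  rw [(postprocess_on_otri hX hY ht hi hj hp).2.2,
    (postprocess_on_otri hY hX ht.swap hj hi
      (swap_mem_otri.2 hp : p.swap ∈ otri b a k h)).2.1]
  rfl

theorem postprocess_stable_dY {X Y : ℕ → ℝ} {χ : ℝ × ℝ → ℝ} (hX : MacroGrid N X)
    (hY : MacroGrid N Y) (hχ : IsPL N X Y χ) :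
    ∫ p in Omega, dY (postprocess N X Y χ) p ^ 2 ≤ 6048 * ∫ p in Omega, dY χ p ^ 2 := by
  have h := postprocess_stable_dX hY hX hχ.swap
  rw [← integral_Omega_swap, dX_swap, ← integral_Omega_swap fun p => (dY χ ∘ Prod.swap) p ^ 2] at h
  refine (integral_congr_ae ?_).trans_le h
  filter_upwards [dY_postprocess_ae (v := χ) hX hY] with p hp
  rw [hp]

theorem postprocess_error_dY (hP : Params N ε β₁ β₂) (hu : HasDecomposition C₁ ε β₁ β₂ u) :
    ε * ∫ p in Omega, (dY u p - dY (postprocess N (node N ε β₁) (node N ε β₂) u) p) ^ 2 ≤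
      gradConst C₁ β₁ β₂ * eta N ^ 2 := by
  have h := postprocess_error_dX hP.swap hu.swap
  rw [gradConst_comm, ← integral_Omega_swap, dX_swap] at h
  refine (mul_le_mul_of_nonneg_left (integral_congr_ae ?_).le hP.ε_pos.le).trans h
  filter_upwards [dY_postprocess_ae (v := u) hP.macroGrid hP.swap.macroGrid] with p hp
  rw [hp]; rfl

theorem postprocess_error_val (hP : Params N ε β₁ β₂) (hu : HasDecomposition C₁ ε β₁ β₂ u) :
    ∫ p in Omega, (u p - postprocess N (node N ε β₁) (node N ε β₂) u p) ^ 2 ≤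
      (316 * C₁ * sigma β₁ β₂ ^ 2) ^ 2 * eta N ^ 2 := by
  have hC := hu.nonneg
  have hF : BM fun p => u p - postprocess N (node N ε β₁) (node N ε β₂) u p :=
    (hu.pw hP.isGrid hP.swap.isGrid).bm.sub (bm_postprocess hP.macroGrid hP.swap.macroGrid).1
  have h := setIntegral_sq_le hF le_rfl (ae_postprocess_error_le hP hu) volume_real_hSquare.le
  rw [integral_hSquare, mul_one] at h
  refine h.trans ?_
  rw [← mul_pow]
  have h1 := mul_le_mul_of_nonneg_left hP.rho_sq_le (show 0 ≤ 316 * C₁ by positivity)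
  exact pow_le_pow_left₀ (by positivity) (by linarith) 2

end


/-! ### Splitting of the error and conclusion -/

section

variable {N : ℕ} {X Y : ℕ → ℝ} {i j : ℕ} {a b h k : ℝ} {g u v : ℝ × ℝ → ℝ}

theorem SubTri.interp_eq (hX : MacroGrid N X) (hY : MacroGrid N Y) (hi : i < N / 2)
    (hj : j < N / 2) (ht : SubTri X Y i j a b h k) :
    interp N X Y g (a, b) = g (a, b) ∧ interp N X Y g (a + h, b) = g (a + h, b) ∧
      interp N X Y g (a, b + k) = g (a, b + k) := by
  obtain ⟨i', j', h1, h2, h3, h4, ht⟩ := ht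
  exact ht.interp_eq hX.grid hY.grid (by omega) (by omega)

/-- All six interpolation points are mesh nodes, where a function and its nodal interpolant agree.
-/
theorem IsTri.quad_interp (hX : MacroGrid N X) (hY : MacroGrid N Y)
    (ht : IsTri (macroNode X) (macroNode Y) i j a b h k) (hi : i < N / 2) (hj : j < N / 2) :
    quadP (interp N X Y g) a b h k = quadP g a b h k ∧
      quadDX (interp N X Y g) a b h k = quadDX g a b h k := by
  obtain ⟨t1, t2, t3⟩ := ht.subTri hX hY hi hj
  obtain ⟨a1, a2, a3⟩ := t1.interp_eq (g := g) hX hY hi hj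
  obtain ⟨b1, b2, b3⟩ := t2.interp_eq (g := g) hX hY hi hj
  obtain ⟨c1, c2, c3⟩ := t3.interp_eq (g := g) hX hY hi hj
  have e1 : a + h / 2 + h / 2 = a + h := by ring
  have e2 : b + k / 2 + k / 2 = b + k := by ring
  rw [e1] at b2
  rw [e2] at c3
  constructor <;> ext p
  · simp only [quadP, quadST, a1, a2, a3, b2, b3, c3]
  · simp only [quadDX, slopeX, e1, a1, a2, a3, b2, c2]

theorem IsTri.quadDY_interp (hX : MacroGrid N X) (hY : MacroGrid N Y)
    (ht : IsTri (macroNode X) (macroNode Y) i j a b h k) (hi : i < N / 2) (hj : j < N / 2) :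
    quadDY (interp N X Y g) a b h k = quadDY g a b h k := by
  ext p
  have := (ht.swap.quad_interp (g := g ∘ Prod.swap) hY hX hj hi).2
  rw [interp_swap] at this
  exact congrFun this p.swap

/-- The error of the postprocessed discrete solution, split by the postprocessed interpolant. -/
theorem sub_postprocess_ae (hX : MacroGrid N X) (hY : MacroGrid N Y)
    (hd : ∀ p ∈ Omega, DifferentiableAt ℝ u p) :
    ∀ᵐ p ∂(volume.restrict Omega),
      (u - postprocess N X Y v) p =
        (u p - postprocess N X Y u p) + postprocess N X Y (interp N X Y u - v) p ∧
      dX (u - postprocess N X Y v) p =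
        (dX u p - dX (postprocess N X Y u) p) + dX (postprocess N X Y (interp N X Y u - v)) p ∧
      dY (u - postprocess N X Y v) p =
        (dY u p - dY (postprocess N X Y u) p) +
          dY (postprocess N X Y (interp N X Y u - v)) p := by
  filter_upwards [ae_mem_goodSet hX.isGrid hY.isGrid] with p hp
  have hO := goodSet_subset hX.isGrid hY.isGrid hp
  obtain ⟨i, hi, j, hj, a, b, h, k, ht, hp⟩ := hp
  obtain ⟨hh, hk⟩ := ht.ne hX.isGrid hY.isGrid hi hj
  obtain ⟨u1, u2, u3⟩ := postprocess_on_otri (v := u) hX hY ht hi hj hp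
  obtain ⟨c1, c2, c3⟩ := postprocess_on_otri (v := interp N X Y u - v) hX hY ht hi hj hp
  rw [u1, u2, u3, c1, c2, c3, quadP_sub, quadDX_sub, quadDY_sub, (ht.quad_interp hX hY hi hj).1,
    (ht.quad_interp hX hY hi hj).2, ht.quadDY_interp hX hY hi hj]
  have hev : u - postprocess N X Y v =ᶠ[nhds p] u - quadP v a b h k := by
    filter_upwards [(isOpen_otri a b h k).mem_nhds hp] with q hq
    rw [Pi.sub_apply, Pi.sub_apply, postprocess_eqOn hX hY ht hi hj hq]
  have cx : Filter.Tendsto (fun t : ℝ => (t, p.2)) (nhds p.1) (nhds p) := by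
    have : Continuous fun t : ℝ => (t, p.2) := by fun_prop
    exact this.tendsto p.1
  have cy : Filter.Tendsto (fun t : ℝ => (p.1, t)) (nhds p.2) (nhds p) := by
    have : Continuous fun t : ℝ => (p.1, t) := by fun_prop
    exact this.tendsto p.2
  have d1 := dX_of_hasDerivAt (Omega_subset hO) ((((dX_hasDerivAt hO (hd p hO)).sub
    (hasDerivAt_quadP (v := v) (b := b) (k := k) (a := a) hh p))).congr_of_eventuallyEq
      (cx.eventually hev))
  have d2 := dY_of_hasDerivAt (Omega_subset hO) ((((dY_hasDerivAt hO (hd p hO)).sub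
    (hasDerivAt_quadP_y (v := v) (b := b) (h := h) (a := a) hk p))).congr_of_eventuallyEq
      (cy.eventually hev))
  refine ⟨?_, ?_, ?_⟩
  · rw [hev.eq_of_nhds, Pi.sub_apply, Pi.sub_apply]; ring
  · rw [d1, Pi.sub_apply]; ring
  · rw [d2, Pi.sub_apply]; ring

theorem integral_sq_le_two {F G H : ℝ × ℝ → ℝ} (hG : BM G) (hH : BM H)
    (h : ∀ᵐ p ∂(volume.restrict Omega), F p = G p + H p) :
    ∫ p in Omega, F p ^ 2 ≤ 2 * (∫ p in Omega, G p ^ 2) + 2 * ∫ p in Omega, H p ^ 2 := by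
  have hF := (hG.add hH).congr h
  rw [← integral_const_mul, ← integral_const_mul,
    ← integral_add ((BM.const 2).mul hG.sq).int ((BM.const 2).mul hH.sq).int]
  refine integral_mono_ae hF.sq.int (((BM.const 2).mul hG.sq).add ((BM.const 2).mul hH.sq)).int ?_
  filter_upwards [h] with p hp
  rw [hp]
  nlinarith [sq_nonneg (G p - H p)]

end

/-- The error of the postprocessed solution. -/
theorem postprocess_error {b₁ b₂ c : ℝ × ℝ → ℝ} {β₁ β₂ μ₀ : ℝ}
    (hb : Coefficients b₁ b₂ c β₁ β₂ μ₀) {Cs : ℝ} (hCs : 0 < Cs) (C₁ : ℝ) :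
    ∃ K : ℝ, ∀ (N : ℕ) (ε : ℝ), Params N ε β₁ β₂ →
      IsCoercive Cs N (node N ε β₁) (node N ε β₂) ε μ₀ b₁ b₂ c →
      ∀ f u uN : ℝ × ℝ → ℝ, IsSolution ε b₁ b₂ c f u → HasDecomposition C₁ ε β₁ β₂ u →
        IsSDFEMSolution Cs N (node N ε β₁) (node N ε β₂) ε b₁ b₂ c f uN →
        energySq ε μ₀ (u - postprocess N (node N ε β₁) (node N ε β₂) uN) ≤ K * eta N ^ 2 := by
  obtain ⟨K, hK⟩ := discrete_error hb hCs C₁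
  -- Each square of a sum costs a factor 2. The two partial derivatives contribute `4 * gradConst`,
  -- and `979776 = 2 · 489888` covers the stability constants of the values and, with room to spare,
  -- of the derivatives.
  refine ⟨4 * gradConst C₁ β₁ β₂ + 2 * μ₀ * (316 * C₁ * sigma β₁ β₂ ^ 2) ^ 2 + 979776 * K ^ 2, ?_⟩
  intro N ε hP hco f u uN hsol hu hN
  have hε := hP.ε_pos
  have hμ := hb.μ₀_pos
  have hX := hP.macroGrid
  have hY := hP.swap.macroGrid
  have hd := hK N ε hP hco f u uN hsol hu hN
  have hχ : IsPL N (node N ε β₁) (node N ε β₂) (interp N (node N ε β₁) (node N ε β₂) u - uN) :=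
    ((isFE_interp hX.grid hY.grid (by have := hP.four_le; omega) hsol.bdry).sub hN.mem).isPL
  have hpw := hu.pw hX.grid hY.grid
  have hD : ∀ p ∈ Omega, DifferentiableAt ℝ u p := fun p hp =>
    (hu.smooth.contDiffAt (Filter.mem_of_superset (isOpen_Omega.mem_nhds hp)
      Omega_subset)).differentiableAt (by norm_num)
  have hs := sub_postprocess_ae (v := uN) hX hY hD
  set χ := interp N (node N ε β₁) (node N ε β₂) u - uN
  set w := u - postprocess N (node N ε β₁) (node N ε β₂) uN
  obtain ⟨p0, p1, p2⟩ := bm_postprocess (v := u) hX hY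
  obtain ⟨q0, q1, q2⟩ := bm_postprocess (v := χ) hX hY
  have i0 := integral_sq_le_two (hpw.bm.sub p0) q0 (hs.mono fun p hp => hp.1)
  have i1 := integral_sq_le_two (hpw.bm_dX.sub p1) q1 (hs.mono fun p hp => hp.2.1)
  have i2 := integral_sq_le_two (hpw.bm_dY.sub p2) q2 (hs.mono fun p hp => hp.2.2)
  have bX : BM (dX w) := ((hpw.bm_dX.sub p1).add q1).congr (hs.mono fun p hp => hp.2.1)
  have bY : BM (dY w) := ((hpw.bm_dY.sub p2).add q2).congr (hs.mono fun p hp => hp.2.2)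
  have e0 := postprocess_error_val hP hu
  have e1 := postprocess_error_dX hP hu
  have e2 := postprocess_error_dY hP hu
  have s0 := postprocess_stable_val hX hY hχ
  have s1 := postprocess_stable_dX hX hY hχ
  have s2 := postprocess_stable_dY hX hY hχ
  have cX := hχ.bm_dX hX.grid hY.grid
  have cY := hχ.bm_dY hX.grid hY.grid
  have n1 : 0 ≤ ε * ∫ p in Omega, dX χ p ^ 2 :=
    mul_nonneg hε.le (integral_nonneg fun _ => sq_nonneg _)
  have n2 : 0 ≤ ε * ∫ p in Omega, dY χ p ^ 2 :=
    mul_nonneg hε.le (integral_nonneg fun _ => sq_nonneg _)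
  unfold energySq at hd ⊢
  rw [integral_add cX.sq.int cY.sq.int, mul_add] at hd
  rw [integral_add bX.sq.int bY.sq.int, mul_add]
  have j0 := mul_le_mul_of_nonneg_left i0 hμ.le
  have j1 := mul_le_mul_of_nonneg_left i1 hε.le
  have j2 := mul_le_mul_of_nonneg_left i2 hε.le
  have t0 := mul_le_mul_of_nonneg_left s0 hμ.le
  have t1 := mul_le_mul_of_nonneg_left s1 hε.le
  have t2 := mul_le_mul_of_nonneg_left s2 hε.le
  have f0 := mul_le_mul_of_nonneg_left e0 hμ.le
  linarith

theorem eta_eq {N : ℕ} (hN : 4 ≤ N) :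
    eta N = (N : ℝ) ^ (-(3 / 2) : ℝ) * Real.log N ^ (3 / 2 : ℝ) := by
  have h0 : (0 : ℝ) < N := by exact_mod_cast (by omega : 0 < N)
  have hL : 0 ≤ Real.log N := Real.log_natCast_nonneg N
  unfold eta
  rw [Real.sqrt_eq_rpow, ← Real.rpow_natCast, ← Real.rpow_mul (by positivity),
    show ((3 : ℕ) : ℝ) * (1 / 2) = 3 / 2 by norm_num, Real.div_rpow hL h0.le,
    Real.rpow_neg h0.le, div_eq_mul_inv, mul_comm]

end SDFEM

end

/-! ### The main theorem -/

theorem mainTheorem2 (b₁ b₂ c : ℝ × ℝ → ℝ) (β₁ β₂ μ₀ : ℝ)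
    (hcoef : SDFEM.Coefficients b₁ b₂ c β₁ β₂ μ₀) :
    -- the stabilization constants `Cs` that give coercivity include all small positive ones
    (∃ C₀ : ℝ, 0 < C₀ ∧ ∀ Cs : ℝ, 0 < Cs → Cs ≤ C₀ →
      ∀ (N : ℕ) (ε : ℝ), 4 ≤ N → 4 ∣ N → 0 < ε → ε ≤ 1 / N →
        5 / 2 * (ε / β₁) * Real.log N ≤ 1 / 2 → 5 / 2 * (ε / β₂) * Real.log N ≤ 1 / 2 →
        SDFEM.IsCoercive Cs N (SDFEM.node N ε β₁) (SDFEM.node N ε β₂) ε μ₀ b₁ b₂ c) ∧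
    -- the error bound for the postprocessed solution
    ∀ Cs C₁ : ℝ, 0 < Cs → ∃ C : ℝ, 0 < C ∧
      ∀ (N : ℕ) (ε : ℝ), 4 ≤ N → 4 ∣ N → 0 < ε → ε ≤ 1 / N →
        5 / 2 * (ε / β₁) * Real.log N ≤ 1 / 2 → 5 / 2 * (ε / β₂) * Real.log N ≤ 1 / 2 →
        SDFEM.IsCoercive Cs N (SDFEM.node N ε β₁) (SDFEM.node N ε β₂) ε μ₀ b₁ b₂ c →
        ∀ f u uN : ℝ × ℝ → ℝ,
          SDFEM.IsSolution ε b₁ b₂ c f u →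
          SDFEM.HasDecomposition C₁ ε β₁ β₂ u →
          SDFEM.IsSDFEMSolution Cs N (SDFEM.node N ε β₁) (SDFEM.node N ε β₂) ε b₁ b₂ c f uN →
          SDFEM.energyNorm ε μ₀
              (u - SDFEM.postprocess N (SDFEM.node N ε β₁) (SDFEM.node N ε β₂) uN) ≤
            C * (ε ^ (1 / 2 : ℝ) * (N : ℝ)⁻¹ + (N : ℝ) ^ (-(3 / 2) : ℝ)) *
              Real.log N ^ (3 / 2 : ℝ) := by
  have params : ∀ {N : ℕ} {ε : ℝ}, 4 ≤ N → 4 ∣ N → 0 < ε → ε ≤ 1 / N →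
      5 / 2 * (ε / β₁) * Real.log N ≤ 1 / 2 → 5 / 2 * (ε / β₂) * Real.log N ≤ 1 / 2 →
      SDFEM.Params N ε β₁ β₂ := fun h1 h2 h3 h4 h5 h6 =>
    ⟨h1, h2, h3, h4, hcoef.β₁_pos, hcoef.β₂_pos, h5, h6⟩
  constructor
  · obtain ⟨B, -, hB⟩ := hcoef.exists_bound
    have hμ := hcoef.μ₀_pos
    -- This choice gives `Cs * B ^ 2 ≤ μ₀`, which is the condition for coercivity; the 1 covers `B =
    -- 0`.
    refine ⟨μ₀ / (1 + B ^ 2), by positivity, fun Cs hCs hC N ε h1 h2 h3 h4 h5 h6 => ?_⟩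
    have hP := params h1 h2 h3 h4 h5 h6
    rw [le_div_iff₀ (by positivity)] at hC
    exact SDFEM.isCoercive hP.isGrid hP.swap.isGrid hcoef (by omega) (fun p hp => (hB p hp).2.2.1)
      hCs (by linarith) h3
  · intro Cs C₁ hCs
    obtain ⟨K, hK⟩ := SDFEM.postprocess_error hcoef hCs C₁
    -- `K` bounds the squared norm and has no sign attached, hence the absolute value; adding 1
    -- makes the constant positive.
    refine ⟨√|K| + 1, by positivity, fun N ε h1 h2 h3 h4 h5 h6 hco f u uN hsol hu hN => ?_⟩
    have h := hK N ε (params h1 h2 h3 h4 h5 h6) hco f u uN hsol hu hN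
    have hη := SDFEM.eta_nonneg (N := N)
    have hL : 0 ≤ Real.log N := Real.log_natCast_nonneg N
    have h7 : SDFEM.energyNorm ε μ₀
        (u - SDFEM.postprocess N (SDFEM.node N ε β₁) (SDFEM.node N ε β₂) uN) ≤
        √|K| * SDFEM.eta N := by
      refine Real.sqrt_le_iff.2 ⟨by positivity, h.trans ?_⟩
      rw [mul_pow, Real.sq_sqrt (abs_nonneg K)]
      exact mul_le_mul_of_nonneg_right (le_abs_self K) (sq_nonneg _)
    have h8 : SDFEM.eta N ≤ (ε ^ (1 / 2 : ℝ) * (N : ℝ)⁻¹ + (N : ℝ) ^ (-(3 / 2) : ℝ)) *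
        Real.log N ^ (3 / 2 : ℝ) := by
      rw [SDFEM.eta_eq h1]
      -- The term with `ε ^ (1/2)` is simply added: the bound by `N^(-3/2) ln^(3/2) N` alone has
      -- already been reached.
      exact mul_le_mul_of_nonneg_right (le_add_of_nonneg_left (by positivity)) (by positivity)
    rw [mul_assoc]
    exact h7.trans ((mul_le_mul_of_nonneg_right (by linarith) hη).trans
      (mul_le_mul_of_nonneg_left h8 (by positivity)))
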